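/- **Setup.** Let $p$ be a prime, $\Bbbk$ a field of characteristic $p$, and $n\ge 1$ an integer; $\otimes$ without subscript means $\otimes_\Bbbk$. A *$p$-DG algebra* is a $\mathbb Z$-graded $\Bbbk$-algebra $B$ with a degree-two linear map $\partial$ such that $\partial^p=0$ and $\partial(ab)=\partial(a)b+a\partial(b)$. A (left) *$p$-DG module* is a graded module $M$ with a degree-two linear map $\partial$ such that $\partial^p=0$ and $\partial(am)=\partial(a)m+a\partial(m)$; a $p$-DG $(B,B')$-bimodule is a $p$-DG module over $B\otimes B'^{\mathrm{op}}$. Morphisms are degree-preserving module maps commuting with $\partial$. A morphism $f\colon M\to N$ is null-homotopic if $f=\sum_{i=0}^{p-1}\partial^{i}h\,\partial^{p-1-i}$ for some module map $h$ of degree $2-2p$. The quotient by null-homotopic morphisms is the homotopy category. A *quasi-isomorphism* is a morphism which becomes invertible in the homotopy category of $p$-DG modules over $\Bbbk$ (with $\partial_\Bbbk=0$), and the *derived category* $\mathcal D(B)$ is the localization of the homotopy category at the quasi-isomorphisms. The *$p$-cohomology* of $M$ consists of the spaces $\ker\partial^i/\operatorname{im}\partial^{p-i}$, $0<i<p$.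 A $p$-DG module $K$ over $B$ has *property (P)* if it has an exhaustive increasing filtration $F^0\subseteq F^1\subseteq\cdots$ by $p$-DG submodules such that $F^0$ and all $F^{i+1}/F^i$ are direct sums of $p$-DG direct summands of grading shifts of $B$; it is a *finite cell* module if in addition it is finitely generated over $B$. A *bar resolution* of $M$ is a surjective quasi-isomorphism $\mathbf p(M)\to M$ with $\mathbf p(M)$ having property (P). Let $C=\Bbbk[x]/(x^n)$ with $\deg x=2$, $\partial(x)=x^2$. Let $A=A_n^!$ be the path algebra of the quiver with vertices $1,\dots,n$ and one arrow $(i|j)$ from $i$ to $j$ whenever $|i-j|=1$, modulo the relations $(1|2|1)=0$ (if $n\ge2$) and $(i|i-1|i)=(i|i+1|i)$ for $1<i<n$. Here $(i|j|l)=(i|j)(j|l)$, the grading is by path length, and $\partial(i)=0$, $\partial(i|i+1)=(i|i+1|i|i+1)$, $\partial(i+1|i)=0$. Let $A(n)$ (resp. $(n)A$) be the span of the paths ending (resp. starting) at $n$. It is a $p$-DG $(A,C)$-bimodule (resp. $(C,A)$-bimodule), where $x$ acts as multiplication by $(n|n-1|n)$ (by $0$ if $n=1$). Let $L_n$ be the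 one-dimensional simple left $A$-module at the vertex $n$, in degree $0$, with $\partial=0$. The categorified Jones–Wenzl projector is the functor $$\mathfrak P\colon\mathcal D(A)\to\mathcal D(A),\qquad \mathfrak P(M)=A(n)\otimes_C^{\mathbf L}\big((n)A\otimes_A M\big),$$ and it is represented by the $p$-DG $(A,A)$-bimodule $A(n)\otimes_C^{\mathbf L}(n)A$. Here $A(n)\otimes^{\mathbf L}_C(-)=\mathbf p(A(n))\otimes_C(-)$ for a bar resolution $\mathbf p(A(n))$ of $A(n)$ as a $p$-DG $(A,C)$-bimodule. **Theorem.** Bar resolutions of the $p$-DG $(A,C)$-bimodule $A(n)$ exist, and for every choice of one the following hold. 1. If $p$ divides $n-1$, then $A(n)\otimes (n)A$ is a finite cell $p$-DG $(A,A)$-bimodule, $A(n)\otimes_C^{\mathbf L}(n)A\cong A(n)\otimes(n)A$ in the derived category of $p$-DG $(A,A)$-bimodules, and $\mathfrak P\cong \big(A(n)\otimes(n)A\big)\otimes_A^{\mathbf L}(-)$ as functors. 2. If $p$ does not divide $n-1$, then $\mathfrak P$ cannot be represented by a finite cell $p$-DG $(A,A)$-bimodule: for every finite cell $(A,A)$-bimodule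 $K$, the bimodule $A(n)\otimes_C^{\mathbf L}(n)A$ is not isomorphic to $K$ in the derived category of $(A,A)$-bimodules, and $\mathfrak P$ is not isomorphic to the functor $K\otimes_A^{\mathbf L}(-)$. Moreover $\mathfrak P(L_n)$ has infinite-dimensional $p$-cohomology: $\ker\partial^i/\operatorname{im}\partial^{p-i}$ is infinite-dimensional over $\Bbbk$ for some $0<i<p$. -/

import Mathlib

open CategoryTheory MulOpposite
open scoped TensorProduct

universe u

namespace PDG

/-- A `p`-DG algebra over `k`: a `ℤ`-graded algebra `A = ⨁ gr i` with a differential `d` of degree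
two satisfying the Leibniz rule without signs and `d ^ p = 0`. -/
class PDGAlgebra (p : ℕ) (k A : Type u) [Field k] [Ring A] [Algebra k A] where
  gr : ℤ → Submodule k A
  gradedMonoid : SetLike.GradedMonoid gr
  internal : DirectSum.IsInternal gr
  d : Module.End k A
  d_mem : ∀ {i : ℤ} {a : A}, a ∈ gr i → d a ∈ gr (i + 2)
  d_mul : ∀ a b : A, d (a * b) = d a * b + a * d b
  d_pow : d ^ p = 0

section Graded

variable {k M : Type u} [Field k] [AddCommGroup M] [Module k M]

/-- A family of subspaces spanning `M` is a direct sum decomposition once some linear map sends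
each `m ∈ gr i` to `m` placed in degree `i`. -/
theorem isInternal_of_coaction (gr : ℤ → Submodule k M) (htop : ⨆ i, gr i = ⊤)
    (δ : M →ₗ[k] (ℤ →₀ M)) (hδ : ∀ i, ∀ m ∈ gr i, δ m = Finsupp.single i m) :
    DirectSum.IsInternal gr := by
  rw [DirectSum.isInternal_submodule_iff_iSupIndep_and_iSup_eq_top]
  refine ⟨?_, htop⟩
  rw [iSupIndep_def]
  intro i
  rw [Submodule.disjoint_def]
  intro m hm hm'
  have key : (⨆ j, ⨆ (_ : j ≠ i), gr j) ≤ LinearMap.ker ((Finsupp.lapply i).comp δ) := by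
    refine iSup_le fun j => iSup_le fun hj => ?_
    intro x hx
    simp [hδ j x hx, hj]
  have := key hm'
  simpa [hδ i m hm] using this

/-- The map decomposing an element of a graded space into its homogeneous components. -/
noncomputable def coaction (gr : ℤ → Submodule k M) (h : DirectSum.IsInternal gr) :
    M →ₗ[k] (ℤ →₀ M) :=
  (DirectSum.toModule k ℤ (ℤ →₀ M)
    (fun i => (Finsupp.lsingle (R := k) i).comp (gr i).subtype)).comp
    (LinearEquiv.ofBijective (DirectSum.coeLinearMap gr) h).symm.toLinearMap

theorem coaction_of_mem (gr : ℤ → Submodule k M) (h : DirectSum.IsInternal gr)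
    (i : ℤ) (m : M) (hm : m ∈ gr i) : coaction gr h m = Finsupp.single i m := by
  have h1 : (LinearEquiv.ofBijective (DirectSum.coeLinearMap gr) h).symm m
      = DirectSum.lof k ℤ (fun i => gr i) i ⟨m, hm⟩ := by
    rw [LinearEquiv.symm_apply_eq]
    exact (DirectSum.coeLinearMap_lof gr i ⟨m, hm⟩).symm
  simp [coaction, h1]

theorem iSup_eq_top_of_isInternal {gr : ℤ → Submodule k M} (h : DirectSum.IsInternal gr) :
    ⨆ i, gr i = ⊤ :=
  ((DirectSum.isInternal_submodule_iff_iSupIndep_and_iSup_eq_top gr).1 h).2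

theorem linearMap_ext_of_iSup {W : Type u} [AddCommGroup W] [Module k W]
    {gr : ℤ → Submodule k M} (h : ⨆ i, gr i = ⊤) {f g : M →ₗ[k] W}
    (hfg : ∀ i, ∀ m ∈ gr i, f m = g m) : f = g := by
  have : ⨆ i, gr i ≤ LinearMap.eqLocus f g := iSup_le hfg
  exact LinearMap.ext fun m => this (h ▸ Submodule.mem_top)

theorem add_pow_prime_of_commute {p : ℕ} (hp : p.Prime) [CharP k p] {f g : Module.End k M}
    (h : Commute f g) : (f + g) ^ p = f ^ p + g ^ p := by
  have h0 : ((p : ℕ) : Module.End k M) = 0 := by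
    have : ((p : ℕ) : Module.End k M) = algebraMap k (Module.End k M) (p : k) :=
      (map_natCast (algebraMap k (Module.End k M)) p).symm
    rw [this, CharP.cast_eq_zero, map_zero]
  rw [h.add_pow_prime_eq hp, h0]
  simp

end Graded

section OfGenerators

variable {k A : Type u} [Field k] [Ring A] [Algebra k A] {S : Type}

/-- The span of the monomials of total degree `i` in generators `g s` of degree `deg s`. -/
def monomialGrading (k : Type u) {A : Type u} [Field k] [Ring A] [Algebra k A]
    {S : Type} (g : S → A) (deg : S → ℤ) (i : ℤ) : Submodule k A :=
  Submodule.span k {a | ∃ l : List S, (l.map deg).sum = i ∧ a = (l.map g).prod}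

theorem monomialGrading_mul (g : S → A) (deg : S → ℤ) {i j : ℤ} {a b : A}
    (ha : a ∈ monomialGrading k g deg i) (hb : b ∈ monomialGrading k g deg j) :
    a * b ∈ monomialGrading k g deg (i + j) := by
  unfold monomialGrading at *
  induction ha, hb using Submodule.span_induction₂ with
  | mem_mem x y hx hy =>
    obtain ⟨l, hl, rfl⟩ := hx
    obtain ⟨l', hl', rfl⟩ := hy
    exact Submodule.subset_span ⟨l ++ l', by simp [hl, hl'], by simp⟩
  | zero_left y hy => simp
  | zero_right x hx => simp
  | add_left x y z _ _ _ h1 h2 => rw [add_mul]; exact add_mem h1 h2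
  | add_right x y z _ _ _ h1 h2 => rw [mul_add]; exact add_mem h1 h2
  | smul_left r x y _ _ h => rw [smul_mul_assoc]; exact Submodule.smul_mem _ _ h
  | smul_right r x y _ _ h => rw [mul_smul_comm]; exact Submodule.smul_mem _ _ h

theorem monomialGrading_one (g : S → A) (deg : S → ℤ) : (1 : A) ∈ monomialGrading k g deg 0 :=
  Submodule.subset_span ⟨[], by simp, by simp⟩

theorem monomialGrading_gen (g : S → A) (deg : S → ℤ) (s : S) :
    g s ∈ monomialGrading k g deg (deg s) :=
  Submodule.subset_span ⟨[s], by simp, by simp⟩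

theorem iSup_monomialGrading (g : S → A) (deg : S → ℤ)
    (hg : Algebra.adjoin k (Set.range g) = ⊤) : ⨆ i, monomialGrading k g deg i = ⊤ := by
  rw [eq_top_iff]
  rintro a -
  have ha : a ∈ Algebra.adjoin k (Set.range g) := by rw [hg]; trivial
  induction ha using Algebra.adjoin_induction with
  | mem x hx =>
    obtain ⟨s, rfl⟩ := hx
    exact Submodule.mem_iSup_of_mem _ (monomialGrading_gen g deg s)
  | algebraMap r =>
    rw [Algebra.algebraMap_eq_smul_one]
    exact Submodule.smul_mem _ _ (Submodule.mem_iSup_of_mem 0 (monomialGrading_one g deg))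
  | add x y _ _ hx hy => exact add_mem hx hy
  | mul x y _ _ hx hy =>
    refine Submodule.iSup_induction _ (motive := fun x => x * y ∈ ⨆ i, monomialGrading k g deg i)
      hx (fun i x hx => ?_) (by simp) (fun x y h1 h2 => by rw [add_mul]; exact add_mem h1 h2)
    refine Submodule.iSup_induction _ (motive := fun y => x * y ∈ ⨆ i, monomialGrading k g deg i)
      hy (fun j y hy => ?_) (by simp) (fun x y h1 h2 => by rw [mul_add]; exact add_mem h1 h2)
    exact Submodule.mem_iSup_of_mem _ (monomialGrading_mul g deg hx hy)

theorem isInternal_monomialGrading (g : S → A) (deg : S → ℤ)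
    (hg : Algebra.adjoin k (Set.range g) = ⊤)
    (δ : A →ₐ[k] AddMonoidAlgebra A ℤ)
    (hδ : ∀ s, δ (g s) = AddMonoidAlgebra.single (deg s) (g s)) :
    DirectSum.IsInternal (monomialGrading k g deg) := by
  refine isInternal_of_coaction _ (iSup_monomialGrading g deg hg)
    ((AddMonoidAlgebra.coeffLinearEquiv k).toLinearMap.comp δ.toLinearMap) ?_
  intro i m hm
  unfold monomialGrading at hm
  suffices h : δ m = AddMonoidAlgebra.single i m by
    change (δ m).coeff = _
    rw [h]; rfl
  induction hm using Submodule.span_induction with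
  | mem x hx =>
    obtain ⟨l, rfl, rfl⟩ := hx
    induction l with
    | nil => exact map_one δ
    | cons s l ih =>
      simp only [List.map_cons, List.prod_cons, List.sum_cons]
      rw [map_mul, hδ, ih, AddMonoidAlgebra.single_mul_single]
  | zero => rw [map_zero, AddMonoidAlgebra.single_zero]
  | add x y _ _ hx hy => rw [map_add, hx, hy, AddMonoidAlgebra.single_add]
  | smul r x _ hx => rw [map_smul, hx, AddMonoidAlgebra.smul_single]

/-- A `k`-linear derivation of `A` whose `p`-th power kills a set of generators. -/
theorem derivation_pow_eq_zero {p : ℕ} (hp : p.Prime) [CharP k p] (g : S → A)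
    (hg : Algebra.adjoin k (Set.range g) = ⊤) (D : Module.End k A)
    (hD : ∀ a b, D (a * b) = D a * b + a * D b) (h0 : ∀ s, (D ^ p) (g s) = 0) : D ^ p = 0 := by
  have h1 : D ∘ₗ LinearMap.mul' k A
      = LinearMap.mul' k A ∘ₗ (LinearMap.rTensor A D + LinearMap.lTensor A D) := by
    ext a b; simp [hD]
  have hcomm : Commute (LinearMap.rTensor A D) (LinearMap.lTensor A D) := by
    ext a b; simp
  have h2 : ∀ m : ℕ, (D ^ m) ∘ₗ LinearMap.mul' k A
      = LinearMap.mul' k A ∘ₗ ((LinearMap.rTensor A D + LinearMap.lTensor A D) ^ m) := by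
    intro m
    induction m with
    | zero => rfl
    | succ m ih =>
      rw [pow_succ, Module.End.mul_eq_comp, LinearMap.comp_assoc, h1, ← LinearMap.comp_assoc, ih,
        LinearMap.comp_assoc, pow_succ, Module.End.mul_eq_comp]
  have h3 : ∀ a b, (D ^ p) (a * b) = (D ^ p) a * b + a * (D ^ p) b := by
    intro a b
    have := LinearMap.congr_fun (h2 p) (a ⊗ₜ[k] b)
    rw [add_pow_prime_of_commute hp hcomm, LinearMap.rTensor_pow, LinearMap.lTensor_pow] at this
    simpa using this
  have h4 : (D ^ p) 1 = 0 := by simpa using h3 1 1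
  ext a
  have ha : a ∈ Algebra.adjoin k (Set.range g) := by rw [hg]; trivial
  induction ha using Algebra.adjoin_induction with
  | mem x hx => obtain ⟨s, rfl⟩ := hx; exact h0 s
  | algebraMap r => simp [Algebra.algebraMap_eq_smul_one, h4]
  | add x y _ _ hx hy => rw [map_add, hx, hy]; simp
  | mul x y _ _ hx hy => rw [h3, hx, hy]; simp

theorem derivation_mem (g : S → A) (deg : S → ℤ) (D : Module.End k A)
    (hD : ∀ a b, D (a * b) = D a * b + a * D b)
    (hdeg : ∀ s, D (g s) ∈ monomialGrading k g deg (deg s + 2)) {i : ℤ} {a : A}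
    (ha : a ∈ monomialGrading k g deg i) : D a ∈ monomialGrading k g deg (i + 2) := by
  have h4 : D 1 = 0 := by simpa using hD 1 1
  change a ∈ Submodule.span k _ at ha
  induction ha using Submodule.span_induction with
  | mem x hx =>
    obtain ⟨l, rfl, rfl⟩ := hx
    induction l with
    | nil => simp [h4]
    | cons s l ih =>
      simp only [List.map_cons, List.prod_cons, List.sum_cons, hD]
      refine add_mem ?_ ?_
      · have := monomialGrading_mul g deg (hdeg s)
          (Submodule.subset_span ⟨l, rfl, rfl⟩ : (l.map g).prod ∈ monomialGrading k g deg _)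
        convert this using 2; ring
      · have := monomialGrading_mul g deg (monomialGrading_gen (k := k) g deg s) ih
        convert this using 2; ring
  | zero => simp
  | add x y _ _ hx hy => rw [map_add]; exact add_mem hx hy
  | smul r x _ hx => rw [map_smul]; exact Submodule.smul_mem _ _ hx

/-- The derivation `D` packaged in an algebra map of the form `a ↦ a + D(a) ε`. -/
def derivationOfAlgHom (η : A →ₐ[k] TrivSqZeroExt A A) : Module.End k A :=
  (TrivSqZeroExt.sndHom A A).restrictScalars k ∘ₗ η.toLinearMap

theorem derivationOfAlgHom_apply (η : A →ₐ[k] TrivSqZeroExt A A) (a : A) :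
    derivationOfAlgHom η a = (η a).snd := rfl

theorem derivationOfAlgHom_mul (g : S → A) (hg : Algebra.adjoin k (Set.range g) = ⊤)
    (η : A →ₐ[k] TrivSqZeroExt A A) (hη : ∀ s, (η (g s)).fst = g s) (a b : A) :
    derivationOfAlgHom η (a * b) = derivationOfAlgHom η a * b + a * derivationOfAlgHom η b := by
  have hfst : ∀ a, (η a).fst = a := by
    intro a
    have ha : a ∈ Algebra.adjoin k (Set.range g) := by rw [hg]; trivial
    induction ha using Algebra.adjoin_induction with
    | mem x hx => obtain ⟨s, rfl⟩ := hx; exact hη s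
    | algebraMap r => rw [AlgHom.commutes]; rfl
    | add x y _ _ hx hy => simp [hx, hy]
    | mul x y _ _ hx hy => simp [hx, hy]
  simp [derivationOfAlgHom_apply, hfst, add_comm]

/-- The `p`-DG algebra structure on an algebra `A` generated by the elements `g s`: `g s` has degree
`deg s` (the map `δ : A → A[ℤ]` witnesses that this grading is well defined), and `d (g s)` is the
`ε`-component of `η (g s)` (the map `η : A → A[ε]/(ε²)` witnesses that this derivation is well
defined). -/
@[reducible] noncomputable def PDGAlgebra.ofGenerators (p : ℕ) [hp : Fact p.Prime] [CharP k p]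
    (g : S → A) (hg : Algebra.adjoin k (Set.range g) = ⊤) (deg : S → ℤ)
    (δ : A →ₐ[k] AddMonoidAlgebra A ℤ)
    (hδ : ∀ s, δ (g s) = AddMonoidAlgebra.single (deg s) (g s))
    (η : A →ₐ[k] TrivSqZeroExt A A) (hη : ∀ s, (η (g s)).fst = g s)
    (hdeg : ∀ s, (η (g s)).snd ∈ monomialGrading k g deg (deg s + 2))
    (h0 : ∀ s, (derivationOfAlgHom η ^ p) (g s) = 0) : PDGAlgebra p k A where
  gr := monomialGrading k g deg
  gradedMonoid :=
    { one_mem := monomialGrading_one g deg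
      mul_mem := fun _ _ _ _ ha hb => monomialGrading_mul g deg ha hb }
  internal := isInternal_monomialGrading g deg hg δ hδ
  d := derivationOfAlgHom η
  d_mem := derivation_mem g deg _ (derivationOfAlgHom_mul g hg η hη) hdeg
  d_mul := derivationOfAlgHom_mul g hg η hη
  d_pow := derivation_pow_eq_zero hp.out g hg _ (derivationOfAlgHom_mul g hg η hη) h0

end OfGenerators

section Algebras

/-- The ground field as a `p`-DG algebra: concentrated in degree zero, with zero differential. -/
instance PDGAlgebra.base (p : ℕ) [hp : Fact p.Prime] (k : Type u) [Field k] : PDGAlgebra p k k where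
  gr i := if i = 0 then ⊤ else ⊥
  gradedMonoid :=
    { one_mem := by simp
      mul_mem := by
        intro i j a b ha hb
        by_cases hi : i = 0 <;> by_cases hj : j = 0 <;> simp_all }
  internal := by
    refine isInternal_of_coaction _ ?_ (Finsupp.lsingle 0) ?_
    · exact le_antisymm le_top (le_iSup_of_le 0 (by simp))
    · intro i m hm
      by_cases hi : i = 0 <;> simp_all
  d := 0
  d_mem := by simp
  d_mul := by simp
  d_pow := zero_pow hp.out.ne_zero

/-- The algebra `C = k[x]/(x ^ n)`. -/
abbrev TruncPoly (k : Type u) [Field k] (n : ℕ) : Type u :=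
  Polynomial k ⧸ Ideal.span {(Polynomial.X : Polynomial k) ^ n}

namespace TruncPoly

variable (k : Type u) [Field k] (n : ℕ)

/-- The class of the variable. -/
noncomputable def x : TruncPoly k n := Ideal.Quotient.mk _ Polynomial.X

theorem x_pow : x k n ^ n = 0 := by
  rw [x, ← map_pow]
  exact Ideal.Quotient.eq_zero_iff_mem.2 (Ideal.subset_span rfl)

variable {k n} in
/-- The algebra map sending `x` to an element `r` with `r ^ n = 0`. -/
noncomputable def lift {R : Type u} [Ring R] [Algebra k R] (r : R) (hr : r ^ n = 0) :
    TruncPoly k n →ₐ[k] R :=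
  Ideal.Quotient.liftₐ _ (Polynomial.aeval r) (by
    intro a ha
    obtain ⟨b, rfl⟩ := Ideal.mem_span_singleton.1 ha
    simp [hr])

theorem lift_x {R : Type u} [Ring R] [Algebra k R] (r : R) (hr : r ^ n = 0) :
    lift (k := k) r hr (x k n) = r := by
  exact Polynomial.aeval_X r

theorem adjoin_x : Algebra.adjoin k (Set.range fun _ : Unit => x k n) = ⊤ := by
  rw [eq_top_iff]
  rintro a -
  obtain ⟨f, rfl⟩ := Ideal.Quotient.mk_surjective a
  have : f ∈ Algebra.adjoin k {(Polynomial.X : Polynomial k)} := by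
    rw [Polynomial.adjoin_X]; trivial
  induction this using Algebra.adjoin_induction with
  | mem y hy =>
    rw [Set.mem_singleton_iff] at hy
    subst hy
    exact Algebra.subset_adjoin ⟨(), rfl⟩
  | algebraMap r => exact Subalgebra.algebraMap_mem _ r
  | add y z _ _ hy hz => rw [map_add]; exact add_mem hy hz
  | mul y z _ _ hy hz => rw [map_mul]; exact mul_mem hy hz

theorem pow_single (m : ℕ) : (AddMonoidAlgebra.single (2 : ℤ) (x k n)) ^ m
    = AddMonoidAlgebra.single (2 * m : ℤ) (x k n ^ m) := by
  rw [AddMonoidAlgebra.single_pow]; congr 1; simp [mul_comm]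

/-- The coaction defining the grading, `x` having degree two. -/
noncomputable def δ : TruncPoly k n →ₐ[k] AddMonoidAlgebra (TruncPoly k n) ℤ :=
  lift (AddMonoidAlgebra.single 2 (x k n)) (by rw [pow_single, x_pow, AddMonoidAlgebra.single_zero])

/-- The map `x ↦ x + x² ε`, defining the differential with `d x = x²`. -/
noncomputable def η : TruncPoly k n →ₐ[k] TrivSqZeroExt (TruncPoly k n) (TruncPoly k n) :=
  lift (TrivSqZeroExt.inl (x k n) + TrivSqZeroExt.inr (x k n ^ 2)) (by
    ext
    · simp [x_pow]
    · have h : x k n ^ (n + 1) = 0 := by rw [pow_succ, x_pow, zero_mul]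
      rcases n with _ | n
      · simp
      · simp only [TrivSqZeroExt.snd_pow, TrivSqZeroExt.fst_add, TrivSqZeroExt.fst_inl,
          TrivSqZeroExt.fst_inr, add_zero, TrivSqZeroExt.snd_add, TrivSqZeroExt.snd_inl,
          TrivSqZeroExt.snd_inr, zero_add, TrivSqZeroExt.snd_zero, smul_eq_mul, Nat.pred_succ]
        rw [← pow_add, show n + 2 = n + 1 + 1 from rfl, h, smul_zero])

theorem η_x : η k n (x k n) = TrivSqZeroExt.inl (x k n) + TrivSqZeroExt.inr (x k n ^ 2) :=
  lift_x k n _ _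

/-- The `p`-DG algebra `k[x]/(x ^ n)` with `x` in degree two and `d x = x²`. -/
noncomputable instance (p : ℕ) [hp : Fact p.Prime] [CharP k p] : PDGAlgebra p k (TruncPoly k n) :=
  PDGAlgebra.ofGenerators p (fun _ : Unit => x k n) (adjoin_x k n) (fun _ => 2) (δ k n)
    (fun _ => lift_x k n _ _) (η k n) (fun _ => by simp [η_x])
    (fun _ => by
      simp only [η_x, TrivSqZeroExt.snd_add, TrivSqZeroExt.snd_inl, TrivSqZeroExt.snd_inr, zero_add]
      exact Submodule.subset_span ⟨[(), ()], by simp, by simp [pow_two]⟩)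
    (fun _ => by
      have hmul := derivationOfAlgHom_mul (fun _ : Unit => x k n) (adjoin_x k n) (η k n)
        (fun _ => by simp [η_x])
      have hx : derivationOfAlgHom (η k n) (x k n) = x k n ^ 2 := by
        simp [derivationOfAlgHom_apply, η_x]
      have hpow : ∀ m : ℕ, derivationOfAlgHom (η k n) (x k n ^ m) = (m : k) • x k n ^ (m + 1) := by
        intro m
        induction m with
        | zero =>
          have := hmul 1 1
          simpa using this
        | succ m ih =>
          rw [pow_succ, hmul, ih, hx, smul_mul_assoc, ← pow_succ, ← pow_add, Nat.cast_succ,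
            add_smul, one_smul]
      have : ∀ m : ℕ, (derivationOfAlgHom (η k n) ^ m) (x k n)
          = (m.factorial : k) • x k n ^ (m + 1) := by
        intro m
        induction m with
        | zero => simp
        | succ m ih =>
          rw [pow_succ', Module.End.mul_apply, ih, map_smul, hpow, smul_smul, Nat.factorial_succ,
            Nat.cast_mul, mul_comm]
      rw [this, (CharP.cast_eq_zero_iff k p _).2 (Nat.dvd_factorial hp.out.pos le_rfl), zero_smul])

end TruncPoly

/-- The generators of a quiver algebra on the `n` vertices `0, …, n - 1` (written `1, …, n` in
ordinary notation): the constant path at `i`, and the path `(i|j)` of length one, which the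
relations below put equal to zero unless `i` and `j` are adjacent. -/
inductive QuiverGen (n : ℕ) : Type
  | vertex (i : Fin n)
  | arrow (i j : Fin n)

section Rel
variable (k : Type u) [Field k] (n : ℕ)

local notation "V" => fun i : Fin n => FreeAlgebra.ι k (QuiverGen.vertex i)
local notation "E" => fun i j : Fin n => FreeAlgebra.ι k (QuiverGen.arrow i j)

/-- Relations of the quiver algebra `A_n^!`: those of the path algebra of the quiver with one arrow
in each direction between adjacent vertices, together with `(1|2|1) = 0` and
`(i|i-1|i) = (i|i+1|i)` for `1 < i < n`. Here `(i|j|l)` is the product of `(i|j)` and `(j|l)`. -/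
inductive AShriekRel : FreeAlgebra k (QuiverGen n) → FreeAlgebra k (QuiverGen n) → Prop
  | vertex_mul_self (i : Fin n) : AShriekRel (V i * V i) (V i)
  | vertex_mul_vertex (i j : Fin n) (h : i ≠ j) : AShriekRel (V i * V j) 0
  | sum_vertex : AShriekRel (∑ i, V i) 1
  | vertex_mul_arrow (i j : Fin n) : AShriekRel (V i * E i j) (E i j)
  | arrow_mul_vertex (i j : Fin n) : AShriekRel (E i j * V j) (E i j)
  | not_adjacent (i j : Fin n) (h : ¬ (i.val + 1 = j.val ∨ j.val + 1 = i.val)) :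
      AShriekRel (E i j) 0
  | first (i j : Fin n) (hi : i.val = 0) (hj : j.val = 1) : AShriekRel (E i j * E j i) 0
  | middle (h i j : Fin n) (hi : h.val + 1 = i.val) (hj : i.val + 1 = j.val) :
      AShriekRel (E i h * E h i) (E i j * E j i)
end Rel

/-- The algebra `A_n^!`. -/
def AShriek (k : Type u) [Field k] (n : ℕ) : Type u := RingQuot (AShriekRel k n)

namespace AShriek
variable (k : Type u) [Field k] (n : ℕ)

noncomputable instance : Ring (AShriek k n) := inferInstanceAs (Ring (RingQuot (AShriekRel k n)))
noncomputable instance : Algebra k (AShriek k n) :=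
  inferInstanceAs (Algebra k (RingQuot (AShriekRel k n)))

/-- The quotient map from the free algebra. -/
noncomputable def mk : FreeAlgebra k (QuiverGen n) →ₐ[k] AShriek k n :=
  RingQuot.mkAlgHom k (AShriekRel k n)

variable {n}

/-- The idempotent `(i)`. -/
noncomputable def vertex (i : Fin n) : AShriek k n := mk k n (FreeAlgebra.ι k (QuiverGen.vertex i))

/-- The path `(i|j)` of length one; zero unless `i` and `j` are adjacent. -/
noncomputable def arrow (i j : Fin n) : AShriek k n :=
  mk k n (FreeAlgebra.ι k (QuiverGen.arrow i j))

theorem mk_rel {a b : FreeAlgebra k (QuiverGen n)} (h : AShriekRel k n a b) : mk k n a = mk k n b :=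
  RingQuot.mkAlgHom_rel k h

@[simp] theorem vertex_mul_self (i : Fin n) : vertex k i * vertex k i = vertex k i := by
  simpa [vertex, arrow] using mk_rel k (AShriekRel.vertex_mul_self i)
theorem vertex_mul_vertex {i j : Fin n} (h : i ≠ j) : vertex k i * vertex k j = 0 := by
  simpa [vertex, arrow] using mk_rel k (AShriekRel.vertex_mul_vertex i j h)
theorem sum_vertex : ∑ i, vertex k (n := n) i = 1 := by
  simpa [vertex, arrow] using mk_rel k (AShriekRel.sum_vertex (k := k) (n := n))
@[simp] theorem vertex_mul_arrow (i j : Fin n) : vertex k i * arrow k i j = arrow k i j := by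
  simpa [vertex, arrow] using mk_rel k (AShriekRel.vertex_mul_arrow i j)
@[simp] theorem arrow_mul_vertex (i j : Fin n) : arrow k i j * vertex k j = arrow k i j := by
  simpa [vertex, arrow] using mk_rel k (AShriekRel.arrow_mul_vertex i j)
theorem arrow_eq_zero {i j : Fin n} (h : ¬ (i.val + 1 = j.val ∨ j.val + 1 = i.val)) :
    arrow k i j = 0 := by
  simpa [vertex, arrow] using mk_rel k (AShriekRel.not_adjacent i j h)
theorem first {i j : Fin n} (hi : i.val = 0) (hj : j.val = 1) : arrow k i j * arrow k j i = 0 := by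
  simpa [vertex, arrow] using mk_rel k (AShriekRel.first i j hi hj)
theorem middle {h i j : Fin n} (hi : h.val + 1 = i.val) (hj : i.val + 1 = j.val) :
    arrow k i h * arrow k h i = arrow k i j * arrow k j i := by
  simpa [vertex, arrow] using mk_rel k (AShriekRel.middle h i j hi hj)

/-- The generators as elements of `A_n^!`. -/
noncomputable def gen : QuiverGen n → AShriek k n
  | .vertex i => vertex k i
  | .arrow i j => arrow k i j

/-- The grading is by path length. -/
def deg : QuiverGen n → ℤ
  | .vertex _ => 0
  | .arrow _ _ => 1

/-- Values of the differential: `d (i) = 0`, `d (i|i+1) = (i|i+1|i|i+1)` and `d (i+1|i) = 0`. -/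
noncomputable def dGen : QuiverGen n → AShriek k n
  | .vertex _ => 0
  | .arrow i j => if i < j then arrow k i j * arrow k j i * arrow k i j else 0

theorem gen_eq (g : QuiverGen n) : gen k g = mk k n (FreeAlgebra.ι k g) := by cases g <;> rfl

theorem adjoin_gen : Algebra.adjoin k (Set.range (gen k (n := n))) = ⊤ := by
  have h : gen k (n := n) = mk k n ∘ FreeAlgebra.ι k := funext (gen_eq k)
  rw [h, Set.range_comp, ← AlgHom.map_adjoin, FreeAlgebra.adjoin_range_ι, Algebra.map_top,
    AlgHom.range_eq_top]
  exact RingQuot.mkAlgHom_surjective k _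

/-- The algebra map out of `A_n^!` with given values on generators. -/
noncomputable def lift {R : Type u} [Ring R] [Algebra k R] (f : QuiverGen n → R)
    (hf : ∀ ⦃a b⦄, AShriekRel k n a b → FreeAlgebra.lift k f a = FreeAlgebra.lift k f b) :
    AShriek k n →ₐ[k] R :=
  RingQuot.liftAlgHom k ⟨FreeAlgebra.lift k f, hf⟩

theorem lift_gen {R : Type u} [Ring R] [Algebra k R] (f : QuiverGen n → R)
    (hf : ∀ ⦃a b⦄, AShriekRel k n a b → FreeAlgebra.lift k f a = FreeAlgebra.lift k f b)
    (g : QuiverGen n) : lift k f hf (gen k g) = f g := by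
  rw [gen_eq]
  exact (RingQuot.liftAlgHom_mkAlgHom_apply k (FreeAlgebra.lift k f) hf _).trans
    (FreeAlgebra.lift_ι_apply f g)

/-- The coaction defining the path length grading. -/
noncomputable def δ : AShriek k n →ₐ[k] AddMonoidAlgebra (AShriek k n) ℤ :=
  lift k (fun g => AddMonoidAlgebra.single (deg g) (gen k g)) (by
    intro a b h
    cases h with
    | vertex_mul_self i =>
      simp only [map_mul, FreeAlgebra.lift_ι_apply, AddMonoidAlgebra.single_mul_single, deg, gen,
        vertex_mul_self, add_zero]
    | vertex_mul_vertex i j h =>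
      simp only [map_mul, FreeAlgebra.lift_ι_apply, AddMonoidAlgebra.single_mul_single, gen,
        vertex_mul_vertex k h, AddMonoidAlgebra.single_zero, map_zero]
    | sum_vertex =>
      simp only [map_sum, FreeAlgebra.lift_ι_apply, deg, gen, map_one]
      rw [AddMonoidAlgebra.one_def, ← sum_vertex k]
      exact (map_sum (AddMonoidAlgebra.singleAddHom (R := AShriek k n) (0 : ℤ)) _ _).symm
    | vertex_mul_arrow i j =>
      simp only [map_mul, FreeAlgebra.lift_ι_apply, AddMonoidAlgebra.single_mul_single, deg, gen,
        vertex_mul_arrow, zero_add]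
    | arrow_mul_vertex i j =>
      simp only [map_mul, FreeAlgebra.lift_ι_apply, AddMonoidAlgebra.single_mul_single, deg, gen,
        arrow_mul_vertex, add_zero]
    | not_adjacent i j h =>
      simp only [FreeAlgebra.lift_ι_apply, gen, arrow_eq_zero k h, AddMonoidAlgebra.single_zero,
        map_zero]
    | first i j hi hj =>
      simp only [map_mul, FreeAlgebra.lift_ι_apply, AddMonoidAlgebra.single_mul_single, gen,
        first k hi hj, AddMonoidAlgebra.single_zero, map_zero]
    | middle h i j hi hj =>
      simp only [map_mul, FreeAlgebra.lift_ι_apply, AddMonoidAlgebra.single_mul_single, gen, deg,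
        middle k hi hj])

/-- The map `g ↦ g + d(g) ε` defining the differential. -/
noncomputable def η : AShriek k n →ₐ[k] TrivSqZeroExt (AShriek k n) (AShriek k n) :=
  lift k (fun g => TrivSqZeroExt.inl (gen k g) + TrivSqZeroExt.inr (dGen k g)) (by
    intro a b h
    cases h with
    | vertex_mul_self i => ext <;> simp [gen, dGen]
    | vertex_mul_vertex i j h => ext <;> simp [gen, dGen, vertex_mul_vertex k h]
    | sum_vertex =>
      simp only [map_sum, FreeAlgebra.lift_ι_apply, gen, dGen, map_one, TrivSqZeroExt.inr_zero,
        add_zero]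
      rw [← TrivSqZeroExt.inl_one, ← sum_vertex k]
      exact (map_sum (TrivSqZeroExt.inlHom (AShriek k n) (AShriek k n)) _ _).symm
    | vertex_mul_arrow i j =>
      by_cases hij : i < j <;> ext <;> simp [gen, dGen, hij, ← mul_assoc]
    | arrow_mul_vertex i j =>
      by_cases hij : i < j <;> ext <;> simp [gen, dGen, hij, mul_assoc]
    | not_adjacent i j h => ext <;> simp [gen, dGen, arrow_eq_zero k h]
    | first i j hi hj =>
      have h1 : i < j := by rw [Fin.lt_def]; omega
      have h2 : ¬ j < i := not_lt.2 h1.le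
      ext
      · simp [gen, first k hi hj]
      · simp [gen, dGen, h1, h2, mul_assoc, first k hi hj]
    | middle h i j hi hj =>
      have h1 : h < i := by rw [Fin.lt_def]; omega
      have h2 : i < j := by rw [Fin.lt_def]; omega
      ext
      · simp [gen, middle k hi hj]
      · simp only [map_mul, FreeAlgebra.lift_ι_apply, gen, dGen, h1, h2, not_lt.2 h1.le,
          not_lt.2 h2.le, if_true, if_false, TrivSqZeroExt.snd_mul, TrivSqZeroExt.fst_add,
          TrivSqZeroExt.snd_add, TrivSqZeroExt.fst_inl, TrivSqZeroExt.fst_inr,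
          TrivSqZeroExt.snd_inl, TrivSqZeroExt.snd_inr, add_zero, zero_add, smul_eq_mul, mul_zero,
          MulOpposite.smul_eq_mul_unop, MulOpposite.unop_op, zero_mul]
        simp only [← mul_assoc]
        rw [middle k hi hj, mul_assoc (arrow k i j * _), middle k hi hj, ← mul_assoc])

theorem η_gen (g : QuiverGen n) :
    η k (gen k g) = TrivSqZeroExt.inl (gen k g) + TrivSqZeroExt.inr (dGen k g) :=
  lift_gen k _ _ g

/-- The `p`-DG algebra `A_n^!`. -/
noncomputable instance (p : ℕ) [hp : Fact p.Prime] [CharP k p] : PDGAlgebra p k (AShriek k n) :=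
  PDGAlgebra.ofGenerators p (gen k) (adjoin_gen k) deg (δ k) (fun g => lift_gen k _ _ g)
    (η k) (fun g => by simp [η_gen])
    (fun g => by
      simp only [η_gen, TrivSqZeroExt.snd_add, TrivSqZeroExt.snd_inl, TrivSqZeroExt.snd_inr,
        zero_add]
      cases g with
      | vertex i => exact Submodule.zero_mem _
      | arrow i j =>
        by_cases hij : i < j
        · simp only [dGen, hij, if_true]
          exact Submodule.subset_span
            ⟨[.arrow i j, .arrow j i, .arrow i j], by simp [deg], by simp [gen, mul_assoc]⟩
        · simp [dGen, hij])
    (fun g => by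
      have hmul := derivationOfAlgHom_mul (gen k) (adjoin_gen k (n := n)) (η k)
        (fun g => by simp [η_gen])
      have hgen : ∀ g : QuiverGen n, derivationOfAlgHom (η k) (gen k g) = dGen k g := by
        intro g; simp [derivationOfAlgHom_apply, η_gen]
      obtain ⟨q, rfl⟩ : ∃ q, p = q + 1 := ⟨p - 1, (Nat.succ_pred hp.out.ne_zero).symm⟩
      cases g with
      | vertex i => rw [pow_succ, Module.End.mul_apply, hgen]; exact map_zero _
      | arrow i j =>
        by_cases hij : i < j
        · have ha := hgen (.arrow i j)
          have hb := hgen (.arrow j i)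
          simp only [gen, dGen, hij, not_lt.2 hij.le, if_true, if_false] at ha hb
          set D := derivationOfAlgHom (η k (n := n))
          set a := arrow k i j
          set b := arrow k j i
          have hpow : ∀ m : ℕ, D ((a * b) ^ m * a) = ((m + 1 : ℕ) : k) • ((a * b) ^ (m + 1) * a) := by
            intro m
            induction m with
            | zero => simp [ha]
            | succ m ih =>
              have : (a * b) ^ (m + 1) * a = a * (b * ((a * b) ^ m * a)) := by
                rw [pow_succ']; simp only [mul_assoc]
              rw [this, hmul, hmul, hb, ih, ha]
              rw [Nat.cast_succ (m + 1), add_smul, one_smul]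
              simp only [zero_mul, zero_add, mul_smul_comm, pow_succ', mul_assoc]
              rw [add_comm]
          have hfac : ∀ m : ℕ, (D ^ m) a = (m.factorial : k) • ((a * b) ^ m * a) := by
            intro m
            induction m with
            | zero => simp
            | succ m ih =>
              rw [pow_succ', Module.End.mul_apply, ih, map_smul, hpow, smul_smul,
                Nat.factorial_succ, Nat.cast_mul, mul_comm]
          change (D ^ (q + 1)) a = 0
          rw [hfac, (CharP.cast_eq_zero_iff k (q + 1) _).2 (Nat.dvd_factorial hp.out.pos le_rfl),
            zero_smul]
        · rw [pow_succ, Module.End.mul_apply, hgen]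
          simp [dGen, hij])

/-- The vertex `n` of the quiver, that is the last one. -/
def last (n : ℕ) [NeZero n] : Fin n := ⟨n - 1, Nat.sub_lt (NeZero.pos n) one_pos⟩

/-- The loop `(n|n-1|n)` at the last vertex (only `j = n - 1` contributes to the sum); it is zero for
`n = 1`. -/
noncomputable def loop (n : ℕ) [NeZero n] : AShriek k n :=
  ∑ j, arrow k (last n) j * arrow k j (last n)

end AShriek
end Algebras

section Bimodules

/-- A `p`-DG bimodule over `(A, B)`: a `ℤ`-graded `(A, B)`-bimodule on which `k` acts centrally, with
a differential `d` of degree two satisfying the Leibniz rule for both actions and `d ^ p = 0`; in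
other words a `p`-DG module over `A ⊗ B^op`. Left `p`-DG modules over `A` are the case `B = k`, right
`p`-DG modules over `B` the case `A = k`, and `p`-complexes the case `A = B = k`. -/
structure PDGBimod (p : ℕ) (k A B : Type u) [Field k] [Ring A] [Algebra k A] [PDGAlgebra p k A]
    [Ring B] [Algebra k B] [PDGAlgebra p k B] where
  carrier : Type u
  [addCommGroup : AddCommGroup carrier]
  [module : Module k carrier]
  gr : ℤ → Submodule k carrier
  internal : DirectSum.IsInternal gr
  lact : A →ₐ[k] Module.End k carrier
  ract : Bᵐᵒᵖ →ₐ[k] Module.End k carrier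
  lact_ract : ∀ (a : A) (b : Bᵐᵒᵖ) (m : carrier), lact a (ract b m) = ract b (lact a m)
  lact_mem : ∀ {i j : ℤ} {a : A} {m : carrier},
    a ∈ PDGAlgebra.gr (p := p) (k := k) i → m ∈ gr j → lact a m ∈ gr (i + j)
  ract_mem : ∀ {i j : ℤ} {b : B} {m : carrier},
    b ∈ PDGAlgebra.gr (p := p) (k := k) i → m ∈ gr j → ract (op b) m ∈ gr (j + i)
  d : Module.End k carrier
  d_mem : ∀ {i : ℤ} {m : carrier}, m ∈ gr i → d m ∈ gr (i + 2)
  d_lact : ∀ (a : A) (m : carrier),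
    d (lact a m) = lact (PDGAlgebra.d (p := p) (k := k) a) m + lact a (d m)
  d_ract : ∀ (b : B) (m : carrier),
    d (ract (op b) m) = ract (op b) (d m) + ract (op (PDGAlgebra.d (p := p) (k := k) b)) m
  d_pow : d ^ p = 0

namespace PDGBimod

attribute [instance] addCommGroup module

variable {p : ℕ} {k A B C : Type u} [Field k] [Ring A] [Algebra k A] [PDGAlgebra p k A]
  [Ring B] [Algebra k B] [PDGAlgebra p k B] [Ring C] [Algebra k C] [PDGAlgebra p k C]

instance : CoeSort (PDGBimod p k A B) (Type u) := ⟨carrier⟩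

/-- Morphisms: bimodule maps preserving the grading and commuting with the differentials. -/
@[ext]
structure Hom (M N : PDGBimod p k A B) where
  lin : M →ₗ[k] N
  map_lact : ∀ a m, lin (M.lact a m) = N.lact a (lin m)
  map_ract : ∀ b m, lin (M.ract b m) = N.ract b (lin m)
  map_mem : ∀ {i : ℤ} {m : M}, m ∈ M.gr i → lin m ∈ N.gr i
  map_d : ∀ m, lin (M.d m) = N.d (lin m)

instance : Category (PDGBimod p k A B) where
  Hom := Hom
  id M := ⟨LinearMap.id, fun _ _ => rfl, fun _ _ => rfl, fun h => h, fun _ => rfl⟩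
  comp f g := ⟨g.lin ∘ₗ f.lin, fun a m => by simp [f.map_lact, g.map_lact],
    fun b m => by simp [f.map_ract, g.map_ract], fun h => g.map_mem (f.map_mem h),
    fun m => by simp [f.map_d, g.map_d]⟩

@[ext]
theorem hom_ext {M N : PDGBimod p k A B} {f g : M ⟶ N} (h : ∀ m, f.lin m = g.lin m) : f = g :=
  Hom.ext (LinearMap.ext h)

@[simp] theorem id_lin (M : PDGBimod p k A B) : Hom.lin (𝟙 M) = LinearMap.id := rfl
@[simp] theorem comp_lin {M N K : PDGBimod p k A B} (f : M ⟶ N) (g : N ⟶ K) :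
    Hom.lin (f ≫ g) = g.lin ∘ₗ f.lin := rfl

section Regular
variable (p k A)

/-- `A` as a bimodule over itself. -/
def regular : PDGBimod p k A A where
  carrier := A
  gr := PDGAlgebra.gr (p := p) (k := k)
  internal := PDGAlgebra.internal
  lact := Algebra.lmul k A
  ract := Algebra.lsmul k k A
  lact_ract a b m := by simp [mul_assoc]
  lact_mem ha hm := PDGAlgebra.gradedMonoid.mul_mem ha hm
  ract_mem hb hm := PDGAlgebra.gradedMonoid.mul_mem hm hb
  d := PDGAlgebra.d (p := p)
  d_mem := PDGAlgebra.d_mem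
  d_lact a m := by simp [PDGAlgebra.d_mul]
  d_ract b m := by simp [PDGAlgebra.d_mul]
  d_pow := PDGAlgebra.d_pow

end Regular

section Base
variable [hp : Fact p.Prime]

theorem d_algebraMap (c : k) : PDGAlgebra.d (p := p) (k := k) c = 0 := rfl

theorem base_mem {i : ℤ} {c : k} (hc : c ∈ PDGAlgebra.gr (p := p) (k := k) (A := k) i) :
    c = 0 ∨ i = 0 := by
  by_cases hi : i = 0
  · exact Or.inr hi
  · left
    have : c ∈ (if i = 0 then ⊤ else ⊥ : Submodule k k) := hc
    simpa [hi] using this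

/-- Forget the right action. -/
def leftPart (M : PDGBimod p k A B) : PDGBimod p k A k where
  carrier := M.carrier
  gr := M.gr
  internal := M.internal
  lact := M.lact
  ract := (Algebra.ofId k (Module.End k M)).comp (AlgEquiv.toOpposite k k).symm.toAlgHom
  lact_ract a b m := by simp [Algebra.ofId_apply]
  lact_mem := M.lact_mem
  ract_mem {i j b m} hb hm := by
    rcases base_mem hb with rfl | rfl
    · simp
    · simpa [Algebra.ofId_apply] using Submodule.smul_mem _ b hm
  d := M.d
  d_mem := M.d_mem
  d_lact := M.d_lact
  d_ract b m := by simp [Algebra.ofId_apply, d_algebraMap]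
  d_pow := M.d_pow

/-- Forget the left action. -/
def rightPart (M : PDGBimod p k A B) : PDGBimod p k k B where
  carrier := M.carrier
  gr := M.gr
  internal := M.internal
  lact := Algebra.ofId k (Module.End k M)
  ract := M.ract
  lact_ract a b m := by simp [Algebra.ofId_apply]
  lact_mem {i j b m} hb hm := by
    rcases base_mem hb with rfl | rfl
    · simp
    · simpa [Algebra.ofId_apply] using Submodule.smul_mem _ b hm
  ract_mem := M.ract_mem
  d := M.d
  d_mem := M.d_mem
  d_lact b m := by simp [Algebra.ofId_apply, d_algebraMap]
  d_ract := M.d_ract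
  d_pow := M.d_pow

variable (p k A B) in
/-- The underlying `p`-complex. -/
def forget : PDGBimod p k A B ⥤ PDGBimod p k k k where
  obj M := M.leftPart.rightPart
  map f :=
    { lin := f.lin
      map_lact := fun a m => map_smul f.lin a m
      map_ract := fun b m => map_smul f.lin b.unop m
      map_mem := f.map_mem
      map_d := f.map_d }
  map_id _ := rfl
  map_comp _ _ := rfl

end Base

/-- The grading shift `M{s}`, with `M{s}_i = M_{i - s}`. -/
def shift (M : PDGBimod p k A B) (s : ℤ) : PDGBimod p k A B where
  carrier := M.carrier
  gr i := M.gr (i - s)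
  internal := by
    rw [DirectSum.isInternal_submodule_iff_iSupIndep_and_iSup_eq_top]
    have h := (DirectSum.isInternal_submodule_iff_iSupIndep_and_iSup_eq_top _).1 M.internal
    exact ⟨h.1.comp (sub_left_injective), ((Equiv.subRight s).iSup_comp (g := M.gr)).trans h.2⟩
  lact := M.lact
  ract := M.ract
  lact_ract := M.lact_ract
  lact_mem ha hm := by rw [add_sub_assoc]; exact M.lact_mem ha hm
  ract_mem ha hm := by rw [add_sub_right_comm]; exact M.ract_mem ha hm
  d := M.d
  d_mem hm := by rw [add_sub_right_comm]; exact M.d_mem hm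
  d_lact := M.d_lact
  d_ract := M.d_ract
  d_pow := M.d_pow

theorem homogeneous_induction (M : PDGBimod p k A B) {motive : M → Prop}
    (mem : ∀ i, ∀ m ∈ M.gr i, motive m) (add : ∀ x y, motive x → motive y → motive (x + y))
    (m : M) : motive m := by
  have hm : m ∈ ⨆ i, M.gr i := by rw [iSup_eq_top_of_isInternal M.internal]; trivial
  exact Submodule.iSup_induction _ (motive := motive) hm mem (mem 0 0 (zero_mem _)) add

section Tensor
variable (X : PDGBimod p k A B) (Y : PDGBimod p k B C)

/-- The relations `x b ⊗ y = x ⊗ b y` defining the tensor product over `B`. -/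
def balanced : Submodule k (X ⊗[k] Y) :=
  Submodule.span k {t | ∃ (x : X) (b : B) (y : Y),
    t = X.ract (op b) x ⊗ₜ[k] y - x ⊗ₜ[k] Y.lact b y}

/-- The vector space `X ⊗_B Y`. -/
abbrev tensorCarrier : Type u := (X ⊗[k] Y) ⧸ balanced X Y

/-- A pure tensor in `X ⊗_B Y`. -/
def tmul (x : X) (y : Y) : tensorCarrier X Y := (balanced X Y).mkQ (x ⊗ₜ[k] y)

theorem tmul_balanced (x : X) (b : B) (y : Y) :
    tmul X Y (X.ract (op b) x) y = tmul X Y x (Y.lact b y) := by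
  rw [tmul, tmul, ← sub_eq_zero, ← map_sub]
  exact (Submodule.Quotient.mk_eq_zero _).2 (Submodule.subset_span ⟨x, b, y, rfl⟩)

variable {X Y} in
theorem tensor_ext {W : Type u} [AddCommGroup W] [Module k W] {f g : tensorCarrier X Y →ₗ[k] W}
    (h : ∀ x y, f (tmul X Y x y) = g (tmul X Y x y)) : f = g := by
  apply Submodule.linearMap_qext
  ext x y
  exact h x y

/-- The total grading on `X ⊗_B Y`. -/
def tensorGr (i : ℤ) : Submodule k (tensorCarrier X Y) :=
  Submodule.span k {t | ∃ (a b : ℤ) (x : X) (y : Y),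
    x ∈ X.gr a ∧ y ∈ Y.gr b ∧ a + b = i ∧ t = tmul X Y x y}

theorem tmul_mem {a b i : ℤ} {x : X} {y : Y} (hx : x ∈ X.gr a) (hy : y ∈ Y.gr b)
    (h : a + b = i) : tmul X Y x y ∈ tensorGr X Y i :=
  Submodule.subset_span ⟨a, b, x, y, hx, hy, h, rfl⟩

theorem iSup_tensorGr : ⨆ i, tensorGr X Y i = ⊤ := by
  rw [eq_top_iff]
  rintro t -
  obtain ⟨t, rfl⟩ := Submodule.mkQ_surjective _ t
  induction t using TensorProduct.induction_on with
  | zero => simp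
  | add s t hs ht => rw [map_add]; exact add_mem hs ht
  | tmul x y =>
    refine X.homogeneous_induction
      (motive := fun x => (balanced X Y).mkQ (x ⊗ₜ[k] y) ∈ ⨆ i, tensorGr X Y i)
      (fun i x hx => ?_) (fun x x' h h' => ?_) x
    · refine Y.homogeneous_induction
        (motive := fun y => (balanced X Y).mkQ (x ⊗ₜ[k] y) ∈ ⨆ i, tensorGr X Y i)
        (fun j y hy => ?_) (fun y y' h h' => ?_) y
      · exact Submodule.mem_iSup_of_mem (i + j) (tmul_mem X Y hx hy rfl)
      · rw [TensorProduct.tmul_add, map_add]; exact add_mem h h'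
    · rw [TensorProduct.add_tmul, map_add]; exact add_mem h h'

/-- Auxiliary map splitting `X ⊗ Y` into homogeneous components. -/
noncomputable def tensorCoaction₀ : X ⊗[k] Y →ₗ[k] (ℤ →₀ tensorCarrier X Y) :=
  Finsupp.mapRange.linearMap (balanced X Y).mkQ ∘ₗ
    Finsupp.lmapDomain _ k (fun ij : ℤ × ℤ => ij.1 + ij.2) ∘ₗ
    (finsuppTensorFinsupp k k X Y ℤ ℤ).toLinearMap ∘ₗ
    TensorProduct.map (coaction X.gr X.internal) (coaction Y.gr Y.internal)

theorem tensorCoaction₀_tmul {i j : ℤ} {x : X} {y : Y} (hx : x ∈ X.gr i) (hy : y ∈ Y.gr j) :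
    tensorCoaction₀ X Y (x ⊗ₜ y) = Finsupp.single (i + j) (tmul X Y x y) := by
  simp [tensorCoaction₀, coaction_of_mem _ _ _ _ hx, coaction_of_mem _ _ _ _ hy,
    finsuppTensorFinsupp_single, Finsupp.mapDomain_single, tmul]

theorem tensorCoaction₀_balanced (x : X) (b : B) (y : Y) :
    tensorCoaction₀ X Y (X.ract (op b) x ⊗ₜ[k] y) = tensorCoaction₀ X Y (x ⊗ₜ[k] Y.lact b y) := by
  have hX := iSup_eq_top_of_isInternal X.internal
  have hY := iSup_eq_top_of_isInternal Y.internal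
  have hB := iSup_eq_top_of_isInternal (PDGAlgebra.internal (p := p) (k := k) (A := B))
  refine LinearMap.congr_fun (f := tensorCoaction₀ X Y ∘ₗ (TensorProduct.mk k X Y).flip y ∘ₗ
    X.ract (op b)) (g := tensorCoaction₀ X Y ∘ₗ (TensorProduct.mk k X Y).flip (Y.lact b y))
    (linearMap_ext_of_iSup hX fun i x hx => ?_) x
  refine LinearMap.congr_fun
    (f := tensorCoaction₀ X Y ∘ₗ TensorProduct.mk k X Y (X.ract (op b) x))
    (g := tensorCoaction₀ X Y ∘ₗ TensorProduct.mk k X Y x ∘ₗ Y.lact b)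
    (linearMap_ext_of_iSup hY fun j y hy => ?_) y
  refine LinearMap.congr_fun
    (f := tensorCoaction₀ X Y ∘ₗ (TensorProduct.mk k X Y).flip y ∘ₗ
      X.ract.toLinearMap.flip x ∘ₗ (opLinearEquiv k).toLinearMap)
    (g := tensorCoaction₀ X Y ∘ₗ TensorProduct.mk k X Y x ∘ₗ Y.lact.toLinearMap.flip y)
    (linearMap_ext_of_iSup hB fun l b hb => ?_) b
  change tensorCoaction₀ X Y (X.ract (op b) x ⊗ₜ[k] y) = tensorCoaction₀ X Y (x ⊗ₜ[k] Y.lact b y)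
  rw [tensorCoaction₀_tmul X Y (X.ract_mem hb hx) hy,
    tensorCoaction₀_tmul X Y hx (Y.lact_mem hb hy), tmul_balanced, add_assoc]

/-- The map splitting `X ⊗_B Y` into homogeneous components. -/
noncomputable def tensorCoaction : tensorCarrier X Y →ₗ[k] (ℤ →₀ tensorCarrier X Y) :=
  (balanced X Y).liftQ (tensorCoaction₀ X Y) (by
    refine Submodule.span_le.2 ?_
    rintro _ ⟨x, b, y, rfl⟩
    change _ = _
    rw [map_sub, sub_eq_zero, tensorCoaction₀_balanced])

theorem tensor_internal : DirectSum.IsInternal (tensorGr X Y) := by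
  refine isInternal_of_coaction _ (iSup_tensorGr X Y) (tensorCoaction X Y) ?_
  intro i m hm
  change m ∈ Submodule.span k _ at hm
  induction hm using Submodule.span_induction with
  | mem t ht =>
    obtain ⟨a, b, x, y, hx, hy, rfl, rfl⟩ := ht
    exact tensorCoaction₀_tmul X Y hx hy
  | zero => simp
  | add s t _ _ hs ht => rw [map_add, hs, ht, Finsupp.single_add]
  | smul c t _ ht => rw [map_smul, ht, Finsupp.smul_single]

variable {X Y} in
/-- A map between tensor products over `B` induced from one over `k`. -/
def tensorMap {X' : PDGBimod p k A B} {Y' : PDGBimod p k B C} (f : X ⊗[k] Y →ₗ[k] X' ⊗[k] Y')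
    (hf : ∀ x b y, f (X.ract (op b) x ⊗ₜ[k] y - x ⊗ₜ[k] Y.lact b y) ∈ balanced X' Y') :
    tensorCarrier X Y →ₗ[k] tensorCarrier X' Y' :=
  (balanced X Y).mapQ (balanced X' Y') f (by
    refine Submodule.span_le.2 ?_
    rintro _ ⟨x, b, y, rfl⟩
    exact hf x b y)

theorem mem_balanced (x : X) (b : B) (y : Y) :
    X.ract (op b) x ⊗ₜ[k] y - x ⊗ₜ[k] Y.lact b y ∈ balanced X Y :=
  Submodule.subset_span ⟨x, b, y, rfl⟩

/-- The left action on `X ⊗_B Y`. -/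
def tensorLact (a : A) : Module.End k (tensorCarrier X Y) :=
  tensorMap (LinearMap.rTensor Y (X.lact a)) (fun x b y => by
    simpa [X.lact_ract] using mem_balanced X Y (X.lact a x) b y)

/-- The right action on `X ⊗_B Y`. -/
def tensorRact (c : Cᵐᵒᵖ) : Module.End k (tensorCarrier X Y) :=
  tensorMap (LinearMap.lTensor X (Y.ract c)) (fun x b y => by
    simpa [Y.lact_ract] using mem_balanced X Y x b (Y.ract c y))

theorem tensorD_aux (x : X) (b : B) (y : Y) :
    (LinearMap.rTensor Y X.d + LinearMap.lTensor X Y.d : Module.End k (X ⊗[k] Y))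
      (X.ract (op b) x ⊗ₜ[k] y - x ⊗ₜ[k] Y.lact b y) ∈ balanced X Y := by
  have h1 := mem_balanced X Y (X.d x) b y
  have h2 := mem_balanced X Y x b (Y.d y)
  have h3 := mem_balanced X Y x (PDGAlgebra.d (p := p) (k := k) b) y
  convert add_mem (add_mem h1 h2) h3 using 1
  simp only [LinearMap.add_apply, map_sub, LinearMap.rTensor_tmul, LinearMap.lTensor_tmul,
    X.d_ract, Y.d_lact, TensorProduct.add_tmul, TensorProduct.tmul_add]
  abel

/-- The differential `d(x ⊗ y) = d x ⊗ y + x ⊗ d y`. -/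
def tensorD : Module.End k (tensorCarrier X Y) :=
  tensorMap (LinearMap.rTensor Y X.d + LinearMap.lTensor X Y.d) (tensorD_aux X Y)

theorem tensorLact_tmul (a : A) (x : X) (y : Y) :
    tensorLact X Y a (tmul X Y x y) = tmul X Y (X.lact a x) y := rfl
theorem tensorRact_tmul (c : Cᵐᵒᵖ) (x : X) (y : Y) :
    tensorRact X Y c (tmul X Y x y) = tmul X Y x (Y.ract c y) := rfl
theorem tensorD_tmul (x : X) (y : Y) :
    tensorD X Y (tmul X Y x y) = tmul X Y (X.d x) y + tmul X Y x (Y.d y) := rfl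

theorem tmul_add (x : X) (y y' : Y) : tmul X Y x (y + y') = tmul X Y x y + tmul X Y x y' := by
  simp [tmul, TensorProduct.tmul_add]
theorem add_tmul (x x' : X) (y : Y) : tmul X Y (x + x') y = tmul X Y x y + tmul X Y x' y := by
  simp [tmul, TensorProduct.add_tmul]
theorem smul_tmul (c : k) (x : X) (y : Y) : tmul X Y (c • x) y = c • tmul X Y x y := by
  rw [tmul, ← TensorProduct.smul_tmul', map_smul]; rfl
theorem tmul_smul (c : k) (x : X) (y : Y) : tmul X Y x (c • y) = c • tmul X Y x y := by
  simp [tmul]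

theorem tensorGr_mem_of {f : Module.End k (tensorCarrier X Y)} {i j : ℤ}
    (h : ∀ a b x y, x ∈ X.gr a → y ∈ Y.gr b → a + b = i → f (tmul X Y x y) ∈ tensorGr X Y j)
    {t : tensorCarrier X Y} (ht : t ∈ tensorGr X Y i) : f t ∈ tensorGr X Y j := by
  have : tensorGr X Y i ≤ (tensorGr X Y j).comap f := by
    refine Submodule.span_le.2 ?_
    rintro _ ⟨a, b, x, y, hx, hy, hab, rfl⟩
    exact h a b x y hx hy hab
  exact this ht

variable [hp : Fact p.Prime] [CharP k p]

/-- The tensor product `X ⊗_B Y` of an `(A, B)`- and a `(B, C)`-bimodule. -/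
def tensor : PDGBimod p k A C where
  carrier := tensorCarrier X Y
  gr := tensorGr X Y
  internal := tensor_internal X Y
  lact := AlgHom.ofLinearMap
    { toFun := tensorLact X Y
      map_add' := fun a b => tensor_ext fun x y => by
        simp [tensorLact_tmul, add_tmul]
      map_smul' := fun c a => tensor_ext fun x y => by
        simp [tensorLact_tmul, smul_tmul] }
    (tensor_ext fun x y => by simp [tensorLact_tmul])
    (fun a b => tensor_ext fun x y => by simp [tensorLact_tmul])
  ract := AlgHom.ofLinearMap
    { toFun := tensorRact X Y
      map_add' := fun a b => tensor_ext fun x y => by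
        simp [tensorRact_tmul, tmul_add]
      map_smul' := fun c a => tensor_ext fun x y => by
        simp [tensorRact_tmul, tmul_smul] }
    (tensor_ext fun x y => by simp [tensorRact_tmul])
    (fun a b => tensor_ext fun x y => by simp [tensorRact_tmul])
  lact_ract a c := LinearMap.congr_fun (f := tensorLact X Y a ∘ₗ tensorRact X Y c)
    (g := tensorRact X Y c ∘ₗ tensorLact X Y a) (tensor_ext fun x y => rfl)
  lact_mem ha ht := tensorGr_mem_of X Y (fun a b x y hx hy hab =>
    tmul_mem X Y (X.lact_mem ha hx) hy (by omega)) ht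
  ract_mem hc ht := tensorGr_mem_of X Y (fun a b x y hx hy hab =>
    tmul_mem X Y hx (Y.ract_mem hc hy) (by omega)) ht
  d := tensorD X Y
  d_mem ht := tensorGr_mem_of X Y (fun a b x y hx hy hab => add_mem
    (tmul_mem X Y (X.d_mem hx) hy (by omega)) (tmul_mem X Y hx (Y.d_mem hy) (by omega))) ht
  d_lact a := LinearMap.congr_fun (f := tensorD X Y ∘ₗ tensorLact X Y a)
    (g := tensorLact X Y (PDGAlgebra.d (p := p) (k := k) a) + tensorLact X Y a ∘ₗ tensorD X Y)
    (tensor_ext fun x y => by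
      simp [tensorLact_tmul, tensorD_tmul, X.d_lact, add_tmul, add_assoc])
  d_ract c := LinearMap.congr_fun (f := tensorD X Y ∘ₗ tensorRact X Y (op c))
    (g := tensorRact X Y (op c) ∘ₗ tensorD X Y
      + tensorRact X Y (op (PDGAlgebra.d (p := p) (k := k) c)))
    (tensor_ext fun x y => by
      simp [tensorRact_tmul, tensorD_tmul, Y.d_ract, tmul_add, add_assoc])
  d_pow := by
    have hcomm : Commute (LinearMap.rTensor Y X.d) (LinearMap.lTensor (R := k) X Y.d) := by
      ext x y; simp
    have h : (LinearMap.rTensor Y X.d + LinearMap.lTensor (R := k) X Y.d) ^ p = 0 := by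
      rw [add_pow_prime_of_commute hp.out hcomm, LinearMap.rTensor_pow, LinearMap.lTensor_pow,
        X.d_pow, Y.d_pow]
      simp
    have h2 : ∀ m : ℕ, ∀ t : X ⊗[k] Y, (tensorD X Y ^ m) ((balanced X Y).mkQ t)
        = (balanced X Y).mkQ (((LinearMap.rTensor Y X.d + LinearMap.lTensor X Y.d) ^ m) t) := by
      intro m
      induction m with
      | zero => intro t; rfl
      | succ m ih => intro t; rw [pow_succ, pow_succ]; exact ih _
    exact tensor_ext fun x y => by rw [tmul, h2, h]; simp

variable {Y} in
/-- The map `X ⊗_B f`. -/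
def tensorMapRight {Y' : PDGBimod p k B C} (f : Y ⟶ Y') :
    tensorCarrier X Y →ₗ[k] tensorCarrier X Y' :=
  tensorMap (LinearMap.lTensor X f.lin) (fun x b y => by
    simpa [f.map_lact] using mem_balanced X Y' x b (f.lin y))

/-- The functor `X ⊗_B (-)`; with `C = k` it goes from left `p`-DG modules over `B` to those over `A`. -/
def tensorLeft : PDGBimod p k B C ⥤ PDGBimod p k A C where
  obj Y := X.tensor Y
  map {Y Y'} f :=
    { lin := tensorMapRight X f
      map_lact := fun a => LinearMap.congr_fun (f := tensorMapRight X f ∘ₗ tensorLact X Y a)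
        (g := tensorLact X Y' a ∘ₗ tensorMapRight X f) (tensor_ext fun x y => rfl)
      map_ract := fun c => LinearMap.congr_fun (f := tensorMapRight X f ∘ₗ tensorRact X Y c)
        (g := tensorRact X Y' c ∘ₗ tensorMapRight X f)
        (tensor_ext fun x y => congrArg (tmul X Y' x) (f.map_ract c y))
      map_mem := fun {i t} ht => by
        have : tensorGr X Y i ≤ (tensorGr X Y' i).comap (tensorMapRight X f) := by
          refine Submodule.span_le.2 ?_
          rintro _ ⟨a, b, x, y, hx, hy, hab, rfl⟩
          exact tmul_mem X Y' hx (f.map_mem hy) hab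
        exact this ht
      map_d := LinearMap.congr_fun (f := tensorMapRight X f ∘ₗ tensorD X Y)
        (g := tensorD X Y' ∘ₗ tensorMapRight X f)
        (tensor_ext fun x y => congrArg (tmul X Y' (X.d x) (f.lin y) + ·)
          (congrArg (tmul X Y' x) (f.map_d y))) }
  map_id Y := Hom.ext (tensor_ext (X := X) (Y := Y) (f := tensorMapRight X (𝟙 Y))
    (g := LinearMap.id) fun x y => rfl)
  map_comp {Y _ Y''} f g := Hom.ext (tensor_ext (X := X) (Y := Y) (f := tensorMapRight X (f ≫ g))
    (g := tensorMapRight X g ∘ₗ tensorMapRight X f) fun x y => rfl)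

end Tensor
end PDGBimod
end Bimodules

section Maps

variable {k A B : Type u} [Field k] [Ring A] [Algebra k A] [Ring B] [Algebra k B] {S : Type}

theorem map_monomialGrading (g : S → A) (deg : S → ℤ) (ψ : A →ₐ[k] B) (gr : ℤ → Submodule k B)
    (hgr : SetLike.GradedMonoid gr) (h : ∀ s, ψ (g s) ∈ gr (deg s)) {i : ℤ} {a : A}
    (ha : a ∈ monomialGrading k g deg i) : ψ a ∈ gr i := by
  change a ∈ Submodule.span k _ at ha
  induction ha using Submodule.span_induction with
  | mem x hx =>
    obtain ⟨l, rfl, rfl⟩ := hx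
    induction l with
    | nil => simpa using hgr.one_mem
    | cons s l ih =>
      simp only [List.map_cons, List.prod_cons, List.sum_cons, map_mul]
      exact hgr.mul_mem (h s) ih
  | zero => simp
  | add x y _ _ hx hy => rw [map_add]; exact add_mem hx hy
  | smul r x _ hx => rw [map_smul]; exact Submodule.smul_mem _ _ hx

theorem map_derivation (g : S → A) (hg : Algebra.adjoin k (Set.range g) = ⊤) (ψ : A →ₐ[k] B)
    (D : Module.End k A) (D' : Module.End k B) (hD : ∀ a b, D (a * b) = D a * b + a * D b)
    (hD' : ∀ a b, D' (a * b) = D' a * b + a * D' b) (h : ∀ s, ψ (D (g s)) = D' (ψ (g s))) (a : A) :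
    ψ (D a) = D' (ψ a) := by
  have h1 : D 1 = 0 := by simpa using hD 1 1
  have h1' : D' 1 = 0 := by simpa using hD' 1 1
  have ha : a ∈ Algebra.adjoin k (Set.range g) := by rw [hg]; trivial
  induction ha using Algebra.adjoin_induction with
  | mem x hx => obtain ⟨s, rfl⟩ := hx; exact h s
  | algebraMap r => simp [Algebra.algebraMap_eq_smul_one, h1, h1']
  | add x y _ _ hx hy => simp [hx, hy]
  | mul x y _ _ hx hy => simp [hD, hD', hx, hy]

theorem isInternal_comap {M : Type u} [AddCommGroup M] [Module k M] {gr : ℤ → Submodule k M}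
    (h : DirectSum.IsInternal gr) (W : Submodule k M) (π : M →ₗ[k] W) (hπ : ∀ w : W, π w = w)
    (hgr : ∀ i, ∀ m ∈ gr i, (π m : M) ∈ gr i) :
    DirectSum.IsInternal (fun i => (gr i).comap W.subtype) := by
  refine isInternal_of_coaction _ ?_
    (Finsupp.mapRange.linearMap π ∘ₗ coaction gr h ∘ₗ W.subtype) ?_
  · rw [eq_top_iff]
    rintro w -
    have hw : (w : M) ∈ ⨆ i, gr i := by rw [iSup_eq_top_of_isInternal h]; trivial
    rw [← hπ w]
    refine Submodule.iSup_induction _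
      (motive := fun m => π m ∈ ⨆ i, (gr i).comap W.subtype) hw ?_ (by simp) ?_
    · intro i m hm
      exact Submodule.mem_iSup_of_mem i (hgr i m hm)
    · intro m m' hm hm'
      rw [map_add]; exact add_mem hm hm'
  · intro i w hw
    have : coaction gr h w = Finsupp.single i (w : M) := coaction_of_mem gr h i w hw
    simp [this, hπ]

end Maps

namespace AShriek

section
variable {p : ℕ} [hp : Fact p.Prime] {k : Type u} [Field k] [CharP k p] {n : ℕ}

theorem d_gen (g : QuiverGen n) :
    PDGAlgebra.d (p := p) (k := k) (gen k g) = dGen k g := by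
  change (η k (gen k g)).snd = _
  simp [η_gen]

theorem d_vertex (i : Fin n) : PDGAlgebra.d (p := p) (k := k) (vertex k i) = 0 :=
  d_gen (.vertex i)

theorem d_arrow (i j : Fin n) : PDGAlgebra.d (p := p) (k := k) (arrow k i j)
    = if i < j then arrow k i j * arrow k j i * arrow k i j else 0 :=
  d_gen (.arrow i j)

theorem vertex_mem (i : Fin n) : vertex k i ∈ PDGAlgebra.gr (p := p) (k := k) (0 : ℤ) :=
  monomialGrading_gen (gen k) deg (.vertex i)

theorem arrow_mem (i j : Fin n) : arrow k i j ∈ PDGAlgebra.gr (p := p) (k := k) (1 : ℤ) :=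
  monomialGrading_gen (gen k) deg (.arrow i j)

theorem up_loop_pow (m : ℕ) : ∀ h v : Fin n, h.val = m → h.val + 1 = v.val →
    (arrow k h v * arrow k v h) ^ (m + 1) = 0 := by
  induction m with
  | zero => intro h v hm hv; rw [zero_add, pow_one]; exact first k hm (by omega)
  | succ m ih =>
    intro h v hm hv
    have hlt : m < n := by have := h.isLt; omega
    rw [← middle k (h := ⟨m, hlt⟩) (i := h) (j := v) (by simp [hm]) hv, pow_succ,
      ← mul_assoc, mul_pow_mul, ih ⟨m, hlt⟩ h rfl (by simp [hm])]
    simp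

theorem d_x : PDGAlgebra.d (p := p) (k := k) (TruncPoly.x k n) = TruncPoly.x k n ^ 2 := by
  change (TruncPoly.η k n (TruncPoly.x k n)).snd = _
  simp [TruncPoly.η_x]

variable [NeZero n]

theorem loop_eq (h : Fin n) (hh : h.val + 1 = (last n).val) :
    loop k n = arrow k (last n) h * arrow k h (last n) := by
  rw [loop, Finset.sum_eq_single h]
  · intro j _ hj
    rw [arrow_eq_zero k (i := last n) (j := j), zero_mul]
    rintro (h1 | h1)
    · have := j.isLt; simp only [last] at h1; omega
    · exact hj (Fin.ext (by omega))
  · simp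

theorem loop_eq_zero (hn : n = 1) : loop k n = 0 := by
  subst hn
  rw [loop, Finset.sum_eq_zero]
  intro j _
  rw [arrow_eq_zero k (i := last 1) (j := j), zero_mul]
  have := j.isLt
  simp only [last]; omega

theorem loop_cases : n = 1 ∨ ∃ h : Fin n, h.val + 1 = (last n).val := by
  have := NeZero.pos n
  rcases Nat.lt_or_ge 1 n with h | h
  · exact Or.inr ⟨⟨n - 2, by omega⟩, by simp only [last]; omega⟩
  · exact Or.inl (by omega)

variable (k n) in
theorem loop_pow : loop k n ^ n = 0 := by
  rcases loop_cases (n := n) with h | ⟨h, hh⟩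
  · rw [loop_eq_zero h, zero_pow (NeZero.ne n)]
  · have hn : n = h.val + 1 + 1 := by have := NeZero.pos n; simp only [last] at hh; omega
    rw [loop_eq h hh]
    have key := up_loop_pow (k := k) h.val h (last n) rfl hh
    have : ∀ m, m = h.val + 1 + 1 → (arrow k (last n) h * arrow k h (last n)) ^ m = 0 := by
      rintro m rfl
      rw [pow_succ, ← mul_assoc, mul_pow_mul, key]
      simp
    exact this n hn

theorem loop_mem : loop k n ∈ PDGAlgebra.gr (p := p) (k := k) (2 : ℤ) :=
  Submodule.sum_mem _ fun j _ =>
    (PDGAlgebra.gradedMonoid (p := p) (k := k) (A := AShriek k n)).mul_mem (i := 1) (j := 1)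
      (arrow_mem (last n) j) (arrow_mem j (last n))

theorem d_loop : PDGAlgebra.d (p := p) (k := k) (loop k n) = loop k n ^ 2 := by
  rcases loop_cases (n := n) with h | ⟨h, hh⟩
  · rw [loop_eq_zero h]; simp
  · have h1 : h < last n := by rw [Fin.lt_def]; omega
    rw [loop_eq h hh, PDGAlgebra.d_mul, d_arrow, d_arrow, if_pos h1, if_neg (not_lt.2 h1.le)]
    simp only [zero_mul, zero_add, pow_two, mul_assoc]

theorem vertex_mul_loop : vertex k (last n) * loop k n = loop k n := by
  simp [loop, Finset.mul_sum, ← mul_assoc]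

theorem loop_mul_vertex : loop k n * vertex k (last n) = loop k n := by
  simp [loop, Finset.sum_mul, mul_assoc]

variable (k n) in
/-- The map `k[x]/(x ^ n) → A_n^!` with `x ↦ (n|n-1|n)`. -/
noncomputable def ofTrunc : TruncPoly k n →ₐ[k] AShriek k n := TruncPoly.lift (loop k n) (loop_pow k n)

theorem ofTrunc_x : ofTrunc k n (TruncPoly.x k n) = loop k n := TruncPoly.lift_x k n _ _

theorem ofTrunc_mem {i : ℤ} {c : TruncPoly k n} (hc : c ∈ PDGAlgebra.gr (p := p) (k := k) i) :
    ofTrunc k n c ∈ PDGAlgebra.gr (p := p) (k := k) i :=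
  map_monomialGrading (fun _ : Unit => TruncPoly.x k n) (fun _ => 2) (ofTrunc k n) _
    PDGAlgebra.gradedMonoid (fun _ => by rw [ofTrunc_x]; exact loop_mem) hc

theorem ofTrunc_d (c : TruncPoly k n) : ofTrunc k n (PDGAlgebra.d (p := p) (k := k) c)
    = PDGAlgebra.d (p := p) (k := k) (ofTrunc k n c) :=
  map_derivation (fun _ : Unit => TruncPoly.x k n) (TruncPoly.adjoin_x k n) (ofTrunc k n) _ _
    PDGAlgebra.d_mul PDGAlgebra.d_mul
    (fun _ => by rw [d_x, ofTrunc_x, d_loop, map_pow, ofTrunc_x]) c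

theorem commute_ofTrunc (c : TruncPoly k n) : Commute (vertex k (last n)) (ofTrunc k n c) := by
  have ha : c ∈ Algebra.adjoin k (Set.range fun _ : Unit => TruncPoly.x k n) := by
    rw [TruncPoly.adjoin_x]; trivial
  induction ha using Algebra.adjoin_induction with
  | mem x hx =>
    obtain ⟨s, rfl⟩ := hx
    rw [Commute, SemiconjBy, ofTrunc_x, vertex_mul_loop, loop_mul_vertex]
  | algebraMap r => rw [AlgHom.commutes]; exact Algebra.commute_algebraMap_right r _
  | add x y _ _ hx hy => rw [map_add]; exact hx.add_right hy
  | mul x y _ _ hx hy => rw [map_mul]; exact hx.mul_right hy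

variable (k n)

/-- The span of the paths ending at the last vertex. -/
def endingAtLast : Submodule k (AShriek k n) where
  carrier := {a | a * vertex k (last n) = a}
  add_mem' {a b} ha hb := by
    simp only [Set.mem_ofPred_eq] at *; rw [add_mul, ha, hb]
  zero_mem' := by simp
  smul_mem' c a ha := by simp only [Set.mem_ofPred_eq] at *; rw [smul_mul_assoc, ha]

/-- The span of the paths starting at the last vertex. -/
def startingAtLast : Submodule k (AShriek k n) where
  carrier := {a | vertex k (last n) * a = a}
  add_mem' {a b} ha hb := by
    simp only [Set.mem_ofPred_eq] at *; rw [mul_add, ha, hb]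
  zero_mem' := by simp
  smul_mem' c a ha := by simp only [Set.mem_ofPred_eq] at *; rw [mul_smul_comm, ha]

theorem mem_ending {a : AShriek k n} :
    a ∈ endingAtLast k n ↔ a * vertex k (last n) = a := Iff.rfl
theorem mem_starting {a : AShriek k n} :
    a ∈ startingAtLast k n ↔ vertex k (last n) * a = a := Iff.rfl

/-- right multiplication by the last vertex, a projection onto the span of the paths ending there -/
noncomputable def projEnding : AShriek k n →ₗ[k] endingAtLast k n :=
  (LinearMap.mulRight k (vertex k (last n))).codRestrict _ (fun a => by
    rw [mem_ending, LinearMap.mulRight_apply, mul_assoc, vertex_mul_self])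

/-- left multiplication by the last vertex, a projection onto the span of the paths starting there -/
noncomputable def projStarting : AShriek k n →ₗ[k] startingAtLast k n :=
  (LinearMap.mulLeft k (vertex k (last n))).codRestrict _ (fun a => by
    rw [mem_starting, LinearMap.mulLeft_apply, ← mul_assoc, vertex_mul_self])

theorem projEnding_coe (a : AShriek k n) :
    (projEnding k n a : AShriek k n) = a * vertex k (last n) := rfl
theorem projStarting_coe (a : AShriek k n) :
    (projStarting k n a : AShriek k n) = vertex k (last n) * a := rfl

variable (p)

theorem internal_ending : DirectSum.IsInternal (fun i : ℤ =>
    (PDGAlgebra.gr (p := p) (k := k) (A := AShriek k n) i).comap (endingAtLast k n).subtype) := by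
  refine isInternal_comap (PDGAlgebra.internal (p := p) (k := k) (A := AShriek k n)) _ (projEnding k n) ?_ ?_
  · intro w
    apply Subtype.ext
    rw [projEnding_coe]
    exact w.2
  · intro i m hm
    rw [projEnding_coe]
    have := (PDGAlgebra.gradedMonoid (p := p) (k := k) (A := AShriek k n)).mul_mem (i := i) (j := 0)
      hm (vertex_mem (last n))
    rwa [add_zero] at this

theorem internal_starting : DirectSum.IsInternal (fun i : ℤ =>
    (PDGAlgebra.gr (p := p) (k := k) (A := AShriek k n) i).comap (startingAtLast k n).subtype) := by
  refine isInternal_comap (PDGAlgebra.internal (p := p) (k := k) (A := AShriek k n)) _ (projStarting k n) ?_ ?_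
  · intro w
    apply Subtype.ext
    rw [projStarting_coe]
    exact w.2
  · intro i m hm
    rw [projStarting_coe]
    have := (PDGAlgebra.gradedMonoid (p := p) (k := k) (A := AShriek k n)).mul_mem (i := 0) (j := i)
      (vertex_mem (last n)) hm
    rwa [zero_add] at this

/-- The bimodule `A(n)`: left multiplication by `A = A_n^!`, and `x ∈ C = k[x]/(x ^ n)` acting on
the right as multiplication by `(n|n-1|n)`. -/
noncomputable def columnLast : PDGBimod p k (AShriek k n) (TruncPoly k n) where
  carrier := endingAtLast k n
  gr i := (PDGAlgebra.gr (p := p) (k := k) i).comap (endingAtLast k n).subtype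
  internal := internal_ending p k n
  lact := AlgHom.ofLinearMap
    { toFun := fun a => (LinearMap.mulLeft k a).restrict (fun m hm => by
        rw [mem_ending] at *; rw [LinearMap.mulLeft_apply, mul_assoc, hm])
      map_add' := fun a b => by ext m; simp [add_mul]
      map_smul' := fun c a => by ext m; simp }
    (by ext m; simp) (fun a b => by ext m; simp [mul_assoc])
  ract := AlgHom.ofLinearMap
    { toFun := fun c => (LinearMap.mulRight k (ofTrunc k n c.unop)).restrict (fun m hm => by
        rw [mem_ending] at *
        rw [LinearMap.mulRight_apply, mul_assoc, ← (commute_ofTrunc c.unop).eq, ← mul_assoc, hm])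
      map_add' := fun a b => by ext m; simp [mul_add]
      map_smul' := fun c a => by ext m; simp }
    (by ext m; simp) (fun a b => by ext m; simp [mul_assoc])
  lact_ract a c m := Subtype.ext (mul_assoc a _ _).symm
  lact_mem ha hm := (PDGAlgebra.gradedMonoid (p := p) (k := k)).mul_mem ha hm
  ract_mem hc hm := (PDGAlgebra.gradedMonoid (p := p) (k := k)).mul_mem hm (ofTrunc_mem hc)
  d := (PDGAlgebra.d (p := p) (k := k)).restrict (fun m hm => by
    rw [mem_ending] at *
    have := PDGAlgebra.d_mul (p := p) (k := k) m (vertex k (last n))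
    rw [hm, d_vertex, mul_zero, add_zero] at this
    exact this.symm)
  d_mem {i m} hm := PDGAlgebra.d_mem (p := p) (k := k) (A := AShriek k n) (i := i) (a := m.1) hm
  d_lact a m := Subtype.ext (PDGAlgebra.d_mul (p := p) (k := k) (A := AShriek k n) a m.1)
  d_ract c m := Subtype.ext ((PDGAlgebra.d_mul (p := p) (k := k) (m : AShriek k n) _).trans
    (congrArg (_ + (m : AShriek k n) * ·) (ofTrunc_d c).symm))
  d_pow := by
    rw [Module.End.pow_restrict]
    ext m
    simp [PDGAlgebra.d_pow]

/-- The bimodule `(n)A`: right multiplication by `A = A_n^!`, and `x ∈ C = k[x]/(x ^ n)` acting on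
the left as multiplication by `(n|n-1|n)`. -/
noncomputable def rowLast : PDGBimod p k (TruncPoly k n) (AShriek k n) where
  carrier := startingAtLast k n
  gr i := (PDGAlgebra.gr (p := p) (k := k) i).comap (startingAtLast k n).subtype
  internal := internal_starting p k n
  lact := AlgHom.ofLinearMap
    { toFun := fun c => (LinearMap.mulLeft k (ofTrunc k n c)).restrict (fun m hm => by
        rw [mem_starting] at *
        rw [LinearMap.mulLeft_apply, ← mul_assoc, (commute_ofTrunc c).eq, mul_assoc, hm])
      map_add' := fun a b => by ext m; simp [add_mul]
      map_smul' := fun c a => by ext m; simp }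
    (by ext m; simp) (fun a b => by ext m; simp [mul_assoc])
  ract := AlgHom.ofLinearMap
    { toFun := fun a => (LinearMap.mulRight k a.unop).restrict (fun m hm => by
        rw [mem_starting] at *; rw [LinearMap.mulRight_apply, ← mul_assoc, hm])
      map_add' := fun a b => by ext m; simp [mul_add]
      map_smul' := fun c a => by ext m; simp }
    (by ext m; simp) (fun a b => by ext m; simp [mul_assoc])
  lact_ract a c m := Subtype.ext (mul_assoc _ _ _).symm
  lact_mem ha hm := (PDGAlgebra.gradedMonoid (p := p) (k := k)).mul_mem (ofTrunc_mem ha) hm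
  ract_mem hc hm := (PDGAlgebra.gradedMonoid (p := p) (k := k)).mul_mem hm hc
  d := (PDGAlgebra.d (p := p) (k := k)).restrict (fun m hm => by
    rw [mem_starting] at *
    have := PDGAlgebra.d_mul (p := p) (k := k) (vertex k (last n)) m
    rw [hm, d_vertex, zero_mul, zero_add] at this
    exact this.symm)
  d_mem {i m} hm := PDGAlgebra.d_mem (p := p) (k := k) (A := AShriek k n) (i := i) (a := m.1) hm
  d_lact c m := Subtype.ext ((PDGAlgebra.d_mul (p := p) (k := k) _ (m : AShriek k n)).trans
    (congrArg (· * (m : AShriek k n) + _) (ofTrunc_d c).symm))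
  d_ract a m := Subtype.ext (PDGAlgebra.d_mul (p := p) (k := k) (A := AShriek k n) m.1 a)
  d_pow := by
    rw [Module.End.pow_restrict]
    ext m
    simp [PDGAlgebra.d_pow]

end

section Simple
variable (k : Type u) [Field k] {n : ℕ}

/-- The character of `A_n^!` with `(i) ↦ 1`, killing the other vertices and all arrows. -/
noncomputable def character (i : Fin n) : AShriek k n →ₐ[k] k :=
  lift k (fun g => match g with
    | .vertex j => if j = i then 1 else 0
    | .arrow _ _ => 0) (by
    intro a b h
    cases h with
    | vertex_mul_vertex j l h =>
      by_cases hj : j = i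
      · subst hj; simp [h.symm]
      · simp [hj]
    | _ => simp)

variable (p : ℕ) [hp : Fact p.Prime] [CharP k p]

/-- The simple module `L_i`, in degree zero and with zero differential. -/
noncomputable def simple (i : Fin n) : PDGBimod p k (AShriek k n) k where
  carrier := k
  gr := PDGAlgebra.gr (p := p) (k := k)
  internal := PDGAlgebra.internal
  lact := (Algebra.lmul k k).comp (character k i)
  ract := Algebra.lsmul k k k
  lact_ract a b m := by simp [mul_assoc]
  lact_mem ha hm := (PDGAlgebra.gradedMonoid (p := p) (k := k)).mul_mem
    (map_monomialGrading (gen k) deg (character k i) _ PDGAlgebra.gradedMonoid (fun g => by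
      cases g with
      | vertex j => exact Submodule.mem_top
      | arrow j l => rw [character, lift_gen]; exact zero_mem _) ha) hm
  ract_mem hc hm := (PDGAlgebra.gradedMonoid (p := p) (k := k)).mul_mem hm hc
  d := 0
  d_mem _ := zero_mem _
  d_lact a m := by
    have : character k i (PDGAlgebra.d (p := p) (k := k) a) = 0 :=
      map_derivation (gen k) (adjoin_gen k) (character k i) _ (0 : Module.End k k)
        PDGAlgebra.d_mul (by simp) (fun g => by
          rw [d_gen]
          cases g with
          | vertex j => simp [dGen]
          | arrow j l =>
            have : character k i (arrow k j l) = 0 := lift_gen k _ _ (.arrow j l)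
            by_cases hjl : j < l <;> simp [dGen, hjl, this]) a
    simp [this]
  d_ract a m := by simp [PDGBimod.d_algebraMap]
  d_pow := zero_pow hp.out.ne_zero

end Simple
end AShriek

section Derived

namespace PDGBimod

variable {p : ℕ} {k A B C : Type u} [Field k] [Ring A] [Algebra k A] [PDGAlgebra p k A]
  [Ring B] [Algebra k B] [PDGAlgebra p k B] [Ring C] [Algebra k C] [PDGAlgebra p k C]

/-- The `p`-cohomology `ker d^i / im d^(p-i)`, for `0 < i < p`, summed over all degrees. -/
abbrev pCohomology (M : PDGBimod p k A B) (i : ℕ) : Type u :=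
  LinearMap.ker (M.d ^ i) ⧸ (LinearMap.range (M.d ^ (p - i))).submoduleOf (LinearMap.ker (M.d ^ i))

/-- Two morphisms are homotopic if their difference is null-homotopic, that is of the form
`∑ i, d^i ∘ h ∘ d^(p-1-i)` for a bimodule map `h` of degree `2 - 2p`. -/
def Homotopic : HomRel (PDGBimod p k A B) := fun M N f g =>
  ∃ h : M →ₗ[k] N, (∀ a m, h (M.lact a m) = N.lact a (h m)) ∧
    (∀ b m, h (M.ract b m) = N.ract b (h m)) ∧
    (∀ (i : ℤ), ∀ m ∈ M.gr i, h m ∈ N.gr (i + (2 - 2 * p))) ∧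
    ∀ m, f.lin m - g.lin m = ∑ i ∈ Finset.range p, (N.d ^ i) (h ((M.d ^ (p - 1 - i)) m))

variable (p k A B) in
/-- The homotopy category. -/
abbrev HtpyCat : Type (u + 1) := CategoryTheory.Quotient (Homotopic (p := p) (k := k) (A := A) (B := B))

variable [hp : Fact p.Prime]

variable (p k A B) in
/-- The forgetful functor to the homotopy category of `p`-complexes. -/
def forgetHtpy : HtpyCat p k A B ⥤ HtpyCat p k k k :=
  CategoryTheory.Quotient.lift _ (forget p k A B ⋙ CategoryTheory.Quotient.functor _) (by
    rintro M N f g ⟨h, -, -, hdeg, heq⟩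
    refine CategoryTheory.Quotient.sound _ ⟨h, ?_, ?_, hdeg, heq⟩
    · exact fun c m => map_smul h c m
    · exact fun c m => map_smul h c.unop m)

variable (p k A B) in
/-- Quasi-isomorphisms: the morphisms which become invertible in the homotopy category of
`p`-complexes. -/
def htpyQuasiIso : MorphismProperty (HtpyCat p k A B) := fun _ _ f => IsIso ((forgetHtpy p k A B).map f)

variable (p k A B) in
/-- The `p`-DG derived category: the homotopy category localized at the quasi-isomorphisms. -/
abbrev DCat : Type (u + 1) := (htpyQuasiIso p k A B).Localization

variable (p k A B) in
/-- The functor from the category of `p`-DG bimodules to the derived category. -/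
noncomputable def toD : PDGBimod p k A B ⥤ DCat p k A B :=
  CategoryTheory.Quotient.functor _ ⋙ (htpyQuasiIso p k A B).Q

/-- Quasi-isomorphisms between `p`-DG bimodules. -/
def QuasiIso {M N : PDGBimod p k A B} (f : M ⟶ N) : Prop :=
  htpyQuasiIso p k A B ((CategoryTheory.Quotient.functor _).map f)

variable [CharP k p]

variable (p k A B) in
/-- The free bimodule `A ⊗ B` of rank one, that is `A ⊗ B^op` as a module over itself. -/
def free : PDGBimod p k A B := (regular p k A).leftPart.tensor (regular p k B).rightPart

open Classical in
/-- `G` is a direct sum of `p`-DG direct summands of grading shifts of the free module of rank one. -/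
def IsSumOfSummands (G : PDGBimod p k A B) : Prop :=
  ∃ (J : Type u) (T : J → PDGBimod p k A B) (inc : ∀ j, T j ⟶ G),
    Function.Bijective (DirectSum.toModule k J G (fun j => (inc j).lin)) ∧
    ∀ j, ∃ s : ℤ, Nonempty (Retract (T j) ((free p k A B).shift s))

/-- Property (P): there is an exhaustive increasing filtration of `K` by `p`-DG submodules `F 0 ⊆ F 1 ⊆ …`
whose subquotients `G 0 = F 0` and `G (i+1) = F (i+1) / F i` are direct sums of `p`-DG direct summands
of shifts of the free module. -/
def PropertyP (K : PDGBimod p k A B) : Prop :=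
  ∃ (F : ℕ → PDGBimod p k A B) (ι : ∀ i, F i ⟶ K) (G : ℕ → PDGBimod p k A B) (q : ∀ i, F i ⟶ G i),
    (∀ i, Function.Injective (ι i).lin) ∧
    (∀ i, LinearMap.range (ι i).lin ≤ LinearMap.range (ι (i + 1)).lin) ∧
    (∀ x : K, ∃ i, x ∈ LinearMap.range (ι i).lin) ∧
    (∀ i, Function.Surjective (q i).lin) ∧
    (∀ x, (q 0).lin x = 0 → x = 0) ∧
    (∀ i x, (q (i + 1)).lin x = 0 ↔ (ι (i + 1)).lin x ∈ LinearMap.range (ι i).lin) ∧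
    ∀ i, IsSumOfSummands (G i)

/-- A finite cell module: one which has property (P) and is finitely generated. -/
def IsFiniteCell (K : PDGBimod p k A B) : Prop :=
  PropertyP K ∧ ∃ s : Finset K,
    Submodule.span k {y : K | ∃ (a : A) (b : B), ∃ x ∈ s, y = K.lact a (K.ract (op b) x)} = ⊤

/-- `π : X ⟶ M` is a bar resolution of `M`: a surjective quasi-isomorphism from a module with
property (P). -/
structure IsBarResolution {X M : PDGBimod p k A B} (π : X ⟶ M) : Prop where
  propertyP : PropertyP X
  surjective : Function.Surjective π.lin
  quasiIso : QuasiIso π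

end PDGBimod
end Derived

section JonesWenzl

variable (p : ℕ) [hp : Fact p.Prime] (k : Type u) [Field k] [CharP k p] (n : ℕ) [NeZero n]

/-- The bimodule `A(n) ⊗ (n)A` over `(A, A)`, the tensor product being over `k`. -/
noncomputable def EF : PDGBimod p k (AShriek k n) (AShriek k n) :=
  (AShriek.columnLast p k n).leftPart.tensor (AShriek.rowLast p k n).rightPart

variable {p k n}

/-- The bimodule `A(n) ⊗^L_C (n)A` over `(A, A)`, computed as `X ⊗_C (n)A` from a bar resolution `X`
of the `(A, C)`-bimodule `A(n)`. -/
noncomputable def jwBimod (X : PDGBimod p k (AShriek k n) (TruncPoly k n)) :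
    PDGBimod p k (AShriek k n) (AShriek k n) :=
  X.tensor (AShriek.rowLast p k n)

/-- The categorified Jones-Wenzl projector `M ↦ A(n) ⊗^L_C ((n)A ⊗_A M)`, computed as
`X ⊗_C ((n)A ⊗_A M)` from a bar resolution `X` of the `(A, C)`-bimodule `A(n)`. It is a functor on
left `p`-DG modules over `A`. -/
noncomputable def jonesWenzl (X : PDGBimod p k (AShriek k n) (TruncPoly k n)) :
    PDGBimod p k (AShriek k n) k ⥤ PDGBimod p k (AShriek k n) k :=
  (AShriek.rowLast p k n).tensorLeft ⋙ X.tensorLeft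

/-- A finite cell bimodule `K` (so that `K ⊗_A (-)` computes `K ⊗^L_A (-)`) represents the functor
`F` on the derived category: the functors `M ↦ F M` and `M ↦ K ⊗_A M` to the derived category are
naturally isomorphic. Natural transformations between functors out of the derived category are the
same as natural transformations between their composites with the functor `toD`, since the latter
is the composite of a quotient functor and a localization functor. -/
def Represents {A : Type u} [Ring A] [Algebra k A] [PDGAlgebra p k A] (K : PDGBimod p k A A)
    (F : PDGBimod p k A k ⥤ PDGBimod p k A k) : Prop :=
  Nonempty (F ⋙ PDGBimod.toD p k A k ≅ K.tensorLeft ⋙ PDGBimod.toD p k A k)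

end JonesWenzl
end PDG

/-! The basic criterion: a `p`-complex is acyclic if and only if its differential has a Heisenberg
partner, an operator `s` with `d s - s d = 1` (`AcyclicOn.of_commutator`, `exists_commutator`).
Partners survive tensoring: `1 ⊗ s` is a partner of the total differential. A bimodule `X` with
property (P) is, as a right module, an iterated split extension of summands of free modules, so `X
⊗_C -` preserves injections and surjections with acyclic kernel (`PropertyP.good`). A surjection is
a quasi-isomorphism exactly when its kernel is acyclic (`kerAcyclic_of_quasiIso`,
`quasiIso_of_kerAcyclic`), so derived statements become statements about acyclic kernels.

Suppose `p` divides `n - 1`, so that `n = 1` in `k`. On `C = k[x]/(x ^ n)` the operator `x ^ j ↦ - x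
^ (j - 1)` is a partner of `d` away from the constants, because the top power obeys the same rule as
the others. Hence `C ⊗ Y → Y` has acyclic kernel for every `Y`, the map `X ⊗ Y → X ⊗_C Y` is a
quasi-isomorphism (`quasiIso_collapse`), and so is `X ⊗ Y → A(n) ⊗ Y`. Composing gives both
comparisons.

Suppose `p` does not divide `n - 1`. The space `(1)A(n)` is a line on which `x` and `d` vanish, so
`P = (1)X` is a flat resolution of the trivial `C`-module `k` (`Augmented`). The trivial module is a
retract of `(n)A` and of `(n)A ⊗_A L_n`, so it suffices that `P ⊗_C k = P/Px` has
infinite-dimensional cohomology (`Augmented.not_finite`). Finite cell bimodules are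
finite-dimensional, and finiteness of cohomology is an invariant of the derived category, so all
negative claims follow.

For `n > p` this is a descent. Let `a` be the largest integer with `a ≤ n` and `a = 1` modulo `p`,
and let `V` be a finite-dimensional complex whose dimension is prime to `p`. Apply `P ⊗_C -` to `0 →
K → C ⊗ V → k[x]/(x ^ a) ⊗ V → 0`. The middle term computes `V`, which is not acyclic; the right
term computes `P ⊗_C V` with `V` trivial, since `a = 1` in `k`; and `K` is killed by `x ^ a`, so it
can also be replaced by the trivial module on the complex `K`. The connecting map is onto but not
injective, so the dimension drops strictly while `dim K = (n - a) dim V` stays prime to `p`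
(`Augmented.not_finite_triv`).

For `n ≤ p` one uses the two sequences `0 → Px → P → P/Px → 0` and `0 → P/Px → P → Px → 0` with two
differentials `δ₁ x = x δ₂`, chosen so that the connecting maps give contradictory inequalities
(`not_finite_coh_of_two_step`). For `n = p` the pair is `d`, `d + x`, and `d + x` is acyclic. For `n
< p` it is `d - x`, `d`, and the acyclicity of `d - x` on the augmentation kernel is proved by
induction on the degree, using identities in the algebra with relation `d x = x d + x ^ 2`
(`acyclic_sub_of_acyclic`).

Bar resolutions are built by hand. Generators are words in letters `(v, i)` with `0 ≤ v < p - 1`;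
prefixing operators `S_v` satisfy `[D, S_v] = S_(v+1)` and `[D, S_(p-2)] = 1 - ι π`, so that `S_0`
supplies the primitives of cocycles in the kernel of the augmentation `π` (`exists_barD_pow`). -/

namespace PDG

/-! ### Acyclic `p`-complexes over a field -/

section Acyclic

variable {k V W Z : Type u} [Field k] [AddCommGroup V] [Module k V] [AddCommGroup W] [Module k W]
  [AddCommGroup Z] [Module k Z] {p : ℕ}

/-- The subspace `N` is acyclic: each cocycle in `N` is of the form `d^(p-1) v` with `v ∈ N`. -/
def AcyclicOn (p : ℕ) (d : Module.End k V) (N : Submodule k V) : Prop :=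
  ∀ u ∈ N, d u = 0 → ∃ v ∈ N, (d ^ (p - 1)) v = u

theorem pow_apply_mem {d : Module.End k V} {N : Submodule k V} (hN : ∀ u ∈ N, d u ∈ N) (a : ℕ)
    {u : V} (hu : u ∈ N) : (d ^ a) u ∈ N := by
  induction a with
  | zero => exact hu
  | succ a ih => rw [pow_succ']; exact hN _ ih

theorem pow_add_apply (d : Module.End k V) (a b : ℕ) (u : V) :
    (d ^ (a + b)) u = (d ^ a) ((d ^ b) u) := by
  rw [pow_add]; rfl

theorem pow_apply_eq_zero {d : Module.End k V} (hd : d ^ p = 0) {a : ℕ} (h : p ≤ a) (u : V) :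
    (d ^ a) u = 0 := by
  rw [pow_eq_zero_of_le h hd]; rfl

theorem map_pow_apply {d : Module.End k V} {e : Module.End k W} {f : V →ₗ[k] W}
    (hf : ∀ v, f (d v) = e (f v)) (a : ℕ) (v : V) : f ((d ^ a) v) = (e ^ a) (f v) := by
  induction a generalizing v with
  | zero => rfl
  | succ a ih => rw [pow_succ, pow_succ]; exact (ih _).trans (congrArg _ (hf v))

/-- Exactness at the first power of `d` forces it at all powers. If `d^(a+1) u = 0`, the cocycle
`d^a u` equals `d^(p-1) v = d^a (d^(p-a-1) v)`, and `u - d^(p-a-1) v` is killed by `d^a`, so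
induction writes it as `d^(p-a) w`. -/
theorem AcyclicOn.exact {d : Module.End k V} {N : Submodule k V} (h : AcyclicOn p d N)
    (hN : ∀ u ∈ N, d u ∈ N) {a : ℕ} (ha : a ≤ p) :
    ∀ u ∈ N, (d ^ a) u = 0 → ∃ v ∈ N, (d ^ (p - a)) v = u := by
  induction a with
  | zero => intro u _ h0; exact ⟨0, N.zero_mem, by rw [map_zero]; exact h0.symm⟩
  | succ a ih =>
    intro u hu h0
    obtain ⟨v, hv, hvu⟩ := h ((d ^ a) u) (pow_apply_mem hN a hu) (by rwa [pow_succ'] at h0)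
    have e : p - 1 = a + (p - (a + 1)) := by omega
    rw [e, pow_add_apply] at hvu
    obtain ⟨w, hw, hwu⟩ := ih (by omega) (u - (d ^ (p - (a + 1))) v)
      (sub_mem hu (pow_apply_mem hN _ hv)) (by rw [map_sub, hvu, sub_self])
    refine ⟨v + d w, add_mem hv (hN _ hw), ?_⟩
    have e' : p - a = (p - (a + 1)) + 1 := by omega
    rw [e', pow_add_apply, pow_one] at hwu
    rw [map_add, hwu]; abel

/-- The Weyl relation: on a cocycle `u` the elements `s ^ m u` behave under `d` like the monomials
`t ^ m` under differentiation. -/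
theorem pow_mul_apply_of_commutator {d s : Module.End k V} {N : Submodule k V}
    (hs : ∀ u ∈ N, s u ∈ N) (h : ∀ u ∈ N, d (s u) - s (d u) = u) {u : V} (hu : u ∈ N)
    (hdu : d u = 0) (m : ℕ) : (d ^ m) ((s ^ m) u) = (m.factorial : k) • u := by
  have key : ∀ m : ℕ, d ((s ^ (m + 1)) u) = ((m + 1 : ℕ) : k) • (s ^ m) u := by
    intro m
    induction m with
    | zero => have := h u hu; rw [hdu, map_zero, sub_zero] at this; simpa using this
    | succ m ih =>
      have h1 := h ((s ^ (m + 1)) u) (pow_apply_mem hs _ hu)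
      rw [ih, sub_eq_iff_eq_add] at h1
      rw [pow_succ', Module.End.mul_apply, h1, map_smul, ← Module.End.mul_apply, ← pow_succ',
        Nat.cast_succ (m + 1), add_smul, one_smul, add_comm]
  induction m with
  | zero => simp
  | succ m ih =>
    rw [pow_succ d, Module.End.mul_apply, key, map_smul, ih, smul_smul, Nat.factorial_succ,
      Nat.cast_mul]

/-- A Heisenberg partner of `d` on a stable subspace makes it acyclic. -/
theorem AcyclicOn.of_commutator [hp : Fact p.Prime] [CharP k p] {d s : Module.End k V}
    {N : Submodule k V} (hs : ∀ u ∈ N, s u ∈ N) (h : ∀ u ∈ N, d (s u) - s (d u) = u) :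
    AcyclicOn p d N := by
  intro u hu hdu
  have hne : (((p - 1).factorial : ℕ) : k) ≠ 0 := by
    rw [Ne, CharP.cast_eq_zero_iff k p, hp.out.dvd_factorial]
    have := hp.out.pos; omega
  -- The primitive is the divided power of `s`; only `(p - 1)!` has to be inverted, and it is prime
  -- to `p`.
  refine ⟨(((p - 1).factorial : ℕ) : k)⁻¹ • (s ^ (p - 1)) u,
    N.smul_mem _ (pow_apply_mem hs _ hu), ?_⟩
  rw [map_smul, pow_mul_apply_of_commutator hs h hu hdu, smul_smul, inv_mul_cancel₀ hne, one_smul]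

/-- An acyclic complex is free over `k[d]/(d^p)`: coordinates for a basis of the form `d^i s`. -/
theorem exists_coordinates {d : Module.End k V} (hd : d ^ p = 0) (h : AcyclicOn p d ⊤) :
    ∃ (S : Submodule k V) (c : ℕ → V →ₗ[k] S),
      (∀ v, ∑ i ∈ Finset.range p, (d ^ i) (c i v) = v) ∧
      ∀ i < p, ∀ j < p, ∀ s : S, c i ((d ^ j) s) = if i = j then s else 0 := by
  -- A complement of `im d` is a space of free generators over `k[d]/(d^p)`.
  obtain ⟨S, hS⟩ := Submodule.exists_isCompl (LinearMap.range d)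
  have hdis : ∀ s ∈ S, s ∈ LinearMap.range d → s = 0 := fun s h1 h2 =>
    Submodule.disjoint_def.1 hS.disjoint s h2 h1
  let Ψ : (Fin p → S) →ₗ[k] V := ∑ i : Fin p, (d ^ (i : ℕ)) ∘ₗ S.subtype ∘ₗ LinearMap.proj i
  have hΨ : ∀ s, Ψ s = ∑ i : Fin p, (d ^ (i : ℕ)) (s i) := by intro s; simp [Ψ]
  have hsurj : ∀ m : ℕ, ∀ v : V, ∃ (s : ℕ → S) (w : V),
      v = ∑ i ∈ Finset.range m, (d ^ i) (s i) + (d ^ m) w := by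
    intro m
    induction m with
    | zero => intro v; exact ⟨0, v, by simp⟩
    | succ m ih =>
      intro v
      obtain ⟨s, w, rfl⟩ := ih v
      have hw : w ∈ LinearMap.range d ⊔ S := by rw [hS.sup_eq_top]; trivial
      obtain ⟨_, ⟨y, rfl⟩, z, hz, rfl⟩ := Submodule.mem_sup.1 hw
      refine ⟨Function.update s m ⟨z, hz⟩, y, ?_⟩
      rw [Finset.sum_range_succ, Function.update_self, pow_succ, Module.End.mul_apply, map_add]
      have h0 : ∑ i ∈ Finset.range m, (d ^ i) (Function.update s m (⟨z, hz⟩ : S) i : V)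
          = ∑ i ∈ Finset.range m, (d ^ i) (s i : V) := Finset.sum_congr rfl fun i hi => by
        rw [Function.update_of_ne (Finset.mem_range.1 hi).ne]
      rw [h0]
      abel
  have hbij : Function.Bijective Ψ := by
    constructor
    · rw [← LinearMap.ker_eq_bot, LinearMap.ker_eq_bot']
      intro s hs
      rw [hΨ] at hs
      -- Applying `d^(p-1-m)` to a relation kills the terms above `m`, and those below `m` vanish
      -- already. This leaves `d^(p-1) (s m) = 0`, and acyclicity puts `s m` into `im d ∩ S = 0`.
      have key : ∀ m : ℕ, ∀ i : Fin p, (i : ℕ) < m → s i = 0 := by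
        intro m
        induction m with
        | zero => intro i hi; omega
        | succ m ih =>
          intro i hi
          rcases Nat.lt_or_ge i m with h1 | h1
          · exact ih i h1
          have him : (i : ℕ) = m := by omega
          have h2 := congrArg (d ^ (p - 1 - m)) hs
          rw [map_sum, map_zero, Finset.sum_eq_single i] at h2
          · rw [← pow_add_apply, show p - 1 - m + i = p - 1 by have := i.2; omega] at h2
            obtain ⟨v, -, hv⟩ := h.exact (fun _ _ => trivial) (Nat.sub_le p 1) _ trivial h2
            refine Subtype.ext (hdis _ (s i).2 ⟨v, ?_⟩)
            rw [show p - (p - 1) = 1 by have := i.2; omega, pow_one] at hv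
            exact hv
          · intro j _ hj
            rcases lt_trichotomy (j : ℕ) m with h3 | h3 | h3
            · rw [ih j h3]; simp
            · exact absurd (Fin.ext (h3.trans him.symm)) hj
            · rw [← pow_add_apply]
              exact pow_apply_eq_zero hd (by have := j.2; omega) _
          · simp
      exact funext fun i => key p i i.2
    · intro v
      obtain ⟨s, w, hv⟩ := hsurj p v
      refine ⟨fun i => s i, ?_⟩
      rw [hΨ, hv, hd, Finset.sum_range (fun i => (d ^ i) (s i : V))]
      simp
  let e := LinearEquiv.ofBijective Ψ hbij
  refine ⟨S, fun i => if hi : i < p then LinearMap.proj (⟨i, hi⟩ : Fin p) ∘ₗ e.symm.toLinearMap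
    else 0, ?_, ?_⟩
  · intro v
    conv_rhs => rw [← e.apply_symm_apply v]
    change _ = Ψ (e.symm v)
    rw [hΨ, Finset.sum_range]
    exact Finset.sum_congr rfl fun i _ => by simp
  · intro i hi j hj s
    have : (d ^ j) (s : V) = e (Pi.single ⟨j, hj⟩ s) := by
      change _ = Ψ _
      rw [hΨ, Finset.sum_eq_single ⟨j, hj⟩]
      · simp
      · intro l _ hl; simp [Pi.single_eq_of_ne hl]
      · simp
    simp only [hi, dif_pos, LinearMap.comp_apply, LinearEquiv.coe_coe]
    rw [this, e.symm_apply_apply]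
    by_cases hij : i = j
    · subst hij; simp
    · simp [hij]

/-- Coordinates identify `V` with `p` copies of `S`. In the descent this is what guarantees non-zero
cohomology: a complex of dimension prime to `p` is never acyclic. -/
theorem dvd_finrank_of_acyclic [Module.Finite k V] {d : Module.End k V} (hd : d ^ p = 0)
    (h : AcyclicOn p d ⊤) : p ∣ Module.finrank k V := by
  obtain ⟨S, c, h1, h2⟩ := exists_coordinates hd h
  let Φ : V →ₗ[k] (Fin p → S) := LinearMap.pi fun i => c i
  let Ψ : (Fin p → S) →ₗ[k] V := ∑ i : Fin p, (d ^ (i : ℕ)) ∘ₗ S.subtype ∘ₗ LinearMap.proj i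
  have hΨ : ∀ s, Ψ s = ∑ i : Fin p, (d ^ (i : ℕ)) (s i) := by intro s; simp [Ψ]
  have e : V ≃ₗ[k] (Fin p → S) := LinearEquiv.ofLinearMap Φ Ψ
    (by
      refine LinearMap.ext fun s => funext fun i => ?_
      change c i (Ψ s) = s i
      rw [hΨ, map_sum, Finset.sum_eq_single i]
      · rw [h2 i i.2 i i.2, if_pos rfl]
      · intro j _ hj
        rw [h2 i i.2 j j.2, if_neg (fun h => hj (Fin.ext h.symm))]
      · simp)
    (by
      refine LinearMap.ext fun v => ?_
      change Ψ (Φ v) = v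
      rw [hΨ]
      conv_rhs => rw [← h1 v]
      rw [Finset.sum_range]; rfl)
  rw [e.finrank_eq, Module.finrank_pi_fintype]
  simp

/-- An acyclic complex has a null-homotopic identity. -/
theorem exists_contraction {d : Module.End k V} (hp : 0 < p) (hd : d ^ p = 0)
    (h : AcyclicOn p d ⊤) :
    ∃ η : Module.End k V, ∀ v, ∑ i ∈ Finset.range p, (d ^ i) (η ((d ^ (p - 1 - i)) v)) = v := by
  obtain ⟨S, c, h1, h2⟩ := exists_coordinates hd h
  -- The homotopy reads off the top coordinate. The factor `d^(p-1-i)` moves the `i`-th coordinate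
  -- to the top, and `d^i` puts it back in its place.
  refine ⟨S.subtype ∘ₗ c (p - 1), fun v => ?_⟩
  conv_rhs => rw [← h1 v]
  refine Finset.sum_congr rfl fun i hi => ?_
  have hi := Finset.mem_range.1 hi
  congr 1
  change ((c (p - 1) _ : S) : V) = _
  congr 1
  conv_lhs => rw [← h1 v]
  rw [map_sum, map_sum, Finset.sum_eq_single i]
  · rw [← pow_add_apply, show p - 1 - i + i = p - 1 by omega, h2 _ (by omega) _ (by omega),
      if_pos rfl]
  · intro j hj hji
    have hj := Finset.mem_range.1 hj
    rw [← pow_add_apply]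
    rcases Nat.lt_or_ge (p - 1 - i + j) p with h3 | h3
    · rw [h2 _ (by omega) _ h3, if_neg (by omega)]
    · rw [pow_apply_eq_zero hd h3, map_zero]
  · intro h; exact absurd (Finset.mem_range.2 hi) h

/-- In coordinates `s` is minus differentiation, `d^j z ↦ -j d^(j-1) z`. The truncation at `j = p -
1` is harmless because `p = 0` in `k`. Unlike the bare acyclicity condition, such an operator can be
tensored with identities. -/
theorem exists_commutator [CharP k p] {d : Module.End k V} (hd : d ^ p = 0)
    (h : AcyclicOn p d ⊤) : ∃ s : Module.End k V, ∀ v, d (s v) - s (d v) = v := by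
  obtain ⟨S, c, h1, h2⟩ := exists_coordinates hd h
  let s : Module.End k V :=
    -∑ i ∈ Finset.range p, (i : k) • ((d ^ (i - 1)) ∘ₗ S.subtype ∘ₗ c i)
  have hs : ∀ j < p, ∀ z : S, s ((d ^ j) z) = -((j : k) • (d ^ (j - 1)) z) := by
    intro j hj z
    simp only [s, LinearMap.neg_apply, LinearMap.sum_apply, LinearMap.smul_apply,
      LinearMap.comp_apply]
    rw [Finset.sum_eq_single j]
    · rw [h2 j hj j hj, if_pos rfl]; rfl
    · intro i hi hij
      rw [h2 i (Finset.mem_range.1 hi) j hj, if_neg hij]; simp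
    · intro h; exact absurd (Finset.mem_range.2 hj) h
  refine ⟨s, fun v => ?_⟩
  have key : ∀ j < p, ∀ z : S, d (s ((d ^ j) z)) - s (d ((d ^ j) z)) = (d ^ j) z := by
    intro j hj z
    have e1 : d ((d ^ j) (z : V)) = (d ^ (j + 1)) z := by rw [pow_succ']; rfl
    rw [hs j hj z, e1]
    have e2 : d (-((j : k) • (d ^ (j - 1)) (z : V))) = -((j : k) • (d ^ j) (z : V)) := by
      rw [map_neg, map_smul]
      rcases j with _ | j
      · simp
      · rw [Nat.add_sub_cancel, pow_succ' d j]; rfl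
    rw [e2]
    have e3 : s ((d ^ (j + 1)) (z : V)) = -(((j + 1 : ℕ) : k) • (d ^ j) (z : V)) := by
      rcases Nat.lt_or_ge (j + 1) p with h3 | h3
      · rw [hs _ h3]; rfl
      · rw [pow_apply_eq_zero hd h3, show j + 1 = p by omega, CharP.cast_eq_zero]; simp
    rw [e3, Nat.cast_succ, add_smul, one_smul]; abel
  conv_lhs => rw [← h1 v]
  conv_rhs => rw [← h1 v]
  simp only [map_sum]
  rw [← Finset.sum_sub_distrib]
  exact Finset.sum_congr rfl fun j hj => key j (Finset.mem_range.1 hj) _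

/-- Restricting to a stable subspace. -/
theorem acyclicOn_iff_restrict {d : Module.End k V} {N : Submodule k V} (hN : ∀ u ∈ N, d u ∈ N) :
    AcyclicOn p d N ↔ AcyclicOn p (d.restrict hN) ⊤ := by
  constructor
  · rintro h ⟨u, hu⟩ - h0
    obtain ⟨v, hv, h1⟩ := h u hu (congrArg Subtype.val h0)
    exact ⟨⟨v, hv⟩, trivial, Subtype.ext (by rw [Module.End.pow_restrict]; exact h1)⟩
  · intro h u hu h0
    obtain ⟨v, -, h1⟩ := h ⟨u, hu⟩ trivial (Subtype.ext h0)
    refine ⟨v, v.2, ?_⟩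
    have := congrArg Subtype.val h1
    rwa [Module.End.pow_restrict] at this

theorem restrict_pow_eq_zero {d : Module.End k V} (hd : d ^ p = 0) {N : Submodule k V}
    (hN : ∀ u ∈ N, d u ∈ N) : d.restrict hN ^ p = 0 := by
  rw [Module.End.pow_restrict]
  ext u
  simp [hd]

end Acyclic

/-! ### Cohomology of `p`-complexes and connecting maps -/

section Cohomology

variable {k V W Z : Type u} [Field k] [AddCommGroup V] [Module k V] [AddCommGroup W] [Module k W]
  [AddCommGroup Z] [Module k Z] {p : ℕ}

/-- `ker d^a / im d^(p-a)`. -/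
abbrev Coh (p : ℕ) (d : Module.End k V) (a : ℕ) : Type u :=
  LinearMap.ker (d ^ a) ⧸ (LinearMap.range (d ^ (p - a))).submoduleOf (LinearMap.ker (d ^ a))

/-- The class of a cocycle. -/
def Coh.mk (p : ℕ) (d : Module.End k V) (a : ℕ) (u : V) (hu : (d ^ a) u = 0) : Coh p d a :=
  Submodule.Quotient.mk ⟨u, hu⟩

theorem Coh.mk_eq_zero {d : Module.End k V} {a : ℕ} {u : V} (hu : (d ^ a) u = 0) :
    Coh.mk p d a u hu = 0 ↔ ∃ v, (d ^ (p - a)) v = u := by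
  rw [Coh.mk, Submodule.Quotient.mk_eq_zero]; rfl

theorem Coh.exists_mk {d : Module.End k V} {a : ℕ} (x : Coh p d a) :
    ∃ u hu, x = Coh.mk p d a u hu := by
  obtain ⟨⟨u, hu⟩, rfl⟩ := Submodule.Quotient.mk_surjective _ x
  exact ⟨u, hu, rfl⟩

/-- A linear map taking cocycles to cocycles and coboundaries to coboundaries induces a map. -/
def Coh.map {d : Module.End k V} {e : Module.End k W} {a b : ℕ} (f : V →ₗ[k] W)
    (h1 : ∀ u, (d ^ a) u = 0 → (e ^ b) (f u) = 0)
    (h2 : ∀ v, (d ^ a) ((d ^ (p - a)) v) = 0 → ∃ w, (e ^ (p - b)) w = f ((d ^ (p - a)) v)) :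
    Coh p d a →ₗ[k] Coh p e b :=
  Submodule.mapQ _ _ (f.restrict h1) (by
    rintro ⟨u, hu⟩ ⟨v, hv⟩
    change (d ^ (p - a)) v = u at hv
    subst hv
    exact h2 v hu)

theorem Coh.map_mk {d : Module.End k V} {e : Module.End k W} {a b : ℕ} (f : V →ₗ[k] W)
    (h1 : ∀ u, (d ^ a) u = 0 → (e ^ b) (f u) = 0)
    (h2 : ∀ v, (d ^ a) ((d ^ (p - a)) v) = 0 → ∃ w, (e ^ (p - b)) w = f ((d ^ (p - a)) v))
    (u : V) (hu : (d ^ a) u = 0) :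
    Coh.map f h1 h2 (Coh.mk p d a u hu) = Coh.mk p e b (f u) (h1 u hu) := rfl

/-- The map induced by a chain map. -/
def Coh.mapChain (p : ℕ) {d : Module.End k V} {e : Module.End k W} (a : ℕ) (f : V →ₗ[k] W)
    (hf : ∀ v, f (d v) = e (f v)) : Coh p d a →ₗ[k] Coh p e a :=
  Coh.map f (fun u hu => by rw [← map_pow_apply hf, hu, map_zero])
    (fun v _ => ⟨f v, (map_pow_apply hf _ _).symm⟩)

theorem Coh.mapChain_mk {d : Module.End k V} {e : Module.End k W} (a : ℕ) (f : V →ₗ[k] W)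
    (hf : ∀ v, f (d v) = e (f v)) (u : V) (hu : (d ^ a) u = 0) :
    Coh.mapChain p a f hf (Coh.mk p d a u hu)
      = Coh.mk p e a (f u) (by rw [← map_pow_apply hf, hu, map_zero]) := rfl

/-- Three-term exactness for cohomology of a short exact sequence. -/
theorem Coh.finite_of_exact {dV : Module.End k V} {dW : Module.End k W} {dZ : Module.End k Z}
    {i : V →ₗ[k] W} {q : W →ₗ[k] Z} (hi : ∀ v, i (dV v) = dW (i v)) (hq : ∀ w, q (dW w) = dZ (q w))
    (inj : Function.Injective i) (surj : Function.Surjective q)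
    (exact : ∀ w, q w = 0 ↔ ∃ v, i v = w) {a : ℕ} (hap : a ≤ p) (hd : dW ^ p = 0)
    (h1 : Module.Finite k (Coh p dV a)) (h2 : Module.Finite k (Coh p dZ a)) :
    Module.Finite k (Coh p dW a) := by
  have h1' : IsNoetherian k (Coh p dV a) := inferInstance
  have h2' : IsNoetherian k (Coh p dZ a) := inferInstance
  have : IsNoetherian k (Coh p dW a) := by
    refine isNoetherian_of_range_eq_ker (Coh.mapChain p a i hi) (Coh.mapChain p a q hq)
      (le_antisymm ?_ ?_)
    · rintro _ ⟨x, rfl⟩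
      obtain ⟨u, hu, rfl⟩ := x.exists_mk
      rw [LinearMap.mem_ker, mapChain_mk, mapChain_mk, Coh.mk_eq_zero]
      exact ⟨0, by rw [map_zero]; exact ((exact _).2 ⟨u, rfl⟩).symm⟩
    · intro x hx
      obtain ⟨u, hu, rfl⟩ := x.exists_mk
      rw [LinearMap.mem_ker, mapChain_mk, Coh.mk_eq_zero] at hx
      obtain ⟨z, hz⟩ := hx
      obtain ⟨w, rfl⟩ := surj z
      rw [← map_pow_apply hq, eq_comm, ← sub_eq_zero, ← map_sub, exact] at hz
      obtain ⟨v, hv⟩ := hz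
      have hv0 : (dV ^ a) v = 0 := by
        apply inj
        rw [map_pow_apply hi, hv, map_sub, hu, ← pow_add_apply, Nat.add_sub_cancel' hap, hd]
        simp
      refine ⟨Coh.mk p dV a v hv0, ?_⟩
      rw [mapChain_mk, ← sub_eq_zero]
      change Coh.mk p dW a (i v - u) (by
        rw [map_sub, hu, ← map_pow_apply hi, hv0, map_zero, sub_zero]) = 0
      rw [Coh.mk_eq_zero]
      exact ⟨-w, by rw [hv, map_neg]; abel⟩
  infer_instance

/-- An acyclic kernel contributes nothing. A class dying in the target is corrected inside the
kernel by exactness at `d^a`; a lift of a class is made a cocycle by exactness at `d^(p-a)`. -/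
theorem Coh.mapChain_bijective {dV : Module.End k V} {dW : Module.End k W} {f : V →ₗ[k] W}
    (hf : ∀ v, f (dV v) = dW (f v)) (surj : Function.Surjective f)
    (hk : AcyclicOn p dV (LinearMap.ker f)) {a : ℕ} (hap : a ≤ p) (hd : dV ^ p = 0) :
    Function.Bijective (Coh.mapChain p a f hf) := by
  have hst : ∀ u ∈ LinearMap.ker f, dV u ∈ LinearMap.ker f := fun u hu => by
    rw [LinearMap.mem_ker] at *; rw [hf, hu, map_zero]
  constructor
  · rw [← LinearMap.ker_eq_bot, LinearMap.ker_eq_bot']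
    intro x hx
    obtain ⟨u, hu, rfl⟩ := x.exists_mk
    rw [mapChain_mk, Coh.mk_eq_zero] at hx
    obtain ⟨z, hz⟩ := hx
    obtain ⟨w, rfl⟩ := surj z
    obtain ⟨v, -, hv⟩ := hk.exact hst hap (u - (dV ^ (p - a)) w)
      (by rw [LinearMap.mem_ker, map_sub, map_pow_apply hf, hz, sub_self])
      (by rw [map_sub, hu, ← pow_add_apply, Nat.add_sub_cancel' hap, hd]; simp)
    rw [Coh.mk_eq_zero]
    exact ⟨v + w, by rw [map_add, hv]; abel⟩
  · intro y
    obtain ⟨z, hz, rfl⟩ := y.exists_mk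
    obtain ⟨u, rfl⟩ := surj z
    obtain ⟨v, hv, hvu⟩ := hk.exact hst (a := p - a) (Nat.sub_le p a) ((dV ^ a) u)
      (by rw [LinearMap.mem_ker, map_pow_apply hf, hz])
      (by rw [← pow_add_apply, Nat.sub_add_cancel hap, hd]; rfl)
    rw [Nat.sub_sub_self hap] at hvu
    refine ⟨Coh.mk p dV a (u - v) (by rw [map_sub, hvu, sub_self]), ?_⟩
    rw [mapChain_mk]
    congr 1
    rw [map_sub, LinearMap.mem_ker.1 hv, sub_zero]

/-- The connecting map of a short exact sequence of complexes. -/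
theorem Coh.exists_connecting {dV : Module.End k V} {dW : Module.End k W} {dZ : Module.End k Z}
    {i : V →ₗ[k] W} {q : W →ₗ[k] Z} (hi : ∀ v, i (dV v) = dW (i v)) (hq : ∀ w, q (dW w) = dZ (q w))
    (inj : Function.Injective i) (surj : Function.Surjective q)
    (exact : ∀ w, q w = 0 ↔ ∃ v, i v = w) {a : ℕ} (hap : a ≤ p) (hd : dW ^ p = 0) :
    ∃ δ : Coh p dZ a →ₗ[k] Coh p dV (p - a), ∀ (w : W) (hw : (dZ ^ a) (q w) = 0) (v : V)
      (hv : (dV ^ (p - a)) v = 0), i v = (dW ^ a) w →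
        δ (Coh.mk p dZ a (q w) hw) = Coh.mk p dV (p - a) v hv := by
  -- Linear splittings turn the diagram chase into the formula `r ∘ d^a ∘ t`. Since `d^(p-a) d^a =
  -- 0`, the image of a class killed by `d^a` is killed by `d^(p-a)`, which explains the change of
  -- index.
  obtain ⟨t, ht⟩ := q.exists_rightInverse_of_surjective (LinearMap.range_eq_top.2 surj)
  obtain ⟨r, hr⟩ := i.exists_leftInverse_of_injective (LinearMap.ker_eq_bot.2 inj)
  have ht' : ∀ z, q (t z) = z := fun z => LinearMap.congr_fun ht z
  have hr' : ∀ v, r (i v) = v := fun v => LinearMap.congr_fun hr v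
  have hir : ∀ w, q w = 0 → i (r w) = w := by
    intro w hw
    obtain ⟨v, rfl⟩ := (exact w).1 hw
    rw [hr']
  have h1 : ∀ u, (dZ ^ a) u = 0 → (dV ^ (p - a)) ((r ∘ₗ (dW ^ a) ∘ₗ t) u) = 0 := by
    intro u hu
    apply inj
    rw [map_pow_apply hi]
    change (dW ^ (p - a)) (i (r ((dW ^ a) (t u)))) = _
    rw [hir _ (by rw [map_pow_apply hq, ht', hu]), ← pow_add_apply, Nat.sub_add_cancel hap, hd]
    simp
  -- Independence of the chosen lift: two lifts differ by an element of `V`, so the results differ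
  -- by `d^a` of it, which is a coboundary at index `p - a`.
  have key : ∀ u w, q w = u → ∀ v, i v = (dW ^ a) w → ∃ v', (dV ^ a) v' =
      (r ∘ₗ (dW ^ a) ∘ₗ t) u - v := by
    intro u w hw v hv
    have h0 : q (t u - w) = 0 := by rw [map_sub, ht', hw, sub_self]
    refine ⟨r (t u - w), inj ?_⟩
    rw [map_pow_apply hi, hir _ h0, map_sub, map_sub, hv]
    congr 1
    change _ = i (r ((dW ^ a) (t u)))
    have h3 : q ((dW ^ a) (t u)) = 0 := by
      have : (dW ^ a) (t u) = (dW ^ a) (t u - w) + i v := by rw [map_sub, hv]; abel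
      rw [this, map_add, map_pow_apply hq, h0, map_zero, (exact _).2 ⟨v, rfl⟩, add_zero]
    rw [hir _ h3]
  refine ⟨Coh.map (r ∘ₗ (dW ^ a) ∘ₗ t) h1 ?_, ?_⟩
  · intro z hz
    obtain ⟨w, rfl⟩ := surj z
    obtain ⟨v', hv'⟩ := key ((dZ ^ (p - a)) (q w)) ((dW ^ (p - a)) w) (map_pow_apply hq _ _) 0
      (by rw [← pow_add_apply, Nat.add_sub_cancel' hap, hd]; simp)
    exact ⟨v', by rw [Nat.sub_sub_self hap, hv', sub_zero]⟩
  · intro w hw v hv hiv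
    rw [Coh.map_mk, ← sub_eq_zero]
    change Coh.mk p dV (p - a) ((r ∘ₗ (dW ^ a) ∘ₗ t) (q w) - v) (by
      rw [map_sub, hv, h1 _ hw, sub_zero]) = 0
    rw [Coh.mk_eq_zero, Nat.sub_sub_self hap]
    exact key (q w) w rfl v hiv

/-- Dimension drop along a connecting map which is onto but not injective. -/
theorem Coh.finrank_lt {dV : Module.End k V} {dW : Module.End k W} {dZ : Module.End k Z}
    {i : V →ₗ[k] W} {q : W →ₗ[k] Z} (hi : ∀ v, i (dV v) = dW (i v)) (hq : ∀ w, q (dW w) = dZ (q w))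
    (inj : Function.Injective i) (surj : Function.Surjective q)
    (exact : ∀ w, q w = 0 ↔ ∃ v, i v = w) {a : ℕ} (hap : a ≤ p) (hd : dW ^ p = 0)
    (honto : ∀ v, (dV ^ (p - a)) v = 0 → ∃ w, (dW ^ a) w = i v)
    {w₀ : W} (hw₀ : (dW ^ a) w₀ = 0) (hne : ∀ z, (dZ ^ (p - a)) z ≠ q w₀)
    (hfin : Module.Finite k (Coh p dZ a)) :
    Module.Finite k (Coh p dV (p - a)) ∧
      Module.finrank k (Coh p dV (p - a)) < Module.finrank k (Coh p dZ a) := by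
  obtain ⟨δ, hδ⟩ := Coh.exists_connecting hi hq inj surj exact hap hd
  have hsurj : Function.Surjective δ := by
    intro y
    obtain ⟨v, hv, rfl⟩ := y.exists_mk
    obtain ⟨w, hw⟩ := honto v hv
    have hqw : (dZ ^ a) (q w) = 0 := by rw [← map_pow_apply hq, hw, (exact _).2 ⟨v, rfl⟩]
    exact ⟨Coh.mk p dZ a (q w) hqw, hδ w hqw v hv hw.symm⟩
  have hq0 : (dZ ^ a) (q w₀) = 0 := by rw [← map_pow_apply hq, hw₀, map_zero]
  -- The class lifts to the cocycle `w₀` of the middle term, hence is annihilated by the connecting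
  -- map, while `hne` says that it is non-zero. So the kernel has positive dimension.
  have h0 : Coh.mk p dZ a (q w₀) hq0 ∈ LinearMap.ker δ := by
    rw [LinearMap.mem_ker, hδ w₀ hq0 0 (map_zero _) (by rw [map_zero, hw₀])]; rfl
  have hpos : 0 < Module.finrank k (LinearMap.ker δ) := by
    rw [Module.finrank_pos_iff]
    refine ⟨⟨⟨_, h0⟩, 0, fun h => ?_⟩⟩
    have h' : Coh.mk p dZ a (q w₀) hq0 = 0 := congrArg Subtype.val h
    rw [Coh.mk_eq_zero] at h'
    obtain ⟨z, hz⟩ := h'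
    exact hne z hz
  have := LinearMap.finrank_range_add_finrank_ker δ
  rw [LinearMap.range_eq_top.2 hsurj, finrank_top] at this
  exact ⟨Module.Finite.of_surjective δ hsurj, by omega⟩

/-- A connecting map which is onto. -/
theorem Coh.finrank_le {dV : Module.End k V} {dW : Module.End k W} {dZ : Module.End k Z}
    {i : V →ₗ[k] W} {q : W →ₗ[k] Z} (hi : ∀ v, i (dV v) = dW (i v)) (hq : ∀ w, q (dW w) = dZ (q w))
    (inj : Function.Injective i) (surj : Function.Surjective q)
    (exact : ∀ w, q w = 0 ↔ ∃ v, i v = w) {a : ℕ} (hap : a ≤ p) (hd : dW ^ p = 0)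
    (honto : ∀ v, (dV ^ (p - a)) v = 0 → ∃ w, (dW ^ a) w = i v)
    (hfin : Module.Finite k (Coh p dZ a)) :
    Module.finrank k (Coh p dV (p - a)) ≤ Module.finrank k (Coh p dZ a) := by
  obtain ⟨δ, hδ⟩ := Coh.exists_connecting hi hq inj surj exact hap hd
  refine LinearMap.finrank_le_finrank_of_surjective (f := δ) fun y => ?_
  obtain ⟨v, hv, rfl⟩ := y.exists_mk
  obtain ⟨w, hw⟩ := honto v hv
  have hqw : (dZ ^ a) (q w) = 0 := by rw [← map_pow_apply hq, hw, (exact _).2 ⟨v, rfl⟩]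
  exact ⟨Coh.mk p dZ a (q w) hqw, hδ w hqw v hv hw.symm⟩

end Cohomology
end PDG

namespace PDG

/-! ### Ungraded modules with a differential and flatness of the tensor product -/

section RawModules

variable (p : ℕ) (k B : Type u) [Field k] [Ring B] [Algebra k B] [PDGAlgebra p k B]

/-- An ungraded right module with a differential. -/
structure RMod where
  carrier : Type u
  [addCommGroup : AddCommGroup carrier]
  [module : Module k carrier]
  ract : Bᵐᵒᵖ →ₐ[k] Module.End k carrier
  d : Module.End k carrier
  d_ract : ∀ (b : B) (m : carrier),
    d (ract (op b) m) = ract (op b) (d m) + ract (op (PDGAlgebra.d (p := p) (k := k) b)) m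
  d_pow : d ^ p = 0

/-- An ungraded left module with a differential. -/
structure LMod where
  carrier : Type u
  [addCommGroup : AddCommGroup carrier]
  [module : Module k carrier]
  lact : B →ₐ[k] Module.End k carrier
  d : Module.End k carrier
  d_lact : ∀ (b : B) (m : carrier),
    d (lact b m) = lact (PDGAlgebra.d (p := p) (k := k) b) m + lact b (d m)
  d_pow : d ^ p = 0

attribute [instance] RMod.addCommGroup RMod.module LMod.addCommGroup LMod.module

instance : CoeSort (RMod p k B) (Type u) := ⟨RMod.carrier⟩
instance : CoeSort (LMod p k B) (Type u) := ⟨LMod.carrier⟩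

variable {p k B}

/-- Linear maps of right modules, not necessarily compatible with the differentials. -/
structure RLin (X X' : RMod p k B) where
  lin : X →ₗ[k] X'
  map_ract : ∀ b x, lin (X.ract b x) = X'.ract b (lin x)

/-- Linear maps of left modules, not necessarily compatible with the differentials. -/
structure LLin (Y Y' : LMod p k B) where
  lin : Y →ₗ[k] Y'
  map_lact : ∀ b y, lin (Y.lact b y) = Y'.lact b (lin y)

/-- Compatibility with the differentials. -/
def RLin.IsChain {X X' : RMod p k B} (f : RLin X X') : Prop := ∀ x, f.lin (X.d x) = X'.d (f.lin x)

/-- Compatibility with the differentials. -/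
def LLin.IsChain {Y Y' : LMod p k B} (f : LLin Y Y') : Prop := ∀ y, f.lin (Y.d y) = Y'.d (f.lin y)

/-- The identity. -/
def RLin.id (X : RMod p k B) : RLin X X := ⟨LinearMap.id, fun _ _ => rfl⟩
/-- The identity. -/
def LLin.id (Y : LMod p k B) : LLin Y Y := ⟨LinearMap.id, fun _ _ => rfl⟩

/-- Composition. -/
def RLin.comp {X X' X'' : RMod p k B} (g : RLin X' X'') (f : RLin X X') : RLin X X'' :=
  ⟨g.lin ∘ₗ f.lin, fun b x => by simp [f.map_ract, g.map_ract]⟩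

section Tensor

variable (X : RMod p k B) (Y : LMod p k B)

/-- The relations defining `X ⊗_B Y`. -/
def rbal : Submodule k (X ⊗[k] Y) :=
  Submodule.span k {t | ∃ (x : X) (b : B) (y : Y),
    t = X.ract (op b) x ⊗ₜ[k] y - x ⊗ₜ[k] Y.lact b y}

/-- `X ⊗_B Y`. -/
abbrev rtens : Type u := (X ⊗[k] Y) ⧸ rbal X Y

/-- A pure tensor in `X ⊗_B Y`. -/
def rtmul (x : X) (y : Y) : rtens X Y := (rbal X Y).mkQ (x ⊗ₜ[k] y)

theorem rtmul_balanced (x : X) (b : B) (y : Y) :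
    rtmul X Y (X.ract (op b) x) y = rtmul X Y x (Y.lact b y) := by
  rw [rtmul, rtmul, ← sub_eq_zero, ← map_sub]
  exact (Submodule.Quotient.mk_eq_zero _).2 (Submodule.subset_span ⟨x, b, y, rfl⟩)

variable {X Y} in
theorem rtens_ext {W : Type u} [AddCommGroup W] [Module k W] {f g : rtens X Y →ₗ[k] W}
    (h : ∀ x y, f (rtmul X Y x y) = g (rtmul X Y x y)) : f = g := by
  apply Submodule.linearMap_qext
  ext x y
  exact h x y

variable {X Y} in
theorem rtens_induction {motive : rtens X Y → Prop} (zero : motive 0)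
    (tmul : ∀ x y, motive (rtmul X Y x y)) (add : ∀ s t, motive s → motive t → motive (s + t))
    (t : rtens X Y) : motive t := by
  obtain ⟨t, rfl⟩ := Submodule.mkQ_surjective _ t
  induction t using TensorProduct.induction_on with
  | zero => rw [map_zero]; exact zero
  | tmul x y => exact tmul x y
  | add s t hs ht => rw [map_add]; exact add _ _ hs ht

variable {X Y} in
/-- A balanced linear map out of `X ⊗_B Y`. -/
def rlift {W : Type u} [AddCommGroup W] [Module k W] (f : X ⊗[k] Y →ₗ[k] W)
    (hf : ∀ x b y, f (X.ract (op b) x ⊗ₜ[k] y) = f (x ⊗ₜ[k] Y.lact b y)) : rtens X Y →ₗ[k] W :=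
  (rbal X Y).liftQ f (by
    refine Submodule.span_le.2 ?_
    rintro _ ⟨x, b, y, rfl⟩
    change _ = _
    rw [map_sub, sub_eq_zero, hf])

variable {X Y} in
/-- The map induced by a pair of linear maps. -/
def rmap {X' : RMod p k B} {Y' : LMod p k B} (f : RLin X X') (g : LLin Y Y') :
    rtens X Y →ₗ[k] rtens X' Y' :=
  rlift ((rbal X' Y').mkQ ∘ₗ TensorProduct.map f.lin g.lin) (fun x b y => by
    change rtmul X' Y' (f.lin (X.ract (op b) x)) (g.lin y)
      = rtmul X' Y' (f.lin x) (g.lin (Y.lact b y))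
    rw [f.map_ract, g.map_lact, rtmul_balanced])

variable {X Y} in
theorem rmap_tmul {X' : RMod p k B} {Y' : LMod p k B} (f : RLin X X') (g : LLin Y Y') (x : X)
    (y : Y) : rmap f g (rtmul X Y x y) = rtmul X' Y' (f.lin x) (g.lin y) := rfl

variable {X Y} in
theorem rmap_rmap {X' X'' : RMod p k B} {Y' Y'' : LMod p k B} (f : RLin X X') (g : LLin Y Y')
    (f' : RLin X' X'') (g' : LLin Y' Y'') (f'' : RLin X X'') (g'' : LLin Y Y'')
    (hf : ∀ x, f'.lin (f.lin x) = f''.lin x) (hg : ∀ y, g'.lin (g.lin y) = g''.lin y)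
    (t : rtens X Y) : rmap f' g' (rmap f g t) = rmap f'' g'' t :=
  LinearMap.congr_fun (f := rmap f' g' ∘ₗ rmap f g) (g := rmap f'' g'')
    (rtens_ext fun x y => by
      rw [LinearMap.comp_apply, rmap_tmul, rmap_tmul, rmap_tmul, hf, hg]) t

variable {X Y} in
theorem rmap_eq_self (f : RLin X X) (g : LLin Y Y) (hf : ∀ x, f.lin x = x) (hg : ∀ y, g.lin y = y)
    (t : rtens X Y) : rmap f g t = t :=
  LinearMap.congr_fun (f := rmap f g) (g := LinearMap.id)
    (rtens_ext fun x y => by rw [rmap_tmul, hf, hg]; rfl) t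

variable {X Y} in
theorem rmap_surjective {X' : RMod p k B} {Y' : LMod p k B} (f : RLin X X') (g : LLin Y Y')
    (hf : Function.Surjective f.lin) (hg : Function.Surjective g.lin) :
    Function.Surjective (rmap f g) := by
  intro t
  induction t using rtens_induction with
  | zero => exact ⟨0, map_zero _⟩
  | tmul x y =>
    obtain ⟨x, rfl⟩ := hf x
    obtain ⟨y, rfl⟩ := hg y
    exact ⟨rtmul X Y x y, rfl⟩
  | add s t hs ht =>
    obtain ⟨s, rfl⟩ := hs
    obtain ⟨t, rfl⟩ := ht
    exact ⟨s + t, map_add _ _ _⟩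

/-- The differential on `X ⊗_B Y`. -/
def rtD : Module.End k (rtens X Y) :=
  (rbal X Y).mapQ (rbal X Y) (LinearMap.rTensor Y X.d + LinearMap.lTensor X Y.d) (by
    refine Submodule.span_le.2 ?_
    rintro _ ⟨x, b, y, rfl⟩
    have h : ∀ x b y, X.ract (op b) x ⊗ₜ[k] y - x ⊗ₜ[k] Y.lact b y ∈ rbal X Y :=
      fun x b y => Submodule.subset_span ⟨x, b, y, rfl⟩
    have h1 := h (X.d x) b y
    have h2 := h x b (Y.d y)
    have h3 := h x (PDGAlgebra.d (p := p) (k := k) b) y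
    change _ ∈ rbal X Y
    convert add_mem (add_mem h1 h2) h3 using 1
    simp only [LinearMap.add_apply, map_sub, LinearMap.rTensor_tmul, LinearMap.lTensor_tmul,
      X.d_ract, Y.d_lact, TensorProduct.add_tmul, TensorProduct.tmul_add]
    abel)

theorem rtD_tmul (x : X) (y : Y) :
    rtD X Y (rtmul X Y x y) = rtmul X Y (X.d x) y + rtmul X Y x (Y.d y) := rfl

theorem rtD_pow [hp : Fact p.Prime] [CharP k p] : rtD X Y ^ p = 0 := by
  have hcomm : Commute (LinearMap.rTensor Y X.d) (LinearMap.lTensor (R := k) X Y.d) := by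
    ext x y; simp
  have h : (LinearMap.rTensor Y X.d + LinearMap.lTensor (R := k) X Y.d) ^ p = 0 := by
    rw [add_pow_prime_of_commute hp.out hcomm, LinearMap.rTensor_pow, LinearMap.lTensor_pow,
      X.d_pow, Y.d_pow]
    simp
  have h2 : ∀ m : ℕ, ∀ t : X ⊗[k] Y, (rtD X Y ^ m) ((rbal X Y).mkQ t)
      = (rbal X Y).mkQ (((LinearMap.rTensor Y X.d + LinearMap.lTensor X Y.d) ^ m) t) := by
    intro m
    induction m with
    | zero => intro t; rfl
    | succ m ih => intro t; rw [pow_succ, pow_succ]; exact ih _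
  exact rtens_ext fun x y => by rw [rtmul, h2, h]; simp

variable {X Y} in
theorem rmap_d {X' : RMod p k B} {Y' : LMod p k B} {f : RLin X X'} {g : LLin Y Y'}
    (hf : f.IsChain) (hg : g.IsChain) (t : rtens X Y) :
    rmap f g (rtD X Y t) = rtD X' Y' (rmap f g t) :=
  LinearMap.congr_fun (f := rmap f g ∘ₗ rtD X Y) (g := rtD X' Y' ∘ₗ rmap f g)
    (rtens_ext fun x y => by
      rw [LinearMap.comp_apply, LinearMap.comp_apply, rtD_tmul, map_add, rmap_tmul, rmap_tmul,
        rmap_tmul, rtD_tmul, hf x, hg y]) t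

end Tensor

/-- `X ⊗_B -` preserves injections and surjections with acyclic kernel. -/
structure Good (X : RMod p k B) : Prop where
  inj : ∀ {Y Y' : LMod p k B} (f : LLin Y Y'), Function.Injective f.lin →
    Function.Injective (rmap (RLin.id X) f)
  acy : ∀ {Y Y' : LMod p k B} (f : LLin Y Y'), f.IsChain → Function.Surjective f.lin →
    AcyclicOn p Y.d (LinearMap.ker f.lin) →
    AcyclicOn p (rtD X Y) (LinearMap.ker (rmap (RLin.id X) f))

/-- The lifting property of projective modules. -/
def LiftProp (X : RMod p k B) : Prop :=
  ∀ {Z Z' : RMod p k B} (g : RLin Z Z') (φ : RLin X Z'), Function.Surjective g.lin →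
    ∃ ψ : RLin X Z, ∀ x, g.lin (ψ.lin x) = φ.lin x

theorem RLin.id_isChain (X : RMod p k B) : (RLin.id X).IsChain := fun _ => rfl
theorem LLin.id_isChain (Y : LMod p k B) : (LLin.id Y).IsChain := fun _ => rfl

/-- The identity of `X` is a locally finite sum of the chain projections `inc j ∘ π j`, and this
remains true after tensoring. Both conditions can be tested after each `π j` and reassembled by
finite sums. Stating it this way covers retracts and direct sums at once. -/
theorem Good.of_partition {X : RMod p k B} {J : Type u} (T : J → RMod p k B)
    (inc : ∀ j, RLin (T j) X) (π : ∀ j, RLin X (T j)) (hinc : ∀ j, (inc j).IsChain)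
    (hπ : ∀ j, (π j).IsChain)
    (hpart : ∀ x : X, ∃ s : Finset J, ∀ s' : Finset J, s ⊆ s' →
      ∑ j ∈ s', (inc j).lin ((π j).lin x) = x)
    (hT : ∀ j, Good (T j)) : Good X := by
  classical
  have key : ∀ {Y : LMod p k B} (t : rtens X Y), ∃ s : Finset J, ∀ s' : Finset J, s ⊆ s' →
      ∑ j ∈ s', rmap (inc j) (LLin.id Y) (rmap (π j) (LLin.id Y) t) = t := by
    intro Y t
    induction t using rtens_induction with
    | zero => exact ⟨∅, fun s' _ => by simp⟩
    | tmul x y =>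
      obtain ⟨s, hs⟩ := hpart x
      refine ⟨s, fun s' h => ?_⟩
      conv_rhs => rw [← hs s' h]
      simp only [rmap_tmul]
      change _ = ((rbal X Y).mkQ ∘ₗ (TensorProduct.mk k X Y).flip y) _
      rw [map_sum]; rfl
    | add a b ha hb =>
      obtain ⟨s, hs⟩ := ha
      obtain ⟨s', hs'⟩ := hb
      refine ⟨s ∪ s', fun s'' h => ?_⟩
      simp only [map_add, Finset.sum_add_distrib]
      rw [hs _ (Finset.subset_union_left.trans h), hs' _ (Finset.subset_union_right.trans h)]
  have comm : ∀ {Y Y' : LMod p k B} (f : LLin Y Y') (j : J) (t : rtens X Y),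
      rmap (RLin.id (T j)) f (rmap (π j) (LLin.id Y) t)
        = rmap (π j) (LLin.id Y') (rmap (RLin.id X) f t) := by
    intro Y Y' f j t
    rw [rmap_rmap _ _ _ _ (π j) f (fun _ => rfl) (fun _ => rfl),
      rmap_rmap _ _ _ _ (π j) f (fun _ => rfl) (fun _ => rfl)]
  have comm' : ∀ {Y Y' : LMod p k B} (f : LLin Y Y') (j : J) (t : rtens (T j) Y),
      rmap (RLin.id X) f (rmap (inc j) (LLin.id Y) t)
        = rmap (inc j) (LLin.id Y') (rmap (RLin.id (T j)) f t) := by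
    intro Y Y' f j t
    rw [rmap_rmap _ _ _ _ (inc j) f (fun _ => rfl) (fun _ => rfl),
      rmap_rmap _ _ _ _ (inc j) f (fun _ => rfl) (fun _ => rfl)]
  constructor
  · intro Y Y' f hf
    rw [← LinearMap.ker_eq_bot, LinearMap.ker_eq_bot']
    intro t ht
    obtain ⟨s, hs⟩ := key t
    rw [← hs s subset_rfl]
    refine Finset.sum_eq_zero fun j _ => ?_
    have : rmap (π j) (LLin.id Y) t = 0 := by
      apply (hT j).inj f hf
      rw [comm, ht, map_zero, map_zero]
    rw [this, map_zero]
  · intro Y Y' f hf hsurj hker u hu hdu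
    rw [LinearMap.mem_ker] at hu
    have h1 : ∀ j, ∃ v ∈ LinearMap.ker (rmap (RLin.id (T j)) f),
        (rtD (T j) Y ^ (p - 1)) v = rmap (π j) (LLin.id Y) u := by
      intro j
      refine (hT j).acy f hf hsurj hker _ ?_ ?_
      · rw [LinearMap.mem_ker, comm, hu, map_zero]
      · rw [← rmap_d (hπ j) (LLin.id_isChain Y), hdu, map_zero]
    choose v hv hvu using h1
    obtain ⟨s, hs⟩ := key u
    refine ⟨∑ j ∈ s, rmap (inc j) (LLin.id Y) (v j), ?_, ?_⟩
    · rw [LinearMap.mem_ker, map_sum]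
      refine Finset.sum_eq_zero fun j _ => ?_
      rw [comm', LinearMap.mem_ker.1 (hv j), map_zero]
    · rw [map_sum]
      conv_rhs => rw [← hs s subset_rfl]
      refine Finset.sum_congr rfl fun j _ => ?_
      rw [← hvu, map_pow_apply (rmap_d (hinc j) (LLin.id_isChain Y))]

theorem Good.of_retract {X T : RMod p k B} (i : RLin X T) (r : RLin T X) (hi : i.IsChain)
    (hr : r.IsChain) (h : ∀ x, r.lin (i.lin x) = x) (hT : Good T) : Good X :=
  Good.of_partition (J := PUnit) (fun _ => T) (fun _ => r) (fun _ => i) (fun _ => hr) (fun _ => hi)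
    (fun x => ⟨{PUnit.unit}, fun s' hs => by
      rw [Finset.sum_eq_single PUnit.unit, h]
      · intro j _ hj; exact absurd rfl hj
      · intro hn; exact absurd (hs (Finset.mem_singleton_self _)) hn⟩) (fun _ => hT)

/-- Extensions split over the algebra. -/
theorem Good.of_extension [hp : Fact p.Prime] [CharP k p] {N' N G : RMod p k B} (ι : RLin N' N) (q : RLin N G) (hι : ι.IsChain)
    (hq : q.IsChain) (r : RLin N N') (s : RLin G N)
    (h1 : ∀ x, ι.lin (r.lin x) + s.lin (q.lin x) = x) (hr : ∀ x, r.lin (ι.lin x) = x)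
    (hs : ∀ x, q.lin (s.lin x) = x) (hN' : Good N') (hG : Good G) : Good N := by
  have key : ∀ {Y : LMod p k B} (t : rtens N Y), rmap ι (LLin.id Y) (rmap r (LLin.id Y) t)
      + rmap s (LLin.id Y) (rmap q (LLin.id Y) t) = t := by
    intro Y t
    induction t using rtens_induction with
    | zero => simp
    | tmul x y =>
      conv_rhs => rw [← h1 x]
      simp only [rmap_tmul]
      change _ = ((rbal N Y).mkQ ∘ₗ (TensorProduct.mk k N Y).flip y) _
      rw [map_add]; rfl
    | add a b ha hb => conv_rhs => rw [← ha, ← hb]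
                       simp only [map_add]; abel
  have comm : ∀ {X X' : RMod p k B} (φ : RLin X X') {Y Y' : LMod p k B} (f : LLin Y Y')
      (t : rtens X Y), rmap (RLin.id X') f (rmap φ (LLin.id Y) t)
        = rmap φ (LLin.id Y') (rmap (RLin.id X) f t) := by
    intro X X' φ Y Y' f t
    rw [rmap_rmap _ _ _ _ φ f (fun _ => rfl) (fun _ => rfl),
      rmap_rmap _ _ _ _ φ f (fun _ => rfl) (fun _ => rfl)]
  have hι' : ∀ {Y : LMod p k B}, Function.Injective (rmap ι (LLin.id Y)) := by
    intro Y t t' h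
    have := congrArg (rmap r (LLin.id Y)) h
    rwa [rmap_rmap _ _ _ _ (RLin.id N') (LLin.id Y) hr (fun _ => rfl),
      rmap_rmap _ _ _ _ (RLin.id N') (LLin.id Y) hr (fun _ => rfl),
      rmap_eq_self _ _ (fun _ => rfl) (fun _ => rfl),
      rmap_eq_self _ _ (fun _ => rfl) (fun _ => rfl)] at this
  constructor
  · intro Y Y' f hf
    rw [← LinearMap.ker_eq_bot, LinearMap.ker_eq_bot']
    intro t ht
    have e1 : rmap q (LLin.id Y) t = 0 := by
      apply hG.inj f hf
      rw [comm, ht, map_zero, map_zero]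
    have e2 : rmap r (LLin.id Y) t = 0 := by
      apply hN'.inj f hf
      rw [comm, ht, map_zero, map_zero]
    rw [← key t, e1, e2, map_zero, map_zero, add_zero]
  · intro Y Y' f hf hsurj hker u hu hdu
    rw [LinearMap.mem_ker] at hu
    obtain ⟨v, hv, hvu⟩ := hG.acy f hf hsurj hker (rmap q (LLin.id Y) u)
      (by rw [LinearMap.mem_ker, comm, hu, map_zero])
      (by rw [← rmap_d hq (LLin.id_isChain Y), hdu, map_zero])
    have hqs : rmap q (LLin.id Y) (rmap s (LLin.id Y) v) = v := by
      rw [rmap_rmap _ _ _ _ (RLin.id G) (LLin.id Y) hs (fun _ => rfl),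
        rmap_eq_self _ _ (fun _ => rfl) (fun _ => rfl)]
    have hfv : rmap (RLin.id N) f (rmap s (LLin.id Y) v) = 0 := by
      rw [comm, LinearMap.mem_ker.1 hv, map_zero]
    -- The splitting maps `r` and `s` need not commute with `d`. Subtracting `d^(p-1)` of a lifted
    -- primitive moves `u` into the image of the chain map `ι`, and the remaining cocycle condition
    -- is tested after applying `ι`, which stays injective.
    set w := u - (rtD N Y ^ (p - 1)) (rmap s (LLin.id Y) v) with hw
    have hqw : rmap q (LLin.id Y) w = 0 := by
      rw [hw, map_sub, map_pow_apply (rmap_d hq (LLin.id_isChain Y)), hqs, hvu, sub_self]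
    have hιw : rmap ι (LLin.id Y) (rmap r (LLin.id Y) w) = w := by
      have := key w
      rwa [hqw, map_zero, add_zero] at this
    have hfw : rmap (RLin.id N) f w = 0 := by
      rw [hw, map_sub, hu, map_pow_apply (rmap_d (RLin.id_isChain N) hf), hfv, map_zero, sub_zero]
    obtain ⟨v', hv', hvu'⟩ : ∃ v' ∈ LinearMap.ker (rmap (RLin.id N') f),
        (rtD N' Y ^ (p - 1)) v' = rmap r (LLin.id Y) w := by
      refine hN'.acy f hf hsurj hker _ ?_ ?_
      · rw [LinearMap.mem_ker, comm, hfw, map_zero]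
      · apply hι'
        rw [rmap_d hι (LLin.id_isChain Y), hιw, map_zero, hw, map_sub, hdu,
          ← Module.End.mul_apply, ← pow_succ', Nat.sub_add_cancel hp.out.one_le, rtD_pow,
          LinearMap.zero_apply, sub_zero]
    refine ⟨rmap s (LLin.id Y) v + rmap ι (LLin.id Y) v', ?_, ?_⟩
    · rw [LinearMap.mem_ker, map_add, hfv, comm, LinearMap.mem_ker.1 hv', map_zero, add_zero]
    · rw [map_add, ← map_pow_apply (rmap_d hι (LLin.id_isChain Y)), hvu', hιw, hw]
      abel

end RawModules
end PDG

namespace PDG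

/-! ### Unions, free modules, direct sums and the lifting property -/

section RawModules
variable {p : ℕ} {k B : Type u} [Field k] [Ring B] [Algebra k B] [PDGAlgebra p k B]

/-- The right submodule on a stable subspace. -/
abbrev RMod.sub (X : RMod p k B) (N : Submodule k X) (hd : ∀ x ∈ N, X.d x ∈ N)
    (hr : ∀ b, ∀ x ∈ N, X.ract b x ∈ N) : RMod p k B where
  carrier := N
  ract := AlgHom.ofLinearMap
    { toFun := fun b => (X.ract b).restrict (hr b)
      map_add' := fun a b => by ext m; simp
      map_smul' := fun c a => by ext m; simp }
    (by ext m; simp) (fun a b => by ext m; simp)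
  d := X.d.restrict hd
  d_ract b m := Subtype.ext (X.d_ract b m)
  d_pow := restrict_pow_eq_zero X.d_pow hd

/-- The inclusion of a submodule. -/
def RMod.subIncl (X : RMod p k B) (N : Submodule k X) (hd : ∀ x ∈ N, X.d x ∈ N)
    (hr : ∀ b, ∀ x ∈ N, X.ract b x ∈ N) : RLin (X.sub N hd hr) X :=
  ⟨N.subtype, fun _ _ => rfl⟩

/-- The inclusion between submodules. -/
def RMod.inclusion (X : RMod p k B) {N N' : Submodule k X} (hd : ∀ x ∈ N, X.d x ∈ N)
    (hr : ∀ b, ∀ x ∈ N, X.ract b x ∈ N) (hd' : ∀ x ∈ N', X.d x ∈ N')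
    (hr' : ∀ b, ∀ x ∈ N', X.ract b x ∈ N') (h : N ≤ N') :
    RLin (X.sub N hd hr) (X.sub N' hd' hr') :=
  ⟨Submodule.inclusion h, fun _ _ => rfl⟩

/-- A union of good submodules with injective transition maps is good. -/
theorem Good.of_filtration {X : RMod p k B} (N : ℕ → Submodule k X)
    (hd : ∀ i, ∀ x ∈ N i, X.d x ∈ N i) (hr : ∀ i b, ∀ x ∈ N i, X.ract b x ∈ N i)
    (hmono : ∀ i, N i ≤ N (i + 1)) (hex : ∀ x, ∃ i, x ∈ N i)
    (hgood : ∀ i, Good (X.sub (N i) (hd i) (hr i)))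
    (hinj : ∀ i (Y : LMod p k B), Function.Injective
      (rmap (X.inclusion (hd i) (hr i) (hd (i + 1)) (hr (i + 1)) (hmono i)) (LLin.id Y))) :
    Good X := by
  have mono : Monotone N := monotone_nat_of_le_succ hmono
  let S : ℕ → RMod p k B := fun i => X.sub (N i) (hd i) (hr i)
  let inc : ∀ i j, i ≤ j → RLin (S i) (S j) := fun i j h =>
    X.inclusion (hd i) (hr i) (hd j) (hr j) (mono h)
  let ι : ∀ i, RLin (S i) X := fun i => X.subIncl (N i) (hd i) (hr i)
  have hιi : ∀ i, Function.Injective (ι i).lin := fun i => (N i).subtype_injective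
  have hinc : ∀ (Y : LMod p k B) i j (h : i ≤ j), Function.Injective
      (rmap (inc i j h) (LLin.id Y)) := by
    intro Y i j h
    induction j, h using Nat.le_induction with
    | base =>
      intro a b hab
      rwa [rmap_eq_self _ _ (fun _ => rfl) (fun _ => rfl),
        rmap_eq_self _ _ (fun _ => rfl) (fun _ => rfl)] at hab
    | succ j h ih =>
      intro a b hab
      apply ih
      apply hinj j Y
      rw [rmap_rmap _ _ _ _ (inc i (j + 1) (h.trans j.le_succ)) (LLin.id Y) (fun _ => rfl)
        (fun _ => rfl), rmap_rmap _ _ _ _ (inc i (j + 1) (h.trans j.le_succ)) (LLin.id Y)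
        (fun _ => rfl) (fun _ => rfl)]
      exact hab
  -- A balancing relation involves finitely many elements of `X`, so it already holds at some finite
  -- stage. Since inclusions of vector spaces stay injective after tensoring over `k`, a tensor
  -- vanishing over `X` vanishes at that stage.
  have hrel : ∀ (Y : LMod p k B) (i : ℕ) (t : X ⊗[k] Y), t ∈ rbal X Y →
      ∃ j, i ≤ j ∧ ∃ s ∈ rbal (S j) Y, LinearMap.rTensor Y (ι j).lin s = t := by
    intro Y i t ht
    have up : ∀ j j' (h : j ≤ j') (s : S j ⊗[k] Y), s ∈ rbal (S j) Y →
        LinearMap.rTensor Y (inc j j' h).lin s ∈ rbal (S j') Y := by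
      intro j j' h s hs
      have : rbal (S j) Y ≤ (rbal (S j') Y).comap
          (LinearMap.rTensor Y (inc j j' h).lin) := by
        refine Submodule.span_le.2 ?_
        rintro _ ⟨x, b, y, rfl⟩
        exact Submodule.subset_span ⟨(inc j j' h).lin x, b, y, map_sub _ _ _⟩
      exact this hs
    have hup : ∀ j j' (h : j ≤ j') (s : S j ⊗[k] Y),
        LinearMap.rTensor Y (ι j').lin (LinearMap.rTensor Y (inc j j' h).lin s)
          = LinearMap.rTensor Y (ι j).lin s := by
      intro j j' h s
      rw [← LinearMap.comp_apply, ← LinearMap.rTensor_comp]; rfl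
    change t ∈ Submodule.span k _ at ht
    induction ht using Submodule.span_induction with
    | mem t ht =>
      obtain ⟨x, b, y, rfl⟩ := ht
      obtain ⟨j, hj⟩ := hex x
      refine ⟨max i j, le_max_left _ _, (S (max i j)).ract (op b) ⟨x, mono (le_max_right i j) hj⟩
        ⊗ₜ y - (⟨x, mono (le_max_right i j) hj⟩ : S (max i j)) ⊗ₜ Y.lact b y, ?_, ?_⟩
      · exact Submodule.subset_span ⟨_, b, y, rfl⟩
      · exact map_sub _ _ _
    | zero => exact ⟨i, le_rfl, 0, Submodule.zero_mem _, map_zero _⟩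
    | add a b _ _ ha hb =>
      obtain ⟨j, hij, s, hs, rfl⟩ := ha
      obtain ⟨j', hij', s', hs', rfl⟩ := hb
      exact ⟨max j j', hij.trans (le_max_left _ _), _,
        add_mem (up j _ (le_max_left _ _) s hs) (up j' _ (le_max_right _ _) s' hs'), by
          rw [map_add, hup _ _ (le_max_left _ _), hup _ _ (le_max_right _ _)]⟩
    | smul c a _ ha =>
      obtain ⟨j, hij, s, hs, rfl⟩ := ha
      exact ⟨j, hij, c • s, Submodule.smul_mem _ c hs, map_smul _ _ _⟩
  have hι : ∀ (Y : LMod p k B) i, Function.Injective (rmap (ι i) (LLin.id Y)) := by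
    intro Y i
    rw [← LinearMap.ker_eq_bot, LinearMap.ker_eq_bot']
    intro t ht
    obtain ⟨t, rfl⟩ := Submodule.mkQ_surjective _ t
    have h1 : LinearMap.rTensor Y (ι i).lin t ∈ rbal X Y :=
      (Submodule.Quotient.mk_eq_zero _).1 ht
    obtain ⟨j, hij, s, hs, hst⟩ := hrel Y i _ h1
    have h2 : LinearMap.rTensor Y (inc i j hij).lin t = s := by
      apply Module.Flat.rTensor_preserves_injective_linearMap (ι j).lin
        (hιi j)
      rw [hst, ← LinearMap.comp_apply, ← LinearMap.rTensor_comp]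
      rfl
    apply hinc Y i j hij
    rw [map_zero]
    refine (Submodule.Quotient.mk_eq_zero _).2 ?_
    rw [← h2] at hs
    exact hs
  have hcov : ∀ (Y : LMod p k B) (t : rtens X Y), ∃ i s, rmap (ι i) (LLin.id Y) s = t := by
    intro Y t
    induction t using rtens_induction with
    | zero => exact ⟨0, 0, map_zero _⟩
    | tmul x y =>
      obtain ⟨i, hi⟩ := hex x
      exact ⟨i, rtmul (S i) Y ⟨x, hi⟩ y, rfl⟩
    | add a b ha hb =>
      obtain ⟨i, s, rfl⟩ := ha
      obtain ⟨j, s', rfl⟩ := hb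
      refine ⟨max i j, rmap (inc i _ (le_max_left _ _)) (LLin.id Y) s
        + rmap (inc j _ (le_max_right _ _)) (LLin.id Y) s', ?_⟩
      rw [map_add, rmap_rmap _ _ _ _ (ι i) (LLin.id Y) (fun _ => rfl) (fun _ => rfl),
        rmap_rmap _ _ _ _ (ι j) (LLin.id Y) (fun _ => rfl) (fun _ => rfl)]
  have comm : ∀ {Y Y' : LMod p k B} (f : LLin Y Y') (i : ℕ) (t : rtens (S i) Y),
      rmap (RLin.id X) f (rmap (ι i) (LLin.id Y) t)
        = rmap (ι i) (LLin.id Y') (rmap (RLin.id (S i)) f t) := by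
    intro Y Y' f i t
    rw [rmap_rmap _ _ _ _ (ι i) f (fun _ => rfl) (fun _ => rfl),
      rmap_rmap _ _ _ _ (ι i) f (fun _ => rfl) (fun _ => rfl)]
  have hιc : ∀ i, (ι i).IsChain := fun i _ => rfl
  constructor
  · intro Y Y' f hf
    rw [← LinearMap.ker_eq_bot, LinearMap.ker_eq_bot']
    intro t ht
    obtain ⟨i, s, rfl⟩ := hcov Y t
    rw [comm] at ht
    have h1 := hι Y' i (ht.trans (map_zero _).symm)
    rw [(hgood i).inj f hf (h1.trans (map_zero _).symm), map_zero]
  · intro Y Y' f hf hsurj hker u hu hdu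
    obtain ⟨i, s, rfl⟩ := hcov Y u
    rw [LinearMap.mem_ker, comm] at hu
    rw [← rmap_d (hιc i) (LLin.id_isChain Y)] at hdu
    obtain ⟨v, hv, hvs⟩ := (hgood i).acy f hf hsurj hker s (hι Y' i (hu.trans (map_zero _).symm))
      (hι Y i (hdu.trans (map_zero _).symm))
    refine ⟨rmap (ι i) (LLin.id Y) v, ?_, ?_⟩
    · rw [LinearMap.mem_ker, comm, LinearMap.mem_ker.1 hv, map_zero]
    · rw [← map_pow_apply (rmap_d (hιc i) (LLin.id_isChain Y)), hvs]

/-- A right module freely generated by a complex. -/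
theorem Good.of_free [hp : Fact p.Prime] [CharP k p] {X : RMod p k B} {H : Type u}
    [AddCommGroup H] [Module k H] (dH : Module.End k H) (e : H →ₗ[k] X)
    (he : ∀ h, e (dH h) = X.d (e h)) (Φ : X →ₗ[k] H ⊗[k] B)
    (hΦ : ∀ h b, Φ (X.ract (op b) (e h)) = h ⊗ₜ b)
    (hspan : ∀ x, x ∈ Submodule.span k {x : X | ∃ h b, x = X.ract (op b) (e h)}) : Good X := by
  -- The aim is the identification of `X ⊗_B Y` with `H ⊗_k Y` as complexes, by `h b ⊗ y ↦ h ⊗ b y`,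
  -- with inverse `h ⊗ y ↦ e h ⊗ y`.
  let act : ∀ Y : LMod p k B, H ⊗[k] B ⊗[k] Y →ₗ[k] H ⊗[k] Y := fun Y =>
    LinearMap.lTensor H (TensorProduct.lift Y.lact.toLinearMap) ∘ₗ
      (TensorProduct.assoc k H B Y).toLinearMap
  have hact : ∀ Y h b y, act Y ((h ⊗ₜ b) ⊗ₜ y) = h ⊗ₜ Y.lact b y := fun Y h b y => rfl
  have hα : ∀ (Y : LMod p k B) (x : X) (b : B) (y : Y),
      (act Y ∘ₗ LinearMap.rTensor Y Φ) (X.ract (op b) x ⊗ₜ y)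
        = (act Y ∘ₗ LinearMap.rTensor Y Φ) (x ⊗ₜ Y.lact b y) := by
    intro Y x b y
    have hx := hspan x
    induction hx using Submodule.span_induction with
    | mem x hx =>
      obtain ⟨h, c, rfl⟩ := hx
      have : X.ract (op b) (X.ract (op c) (e h)) = X.ract (op (c * b)) (e h) := by
        rw [op_mul, map_mul]; rfl
      rw [this]
      simp only [LinearMap.comp_apply, LinearMap.rTensor_tmul, hΦ, hact, map_mul,
        Module.End.mul_apply]
    | zero => simp
    | add s t _ _ hs ht =>
      rw [map_add, TensorProduct.add_tmul, map_add, hs, ht, TensorProduct.add_tmul, map_add]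
    | smul c s _ hs =>
      rw [map_smul, ← TensorProduct.smul_tmul', map_smul, hs, ← TensorProduct.smul_tmul', map_smul]
  let α : ∀ Y : LMod p k B, rtens X Y →ₗ[k] H ⊗[k] Y := fun Y =>
    rlift (act Y ∘ₗ LinearMap.rTensor Y Φ) (hα Y)
  have hαe : ∀ Y h b y, α Y (rtmul X Y (X.ract (op b) (e h)) y) = h ⊗ₜ Y.lact b y := by
    intro Y h b y
    change act Y (Φ (X.ract (op b) (e h)) ⊗ₜ y) = _
    rw [hΦ, hact]
  let β : ∀ Y : LMod p k B, H ⊗[k] Y →ₗ[k] rtens X Y := fun Y =>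
    (rbal X Y).mkQ ∘ₗ LinearMap.rTensor Y e
  have hβ : ∀ Y h y, β Y (h ⊗ₜ y) = rtmul X Y (e h) y := fun Y h y => rfl
  have ind : ∀ {Y : LMod p k B} {W : Type u} [AddCommGroup W] [Module k W]
      {f g : rtens X Y →ₗ[k] W}, (∀ h b y, f (rtmul X Y (X.ract (op b) (e h)) y)
        = g (rtmul X Y (X.ract (op b) (e h)) y)) → f = g := by
    intro Y W _ _ f g hfg
    refine rtens_ext fun x y => ?_
    have hx := hspan x
    have hle : Submodule.span k {x : X | ∃ h b, x = X.ract (op b) (e h)} ≤ LinearMap.eqLocus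
        (f ∘ₗ (rbal X Y).mkQ ∘ₗ (TensorProduct.mk k X Y).flip y)
        (g ∘ₗ (rbal X Y).mkQ ∘ₗ (TensorProduct.mk k X Y).flip y) := by
      refine Submodule.span_le.2 ?_
      rintro _ ⟨h, b, rfl⟩
      exact hfg h b y
    exact hle hx
  have hβα : ∀ Y t, β Y (α Y t) = t := by
    intro Y
    refine LinearMap.congr_fun (f := β Y ∘ₗ α Y) (g := LinearMap.id) (ind fun h b y => ?_)
    rw [LinearMap.comp_apply, hαe, hβ, ← rtmul_balanced]; rfl
  have hαβ : ∀ Y t, α Y (β Y t) = t := by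
    intro Y
    refine LinearMap.congr_fun (f := α Y ∘ₗ β Y) (g := LinearMap.id) (TensorProduct.ext' ?_)
    intro h y
    rw [LinearMap.comp_apply, hβ]
    have : e h = X.ract (op 1) (e h) := by rw [op_one, map_one]; rfl
    rw [this, hαe, map_one]; rfl
  have nat : ∀ {Y Y' : LMod p k B} (f : LLin Y Y') t,
      LinearMap.lTensor H f.lin (α Y t) = α Y' (rmap (RLin.id X) f t) := by
    intro Y Y' f
    refine LinearMap.congr_fun (f := LinearMap.lTensor H f.lin ∘ₗ α Y)
      (g := α Y' ∘ₗ rmap (RLin.id X) f) (ind fun h b y => ?_)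
    rw [LinearMap.comp_apply, LinearMap.comp_apply, hαe, rmap_tmul]
    exact (congrArg (h ⊗ₜ[k] ·) (f.map_lact b y)).trans (hαe Y' h b (f.lin y)).symm
  have nat' : ∀ {Y Y' : LMod p k B} (f : LLin Y Y') t,
      rmap (RLin.id X) f (β Y t) = β Y' (LinearMap.lTensor H f.lin t) := by
    intro Y Y' f t
    conv_rhs => rw [← hαβ Y t, nat, hβα]
  have hβd : ∀ (Y : LMod p k B) t,
      β Y ((LinearMap.rTensor Y dH + LinearMap.lTensor H Y.d) t) = rtD X Y (β Y t) := by
    intro Y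
    refine LinearMap.congr_fun (f := β Y ∘ₗ (LinearMap.rTensor Y dH + LinearMap.lTensor H Y.d))
      (g := rtD X Y ∘ₗ β Y) (TensorProduct.ext' ?_)
    intro h y
    simp only [LinearMap.comp_apply, LinearMap.add_apply, LinearMap.rTensor_tmul,
      LinearMap.lTensor_tmul, map_add, hβ, rtD_tmul, he]
  constructor
  · intro Y Y' f hf
    rw [← LinearMap.ker_eq_bot, LinearMap.ker_eq_bot']
    intro t ht
    have h1 := nat f t
    rw [ht, map_zero] at h1
    have h2 := Module.Flat.lTensor_preserves_injective_linearMap (M := H) f.lin hf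
      (h1.trans (map_zero _).symm)
    rw [← hβα Y t, h2, map_zero]
  · intro Y Y' f hf hsurj hker u hu hdu
    have hst : ∀ y ∈ LinearMap.ker f.lin, Y.d y ∈ LinearMap.ker f.lin := fun y hy => by
      rw [LinearMap.mem_ker] at *; rw [hf, hy, map_zero]
    set K := LinearMap.ker f.lin with hK
    set dK : Module.End k K := Y.d.restrict hst with hdK
    -- Whatever `dH` is, `1 ⊗ s` commutes with `dH ⊗ 1`, so a partner of `d` on the kernel gives a
    -- partner of the total differential on `H ⊗ K`.
    obtain ⟨s, hs⟩ := exists_commutator (restrict_pow_eq_zero Y.d_pow hst)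
      ((acyclicOn_iff_restrict hst).1 hker)
    let D : Module.End k (H ⊗[k] K) := LinearMap.rTensor K dH + LinearMap.lTensor H dK
    have hacy : AcyclicOn p D ⊤ := by
      refine AcyclicOn.of_commutator (s := LinearMap.lTensor H s) (fun _ _ => trivial) ?_
      intro t _
      refine LinearMap.congr_fun (f := D ∘ₗ LinearMap.lTensor H s - LinearMap.lTensor H s ∘ₗ D)
        (g := LinearMap.id) (TensorProduct.ext' fun h y => ?_) t
      simp only [D, LinearMap.sub_apply, LinearMap.comp_apply, LinearMap.add_apply,
        LinearMap.rTensor_tmul, LinearMap.lTensor_tmul, map_add, LinearMap.id_apply]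
      have := hs y
      rw [← this, TensorProduct.tmul_sub]
      simp only [this]
      abel
    have hDι : ∀ t, LinearMap.lTensor H K.subtype (D t)
        = (LinearMap.rTensor Y dH + LinearMap.lTensor H Y.d) (LinearMap.lTensor H K.subtype t) :=
      LinearMap.congr_fun (f := LinearMap.lTensor H K.subtype ∘ₗ D)
        (g := (LinearMap.rTensor Y dH + LinearMap.lTensor H Y.d) ∘ₗ LinearMap.lTensor H K.subtype)
        (TensorProduct.ext' fun h y => by simp [D, hdK])
    have hex : Function.Exact (LinearMap.lTensor H K.subtype) (LinearMap.lTensor H f.lin) :=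
      lTensor_exact H (fun y => by simp [hK, LinearMap.mem_ker]) hsurj
    obtain ⟨w, hw⟩ := (hex (α Y u)).1 (by rw [nat, LinearMap.mem_ker.1 hu, map_zero])
    have hinj := Module.Flat.lTensor_preserves_injective_linearMap (M := H) K.subtype
      K.subtype_injective
    have hβw : β Y (LinearMap.lTensor H K.subtype w) = u := by rw [hw, hβα]
    have hβinj : Function.Injective (β Y) := fun a b h => by
      rw [← hαβ Y a, ← hαβ Y b, h]
    obtain ⟨v, -, hv⟩ := hacy w trivial (by
      apply hinj
      apply hβinj
      rw [hDι, hβd, hβw, hdu, map_zero, map_zero])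
    refine ⟨β Y (LinearMap.lTensor H K.subtype v), ?_, ?_⟩
    · rw [LinearMap.mem_ker, nat', (hex _).2 ⟨v, rfl⟩, map_zero]
    · rw [← map_pow_apply (hβd Y), ← map_pow_apply hDι, hv, hβw]

/-- A linear lift of the generators extends by the right action. No compatibility with `d` is
claimed, so liftings split filtrations of modules but not of complexes. -/
theorem LiftProp.of_free {X : RMod p k B} {H : Type u}
    [AddCommGroup H] [Module k H] (e : H →ₗ[k] X) (Φ : X →ₗ[k] H ⊗[k] B)
    (hΦ : ∀ h b, Φ (X.ract (op b) (e h)) = h ⊗ₜ b)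
    (hspan : ∀ x, x ∈ Submodule.span k {x : X | ∃ h b, x = X.ract (op b) (e h)}) : LiftProp X := by
  intro Z Z' g φ hg
  obtain ⟨t, ht⟩ := g.lin.exists_rightInverse_of_surjective (LinearMap.range_eq_top.2 hg)
  have ht' : ∀ z, g.lin (t z) = z := fun z => LinearMap.congr_fun ht z
  let act : H ⊗[k] B →ₗ[k] Z := TensorProduct.lift
    ((Z.ract.toLinearMap ∘ₗ (opLinearEquiv k).toLinearMap).flip ∘ₗ (t ∘ₗ φ.lin ∘ₗ e))
  have hact : ∀ h b, act (h ⊗ₜ b) = Z.ract (op b) (t (φ.lin (e h))) := fun h b => rfl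
  have key : ∀ h b, (act ∘ₗ Φ) (X.ract (op b) (e h)) = Z.ract (op b) (t (φ.lin (e h))) := by
    intro h b
    rw [LinearMap.comp_apply, hΦ, hact]
  refine ⟨⟨act ∘ₗ Φ, ?_⟩, ?_⟩
  · intro b x
    have hx := hspan x
    induction hx using Submodule.span_induction with
    | mem x hx =>
      obtain ⟨h, c, rfl⟩ := hx
      have : X.ract b (X.ract (op c) (e h)) = X.ract (op (c * b.unop)) (e h) := by
        rw [op_mul, map_mul]; rfl
      rw [this, key, key, op_mul, map_mul]; rfl
    | zero => simp
    | add s t _ _ hs ht => simp only [map_add, hs, ht]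
    | smul c s _ hs => simp only [map_smul, hs]
  · intro x
    have hx := hspan x
    induction hx using Submodule.span_induction with
    | mem x hx =>
      obtain ⟨h, b, rfl⟩ := hx
      change g.lin ((act ∘ₗ Φ) _) = _
      rw [key, g.map_ract, ht', φ.map_ract]
    | zero => simp
    | add s t _ _ hs ht => simp only [map_add, hs, ht]
    | smul c s _ hs => simp only [map_smul, hs]

theorem LiftProp.of_retract {X T : RMod p k B} (i : RLin X T) (r : RLin T X)
    (h : ∀ x, r.lin (i.lin x) = x) (hT : LiftProp T) : LiftProp X := by
  intro Z Z' g φ hg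
  obtain ⟨ψ, hψ⟩ := hT g (φ.comp r) hg
  refine ⟨ψ.comp i, fun x => ?_⟩
  change g.lin (ψ.lin (i.lin x)) = _
  rw [hψ]
  change φ.lin (r.lin (i.lin x)) = _
  rw [h]

open Classical in
theorem LiftProp.of_directSum {X : RMod p k B} {J : Type u} (T : J → RMod p k B)
    (inc : ∀ j, RLin (T j) X)
    (hb : Function.Bijective (DirectSum.toModule k J X (fun j => (inc j).lin)))
    (hT : ∀ j, LiftProp (T j)) : LiftProp X := by
  intro Z Z' g φ hg
  have h1 : ∀ j, ∃ ψ : RLin (T j) Z, ∀ x, g.lin (ψ.lin x) = (φ.comp (inc j)).lin x :=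
    fun j => hT j g _ hg
  choose ψ hψ using h1
  let E := LinearEquiv.ofBijective _ hb
  have hE : ∀ j t, E (DirectSum.lof k J (fun j => T j) j t) = (inc j).lin t := fun j t =>
    DirectSum.toModule_lof k (M := fun j => (T j : Type u)) (φ := fun j => (inc j).lin) j t
  let Ψ : X →ₗ[k] Z := DirectSum.toModule k J Z (fun j => (ψ j).lin) ∘ₗ E.symm.toLinearMap
  have hΨ : ∀ j t, Ψ ((inc j).lin t) = (ψ j).lin t := by
    intro j t
    rw [← hE]
    change DirectSum.toModule k J Z (fun j => (ψ j).lin) (E.symm (E _)) = _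
    rw [E.symm_apply_apply]
    exact DirectSum.toModule_lof k (M := fun j => (T j : Type u)) (φ := fun j => (ψ j).lin) j t
  have ind : ∀ {W : Type u} [AddCommGroup W] [Module k W] {f f' : X →ₗ[k] W},
      (∀ j t, f ((inc j).lin t) = f' ((inc j).lin t)) → f = f' := by
    intro W _ _ f f' h
    have : f ∘ₗ E.toLinearMap = f' ∘ₗ E.toLinearMap := by
      refine DirectSum.linearMap_ext k fun j => LinearMap.ext fun t => ?_
      change f (E _) = f' (E _)
      rw [hE, h]
    refine LinearMap.ext fun x => ?_
    have h2 := LinearMap.congr_fun this (E.symm x)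
    change f (E (E.symm x)) = f' (E (E.symm x)) at h2
    rwa [E.apply_symm_apply] at h2
  refine ⟨⟨Ψ, fun b => LinearMap.congr_fun (f := Ψ ∘ₗ X.ract b) (g := Z.ract b ∘ₗ Ψ)
    (ind fun j t => ?_)⟩, LinearMap.congr_fun (f := g.lin ∘ₗ Ψ) (g := φ.lin) (ind fun j t => ?_)⟩
  · change Ψ (X.ract b ((inc j).lin t)) = Z.ract b (Ψ ((inc j).lin t))
    rw [← (inc j).map_ract, hΨ, hΨ, (ψ j).map_ract]
  · change g.lin (Ψ ((inc j).lin t)) = _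
    rw [hΨ, hψ]; rfl

open Classical in
theorem Good.of_directSum {X : RMod p k B} {J : Type u} (T : J → RMod p k B)
    (inc : ∀ j, RLin (T j) X) (hinc : ∀ j, (inc j).IsChain)
    (hb : Function.Bijective (DirectSum.toModule k J X (fun j => (inc j).lin)))
    (hT : ∀ j, Good (T j)) : Good X := by
  let E := LinearEquiv.ofBijective _ hb
  have hE : ∀ j t, E (DirectSum.lof k J (fun j => T j) j t) = (inc j).lin t := fun j t =>
    DirectSum.toModule_lof k (M := fun j => (T j : Type u)) (φ := fun j => (inc j).lin) j t
  let P : ∀ j, X →ₗ[k] T j := fun j => DirectSum.component k J (fun j => T j) j ∘ₗ E.symm.toLinearMap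
  have hP : ∀ i j t, P i ((inc j).lin t)
      = DirectSum.component k J (fun j => T j) i (DirectSum.lof k J (fun j => T j) j t) := by
    intro i j t
    rw [← hE]
    change DirectSum.component k J (fun j => T j) i (E.symm (E _)) = _
    rw [E.symm_apply_apply]
  have hPs : ∀ j t, P j ((inc j).lin t) = t := by
    intro j t; rw [hP, DirectSum.component.lof_self]
  have hPn : ∀ i j t, i ≠ j → P i ((inc j).lin t) = 0 := by
    intro i j t h; rw [hP, DirectSum.component.of, dif_neg h.symm]
  have ind : ∀ {W : Type u} [AddCommGroup W] [Module k W] {f f' : X →ₗ[k] W},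
      (∀ j t, f ((inc j).lin t) = f' ((inc j).lin t)) → f = f' := by
    intro W _ _ f f' h
    have : f ∘ₗ E.toLinearMap = f' ∘ₗ E.toLinearMap := by
      refine DirectSum.linearMap_ext k fun j => LinearMap.ext fun t => ?_
      change f (E _) = f' (E _)
      rw [hE, h]
    refine LinearMap.ext fun x => ?_
    have h2 := LinearMap.congr_fun this (E.symm x)
    change f (E (E.symm x)) = f' (E (E.symm x)) at h2
    rwa [E.apply_symm_apply] at h2
  have comm : ∀ (F : Module.End k X) (f : ∀ j, Module.End k (T j)),
      (∀ j t, F ((inc j).lin t) = (inc j).lin (f j t)) → ∀ i x, P i (F x) = f i (P i x) := by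
    intro F f h i
    refine LinearMap.congr_fun (f := P i ∘ₗ F) (g := f i ∘ₗ P i) (ind fun j t => ?_)
    change P i (F _) = f i (P i _)
    rw [h]
    by_cases hij : i = j
    · subst hij; rw [hPs, hPs]
    · rw [hPn _ _ _ hij, hPn _ _ _ hij, map_zero]
  refine Good.of_partition T inc (fun j => ⟨P j, fun b x => comm (X.ract b)
    (fun j => (T j).ract b) (fun j t => ((inc j).map_ract b t).symm) j x⟩) hinc
    (fun j x => comm X.d (fun j => (T j).d) (fun j t => (hinc j t).symm) j x) ?_ hT
  intro x
  obtain ⟨z, rfl⟩ := E.surjective x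
  induction z using DirectSum.induction_on with
  | zero => exact ⟨∅, fun s _ => by simp⟩
  | of j t =>
    refine ⟨{j}, fun s hs => ?_⟩
    have h1 : E (DirectSum.of (fun j => (T j : Type u)) j t) = (inc j).lin t := hE j t
    rw [h1, Finset.sum_eq_single j]
    · change (inc j).lin (P j _) = _
      rw [hPs]
    · intro i _ hi
      change (inc i).lin (P i _) = _
      rw [hPn _ _ _ hi, map_zero]
    · intro hn; exact absurd (hs (Finset.mem_singleton_self j)) hn
  | add a b ha hb =>
    obtain ⟨s, hs⟩ := ha
    obtain ⟨s', hs'⟩ := hb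
    refine ⟨s ∪ s', fun s'' h => ?_⟩
    simp only [map_add, Finset.sum_add_distrib]
    rw [hs _ (Finset.subset_union_left.trans h), hs' _ (Finset.subset_union_right.trans h)]

end RawModules
end PDG

namespace PDG

/-! ### Property (P) gives flatness on the right -/

namespace PDGBimod
variable {p : ℕ} {k A B C : Type u} [Field k] [Ring A] [Algebra k A] [PDGAlgebra p k A]
  [Ring B] [Algebra k B] [PDGAlgebra p k B] [Ring C] [Algebra k C] [PDGAlgebra p k C]

/-- The underlying ungraded right module. -/
abbrev toR (X : PDGBimod p k A B) : RMod p k B where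
  carrier := X.carrier
  ract := X.ract
  d := X.d
  d_ract := X.d_ract
  d_pow := X.d_pow

/-- The underlying ungraded left module. -/
abbrev toL (X : PDGBimod p k A B) : LMod p k A where
  carrier := X.carrier
  lact := X.lact
  d := X.d
  d_lact := X.d_lact
  d_pow := X.d_pow

/-- The underlying map of right modules. -/
abbrev homR {X Y : PDGBimod p k A B} (f : X ⟶ Y) : RLin X.toR Y.toR := ⟨f.lin, f.map_ract⟩

theorem homR_isChain {X Y : PDGBimod p k A B} (f : X ⟶ Y) : (homR f).IsChain := f.map_d

theorem d_one : PDGAlgebra.d (p := p) (k := k) (1 : B) = 0 := by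
  have := PDGAlgebra.d_mul (p := p) (k := k) (1 : B) 1
  rw [mul_one, mul_one, one_mul] at this
  exact left_eq_add.1 this

section Base
variable [hp : Fact p.Prime]

theorem ract_base (X : PDGBimod p k A k) (c : k) (x : X) : X.ract (op c) x = c • x := by
  have : X.ract (op c) = X.ract (algebraMap k kᵐᵒᵖ c) := rfl
  rw [this, AlgHom.commutes]; rfl

theorem lact_base (X : PDGBimod p k k B) (c : k) (x : X) : X.lact c x = c • x := by
  have : X.lact c = X.lact (algebraMap k k c) := rfl
  rw [this, AlgHom.commutes]; rfl

theorem balanced_base (X : PDGBimod p k A k) (Y : PDGBimod p k k C) : balanced X Y = ⊥ := by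
  refine Submodule.span_eq_bot.2 ?_
  rintro _ ⟨x, b, y, rfl⟩
  rw [ract_base, lact_base, TensorProduct.smul_tmul, sub_self]

/-- A tensor product over `k` is the usual tensor product of vector spaces. -/
def tensorBase (X : PDGBimod p k A k) (Y : PDGBimod p k k C) :
    tensorCarrier X Y ≃ₗ[k] X ⊗[k] Y :=
  Submodule.quotEquivOfEqBot _ (balanced_base X Y)

variable [CharP k p]

/-- The generating subspace of an induced right module. -/
theorem tensor_span (X : PDGBimod p k A k) :
    ∀ x : (X.tensor (regular p k B).rightPart).toR,
      x ∈ Submodule.span k {x : (X.tensor (regular p k B).rightPart).toR |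
        ∃ (h : X) (b : B), x = (X.tensor (regular p k B).rightPart).toR.ract (op b)
          (tmul X (regular p k B).rightPart h (show (regular p k B).rightPart from (1 : B)))} := by
  intro t
  obtain ⟨t, rfl⟩ := Submodule.mkQ_surjective _ t
  induction t using TensorProduct.induction_on with
  | zero => rw [map_zero]; exact Submodule.zero_mem _
  | tmul x b =>
    refine Submodule.subset_span ⟨x, b, ?_⟩
    exact (congrArg (tmul X (regular p k B).rightPart x) (one_mul (M := B) b)).symm
  | add s t hs ht => rw [map_add]; exact Submodule.add_mem _ hs ht

/-- The inclusion `x ↦ x ⊗ 1` into an induced right module. -/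
def tensorUnit (X : PDGBimod p k A k) : X →ₗ[k] (X.tensor (regular p k B).rightPart).toR :=
  (balanced X (regular p k B).rightPart).mkQ ∘ₗ
    (TensorProduct.mk k X (regular p k B).rightPart).flip (1 : B)

theorem tensorUnit_d (X : PDGBimod p k A k) (x : X) :
    tensorUnit (B := B) X (X.d x) = (X.tensor (regular p k B).rightPart).toR.d (tensorUnit X x) := by
  change tmul X (regular p k B).rightPart (X.d x) (1 : B)
    = tmul X (regular p k B).rightPart (X.d x) (1 : B)
      + tmul X (regular p k B).rightPart x (PDGAlgebra.d (p := p) (k := k) (A := B) 1)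
  rw [d_one]
  have : tmul X (regular p k B).rightPart x 0 = 0 := by simp [tmul]
  exact (add_eq_left.2 this).symm

theorem good_induced (X : PDGBimod p k A k) : Good (X.tensor (regular p k B).rightPart).toR :=
  Good.of_free X.d (tensorUnit X) (tensorUnit_d X)
    (tensorBase X (regular p k B).rightPart).toLinearMap
    (fun h b => congrArg (h ⊗ₜ[k] ·) (one_mul (M := B) b)) (tensor_span X)

theorem liftProp_induced (X : PDGBimod p k A k) :
    LiftProp (X.tensor (regular p k B).rightPart).toR :=
  LiftProp.of_free (tensorUnit X) (tensorBase X (regular p k B).rightPart).toLinearMap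
    (fun h b => congrArg (h ⊗ₜ[k] ·) (one_mul (M := B) b)) (tensor_span X)

/-- As a right module `A ⊗ B` is freely generated by the complex `A ⊗ 1`. Grading shifts are
invisible to the ungraded right module, and both properties pass to retracts and direct sums. -/
theorem good_of_isSumOfSummands {G : PDGBimod p k A B} (h : IsSumOfSummands G) :
    Good G.toR ∧ LiftProp G.toR := by
  obtain ⟨J, T, inc, hb, hT⟩ := h
  have h1 : ∀ j, Good (T j).toR ∧ LiftProp (T j).toR := by
    intro j
    obtain ⟨s, ⟨R⟩⟩ := hT j
    have hR : ∀ x, R.r.lin (R.i.lin x) = x := fun x =>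
      LinearMap.congr_fun (congrArg Hom.lin R.retract) x
    exact ⟨Good.of_retract (T := ((free p k A B).shift s).toR) (homR R.i) (homR R.r) (homR_isChain _)
      (homR_isChain _) hR
      (show Good (free p k A B).toR from good_induced _),
      LiftProp.of_retract (T := ((free p k A B).shift s).toR) (homR R.i) (homR R.r) hR
      (show LiftProp (free p k A B).toR from liftProp_induced _)⟩
  refine ⟨Good.of_directSum (fun j => (T j).toR) (fun j => homR (inc j))
    (fun j => homR_isChain _) hb (fun j => (h1 j).1),
    LiftProp.of_directSum (fun j => (T j).toR) (fun j => homR (inc j)) hb (fun j => (h1 j).2)⟩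

/-- The subquotients have the lifting property, so every step of the filtration splits as an
extension of right modules. That is all `Good.of_extension` needs, and the splittings also keep the
transition maps injective after tensoring, so the union is controlled by `Good.of_filtration`. -/
theorem PropertyP.good {X : PDGBimod p k A B} (h : PropertyP X) : Good X.toR := by
  obtain ⟨F, ι, G, q, hinj, hmono, hex, hq, h0, hker, hG⟩ := h
  let N : ℕ → Submodule k X.toR := fun i => LinearMap.range (ι i).lin
  have hd : ∀ i, ∀ x ∈ N i, X.toR.d x ∈ N i := by
    rintro i _ ⟨x, rfl⟩
    exact ⟨(F i).d x, (ι i).map_d x⟩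
  have hr : ∀ i b, ∀ x ∈ N i, X.toR.ract b x ∈ N i := by
    rintro i b _ ⟨x, rfl⟩
    exact ⟨(F i).ract b x, (ι i).map_ract b x⟩
  let S : ℕ → RMod p k B := fun i => X.toR.sub (N i) (hd i) (hr i)
  have hgoodG : ∀ i, Good (G i).toR := fun i => (good_of_isSumOfSummands (hG i)).1
  let e : ∀ i, (F i) ≃ₗ[k] S i := fun i => LinearEquiv.ofInjective (ι i).lin (hinj i)
  have he : ∀ i x, (e i x : S i).1 = (ι i).lin x := fun i x => rfl
  have hed : ∀ i x, e i ((F i).d x) = (S i).d (e i x) := fun i x => Subtype.ext ((ι i).map_d x)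
  have her : ∀ i b x, e i ((F i).ract b x) = (S i).ract b (e i x) := fun i b x =>
    Subtype.ext ((ι i).map_ract b x)
  let q' : ∀ i, RLin (S i) (G i).toR := fun i => ⟨(q i).lin ∘ₗ (e i).symm.toLinearMap, by
    intro b x
    obtain ⟨x, rfl⟩ := (e i).surjective x
    rw [← her]
    change (q i).lin ((e i).symm (e i _)) = (G i).ract b ((q i).lin ((e i).symm (e i _)))
    rw [(e i).symm_apply_apply, (e i).symm_apply_apply, (q i).map_ract]⟩
  have hq'e : ∀ i x, (q' i).lin (e i x) = (q i).lin x := by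
    intro i x
    change (q i).lin ((e i).symm (e i _)) = _
    rw [(e i).symm_apply_apply]
  have hq'c : ∀ i, (q' i).IsChain := by
    intro i x
    obtain ⟨x, rfl⟩ := (e i).surjective x
    rw [← hed, hq'e, hq'e, (q i).map_d]
  have hq's : ∀ i, Function.Surjective (q' i).lin := by
    intro i y
    obtain ⟨x, rfl⟩ := hq i y
    exact ⟨e i x, hq'e i x⟩
  have hsec : ∀ i, ∃ s : RLin (G i).toR (S i), ∀ y, (q' i).lin (s.lin y) = y := fun i =>
    (good_of_isSumOfSummands (hG i)).2 (q' i) (RLin.id _) (hq's i)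
  choose s hs using hsec
  have hker' : ∀ i (x : S (i + 1)), (q' (i + 1)).lin x = 0 ↔ x.1 ∈ N i := by
    intro i x
    obtain ⟨x, rfl⟩ := (e (i + 1)).surjective x
    rw [hq'e]; exact hker i x
  have hret : ∀ i, ∃ r : RLin (S (i + 1)) (S i), ∀ x,
      (r.lin x).1 + ((s (i + 1)).lin ((q' (i + 1)).lin x)).1 = x.1 := by
    intro i
    have hmem : ∀ x : S (i + 1), (x - (s (i + 1)).lin ((q' (i + 1)).lin x)).1 ∈ N i := by
      intro x
      rw [← hker', map_sub, hs, sub_self]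
    refine ⟨⟨LinearMap.codRestrict (N i) ((X.toR.subIncl (N (i + 1)) (hd _) (hr _)).lin ∘ₗ
      (LinearMap.id - (s (i + 1)).lin ∘ₗ (q' (i + 1)).lin)) hmem, ?_⟩, ?_⟩
    · intro b x
      apply Subtype.ext
      change ((S (i + 1)).ract b x - (s (i + 1)).lin ((q' (i + 1)).lin ((S (i + 1)).ract b x))).1
        = X.ract b (x - (s (i + 1)).lin ((q' (i + 1)).lin x)).1
      rw [(q' (i + 1)).map_ract, (s (i + 1)).map_ract]
      exact (map_sub (X.ract b) x.1 ((s (i + 1)).lin ((q' (i + 1)).lin x)).1).symm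
    · intro x
      exact sub_add_cancel x.1 ((s (i + 1)).lin ((q' (i + 1)).lin x)).1
  choose r hr' using hret
  let inc : ∀ i, RLin (S i) (S (i + 1)) := fun i =>
    X.toR.inclusion (hd i) (hr i) (hd (i + 1)) (hr (i + 1)) (hmono i)
  have hrinc : ∀ i x, (r i).lin ((inc i).lin x) = x := by
    intro i x
    apply Subtype.ext
    have h1 := hr' i ((inc i).lin x)
    have h2 : (q' (i + 1)).lin ((inc i).lin x) = 0 := (hker' i _).2 x.2
    rw [h2, map_zero] at h1
    exact (add_zero _).symm.trans h1
  refine Good.of_filtration N hd hr hmono hex ?_ ?_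
  · intro i
    induction i with
    | zero =>
      have hinj0 : Function.Injective (q' 0).lin := by
        rw [← LinearMap.ker_eq_bot, LinearMap.ker_eq_bot']
        intro x hx
        obtain ⟨x, rfl⟩ := (e 0).surjective x
        rw [hq'e] at hx
        rw [h0 x hx, map_zero]
      -- At the bottom stage the quotient map is bijective, so its section automatically commutes
      -- with `d`.
      refine Good.of_retract (q' 0) (s 0) (hq'c 0) (fun x => ?_) (fun x => ?_) (hgoodG 0)
      · apply hinj0
        rw [hs, hq'c, hs]
      · apply hinj0
        rw [hs]
    | succ i ih =>
      refine Good.of_extension (inc i) (q' (i + 1)) (fun _ => rfl) (hq'c _) (r i) (s (i + 1))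
        (fun x => Subtype.ext (hr' i x)) (hrinc i) (hs _) ih (hgoodG _)
  · intro i Y t t' h
    have := congrArg (rmap (r i) (LLin.id Y)) h
    rwa [rmap_rmap _ _ _ _ (RLin.id _) (LLin.id Y) (hrinc i) (fun _ => rfl),
      rmap_rmap _ _ _ _ (RLin.id _) (LLin.id Y) (hrinc i) (fun _ => rfl),
      rmap_eq_self _ _ (fun _ => rfl) (fun _ => rfl),
      rmap_eq_self _ _ (fun _ => rfl) (fun _ => rfl)] at this

end Base
end PDGBimod
end PDG

namespace PDG

/-! ### Homogeneous components of elements and operators -/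

section Graded
variable {k M N : Type u} [Field k] [AddCommGroup M] [Module k M] [AddCommGroup N] [Module k N]

/-- The projection to the component of degree `i`. -/
noncomputable def gproj {gr : ℤ → Submodule k M} (h : DirectSum.IsInternal gr) (i : ℤ) :
    Module.End k M := Finsupp.lapply i ∘ₗ coaction gr h

theorem gproj_of_mem {gr : ℤ → Submodule k M} (h : DirectSum.IsInternal gr) {i : ℤ} {m : M}
    (hm : m ∈ gr i) (j : ℤ) : gproj h j m = if i = j then m else 0 := by
  rw [gproj, LinearMap.comp_apply, coaction_of_mem gr h i m hm]
  simp [Finsupp.single_apply]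

theorem gproj_mem {gr : ℤ → Submodule k M} (h : DirectSum.IsInternal gr) (j : ℤ) (m : M) :
    gproj h j m ∈ gr j := by
  have : ⨆ i, gr i ≤ (gr j).comap (gproj h j) := by
    refine iSup_le fun i m hm => ?_
    rw [Submodule.mem_comap, gproj_of_mem h hm]
    split_ifs with hij
    · exact hij ▸ hm
    · exact zero_mem _
  exact this (by rw [iSup_eq_top_of_isInternal h]; trivial)

theorem map_gproj {gr : ℤ → Submodule k M} (h : DirectSum.IsInternal gr) {gr' : ℤ → Submodule k N}
    (h' : DirectSum.IsInternal gr') (F : M →ₗ[k] N) (e : ℤ)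
    (hF : ∀ i, ∀ m ∈ gr i, F m ∈ gr' (i + e)) (j : ℤ) (m : M) :
    F (gproj h j m) = gproj h' (j + e) (F m) := by
  refine LinearMap.congr_fun (f := F ∘ₗ gproj h j) (g := gproj h' (j + e) ∘ₗ F)
    (linearMap_ext_of_iSup (iSup_eq_top_of_isInternal h) fun i m hm => ?_) m
  rw [LinearMap.comp_apply, LinearMap.comp_apply, gproj_of_mem h hm, gproj_of_mem h' (hF i m hm)]
  by_cases hij : i = j
  · simp [hij]
  · simp [hij]

/-- An element all of whose components lie in a subspace lies in it. -/
theorem mem_of_gproj_mem {gr : ℤ → Submodule k M} (h : DirectSum.IsInternal gr)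
    (S : Submodule k M) {m : M} (hm : ∀ i, gproj h i m ∈ S) : m ∈ S := by
  have key : (coaction gr h m).sum (fun _ x => x) = m := by
    refine LinearMap.congr_fun (f := Finsupp.lsum k (fun _ : ℤ => LinearMap.id) ∘ₗ coaction gr h)
      (g := LinearMap.id)
      (linearMap_ext_of_iSup (iSup_eq_top_of_isInternal h) fun i m hm => ?_) m
    rw [LinearMap.comp_apply, coaction_of_mem gr h i m hm]
    simp
  rw [← key]
  exact Submodule.sum_mem _ fun i _ => hm i

/-- The part of degree `e` of a linear map. -/
noncomputable def degreePart {gr : ℤ → Submodule k M} (h : DirectSum.IsInternal gr) (e : ℤ)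
    (φ : Module.End k M) : Module.End k M :=
  Finsupp.lsum k (fun i : ℤ => gproj h (i + e) ∘ₗ φ) ∘ₗ coaction gr h

theorem degreePart_of_mem {gr : ℤ → Submodule k M} (h : DirectSum.IsInternal gr) (e : ℤ)
    (φ : Module.End k M) {i : ℤ} {m : M} (hm : m ∈ gr i) :
    degreePart h e φ m = gproj h (i + e) (φ m) := by
  rw [degreePart, LinearMap.comp_apply, coaction_of_mem gr h i m hm]
  simp

end Graded

/-! ### Quasi-isomorphisms, acyclic kernels, and cohomology on the derived category -/

namespace PDGBimod
variable {p : ℕ} {k A B C : Type u} [Field k] [Ring A] [Algebra k A] [PDGAlgebra p k A]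
  [Ring B] [Algebra k B] [PDGAlgebra p k B] [Ring C] [Algebra k C] [PDGAlgebra p k C]

theorem d_pow_mem (M : PDGBimod p k A B) (a : ℕ) {i : ℤ} {m : M} (hm : m ∈ M.gr i) :
    (M.d ^ a) m ∈ M.gr (i + 2 * a) := by
  induction a with
  | zero => simpa using hm
  | succ a ih =>
    rw [pow_succ', Module.End.mul_apply]
    convert M.d_mem ih using 2
    push_cast; ring

theorem gproj_d_pow (M : PDGBimod p k A B) (a : ℕ) (i : ℤ) (m : M) :
    (M.d ^ a) (gproj M.internal i m) = gproj M.internal (i + 2 * a) ((M.d ^ a) m) :=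
  map_gproj M.internal M.internal _ _ (fun _ _ hm => M.d_pow_mem a hm) i m

theorem Hom.map_gproj {M N : PDGBimod p k A B} (f : M ⟶ N) (i : ℤ) (m : M) :
    f.lin (gproj M.internal i m) = gproj N.internal i (f.lin m) := by
  have := PDG.map_gproj M.internal N.internal f.lin 0
    (fun i m hm => by rw [add_zero]; exact f.map_mem hm) i m
  rwa [add_zero] at this

/-- A graded map of degree `2 - 2p` whose associated null-homotopic map is the identity on the
kernel of a surjection with acyclic kernel. -/
theorem exists_graded_homotopy (hp : 0 < p) {M N : PDGBimod p k A B} (f : M ⟶ N)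
    (hk : AcyclicOn p M.d (LinearMap.ker f.lin)) :
    ∃ h : Module.End k M, (∀ i, ∀ m ∈ M.gr i, h m ∈ M.gr (i + (2 - 2 * p))) ∧
      (∀ m, f.lin (h m) = 0) ∧ ∀ u, f.lin u = 0 →
        ∑ i ∈ Finset.range p, (M.d ^ i) (h ((M.d ^ (p - 1 - i)) u)) = u := by
  have hst : ∀ u ∈ LinearMap.ker f.lin, M.d u ∈ LinearMap.ker f.lin := fun u hu => by
    rw [LinearMap.mem_ker] at *; rw [f.map_d, hu, map_zero]
  obtain ⟨η, hη⟩ := exists_contraction hp (restrict_pow_eq_zero M.d_pow hst)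
    ((acyclicOn_iff_restrict hst).1 hk)
  obtain ⟨r, hr⟩ := (LinearMap.ker f.lin).subtype.exists_leftInverse_of_injective
    (Submodule.ker_subtype _)
  have hr' : ∀ u : LinearMap.ker f.lin, r u = u := fun u => LinearMap.congr_fun hr u
  let h₀ : Module.End k M := (LinearMap.ker f.lin).subtype ∘ₗ η ∘ₗ r
  have h₀K : ∀ u, f.lin u = 0 →
      ∑ i ∈ Finset.range p, (M.d ^ i) (h₀ ((M.d ^ (p - 1 - i)) u)) = u := by
    intro u hu
    have h1 := congrArg Subtype.val (hη ⟨u, hu⟩)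
    rw [AddSubmonoidClass.coe_finsetSum] at h1
    refine Eq.trans (Finset.sum_congr rfl fun i _ => ?_) h1
    rw [Module.End.pow_restrict, Module.End.pow_restrict, LinearMap.coe_restrict_apply]
    congr 1
    change ((η (r _) : LinearMap.ker f.lin) : M) = _
    congr 2
    exact hr' ((LinearMap.restrict (M.d ^ (p - 1 - i)) _) ⟨u, hu⟩)
  -- The operators `d^i` and `d^(p-1-i)` together raise degrees by `2p - 2`. So only the component
  -- of the homotopy of degree `2 - 2p` contributes to a map of degree zero, and the others can be
  -- discarded.
  let e : ℤ := 2 - 2 * p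
  refine ⟨degreePart M.internal e h₀, ?_, ?_, ?_⟩
  · intro i m hm
    rw [degreePart_of_mem _ _ _ hm]
    exact gproj_mem _ _ _
  · intro m
    refine LinearMap.congr_fun (f := f.lin ∘ₗ degreePart M.internal e h₀) (g := 0)
      (linearMap_ext_of_iSup (iSup_eq_top_of_isInternal M.internal) fun i m hm => ?_) m
    rw [LinearMap.comp_apply, degreePart_of_mem _ _ _ hm, f.map_gproj]
    have : f.lin (h₀ m) = 0 := (η (r m)).2
    rw [this, map_zero]; rfl
  · let H : Module.End k M := ∑ i ∈ Finset.range p,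
      (M.d ^ i) ∘ₗ degreePart M.internal e h₀ ∘ₗ (M.d ^ (p - 1 - i))
    have hH : ∀ u, H u = ∑ i ∈ Finset.range p,
        (M.d ^ i) (degreePart M.internal e h₀ ((M.d ^ (p - 1 - i)) u)) := by
      intro u; simp [H]
    have hom : ∀ j, ∀ u ∈ M.gr j, f.lin u = 0 → H u = u := by
      intro j u hu hfu
      rw [hH]
      have h2 := congrArg (gproj M.internal j) (h₀K u hfu)
      rw [map_sum, gproj_of_mem _ hu, if_pos rfl] at h2
      refine Eq.trans (Finset.sum_congr rfl fun i hi => ?_) h2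
      have hi := Finset.mem_range.1 hi
      rw [degreePart_of_mem _ _ _ (M.d_pow_mem _ hu), gproj_d_pow]
      congr 2
      have : ((p - 1 - i : ℕ) : ℤ) = p - 1 - i := by omega
      rw [this]; simp only [e]; ring
    intro u hu
    rw [← hH]
    have : u ∈ LinearMap.ker (H - LinearMap.id) := by
      refine mem_of_gproj_mem M.internal _ fun i => ?_
      rw [LinearMap.mem_ker, LinearMap.sub_apply, hom i _ (gproj_mem _ _ _)
        (by rw [f.map_gproj, hu, map_zero])]
      exact sub_self _
    exact sub_eq_zero.1 (LinearMap.mem_ker.1 this)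

/-- The functor taking `p`-cohomology. -/
noncomputable def cohFunctor (p : ℕ) (k A B : Type u) [Field k] [Ring A] [Algebra k A]
    [PDGAlgebra p k A] [Ring B] [Algebra k B] [PDGAlgebra p k B] (a : ℕ) :
    PDGBimod p k A B ⥤ ModuleCat.{u} k where
  obj M := ModuleCat.of k (Coh p M.d a)
  map f := ModuleCat.ofHom (Coh.mapChain p a f.lin f.map_d)
  map_id M := by
    ext x
    rfl
  map_comp f g := by
    ext x
    rfl

/-- On `ker d^a` a term `d^i h d^(p-1-i)` vanishes if `p - 1 - i ≥ a`. In the other case `i ≥ p -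
a`, and the value lies in the image of `d^(p-a)`. -/
theorem cohFunctor_homotopic {M N : PDGBimod p k A B} {f g : M ⟶ N} (h : Homotopic f g) (a : ℕ) :
    (cohFunctor p k A B a).map f = (cohFunctor p k A B a).map g := by
  obtain ⟨h, -, -, -, heq⟩ := h
  ext x
  obtain ⟨u, hu, rfl⟩ := x.exists_mk
  change Coh.mk p N.d a (f.lin u) _ = Coh.mk p N.d a (g.lin u) _
  have hmem : ∃ v, (N.d ^ (p - a)) v = f.lin u - g.lin u := by
    change f.lin u - g.lin u ∈ LinearMap.range (N.d ^ (p - a))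
    rw [heq]
    refine Submodule.sum_mem _ fun i _ => ?_
    rcases le_or_gt a (p - 1 - i) with hi | hi
    · have : (M.d ^ (p - 1 - i)) u = 0 := by
        rw [show p - 1 - i = (p - 1 - i - a) + a by omega, pow_add_apply, hu, map_zero]
      rw [this, map_zero, map_zero]
      exact zero_mem _
    · exact ⟨(N.d ^ (i - (p - a))) (h ((M.d ^ (p - 1 - i)) u)), by
        rw [← pow_add_apply, show p - a + (i - (p - a)) = i by omega]⟩
  rw [← sub_eq_zero]
  exact (Coh.mk_eq_zero (by
    rw [map_sub, ← map_pow_apply f.map_d, ← map_pow_apply g.map_d, hu, map_zero, map_zero,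
      sub_zero])).2 hmem

section HtpyCat
variable [hp : Fact p.Prime]

/-- Cohomology on the homotopy category of `p`-complexes. -/
noncomputable def cohHtpy (p : ℕ) (k A B : Type u) [Field k] [Ring A] [Algebra k A]
    [PDGAlgebra p k A] [Ring B] [Algebra k B] [PDGAlgebra p k B] (a : ℕ) :
    HtpyCat p k A B ⥤ ModuleCat.{u} k :=
  CategoryTheory.Quotient.lift _ (cohFunctor p k A B a)
    (fun _ _ _ _ h => cohFunctor_homotopic h a)

theorem coh_isIso_of_quasiIso {M N : PDGBimod p k A B} (f : M ⟶ N) (h : QuasiIso f) (a : ℕ) :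
    Function.Bijective (Coh.mapChain p a f.lin f.map_d) := by
  have h1 : IsIso ((forgetHtpy p k A B).map ((CategoryTheory.Quotient.functor _).map f)) := h
  have h2 : IsIso ((cohHtpy p k k k a).map
    ((forgetHtpy p k A B).map ((CategoryTheory.Quotient.functor _).map f))) := inferInstance
  have h3 : IsIso (ModuleCat.ofHom (Coh.mapChain p a f.lin f.map_d)) := h2
  exact (ConcreteCategory.isIso_iff_bijective _).1 h3

/-- Injectivity on the first cohomology gives a primitive `w` of a cocycle in the kernel, perhaps
outside the kernel. The class of `f w` at index `p - 1` is hit by some `w'`; subtracting `w'` and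
adding a suitable `d m` moves `w` into the kernel without changing `d^(p-1) w`. -/
theorem kerAcyclic_of_quasiIso {M N : PDGBimod p k A B} (f : M ⟶ N) (h : QuasiIso f)
    (hs : Function.Surjective f.lin) : AcyclicOn p M.d (LinearMap.ker f.lin) := by
  intro u hu hdu
  rw [LinearMap.mem_ker] at hu
  have hu1 : (M.d ^ 1) u = 0 := by rwa [pow_one]
  have h1 : Coh.mk p M.d 1 u hu1 = 0 := by
    apply (coh_isIso_of_quasiIso f h 1).1
    rw [map_zero, Coh.mapChain_mk, Coh.mk_eq_zero]
    exact ⟨0, by rw [map_zero, hu]⟩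
  rw [Coh.mk_eq_zero] at h1
  obtain ⟨w, hw⟩ := h1
  have hfw : (N.d ^ (p - 1)) (f.lin w) = 0 := by rw [← map_pow_apply f.map_d, hw, hu]
  obtain ⟨x, hx⟩ := (coh_isIso_of_quasiIso f h (p - 1)).2 (Coh.mk p N.d (p - 1) (f.lin w) hfw)
  obtain ⟨w', hw', rfl⟩ := x.exists_mk
  rw [Coh.mapChain_mk, ← sub_eq_zero] at hx
  have hx' : Coh.mk p N.d (p - 1) (f.lin w' - f.lin w) (by
    rw [map_sub, hfw, ← map_pow_apply f.map_d, hw', map_zero, sub_zero]) = 0 := hx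
  rw [Coh.mk_eq_zero, Nat.sub_sub_self hp.out.one_le, pow_one] at hx'
  obtain ⟨n, hn⟩ := hx'
  obtain ⟨m, rfl⟩ := hs n
  refine ⟨w - w' + M.d m, ?_, ?_⟩
  · rw [LinearMap.mem_ker, map_add, map_sub, f.map_d, hn]; abel
  · rw [map_add, map_sub, hw, hw', ← Module.End.mul_apply, ← pow_succ,
      Nat.sub_add_cancel hp.out.one_le, M.d_pow]
    simp

/-- The null-homotopic operator `H` built from a contraction of the kernel is the identity on `ker
f` and maps into `ker f`. So `1 - H` factors as `g ∘ f`, and `g` is inverse to `f` up to homotopy.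
It is only linear over `k`, which is enough because quasi-isomorphisms are tested on underlying
complexes. -/
theorem quasiIso_of_kerAcyclic {M N : PDGBimod p k A B} (f : M ⟶ N)
    (hs : Function.Surjective f.lin) (hk : AcyclicOn p M.d (LinearMap.ker f.lin)) :
    QuasiIso f := by
  obtain ⟨h, hdeg, hfh, hid⟩ := exists_graded_homotopy hp.out.pos f hk
  let H : Module.End k M := ∑ i ∈ Finset.range p, (M.d ^ i) ∘ₗ h ∘ₗ (M.d ^ (p - 1 - i))
  have hH : ∀ u, H u = ∑ i ∈ Finset.range p, (M.d ^ i) (h ((M.d ^ (p - 1 - i)) u)) := by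
    intro u; simp [H]
  -- Both sides are the same sum with the index shifted by one; the two boundary terms contain `d^p`
  -- and vanish.
  have hHd : ∀ u, H (M.d u) = M.d (H u) := by
    intro u
    obtain ⟨q, rfl⟩ : ∃ q, p = q + 1 := ⟨p - 1, (Nat.succ_pred hp.out.ne_zero).symm⟩
    have e1 : (M.d ^ (q + 1 - 1 - 0)) (M.d u) = 0 := by
      rw [← Module.End.mul_apply, ← pow_succ, show q + 1 - 1 - 0 + 1 = q + 1 by omega, M.d_pow]
      rfl
    have e2 : ∀ v, M.d ((M.d ^ q) v) = 0 := fun v => by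
      rw [← Module.End.mul_apply, ← pow_succ', M.d_pow]; rfl
    rw [hH, hH, map_sum, Finset.sum_range_succ', Finset.sum_range_succ, e1, e2, map_zero, map_zero]
    congr 1
    refine Finset.sum_congr rfl fun i hi => ?_
    have hi := Finset.mem_range.1 hi
    rw [pow_succ' M.d i, Module.End.mul_apply, ← Module.End.mul_apply _ M.d u, ← pow_succ,
      show q + 1 - 1 - (i + 1) + 1 = q + 1 - 1 - i by omega]
  have hfH : ∀ u, f.lin (H u) = 0 := by
    intro u
    rw [hH, map_sum]
    exact Finset.sum_eq_zero fun i _ => by rw [map_pow_apply f.map_d, hfh, map_zero]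
  obtain ⟨t, ht⟩ := f.lin.exists_rightInverse_of_surjective (LinearMap.range_eq_top.2 hs)
  have ht' : ∀ z, f.lin (t z) = z := fun z => LinearMap.congr_fun ht z
  let g : N →ₗ[k] M := (LinearMap.id - H) ∘ₗ t
  have hgf : ∀ m, g (f.lin m) = m - H m := by
    intro m
    change t (f.lin m) - H (t (f.lin m)) = m - H m
    have h1 := hid (t (f.lin m) - m) (by rw [map_sub, ht', sub_self])
    rw [← hH, map_sub] at h1
    rw [sub_eq_sub_iff_sub_eq_sub, ← h1]
  have hHmem : ∀ i, ∀ m ∈ M.gr i, H m ∈ M.gr i := by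
    intro i m hm
    rw [hH]
    refine Submodule.sum_mem _ fun j hj => ?_
    have hj := Finset.mem_range.1 hj
    have := M.d_pow_mem j (hdeg _ _ (M.d_pow_mem (p - 1 - j) hm))
    convert this using 2
    have : ((p - 1 - j : ℕ) : ℤ) = p - 1 - j := by omega
    rw [this]; ring
  let G : (forget p k A B).obj N ⟶ (forget p k A B).obj M :=
    { lin := g
      map_lact := fun a m => map_smul g a m
      map_ract := fun b m => map_smul g b.unop m
      map_mem := by
        intro i m hm
        obtain ⟨w, rfl⟩ := hs m
        have hm' : f.lin w = f.lin (gproj M.internal i w) := by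
          rw [f.map_gproj, gproj_of_mem N.internal hm, if_pos rfl]
        change g (f.lin w) ∈ M.gr i
        rw [hm', hgf]
        exact sub_mem (gproj_mem _ _ _) (hHmem _ _ (gproj_mem _ _ _))
      map_d := by
        intro n
        obtain ⟨m, rfl⟩ := hs n
        change g (N.d (f.lin m)) = M.d (g (f.lin m))
        rw [← f.map_d, hgf, hgf, hHd, map_sub] }
  let F : (forget p k A B).obj M ⟶ (forget p k A B).obj N := (forget p k A B).map f
  have hGF : G ≫ F = 𝟙 _ := by
    refine hom_ext fun n => ?_
    change f.lin (t n - H (t n)) = n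
    rw [map_sub, hfH, sub_zero]
    exact ht' n
  have hHom : ∀ m : M, m - g (f.lin m)
      = ∑ i ∈ Finset.range p, (M.d ^ i) (h ((M.d ^ (p - 1 - i)) m)) := fun m => by
    rw [hgf, sub_sub_cancel, hH]
  have hFG : Homotopic (𝟙 _) (F ≫ G) := by
    refine ⟨h, fun a m => map_smul h a m, fun b m => map_smul h b.unop m, hdeg, fun m => ?_⟩
    exact hHom m
  change IsIso ((CategoryTheory.Quotient.functor _).map F)
  refine ⟨(CategoryTheory.Quotient.functor _).map G, ?_, ?_⟩
  · rw [← Functor.map_comp, ← CategoryTheory.Quotient.sound _ hFG, CategoryTheory.Functor.map_id]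
  · rw [← Functor.map_comp, hGF, CategoryTheory.Functor.map_id]

theorem cohHtpy_inverts (a : ℕ) :
    (htpyQuasiIso p k A B).IsInvertedBy (forgetHtpy p k A B ⋙ cohHtpy p k k k a) := by
  intro M N f hf
  have : IsIso ((forgetHtpy p k A B).map f) := hf
  exact (inferInstance : IsIso ((cohHtpy p k k k a).map ((forgetHtpy p k A B).map f)))

/-- Cohomology inverts quasi-isomorphisms and so factors through the localization. This is the
invariant that separates the projector from finite cell bimodules. -/
theorem finite_coh_of_iso {M N : PDGBimod p k A B}
    (e : (toD p k A B).obj M ≅ (toD p k A B).obj N) (a : ℕ)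
    (h : Module.Finite k (Coh p N.d a)) : Module.Finite k (Coh p M.d a) := by
  let L := CategoryTheory.Localization.lift _ (cohHtpy_inverts (p := p) (k := k) (A := A) (B := B) a)
    (htpyQuasiIso p k A B).Q
  let φ := CategoryTheory.Localization.fac _ (cohHtpy_inverts (p := p) (k := k) (A := A) (B := B) a)
    (htpyQuasiIso p k A B).Q
  have e1 := φ.app ((CategoryTheory.Quotient.functor _).obj M)
  have e2 := φ.app ((CategoryTheory.Quotient.functor _).obj N)
  have e3 := L.mapIso e
  have e4 : ModuleCat.of k (Coh p M.d a) ≅ ModuleCat.of k (Coh p N.d a) := e1.symm ≪≫ e3 ≪≫ e2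
  exact Module.Finite.equiv e4.toLinearEquiv.symm

theorem toD_map_isIso {M N : PDGBimod p k A B} (f : M ⟶ N) (h : QuasiIso f) :
    IsIso ((toD p k A B).map f) :=
  CategoryTheory.Localization.inverts (htpyQuasiIso p k A B).Q (htpyQuasiIso p k A B) _ h

end HtpyCat
end PDGBimod
end PDG

namespace PDG
namespace AShriek

/-! ### A spanning set of paths for the quiver algebra -/

section Spanning
variable (k : Type u) [Field k] (n : ℕ)

/-- The vertex idempotents, indexed by natural numbers. -/
noncomputable def ve (a : ℕ) : AShriek k n := if h : a < n then vertex k ⟨a, h⟩ else 0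

/-- The arrows, indexed by natural numbers. -/
noncomputable def ar (a b : ℕ) : AShriek k n :=
  if h : a < n ∧ b < n then arrow k ⟨a, h.1⟩ ⟨b, h.2⟩ else 0

/-- The ascending path of length `l` starting at `m`. -/
noncomputable def upPath : ℕ → ℕ → AShriek k n
  | m, 0 => ve k n m
  | m, l + 1 => ar k n m (m + 1) * upPath (m + 1) l

/-- The descending path of length `l` ending at `m`. -/
noncomputable def downPath (m : ℕ) : ℕ → AShriek k n
  | 0 => ve k n m
  | l + 1 => ar k n (m + l + 1) (m + l) * downPath m l

variable {n}

theorem ve_mul_ve (a b : ℕ) : ve k n a * ve k n b = if a = b then ve k n a else 0 := by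
  unfold ve
  by_cases ha : a < n <;> by_cases hb : b < n <;> by_cases hab : a = b <;>
    simp only [ha, hb, hab, dif_pos, dif_neg, not_false_eq_true, if_true, if_false, zero_mul,
      mul_zero]
  · subst hab; simp
  · exact vertex_mul_vertex k (fun h => hab (congrArg Fin.val h))
  all_goals first | rfl | (subst hab; omega)

theorem ve_mul_ar (a b c : ℕ) : ve k n c * ar k n a b = if c = a then ar k n a b else 0 := by
  by_cases h : a < n ∧ b < n
  · have h1 : ve k n a * ar k n a b = ar k n a b := by
      simp [ve, ar, h]
    rw [← h1, ← mul_assoc, ve_mul_ve]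
    by_cases hc : c = a
    · simp [hc]
    · simp [hc]
  · simp [ar, h]

theorem ar_mul_ve (a b c : ℕ) : ar k n a b * ve k n c = if b = c then ar k n a b else 0 := by
  by_cases h : a < n ∧ b < n
  · have h1 : ar k n a b * ve k n b = ar k n a b := by
      simp [ve, ar, h]
    rw [← h1, mul_assoc, ve_mul_ve]
    by_cases hc : b = c
    · simp [hc]
    · simp [hc]
  · simp [ar, h]

theorem ar_first : ar k n 0 1 * ar k n 1 0 = 0 := by
  by_cases h : 1 < n
  · have h0 : 0 < n := by omega
    simp only [ar, h, h0, and_self, dif_pos]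
    exact first k rfl rfl
  · simp [ar, h]

theorem ar_middle {a : ℕ} (h : a + 2 < n) : ar k n (a + 1) a * ar k n a (a + 1)
    = ar k n (a + 1) (a + 2) * ar k n (a + 2) (a + 1) := by
  have h0 : a < n := by omega
  have h1 : a + 1 < n := by omega
  simp only [ar, h, h0, h1, and_self, dif_pos]
  exact middle k rfl rfl

theorem ve_mul_upPath (m l c : ℕ) :
    ve k n c * upPath k n m l = if c = m then upPath k n m l else 0 := by
  cases l with
  | zero => rw [upPath, ve_mul_ve]; split_ifs with h <;> simp [h]
  | succ l => rw [upPath, ← mul_assoc, ve_mul_ar]; split_ifs <;> simp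

theorem upPath_mul_ve (m l c : ℕ) :
    upPath k n m l * ve k n c = if m + l = c then upPath k n m l else 0 := by
  induction l generalizing m with
  | zero => rw [upPath, ve_mul_ve]; rfl
  | succ l ih =>
    rw [upPath, mul_assoc, ih, show m + 1 + l = m + (l + 1) by omega]; split_ifs <;> simp

theorem ve_mul_downPath (m l c : ℕ) :
    ve k n c * downPath k n m l = if c = m + l then downPath k n m l else 0 := by
  cases l with
  | zero => rw [downPath, ve_mul_ve]; split_ifs with h h' h' <;> simp_all
  | succ l => rw [downPath, ← mul_assoc, ve_mul_ar, ← add_assoc]; split_ifs <;> simp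

theorem downPath_mul_ve (m l c : ℕ) :
    downPath k n m l * ve k n c = if m = c then downPath k n m l else 0 := by
  induction l with
  | zero => rw [downPath, ve_mul_ve]
  | succ l ih => rw [downPath, mul_assoc, ih]; split_ifs <;> simp

theorem ar_mul_downPath_of_ne {a b m l : ℕ} (h : b ≠ m + l) :
    ar k n a b * downPath k n m l = 0 := by
  have := ve_mul_downPath k (n := n) m l (m + l)
  rw [if_pos rfl] at this
  rw [← this, ← mul_assoc, ar_mul_ve, if_neg h, zero_mul]

theorem downPath_mul_ar (m l : ℕ) :
    downPath k n (m + 1) l * ar k n (m + 1) m = downPath k n m (l + 1) := by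
  induction l with
  | zero => simp [downPath, ve_mul_ar, ar_mul_ve]
  | succ l ih =>
    rw [downPath, mul_assoc, ih, show m + 1 + l + 1 = m + (l + 1) + 1 by omega,
      show m + 1 + l = m + (l + 1) by omega]
    rfl

/-- A loop slides along a descending path one vertex at a time, because at an inner vertex the loops
through the two neighbours agree. The bound on `m + l` keeps all the loops inside the quiver. -/
theorem ascent_mul_downPath {m l : ℕ} (h : m + l + 1 < n) :
    ar k n (m + l) (m + l + 1) * ar k n (m + l + 1) (m + l) * downPath k n m l
      = downPath k n m l * (ar k n m (m + 1) * ar k n (m + 1) m) := by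
  induction l with
  | zero =>
    rw [downPath, add_zero, mul_assoc, ar_mul_ve, if_pos rfl, ← mul_assoc, ve_mul_ar, if_pos rfl]
  | succ l ih =>
    have h1 := ar_middle k (n := n) (a := m + l) (by omega)
    rw [downPath, mul_assoc _ (downPath k n m l), ← ih (by omega), ← add_assoc, ← h1]
    simp only [mul_assoc]

/-- The span of the paths which first descend and then ascend. -/
noncomputable def pathSpan (k : Type u) [Field k] (n : ℕ) : Submodule k (AShriek k n) :=
  Submodule.span k (Set.range fun t : ℕ × ℕ × ℕ => downPath k n t.1 t.2.1 * upPath k n t.1 t.2.2)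

theorem mem_pathSpan (m l l' : ℕ) : downPath k n m l * upPath k n m l' ∈ pathSpan k n :=
  Submodule.subset_span ⟨(m, l, l'), rfl⟩

theorem upPath_mem_pathSpan (m l : ℕ) : upPath k n m l ∈ pathSpan k n := by
  have := mem_pathSpan k (n := n) m 0 l
  rwa [downPath, ve_mul_upPath, if_pos rfl] at this

/-- Paths that descend and then ascend form a normal form. The only product that leaves it is an
ascent before a non-trivial descent; it creates a loop, which slides down to the turning point. -/
theorem gen_mul_mem_pathSpan (g : QuiverGen n) {a : AShriek k n} (ha : a ∈ pathSpan k n) :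
    gen k g * a ∈ pathSpan k n := by
  change a ∈ Submodule.span k _ at ha
  induction ha using Submodule.span_induction with
  | zero => rw [mul_zero]; exact zero_mem _
  | add x y _ _ hx hy => rw [mul_add]; exact add_mem hx hy
  | smul c x _ hx => rw [mul_smul_comm]; exact Submodule.smul_mem _ _ hx
  | mem x hx =>
    obtain ⟨⟨m, l, l'⟩, rfl⟩ := hx
    cases g with
    | vertex i =>
      have : gen k (.vertex i) = ve k n i := by simp [gen, ve]
      simp only [this, ← mul_assoc, ve_mul_downPath]
      split_ifs
      · exact mem_pathSpan k m l l'
      · rw [zero_mul]; exact zero_mem _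
    | arrow i j =>
      have : gen k (.arrow i j) = ar k n i j := by simp [gen, ar]
      simp only [this, ← mul_assoc]
      by_cases hj : (j : ℕ) = m + l
      · by_cases hij : ¬ (i.val + 1 = j.val ∨ j.val + 1 = i.val)
        · have h0 : ar k n i j = 0 := by
            rw [← this]; exact arrow_eq_zero k hij
          rw [h0, zero_mul, zero_mul]; exact zero_mem _
        push Not at hij
        rcases hij with hij | hij
        · cases l with
          | zero =>
            rw [downPath, mul_assoc, ve_mul_upPath, if_pos rfl]
            have h2 : ar k n i j * upPath k n m l' = upPath k n i (l' + 1) := by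
              rw [upPath, hij, hj]; rfl
            rw [h2]
            exact upPath_mem_pathSpan k _ _
          | succ l =>
            have hi : (i : ℕ) = m + l := by omega
            rw [downPath, ← mul_assoc, hj, hi, ← add_assoc,
              ascent_mul_downPath k (by have := j.2; omega)]
            -- If the turning point is the first vertex, the loop there is zero. Otherwise it is
            -- traded for the loop through the vertex below, which lengthens the descent and the
            -- ascent by one each.
            cases m with
            | zero => rw [zero_add, ar_first, mul_zero, zero_mul]; exact zero_mem _
            | succ m =>
              rw [← ar_middle k (by have := j.2; omega), ← mul_assoc, downPath_mul_ar, mul_assoc]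
              exact mem_pathSpan k m (l + 1) (l' + 1)
        · have h2 : ar k n i j * downPath k n m l = downPath k n m (l + 1) := by
            rw [downPath, ← hij, hj]
          rw [h2]
          exact mem_pathSpan k _ _ _
      · rw [ar_mul_downPath_of_ne k hj, zero_mul]; exact zero_mem _

theorem pathSpan_eq_top : pathSpan k n = ⊤ := by
  rw [eq_top_iff]
  rintro a -
  have h1 : (1 : AShriek k n) ∈ pathSpan k n := by
    rw [← sum_vertex k]
    refine Submodule.sum_mem _ fun i _ => ?_
    have := upPath_mem_pathSpan k (n := n) i 0
    simpa [upPath, ve] using this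
  have key : ∀ b ∈ pathSpan k n, a * b ∈ pathSpan k n := by
    have ha : a ∈ Algebra.adjoin k (Set.range (gen k (n := n))) := by rw [adjoin_gen]; trivial
    induction ha using Algebra.adjoin_induction with
    | mem x hx => obtain ⟨g, rfl⟩ := hx; exact fun b hb => gen_mul_mem_pathSpan k g hb
    | algebraMap r =>
      intro b hb
      rw [← Algebra.smul_def]; exact Submodule.smul_mem _ _ hb
    | add x y _ _ hx hy => intro b hb; rw [add_mul]; exact add_mem (hx b hb) (hy b hb)
    | mul x y _ _ hx hy => intro b hb; rw [mul_assoc]; exact hx _ (hy b hb)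
  simpa using key 1 h1

theorem upPath_eq_zero {m l : ℕ} (h : n ≤ m + l) : upPath k n m l = 0 := by
  have h1 := upPath_mul_ve k (n := n) m l (m + l)
  rw [if_pos rfl] at h1
  rw [← h1, ve, dif_neg (by omega), mul_zero]

theorem downPath_eq_zero {m l : ℕ} (h : n ≤ m + l) : downPath k n m l = 0 := by
  have h1 := ve_mul_downPath k (n := n) m l (m + l)
  rw [if_pos rfl] at h1
  rw [← h1, ve, dif_neg (by omega), zero_mul]

instance : Module.Finite k (AShriek k n) := by
  refine ⟨?_⟩
  rw [← pathSpan_eq_top]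
  have : pathSpan k n = Submodule.span k (Set.range fun t : Fin n × Fin n × Fin n =>
      downPath k n t.1 t.2.1 * upPath k n t.1 t.2.2) := by
    refine le_antisymm (Submodule.span_le.2 ?_) (Submodule.span_mono ?_)
    · rintro _ ⟨⟨m, l, l'⟩, rfl⟩
      by_cases h1 : m + l < n
      · by_cases h2 : m + l' < n
        · exact Submodule.subset_span ⟨(⟨m, by omega⟩, ⟨l, by omega⟩, ⟨l', by omega⟩), rfl⟩
        · change _ * upPath k n m l' ∈ _
          rw [upPath_eq_zero k (by omega), mul_zero]; exact zero_mem _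
      · change downPath k n m l * _ ∈ _
        rw [downPath_eq_zero k (by omega), zero_mul]; exact zero_mem _
    · rintro _ ⟨⟨m, l, l'⟩, rfl⟩
      exact ⟨(m, l, l'), rfl⟩
  rw [this]
  exact Submodule.fg_span (Set.finite_range _)

theorem gr_eq_bot_of_neg {p : ℕ} [hp : Fact p.Prime] [CharP k p] {i : ℤ} (hi : i < 0)
    {a : AShriek k n} (ha : a ∈ PDGAlgebra.gr (p := p) (k := k) i) : a = 0 := by
  have h : (PDGAlgebra.gr (p := p) (k := k) i : Submodule k (AShriek k n)) = ⊥ := by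
    refine Submodule.span_eq_bot.2 ?_
    rintro _ ⟨l, hl, -⟩
    exfalso
    have : 0 ≤ (l.map (deg (n := n))).sum := List.sum_nonneg (by
      intro x hx
      obtain ⟨g, -, rfl⟩ := List.mem_map.1 hx
      cases g <;> simp [deg])
    omega
  rw [h] at ha
  exact (Submodule.mem_bot k).1 ha

end Spanning

/-! ### Matrix representations detecting the two extreme paths -/

section Representation
variable (k : Type u) [Field k] {n : ℕ}

open Classical in
/-- The representation on `k^n` in which only the arrows selected by `r` act, never both arrows
between the same vertices. -/
noncomputable def rep (r : Fin n → Fin n → Prop)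
    (hr : ∀ i j, r i j → (i.val + 1 = j.val ∨ j.val + 1 = i.val)) (hrr : ∀ i j, r i j → ¬ r j i) :
    AShriek k n →ₐ[k] Matrix (Fin n) (Fin n) k :=
  lift k (fun g => match g with
    | .vertex i => Matrix.single i i 1
    | .arrow i j => if r i j then Matrix.single i j 1 else 0) (by
    intro a b h
    have hz : ∀ i j : Fin n, (if r i j then Matrix.single i j (1 : k) else 0)
        * (if r j i then Matrix.single j i (1 : k) else 0) = 0 := by
      intro i j
      by_cases h : r i j
      · rw [if_neg (hrr i j h), mul_zero]
      · rw [if_neg h, zero_mul]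
    cases h with
    | vertex_mul_self i => simp
    | vertex_mul_vertex i j h => simp [Matrix.single_mul_single_of_ne, h]
    | sum_vertex =>
      simp only [map_sum, FreeAlgebra.lift_ι_apply, map_one]
      ext a b
      rw [Matrix.sum_apply, Matrix.one_apply]
      by_cases hab : a = b
      · subst hab; simp [Matrix.single_apply]
      · rw [if_neg hab]
        refine Finset.sum_eq_zero fun i _ => ?_
        rw [Matrix.single_apply, if_neg]
        rintro ⟨rfl, rfl⟩; exact hab rfl
    | vertex_mul_arrow i j => by_cases h : r i j <;> simp [h]
    | arrow_mul_vertex i j => by_cases h : r i j <;> simp [h]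
    | not_adjacent i j h => simp [mt (hr i j) h]
    | first i j hi hj => simpa using hz i j
    | middle h i j hi hj => simpa using (hz i h).trans (hz i j).symm)

variable (r : Fin n → Fin n → Prop)
    (hr : ∀ i j, r i j → (i.val + 1 = j.val ∨ j.val + 1 = i.val)) (hrr : ∀ i j, r i j → ¬ r j i)

theorem rep_vertex (i : Fin n) : rep k r hr hrr (vertex k i) = Matrix.single i i 1 :=
  lift_gen k _ _ (.vertex i)

open Classical in
theorem rep_arrow (i j : Fin n) :
    rep k r hr hrr (arrow k i j) = if r i j then Matrix.single i j 1 else 0 :=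
  lift_gen k _ _ (.arrow i j)

theorem rep_arrow_mul_arrow (i j : Fin n) :
    rep k r hr hrr (arrow k i j * arrow k j i) = 0 := by
  rw [map_mul, rep_arrow, rep_arrow]
  by_cases h : r i j
  · rw [if_neg (hrr i j h), mul_zero]
  · rw [if_neg h, zero_mul]

/-- Vertices and descending arrows have zero differential, and the differential of an ascending
arrow contains a round trip `(i|j|i)`, which acts by zero because at most one of the two arrows
acts. -/
theorem rep_d {p : ℕ} [hp : Fact p.Prime] [CharP k p] (a : AShriek k n) :
    rep k r hr hrr (PDGAlgebra.d (p := p) (k := k) a) = 0 :=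
  map_derivation (gen k) (adjoin_gen k) (rep k r hr hrr) _ (0 : Module.End k _)
    PDGAlgebra.d_mul (by simp) (fun g => by
      rw [d_gen]
      cases g with
      | vertex j => simp [dGen]
      | arrow i j =>
        by_cases hij : i < j
        · simp only [dGen, hij, if_true]
          rw [map_mul, rep_arrow_mul_arrow, zero_mul]; rfl
        · simp [dGen, hij]) a

theorem rep_loop [NeZero n] : rep k r hr hrr (loop k n) = 0 := by
  rw [loop, map_sum]
  exact Finset.sum_eq_zero fun j _ => rep_arrow_mul_arrow k r hr hrr _ _

/-- The representation in which the ascending arrows act. -/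
noncomputable def repUp : AShriek k n →ₐ[k] Matrix (Fin n) (Fin n) k :=
  rep k (fun i j => i.val + 1 = j.val) (fun _ _ h => Or.inl h) (fun _ _ _ _ => by omega)

/-- The representation in which the descending arrows act. -/
noncomputable def repDown : AShriek k n →ₐ[k] Matrix (Fin n) (Fin n) k :=
  rep k (fun i j => j.val + 1 = i.val) (fun _ _ h => Or.inr h) (fun _ _ _ _ => by omega)

theorem repUp_upPath (l : ℕ) : ∀ i j : Fin n, i.val + l = j.val →
    repUp k (upPath k n i l) = Matrix.single i j 1 := by
  induction l with
  | zero =>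
    intro i j h
    obtain rfl : i = j := Fin.ext h
    simp [upPath, ve, repUp, rep_vertex]
  | succ l ih =>
    intro i j h
    have hi : i.val + 1 < n := by have := j.2; omega
    have h1 := ih ⟨i.val + 1, hi⟩ j (by simp only; omega)
    rw [upPath, map_mul, h1]
    have : ar k n i (i.val + 1) = arrow k i ⟨i.val + 1, hi⟩ := by simp [ar, hi]
    rw [this, repUp, rep_arrow, if_pos rfl, Matrix.single_mul_single_same, mul_one]

theorem repDown_downPath (l : ℕ) (i : Fin n) : ∀ j : Fin n, i.val + l = j.val →
    repDown k (downPath k n i l) = Matrix.single j i 1 := by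
  induction l with
  | zero =>
    intro j h
    obtain rfl : i = j := Fin.ext h
    simp [downPath, ve, repDown, rep_vertex]
  | succ l ih =>
    intro j h
    have hi : i.val + l < n := by have := j.2; omega
    have h1 := ih ⟨i.val + l, hi⟩ rfl
    rw [downPath, map_mul, h1]
    have : ar k n (i.val + l + 1) (i.val + l) = arrow k j ⟨i.val + l, hi⟩ := by
      have h2 : i.val + l + 1 < n := by have := j.2; omega
      have h3 : j = ⟨i.val + l + 1, h2⟩ := Fin.ext h.symm
      subst h3
      simp [ar, hi, h2]
    rw [this, repDown, rep_arrow, if_pos (show i.val + l + 1 = j.val by omega), Matrix.single_mul_single_same, mul_one]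

variable (n) [NeZero n]

/-- The coefficient of the ascending path from the first to the last vertex. -/
noncomputable def columnCoeff : AShriek k n →ₗ[k] k :=
  (Matrix.entryLinearMap k k (0 : Fin n) (last n)) ∘ₗ (repUp k).toLinearMap

/-- The coefficient of the descending path from the last to the first vertex. -/
noncomputable def rowCoeff : AShriek k n →ₗ[k] k :=
  (Matrix.entryLinearMap k k (last n) (0 : Fin n)) ∘ₗ (repDown k).toLinearMap

variable {n}

theorem columnCoeff_d {p : ℕ} [hp : Fact p.Prime] [CharP k p] (a : AShriek k n) :
    columnCoeff k n (PDGAlgebra.d (p := p) (k := k) a) = 0 :=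
  congrFun (congrFun (rep_d (p := p) k _ _ _ a) _) _

theorem rowCoeff_d {p : ℕ} [hp : Fact p.Prime] [CharP k p] (a : AShriek k n) :
    rowCoeff k n (PDGAlgebra.d (p := p) (k := k) a) = 0 :=
  congrFun (congrFun (rep_d (p := p) k _ _ _ a) _) _

theorem columnCoeff_mul_loop (a : AShriek k n) : columnCoeff k n (a * loop k n) = 0 := by
  change repUp k (a * loop k n) 0 (last n) = 0
  rw [map_mul, repUp, rep_loop, mul_zero]; rfl

theorem rowCoeff_loop_mul (a : AShriek k n) : rowCoeff k n (loop k n * a) = 0 := by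
  change repDown k (loop k n * a) (last n) 0 = 0
  rw [map_mul, repDown, rep_loop, zero_mul]; rfl

theorem columnCoeff_upPath : columnCoeff k n (upPath k n 0 (n - 1)) = 1 := by
  change repUp k (upPath k n 0 (n - 1)) 0 (last n) = 1
  have := repUp_upPath k (n - 1) (0 : Fin n) (last n) (by simp [last])
  rw [show ((0 : Fin n) : ℕ) = 0 from rfl] at this
  rw [this]; simp

theorem rowCoeff_downPath : rowCoeff k n (downPath k n 0 (n - 1)) = 1 := by
  change repDown k (downPath k n 0 (n - 1)) (last n) 0 = 1
  have := repDown_downPath k (n - 1) (0 : Fin n) (last n) (by simp [last])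
  rw [show ((0 : Fin n) : ℕ) = 0 from rfl] at this
  rw [this]; simp

theorem vertex_zero : vertex k (0 : Fin n) = ve k n 0 := by
  rw [ve, dif_pos (NeZero.pos n)]; rfl

theorem vertex_last : vertex k (last n) = ve k n (n - 1) := by
  rw [ve, dif_pos (Nat.sub_lt (NeZero.pos n) one_pos)]; rfl

/-- A path starting at the first vertex cannot descend, so of the spanning paths only the full
ascent runs from the first vertex to the last. Hence `(1)A(n)` is a line, and `columnCoeff` is a
coordinate on it. -/
theorem vertex_mul_mul_vertex_column (a : AShriek k n) :
    ∃ c : k, vertex k 0 * a * vertex k (last n) = c • upPath k n 0 (n - 1) := by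
  have ha : a ∈ pathSpan k n := by rw [pathSpan_eq_top]; trivial
  change a ∈ Submodule.span k _ at ha
  induction ha using Submodule.span_induction with
  | zero => exact ⟨0, by simp⟩
  | add x y _ _ hx hy =>
    obtain ⟨c, hc⟩ := hx
    obtain ⟨c', hc'⟩ := hy
    exact ⟨c + c', by rw [mul_add, add_mul, hc, hc', add_smul]⟩
  | smul r x _ hx =>
    obtain ⟨c, hc⟩ := hx
    exact ⟨r * c, by rw [mul_smul_comm, smul_mul_assoc, hc, smul_smul]⟩
  | mem x hx =>
    obtain ⟨⟨m, l, l'⟩, rfl⟩ := hx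
    simp only [vertex_zero, vertex_last]
    rw [← mul_assoc, ve_mul_downPath]
    split_ifs with h
    · obtain ⟨rfl, rfl⟩ : m = 0 ∧ l = 0 := by omega
      rw [mul_assoc, upPath_mul_ve]
      split_ifs with h'
      · obtain rfl : l' = n - 1 := by omega
        exact ⟨1, by rw [downPath, ve_mul_upPath, if_pos rfl, one_smul]⟩
      · exact ⟨0, by simp⟩
    · exact ⟨0, by simp⟩

/-- The mirror image: a spanning path that ends at the first vertex has no ascending part. -/
theorem vertex_mul_mul_vertex_row (a : AShriek k n) :
    ∃ c : k, vertex k (last n) * a * vertex k 0 = c • downPath k n 0 (n - 1) := by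
  have ha : a ∈ pathSpan k n := by rw [pathSpan_eq_top]; trivial
  change a ∈ Submodule.span k _ at ha
  induction ha using Submodule.span_induction with
  | zero => exact ⟨0, by simp⟩
  | add x y _ _ hx hy =>
    obtain ⟨c, hc⟩ := hx
    obtain ⟨c', hc'⟩ := hy
    exact ⟨c + c', by rw [mul_add, add_mul, hc, hc', add_smul]⟩
  | smul r x _ hx =>
    obtain ⟨c, hc⟩ := hx
    exact ⟨r * c, by rw [mul_smul_comm, smul_mul_assoc, hc, smul_smul]⟩
  | mem x hx =>
    obtain ⟨⟨m, l, l'⟩, rfl⟩ := hx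
    simp only [vertex_zero, vertex_last]
    rw [mul_assoc, mul_assoc, upPath_mul_ve]
    split_ifs with h
    · obtain ⟨rfl, rfl⟩ : m = 0 ∧ l' = 0 := by omega
      rw [← mul_assoc, ve_mul_downPath]
      split_ifs with h'
      · obtain rfl : l = n - 1 := by omega
        refine ⟨1, ?_⟩
        rw [upPath, downPath_mul_ve, if_pos rfl, one_smul]
      · exact ⟨0, by simp⟩
    · exact ⟨0, by simp⟩

theorem vertex_mul_downPath : vertex k (last n) * downPath k n 0 (n - 1) = downPath k n 0 (n - 1) := by
  rw [vertex_last, ve_mul_downPath, if_pos (by omega)]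

theorem downPath_mul_vertex : downPath k n 0 (n - 1) * vertex k 0 = downPath k n 0 (n - 1) := by
  rw [vertex_zero, downPath_mul_ve, if_pos rfl]

theorem eq_zero_of_rowCoeff {a : AShriek k n} (h1 : vertex k (last n) * a = a)
    (h2 : a * vertex k 0 = a) (h : rowCoeff k n a = 0) : a = 0 := by
  obtain ⟨c, hc⟩ := vertex_mul_mul_vertex_row k a
  rw [h1, h2] at hc
  rw [hc, map_smul, rowCoeff_downPath, smul_eq_mul, mul_one] at h
  rw [hc, h, zero_smul]

theorem eq_zero_of_columnCoeff {a : AShriek k n} (h1 : vertex k 0 * a = a)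
    (h2 : a * vertex k (last n) = a) (h : columnCoeff k n a = 0) : a = 0 := by
  obtain ⟨c, hc⟩ := vertex_mul_mul_vertex_column k a
  rw [h1, h2] at hc
  rw [hc, map_smul, columnCoeff_upPath, smul_eq_mul, mul_one] at h
  rw [hc, h, zero_smul]

/-- The product stays in the line `(n)A(1)`, where `rowCoeff` is faithful, and `rowCoeff` kills
multiples of the loop. The vanishing of the differential of the descending path is seen in the same
way. -/
theorem loop_mul_downPath : loop k n * downPath k n 0 (n - 1) = 0 :=
  eq_zero_of_rowCoeff k (by rw [← mul_assoc, vertex_mul_loop])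
    (by rw [mul_assoc, downPath_mul_vertex]) (rowCoeff_loop_mul k _)

theorem d_downPath {p : ℕ} [hp : Fact p.Prime] [CharP k p] :
    PDGAlgebra.d (p := p) (k := k) (downPath k n 0 (n - 1)) = 0 := by
  refine eq_zero_of_rowCoeff k ?_ ?_ (rowCoeff_d k _)
  · have := PDGAlgebra.d_mul (p := p) (k := k) (vertex k (last n)) (downPath k n 0 (n - 1))
    rw [vertex_mul_downPath, d_vertex, zero_mul, zero_add] at this
    exact this.symm
  · have := PDGAlgebra.d_mul (p := p) (k := k) (downPath k n 0 (n - 1)) (vertex k 0)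
    rw [downPath_mul_vertex, d_vertex, mul_zero, add_zero] at this
    exact this.symm

end Representation
end AShriek
end PDG

namespace PDG

/-! ### Identities in the algebra with relation `d x = x d + x ^ 2` -/

section Jordan

variable {k R : Type u} [Field k] [Ring R] [Algebra k R]

/-- The element `d + c x`. -/
def shiftD (d x : R) (c : k) : R := d + c • x

theorem shiftD_zero (d x : R) : shiftD d x (0 : k) = d := by simp [shiftD]

/-- With `θ = x⁻¹ d` formally, `θ x = x (θ + 1)` and `d + c x = x (θ + c)`. Both sides become `x ^ 2
(θ + a + 1) (θ + b)`, since the polynomials in `θ` commute. -/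
theorem shiftD_exchange {d x : R} (h : d * x = x * d + x * x) (a b : k) :
    shiftD d x a * shiftD d x b = shiftD d x (b - 1) * shiftD d x (a + 1) := by
  simp only [shiftD, mul_add, add_mul, mul_smul_comm, smul_mul_assoc, h]
  module

/-- `D ^ m (d + m x) = d ^ (m + 1)` where `D = d - x`. -/
theorem shiftD_neg_one_pow_mul {d x : R} (h : d * x = x * d + x * x) (m : ℕ) :
    shiftD d x (-1 : k) ^ m * shiftD d x (m : k) = d ^ (m + 1) := by
  induction m with
  | zero => simp [shiftD]
  | succ m ih =>
    rw [pow_succ, mul_assoc, shiftD_exchange h, neg_add_cancel, shiftD_zero, ← mul_assoc]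
    simp only [Nat.cast_succ, add_sub_cancel_right]
    rw [ih, ← pow_succ]

/-- In characteristic `p`, taking `j = p - m - 1` gives `(d - x)^(p-m) = (d + m x) d^(p-m-1)`. The
case `m = 0` says that `d - x` and `d` have the same `p`-th power. -/
theorem shiftD_neg_one_pow_succ {d x : R} (h : d * x = x * d + x * x) (j : ℕ) :
    shiftD d x (-1 : k) ^ (j + 1) = shiftD d x (-((j : k) + 1)) * d ^ j := by
  induction j with
  | zero => simp
  | succ j ih =>
    rw [pow_succ', ih, ← mul_assoc, shiftD_exchange h, neg_add_cancel, shiftD_zero, mul_assoc,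
      ← pow_succ']
    congr 2
    push_cast
    ring

/-- The ordered product `(d + c (l-1) x) ⋯ (d + c 0 x)`. -/
def shiftProd (d x : R) (c : ℕ → k) : ℕ → R
  | 0 => 1
  | l + 1 => shiftD d x (c l) * shiftProd d x c l

theorem shiftProd_succ' (d x : R) (c : ℕ → k) (l : ℕ) :
    shiftProd d x c (l + 1) = shiftProd d x (fun i => c (i + 1)) l * shiftD d x (c 0) := by
  induction l with
  | zero => simp [shiftProd]
  | succ l ih =>
    rw [shiftProd, ih, shiftProd, mul_assoc]

theorem shiftProd_congr (d x : R) {c c' : ℕ → k} {l : ℕ} (h : ∀ i < l, c i = c' i) :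
    shiftProd d x c l = shiftProd d x c' l := by
  induction l with
  | zero => rfl
  | succ l ih =>
    rw [shiftProd, shiftProd, h l (Nat.lt_succ_self l), ih fun i hi => h i (Nat.lt_succ_of_lt hi)]

theorem shiftProd_add (d x : R) (c : ℕ → k) (m l : ℕ) :
    shiftProd d x c (m + l) = shiftProd d x (fun i => c (m + i)) l * shiftProd d x c m := by
  induction l with
  | zero => simp [shiftProd]
  | succ l ih => rw [← Nat.add_assoc, shiftProd, ih, shiftProd, mul_assoc]

theorem shiftProd_const (d x : R) (c : k) (l : ℕ) :
    shiftProd d x (fun _ => c) l = shiftD d x c ^ l := by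
  induction l with
  | zero => rw [shiftProd, pow_zero]
  | succ l ih => rw [shiftProd, ih, pow_succ']

/-- The element which would be `x ^ l * θ ^ i` if `x` were invertible and `θ = x⁻¹ d`; it makes sense
for `i ≤ l`. -/
def eulerMonomial (d x : R) : ℕ → ℕ → R
  | 0, l => x ^ l
  | _ + 1, 0 => 0
  | i + 1, l + 1 => d * eulerMonomial d x i l - (l : R) * eulerMonomial d x i (l + 1)

/-- The restriction `i ≤ l` is where `x ^ l θ ^ i` makes sense without inverting `x`. The value of
`eulerMonomial` at positive `i` and `l = 0` is a placeholder. -/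
theorem mul_eulerMonomial {d x : R} (h : d * x = x * d + x * x) (i : ℕ) :
    ∀ l, i ≤ l → x * eulerMonomial d x i l = eulerMonomial d x i (l + 1) := by
  induction i with
  | zero => intro l _; simp [eulerMonomial, pow_succ']
  | succ i ih =>
    intro l hl
    obtain ⟨l, rfl⟩ : ∃ m, l = m + 1 := ⟨l - 1, by omega⟩
    rw [eulerMonomial, eulerMonomial, mul_sub, ← mul_assoc, ← mul_assoc,
      (Nat.commute_cast x l).eq, mul_assoc _ x, ih _ (by omega), eq_sub_of_add_eq h.symm, sub_mul,
      mul_assoc d, mul_assoc x x, ih _ (by omega), ih _ (by omega)]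
    push_cast
    noncomm_ring

/-- Extends `eulerMonomial` linearly to polynomials in `θ`. -/
noncomputable def eulerOp (d x : R) (l : ℕ) : Polynomial k →ₗ[k] R :=
  Polynomial.lsum fun i => LinearMap.toSpanSingleton k R (eulerMonomial d x i l)

theorem eulerOp_monomial (d x : R) (l i : ℕ) (a : k) :
    eulerOp d x l (Polynomial.monomial i a) = a • eulerMonomial d x i l := by
  simp [eulerOp, Polynomial.lsum_apply]

theorem eulerOp_one (d x : R) (l : ℕ) : eulerOp d x l (1 : Polynomial k) = x ^ l := by
  rw [← Polynomial.monomial_zero_one, eulerOp_monomial, one_smul, eulerMonomial]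

open Polynomial in
-- This is `x (θ + c) x ^ l q(θ) = x ^ (l + 1) (θ + l + c) q(θ)`, from `θ x ^ l = x ^ l (θ + l)`.
-- Iterating it in `shiftProd_eq` turns ordered products in the noncommutative algebra into products
-- of commuting linear polynomials.
theorem shiftD_mul_eulerOp {d x : R} (h : d * x = x * d + x * x) (c : k) (l : ℕ) (q : k[X])
    (hq : q.natDegree ≤ l) :
    shiftD d x c * eulerOp d x l q = eulerOp d x (l + 1) ((X + C ((l : k) + c)) * q) := by
  rw [q.as_sum_range' (l + 1) (by omega), map_sum, Finset.mul_sum, Finset.mul_sum, map_sum]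
  refine Finset.sum_congr rfl fun i hi => ?_
  have hi : i ≤ l := by simpa [Nat.lt_succ_iff] using hi
  rw [add_mul, X_mul_monomial, C_mul_monomial, map_add, eulerOp_monomial, eulerOp_monomial,
    eulerOp_monomial, eulerMonomial, shiftD, add_mul, smul_mul_assoc, mul_smul_comm,
    mul_smul_comm, mul_eulerMonomial h i l hi, ← nsmul_eq_mul, ← Nat.cast_smul_eq_nsmul k]
  module

open Polynomial in
theorem shiftProd_eq {d x : R} (h : d * x = x * d + x * x) (c : ℕ → k) (l : ℕ) :
    shiftProd d x c l = eulerOp d x l (∏ i ∈ Finset.range l, (X + C ((i : k) + c i))) := by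
  induction l with
  | zero => simp [shiftProd, eulerOp_one]
  | succ l ih =>
    rw [shiftProd, ih, shiftD_mul_eulerOp h, Finset.prod_range_succ_comm]
    refine (natDegree_prod_le _ _).trans ((Finset.sum_le_card_nsmul _ _ 1 ?_).trans (by simp))
    intro i _
    rw [natDegree_X_add_C]

open Polynomial in
theorem prod_X_add_natCast (p : ℕ) [hp : Fact p.Prime] [CharP k p] :
    ∏ i ∈ Finset.range p, (X + C (i : k)) = X ^ p - X := by
  have h1 : (X ^ p - X : (ZMod p)[X]) = ∏ a : ZMod p, (X - C a) := by
    have := FiniteField.X_pow_card_sub_X_natDegree_eq (ZMod p) hp.out.one_lt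
    have hr := FiniteField.roots_X_pow_card_sub_X (ZMod p)
    rw [ZMod.card] at hr
    have hm : (X ^ p - X : (ZMod p)[X]).Monic :=
      monic_X_pow_sub (by rw [degree_X]; exact_mod_cast hp.out.one_lt)
    have := prod_multiset_X_sub_C_of_monic_of_roots_card_eq hm
      (by rw [hr, this]; simp)
    rw [← this, hr]
    rfl
  have h2 : (X ^ p - X : (ZMod p)[X]) = ∏ i ∈ Finset.range p, (X + C (i : ZMod p)) := by
    rw [h1]
    symm
    refine Finset.prod_bij (fun i _ => -(i : ZMod p)) (fun _ _ => Finset.mem_univ _) ?_ ?_ ?_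
    · intro i hi j hj hij
      have := (ZMod.natCast_eq_natCast_iff _ _ _).1 (neg_injective hij)
      exact Nat.ModEq.eq_of_lt_of_lt this (Finset.mem_range.1 hi) (Finset.mem_range.1 hj)
    · intro b _
      exact ⟨(-b).val, Finset.mem_range.2 (ZMod.val_lt _), by simp⟩
    · intro i _
      simp
  have := congrArg (Polynomial.map (ZMod.castHom (dvd_refl p) k)) h2
  rw [Polynomial.map_prod] at this
  simp only [Polynomial.map_sub, Polynomial.map_pow, Polynomial.map_add, map_X, map_C,
    ZMod.castHom_apply, ZMod.cast_natCast (dvd_refl p)] at this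
  exact this.symm

open Polynomial in
-- The constants in the product are all residues modulo `p` except `m - 1`. So multiplying by `X +
-- (m - 1)` yields `X ^ p - X`, which by Frobenius equals `(X + m - 1) ^ p - (X + m - 1)`; cancel
-- the factor.
theorem pow_prime_sub_one_eq (p : ℕ) [hp : Fact p.Prime] [CharP k p] (m : ℕ) (hm : m ≤ p - 1) :
    (X + C ((m : k) - 1)) ^ (p - 1)
      = (∏ i ∈ Finset.range (p - 1), (X + C ((i : k) + if i < m then -1 else 0))) + 1 := by
  have hp1 := hp.out.one_lt
  have hne : (X + C ((m : k) - 1)) ≠ 0 := (monic_X_add_C _).ne_zero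
  refine mul_left_cancel₀ hne ?_
  rw [← pow_succ', Nat.sub_add_cancel hp1.le, mul_add, mul_one, add_pow_char, ← C_pow]
  have hfrob : ((m : k) - 1) ^ p = (m : k) - 1 := by
    rw [sub_pow_char, one_pow, ← frobenius_def, map_natCast]
  have hprod : (X + C ((m : k) - 1)) *
      (∏ i ∈ Finset.range (p - 1), (X + C ((i : k) + if i < m then -1 else 0))) = X ^ p - X := by
    rw [← prod_X_add_natCast (k := k) p]
    obtain ⟨q, hq⟩ : ∃ q, p = q + 1 := ⟨p - 1, by omega⟩
    have hc : ((q : k) : k) = -1 := by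
      have := CharP.cast_eq_zero k p
      rw [hq] at this
      push_cast at this
      exact eq_neg_of_add_eq_zero_left this
    rw [show p - 1 = q by omega]
    rw [hq]
    obtain ⟨r, rfl⟩ : ∃ r, q = m + r := ⟨q - m, by omega⟩
    rw [Finset.prod_range_add, show m + r + 1 = m + (r + 1) by ring, Finset.prod_range_add]
    have e2 : ∀ i ∈ Finset.range r, (X + C (((m + i : ℕ) : k) + if m + i < m then -1 else 0) : k[X])
        = X + C ((m + i : ℕ) : k) := fun i _ => by simp
    rw [Finset.prod_congr rfl e2, Finset.prod_range_succ, hc]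
    have e1 : (X + C ((m : k) - 1)) *
        (∏ i ∈ Finset.range m, (X + C ((i : k) + if i < m then -1 else 0)))
          = (X + C (-1)) * ∏ i ∈ Finset.range m, (X + C (i : k)) := by
      have : ∀ i ∈ Finset.range m, (X + C ((i : k) + if i < m then -1 else 0) : k[X])
          = X + C ((i : k) - 1) := fun i hi => by
        rw [if_pos (Finset.mem_range.1 hi), sub_eq_add_neg]
      rw [Finset.prod_congr rfl this, mul_comm, ← Finset.prod_range_succ
        (fun i : ℕ => (X + C ((i : k) - 1) : k[X])), Finset.prod_range_succ', mul_comm]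
      simp
    rw [← mul_assoc, e1]
    ring
  rw [hprod, hfrob, C_sub]
  ring

/-- In characteristic `p` the product `(d + (m+1-p) x) ⋯ (d + (m-1) x)` equals
`d ^ (p-1-m) (d - x) ^ m + x ^ (p-1)`. -/
theorem shiftProd_descending {d x : R} (h : d * x = x * d + x * x) (p : ℕ) [hp : Fact p.Prime]
    [CharP k p] (m : ℕ) (hm : m ≤ p - 1) :
    shiftProd d x (fun i => (m : k) - 1 - i) (p - 1)
      = d ^ (p - 1 - m) * shiftD d x (-1 : k) ^ m + x ^ (p - 1) := by
  have h1 : d ^ (p - 1 - m) * shiftD d x (-1 : k) ^ m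
      = shiftProd d x (fun i => if i < m then (-1 : k) else 0) (p - 1) := by
    obtain ⟨r, hr⟩ : ∃ r, p - 1 = m + r := ⟨p - 1 - m, by omega⟩
    rw [hr, shiftProd_add, ← shiftProd_const, Nat.add_sub_cancel_left]
    congr 1
    · simp only [Nat.not_lt.2 (Nat.le_add_right _ _), if_false]
      rw [shiftProd_const, shiftD_zero]
    · exact shiftProd_congr _ _ fun i hi => by rw [if_pos hi]
  rw [h1, shiftProd_eq h, shiftProd_eq h, ← eulerOp_one (k := k), ← map_add,
    ← pow_prime_sub_one_eq p m hm]
  congr 1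
  -- The constants descend at the rate at which moving past `x` raises them, so every factor becomes
  -- `θ + m - 1`.
  rw [Finset.prod_congr rfl (g := fun _ => (Polynomial.X + Polynomial.C ((m : k) - 1)))
    (fun i _ => by congr 2; ring), Finset.prod_const, Finset.card_range]

end Jordan

/-! ### Acyclicity of `d - x` by induction on the degree -/

section GradedExact

variable {k V : Type u} [Field k] [AddCommGroup V] [Module k V] {N : ℤ → Submodule k V}

theorem pow_mem_of_degree_two {d : Module.End k V} (hd : ∀ i, ∀ u ∈ N i, d u ∈ N (i + 2)) (a : ℕ)
    {i j : ℤ} {u : V} (hu : u ∈ N i) (hj : j = i + 2 * a) : (d ^ a) u ∈ N j := by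
  subst hj
  induction a with
  | zero => simpa using hu
  | succ a ih =>
    rw [pow_succ', Module.End.mul_apply]
    have := hd _ _ ih
    convert this using 2
    push_cast
    ring

/-- The argument of `AcyclicOn.exact` with degrees recorded. It uses primitives only of cocycles of
degree at most `i + 2 (a - 1)`, and this bound makes an induction on the degree possible. -/
theorem exists_pow_eq_of_degree_lt {p : ℕ} {d : Module.End k V}
    (hd : ∀ i, ∀ u ∈ N i, d u ∈ N (i + 2)) (e : ℤ)
    (hacy : ∀ i j : ℤ, i < e → j + 2 * (p - 1) = i → ∀ u ∈ N i, d u = 0 →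
      ∃ v ∈ N j, (d ^ (p - 1)) v = u)
    (a : ℕ) (ha : a ≤ p) {i j : ℤ} (hi : i + 2 * (a - 1) < e) (hj : j + 2 * (p - a) = i) {u : V}
    (hu : u ∈ N i) (h0 : (d ^ a) u = 0) : ∃ v ∈ N j, (d ^ (p - a)) v = u := by
  induction a generalizing u i j with
  | zero => exact ⟨0, zero_mem _, by rw [map_zero]; simpa using h0.symm⟩
  | succ a ih =>
    push_cast at hi hj
    obtain ⟨w, hw, hwu⟩ := hacy (i + 2 * a) (i + 2 * a - 2 * (p - 1)) (by linarith) (by ring)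
      ((d ^ a) u) (pow_mem_of_degree_two hd a hu rfl) (by rw [← h0, pow_succ', Module.End.mul_apply])
    have hw' : (d ^ (p - 1 - a)) w ∈ N i := by
      refine pow_mem_of_degree_two hd _ hw ?_
      have : ((p - 1 - a : ℕ) : ℤ) = p - 1 - a := by omega
      rw [this]
      ring
    obtain ⟨v, hv, hvu⟩ := ih (by omega) (i := i) (j := j - 2) (by linarith) (by linarith)
      (u := u - (d ^ (p - 1 - a)) w) (sub_mem hu hw') (by
        rw [map_sub, ← Module.End.mul_apply, ← pow_add, Nat.add_sub_cancel' (by omega), hwu,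
          sub_self])
    refine ⟨w + d v, add_mem ?_ ?_, ?_⟩
    · convert hw using 2; linarith
    · have := hd _ _ hv
      rwa [sub_add_cancel] at this
    · rw [show p - (a + 1) = p - 1 - a by omega, map_add, ← Module.End.mul_apply _ d, ← pow_succ,
        show p - 1 - a + 1 = p - a by omega, hvu]
      abel

/-- If `d x = x d + x ^ 2` and `x ^ (p - 1) = 0`, then acyclicity for `d` implies acyclicity for
`d - x`, as soon as the latter holds in all sufficiently small degrees. -/
theorem acyclic_sub_of_acyclic (p : ℕ) [hp : Fact p.Prime] [CharP k p] {d x : Module.End k V}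
    (h : d * x = x * d + x * x)
    (hd : ∀ i, ∀ u ∈ N i, d u ∈ N (i + 2)) (hx : ∀ i, ∀ u ∈ N i, x u ∈ N (i + 2))
    (hxp : ∀ i, ∀ u ∈ N i, (x ^ (p - 1)) u = 0)
    (hacy : ∀ i j : ℤ, j + 2 * (p - 1) = i → ∀ u ∈ N i, d u = 0 →
      ∃ v ∈ N j, (d ^ (p - 1)) v = u) (e₀ : ℤ)
    (hlow : ∀ i j : ℤ, i < e₀ → j + 2 * (p - 1) = i → ∀ u ∈ N i, (d - x) u = 0 →
      ∃ v ∈ N j, ((d - x) ^ (p - 1)) v = u) :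
    ∀ i j : ℤ, j + 2 * (p - 1) = i → ∀ u ∈ N i, (d - x) u = 0 →
      ∃ v ∈ N j, ((d - x) ^ (p - 1)) v = u := by
  have hp1 := hp.out.one_lt
  have hD : shiftD d x (-1 : k) = d - x := by simp [shiftD, sub_eq_add_neg]
  have hDd : ∀ i, ∀ u ∈ N i, (d - x) u ∈ N (i + 2) := fun i u hu => sub_mem (hd i u hu) (hx i u hu)
  have hcd : ∀ c : k, ∀ i, ∀ u ∈ N i, shiftD d x c u ∈ N (i + 2) := fun c i u hu =>
    add_mem (hd i u hu) (Submodule.smul_mem _ _ (hx i u hu))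
  suffices H : ∀ s : ℕ, ∀ i j : ℤ, i < e₀ + s → j + 2 * (p - 1) = i → ∀ u ∈ N i, (d - x) u = 0 →
      ∃ v ∈ N j, ((d - x) ^ (p - 1)) v = u by
    intro i j
    exact H (i - e₀ + 1).toNat i j (by have := Int.self_le_toNat (i - e₀ + 1); omega)
  intro s
  induction s with
  | zero => intro i j hi; exact hlow i j (by simpa using hi)
  | succ s ih =>
    intro i j hi hj u hu hu0
    -- Write `u = d (d + x) ⋯ (d + (m - 1) x) c` with more and more factors. At `m = p - 1` the
    -- product is `(d - x)^(p-1)`, by `shiftProd_descending` and `x^(p-1) = 0`, so `c` is the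
    -- required primitive.
    have key : ∀ m : ℕ, m ≤ p - 1 → ∃ c ∈ N (i - 2 * m),
        shiftProd d x (fun l : ℕ => (m : k) - 1 - l) m c = u := by
      intro m
      induction m with
      | zero => exact fun _ => ⟨u, by simpa using hu, rfl⟩
      | succ m ihm =>
        intro hm
        obtain ⟨c, hc, hcu⟩ := ihm (by omega)
        -- Up to `x^(p-1) c = 0` this operator is the product of `p - 1` factors. Its first `m`
        -- factors carry `c` to `u`, and the next one is `d - x`, which kills `u`.
        have h1 : ((d ^ (p - 1 - m)) (((d - x) ^ m) c)) = 0 := by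
          have h2 := congrArg (fun f : Module.End k V => f c)
            (shiftProd_descending (k := k) h p m (by omega))
          simp only [LinearMap.add_apply, Module.End.mul_apply, hxp _ _ hc, add_zero, hD] at h2
          rw [← h2, show p - 1 = m + (1 + (p - 2 - m)) by omega, shiftProd_add, shiftProd_add]
          simp only [Module.End.mul_apply]
          rw [hcu, shiftProd, shiftProd, mul_one]
          have : ((m : k) - 1 - ((m + 0 : ℕ) : k)) = -1 := by push_cast; ring
          rw [this, hD, hu0, map_zero]
        have hDm : ((d - x) ^ m) c ∈ N i := pow_mem_of_degree_two hDd m hc (by ring)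
        -- Acyclicity of `d` gives `d^(m+1) c' = (d - x)^m c`. As `d^(m+1) = (d - x)^m (d + m x)`,
        -- the difference `c - (d + m x) c'` is killed by `(d - x)^m`.
        obtain ⟨c', hc', hcc⟩ := exists_pow_eq_of_degree_lt (p := p) hd (i + 2 * p)
          (fun i j _ => hacy i j) (p - 1 - m) (by omega) (i := i) (j := i - 2 * (m + 1))
          (by omega) (by omega) hDm h1
        rw [show p - (p - 1 - m) = m + 1 by omega] at hcc
        have hI1 := congrArg (fun f : Module.End k V => f c') (shiftD_neg_one_pow_mul (k := k) h m)
        simp only [Module.End.mul_apply, hD] at hI1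
        -- The primitives needed here concern `d - x` in degrees at most `i - 2`, which the outer
        -- induction provides. Since `(d - x)^(p-m) y = (d + m x) d^(p-m-1) y`, the whole of `c` is
        -- divisible by the next factor `d + m x`.
        obtain ⟨y, hy, hyc⟩ := exists_pow_eq_of_degree_lt (p := p) hDd (e₀ + s) ih m (by omega)
          (i := i - 2 * m) (j := i - 2 * p) (by push_cast at hi; omega) (by ring)
          (u := c - shiftD d x (m : k) c')
          (sub_mem hc (by
            have := hcd (m : k) _ _ hc'
            convert this using 2
            ring))
          (by rw [map_sub, hI1, hcc, sub_self])
        have hI2 := congrArg (fun f : Module.End k V => f y)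
          (shiftD_neg_one_pow_succ (k := k) h (p - m - 1))
        simp only [Module.End.mul_apply, hD] at hI2
        rw [show p - m - 1 + 1 = p - m by omega, hyc] at hI2
        have hcast : -(((p - m - 1 : ℕ) : k) + 1) = m := by
          have h3 : ((p - m - 1 + 1 + m : ℕ) : k) = 0 := by
            rw [show p - m - 1 + 1 + m = p by omega, CharP.cast_eq_zero]
          push_cast at h3
          rw [neg_eq_iff_add_eq_zero, h3]
        rw [hcast] at hI2
        refine ⟨c' + (d ^ (p - m - 1)) y, add_mem ?_ ?_, ?_⟩
        · convert hc' using 2; push_cast; ring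
        · exact pow_mem_of_degree_two hd _ hy (by push_cast; omega)
        · rw [shiftProd_succ', Module.End.mul_apply]
          have h4 : shiftD d x (((m + 1 : ℕ) : k) - 1 - ((0 : ℕ) : k)) = shiftD d x (m : k) := by
            congr 1; push_cast; ring
          rw [h4, map_add, ← hI2, add_sub_cancel, ← hcu]
          exact congrArg (fun f : Module.End k V => f c) (shiftProd_congr d x fun l _ => by
            push_cast
            ring)
    obtain ⟨c, hc, hcu⟩ := key (p - 1) le_rfl
    refine ⟨c, by convert hc using 2; omega, ?_⟩
    have := congrArg (fun f : Module.End k V => f c)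
      (shiftProd_descending (k := k) h p (p - 1) le_rfl)
    simp only [LinearMap.add_apply, Module.End.mul_apply, hxp _ _ hc, add_zero, hD,
      Nat.sub_self, pow_zero, Module.End.one_apply] at this
    rw [← this, hcu]

end GradedExact
end PDG

namespace PDG

/-! ### Right exactness of the tensor product -/

section RightExact

variable {p : ℕ} {k B : Type u} [Field k] [Ring B] [Algebra k B] [PDGAlgebra p k B]

theorem rtmul_add_right (X : RMod p k B) (Y : LMod p k B) (x : X) (y y' : Y) :
    rtmul X Y x (y + y') = rtmul X Y x y + rtmul X Y x y' := by
  rw [rtmul, TensorProduct.tmul_add, map_add]; rfl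

theorem rtmul_add_left (X : RMod p k B) (Y : LMod p k B) (x x' : X) (y : Y) :
    rtmul X Y (x + x') y = rtmul X Y x y + rtmul X Y x' y := by
  rw [rtmul, TensorProduct.add_tmul, map_add]; rfl

theorem rtmul_smul_right (X : RMod p k B) (Y : LMod p k B) (c : k) (x : X) (y : Y) :
    rtmul X Y x (c • y) = c • rtmul X Y x y := by
  rw [rtmul, TensorProduct.tmul_smul, map_smul]; rfl

theorem rtmul_zero_right (X : RMod p k B) (Y : LMod p k B) (x : X) : rtmul X Y x 0 = 0 := by
  rw [rtmul, TensorProduct.tmul_zero, map_zero]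

theorem rtmul_zero_left (X : RMod p k B) (Y : LMod p k B) (y : Y) : rtmul X Y 0 y = 0 := by
  rw [rtmul, TensorProduct.zero_tmul, map_zero]

/-- Right exactness of the tensor product. -/
theorem rmap_exact (X : RMod p k B) {Y' Y Y'' : LMod p k B} (f : LLin Y' Y) (g : LLin Y Y'')
    (hg : Function.Surjective g.lin) (hfg : ∀ y, g.lin y = 0 ↔ ∃ y', f.lin y' = y)
    (t : rtens X Y) :
    rmap (RLin.id X) g t = 0 ↔ ∃ s, rmap (RLin.id X) f s = t := by
  constructor
  · intro ht
    obtain ⟨σ, hσ⟩ := LinearMap.exists_rightInverse_of_surjective g.lin (LinearMap.range_eq_top.2 hg)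
    have hσ : ∀ y, g.lin (σ y) = y := fun y => LinearMap.congr_fun hσ y
    let R := LinearMap.range (rmap (RLin.id X) f)
    have hR : ∀ x y, g.lin y = 0 → rtmul X Y x y ∈ R := by
      intro x y hy
      obtain ⟨y', rfl⟩ := (hfg y).1 hy
      exact ⟨rtmul X Y' x y', rfl⟩
    -- The section `σ` is only linear over `k`. Its failure to commute with `B` lies in the kernel
    -- of `g`, hence in the image of `f`, so the induced map is balanced modulo `R`.
    let φ : rtens X Y'' →ₗ[k] rtens X Y ⧸ R :=
      rlift (R.mkQ ∘ₗ (rbal X Y).mkQ ∘ₗ LinearMap.lTensor X σ) (fun x b y => by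
        change R.mkQ (rtmul X Y (X.ract (op b) x) (σ y)) = R.mkQ (rtmul X Y x (σ (Y''.lact b y)))
        rw [rtmul_balanced, ← sub_eq_zero, ← map_sub]
        refine (Submodule.Quotient.mk_eq_zero _).2 ?_
        have : rtmul X Y x (Y.lact b (σ y)) - rtmul X Y x (σ (Y''.lact b y))
            = rtmul X Y x (Y.lact b (σ y) - σ (Y''.lact b y)) := by
          rw [sub_eq_iff_eq_add, ← rtmul_add_right, sub_add_cancel]
        rw [this]
        exact hR _ _ (by rw [map_sub, g.map_lact, hσ, hσ, sub_self]))
    have hφ : φ ∘ₗ rmap (RLin.id X) g = R.mkQ := rtens_ext fun x y => by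
      change R.mkQ (rtmul X Y x (σ (g.lin y))) = R.mkQ (rtmul X Y x y)
      rw [← sub_eq_zero, ← map_sub]
      refine (Submodule.Quotient.mk_eq_zero _).2 ?_
      have : rtmul X Y x (σ (g.lin y)) - rtmul X Y x y = rtmul X Y x (σ (g.lin y) - y) := by
        rw [sub_eq_iff_eq_add, ← rtmul_add_right, sub_add_cancel]
      rw [this]
      exact hR _ _ (by rw [map_sub, hσ, sub_self])
    have := LinearMap.congr_fun hφ t
    rw [LinearMap.comp_apply, ht, map_zero] at this
    exact (Submodule.Quotient.mk_eq_zero _).1 this.symm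
  · rintro ⟨s, rfl⟩
    have : rmap (RLin.id X) g ∘ₗ rmap (RLin.id X) f = 0 := rtens_ext fun x y => by
      rw [LinearMap.comp_apply, rmap_tmul, rmap_tmul, (hfg _).2 ⟨y, rfl⟩, rtmul_zero_right]
      rfl
    exact LinearMap.congr_fun this s

end RightExact

/-! ### The algebra `k[x]/(x ^ n)` and its lowering operator -/

namespace TruncPoly

variable {k : Type u} [Field k] {n : ℕ}

theorem induction {motive : TruncPoly k n → Prop} (x : motive (x k n))
    (algebraMap : ∀ r, motive (algebraMap k _ r))
    (add : ∀ a b, motive a → motive b → motive (a + b))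
    (mul : ∀ a b, motive a → motive b → motive (a * b)) (c : TruncPoly k n) : motive c := by
  have ha : c ∈ Algebra.adjoin k (Set.range fun _ : Unit => TruncPoly.x k n) := by
    rw [adjoin_x]; trivial
  induction ha using Algebra.adjoin_induction with
  | mem y hy => obtain ⟨_, rfl⟩ := hy; exact x
  | algebraMap r => exact algebraMap r
  | add a b _ _ ha hb => exact add a b ha hb
  | mul a b _ _ ha hb => exact mul a b ha hb

theorem pow_eq_zero {j : ℕ} (h : n ≤ j) : x k n ^ j = 0 := by
  rw [← Nat.sub_add_cancel h, pow_add, x_pow, mul_zero]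

theorem mk_eq_zero_iff (f : Polynomial k) :
    (Ideal.Quotient.mk (Ideal.span {(Polynomial.X : Polynomial k) ^ n}) f = 0) ↔ ∀ j < n, f.coeff j = 0 := by
  rw [Ideal.Quotient.eq_zero_iff_mem, Ideal.mem_span_singleton, Polynomial.X_pow_dvd_iff]

theorem mk_eq_aeval (f : Polynomial k) :
    Ideal.Quotient.mk (Ideal.span {(Polynomial.X : Polynomial k) ^ n}) f
      = Polynomial.aeval (x k n) f := by
  induction f using Polynomial.induction_on' with
  | add a b ha hb => rw [map_add, map_add, ha, hb]
  | monomial j a =>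
    rw [Polynomial.aeval_monomial, ← Polynomial.C_mul_X_pow_eq_monomial, map_mul, map_pow]
    rfl

theorem linearIndependent_pow : LinearIndependent k fun j : Fin n => x k n ^ (j : ℕ) := by
  rw [Fintype.linearIndependent_iff]
  intro g hg i
  have h : Polynomial.aeval (x k n) (∑ j : Fin n, Polynomial.monomial (j : ℕ) (g j)) = 0 := by
    rw [map_sum, ← hg]
    refine Finset.sum_congr rfl fun j _ => ?_
    rw [Polynomial.aeval_monomial]
    exact (Algebra.smul_def _ _).symm
  rw [← mk_eq_aeval, mk_eq_zero_iff] at h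
  have := h i i.2
  rw [Polynomial.finsetSum_coeff, Finset.sum_eq_single i] at this
  · simpa using this
  · intro j _ hj
    rw [Polynomial.coeff_monomial, if_neg (fun h => hj (Fin.ext h))]
  · simp

theorem span_pow : ⊤ ≤ Submodule.span k (Set.range fun j : Fin n => x k n ^ (j : ℕ)) := by
  rintro c -
  obtain ⟨f, rfl⟩ := Ideal.Quotient.mk_surjective c
  rw [mk_eq_aeval, Polynomial.aeval_eq_sum_range]
  refine Submodule.sum_mem _ fun j _ => Submodule.smul_mem _ _ ?_
  by_cases hj : j < n
  · exact Submodule.subset_span ⟨⟨j, hj⟩, rfl⟩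
  · rw [pow_eq_zero (not_lt.1 hj)]
    exact zero_mem _

variable (k n) in
/-- The basis of powers of `x`. -/
noncomputable def powBasis : Module.Basis (Fin n) k (TruncPoly k n) :=
  Module.Basis.mk linearIndependent_pow span_pow

theorem powBasis_apply (j : Fin n) : powBasis k n j = x k n ^ (j : ℕ) := by
  rw [powBasis, Module.Basis.mk_apply]

theorem linearMap_ext {W : Type*} [AddCommGroup W] [Module k W] {f g : TruncPoly k n →ₗ[k] W}
    (h : ∀ j < n, f (x k n ^ j) = g (x k n ^ j)) : f = g :=
  (powBasis k n).ext fun j => by rw [powBasis_apply]; exact h j j.2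

variable (k n) in
/-- The map `x ^ (j + 1) ↦ - x ^ j` for `j + 1 < n`, `1 ↦ 0`. -/
noncomputable def lower : Module.End k (TruncPoly k n) :=
  (powBasis k n).constr k fun j => if (j : ℕ) = 0 then 0 else (-1 : k) • x k n ^ ((j : ℕ) - 1)

theorem lower_pow {j : ℕ} (hj : j < n) :
    lower k n (x k n ^ j) = if j = 0 then 0 else (-1 : k) • x k n ^ (j - 1) := by
  have := (powBasis k n).constr_basis k
    (fun j : Fin n => if (j : ℕ) = 0 then 0 else (-1 : k) • x k n ^ ((j : ℕ) - 1)) ⟨j, hj⟩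
  rwa [powBasis_apply] at this

variable {p : ℕ} [hp : Fact p.Prime] [CharP k p]

theorem d_gen : PDGAlgebra.d (p := p) (k := k) (x k n) = x k n ^ 2 := by
  change (η k n (x k n)).snd = _
  rw [η_x]
  simp

theorem d_pow (j : ℕ) :
    PDGAlgebra.d (p := p) (k := k) (x k n ^ j) = (j : k) • x k n ^ (j + 1) := by
  induction j with
  | zero => simpa using PDGBimod.d_one
  | succ j ih =>
    rw [pow_succ, PDGAlgebra.d_mul, ih, d_gen, smul_mul_assoc, ← pow_succ, ← pow_add,
      Nat.cast_succ, add_smul, one_smul]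

/-- `[d, lower] = 1 - aug` when `n ≡ 1` modulo `p`. -/
theorem d_lower_sub (h : (n : k) = 1) {j : ℕ} (hj : j < n) :
    PDGAlgebra.d (p := p) (k := k) (lower k n (x k n ^ j))
      - lower k n (PDGAlgebra.d (p := p) (k := k) (x k n ^ j))
      = if j = 0 then 0 else x k n ^ j := by
  rw [d_pow, map_smul, lower_pow hj]
  split_ifs with h0
  · subst h0; simp
  · rw [map_smul, d_pow, Nat.sub_add_cancel (Nat.pos_of_ne_zero h0),
      Nat.cast_sub (Nat.pos_of_ne_zero h0), Nat.cast_one]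
    by_cases hj' : j + 1 < n
    · rw [lower_pow hj', if_neg (Nat.succ_ne_zero j), Nat.add_sub_cancel]
      module
    -- The top power is the only place where `n` matters. Its differential vanishes by truncation,
    -- and this agrees with the rule `d x ^ j = j x ^ (j + 1)` for lower powers because `n - 1 = 0`
    -- in `k`.
    · have hj1 : n = j + 1 := by omega
      have h2 : (j : k) = 0 := by
        rw [hj1] at h; push_cast at h; exact add_eq_right.1 h
      rw [pow_eq_zero (by omega : n ≤ j + 1), map_zero, smul_zero, h2]
      module

/-- `[d + x, lower] = 1` when `p` divides `n`. -/
theorem d_add_lower_sub (h : (n : k) = 0) (hn : 2 ≤ n) {j : ℕ} (hj : j < n) :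
    (PDGAlgebra.d (p := p) (k := k) (lower k n (x k n ^ j)) + x k n * lower k n (x k n ^ j))
      - lower k n (PDGAlgebra.d (p := p) (k := k) (x k n ^ j) + x k n * x k n ^ j)
      = x k n ^ j := by
  rw [d_pow, ← pow_succ', map_add, map_smul, lower_pow hj]
  split_ifs with h0
  · subst h0; rw [lower_pow (by omega)]; simp
  · rw [map_smul, d_pow, mul_smul_comm, ← pow_succ', Nat.sub_add_cancel (Nat.pos_of_ne_zero h0),
      Nat.cast_sub (Nat.pos_of_ne_zero h0), Nat.cast_one]
    by_cases hj' : j + 1 < n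
    · rw [lower_pow hj', if_neg (Nat.succ_ne_zero j), Nat.add_sub_cancel]
      module
    -- For `d + x` the coefficient at the top power is `n` in place of `n - 1`, so now `p` has to
    -- divide `n`.
    · have hj1 : n = j + 1 := by omega
      have h2 : (j : k) = -1 := by
        rw [hj1] at h; push_cast at h; exact eq_neg_of_add_eq_zero_left h
      rw [pow_eq_zero (by omega : n ≤ j + 1), map_zero, smul_zero, h2]
      module

/-- If `n ≡ 1` modulo `p`, then for any module `Y` over `k[x]/(x ^ n)` the kernel of the action map
`k[x]/(x ^ n) ⊗ Y → Y` is acyclic. -/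
theorem acyclicOn_ker_lift (h : (n : k) = 1) {Y : Type u} [AddCommGroup Y] [Module k Y]
    (ℓ : TruncPoly k n →ₐ[k] Module.End k Y) (dY : Module.End k Y)
    (hℓ : ∀ c y, dY (ℓ c y) = ℓ (PDGAlgebra.d (p := p) (k := k) c) y + ℓ c (dY y)) :
    AcyclicOn p (LinearMap.rTensor Y (PDGAlgebra.d (p := p) (k := k) (A := TruncPoly k n))
      + LinearMap.lTensor (TruncPoly k n) dY) (LinearMap.ker (TensorProduct.lift ℓ.toLinearMap)) := by
  set m := TensorProduct.lift ℓ.toLinearMap with hm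
  have hmt : ∀ c y, m (c ⊗ₜ y) = ℓ c y := fun c y => TensorProduct.lift.tmul _ _
  let ι : Y →ₗ[k] TruncPoly k n ⊗[k] Y := TensorProduct.mk k _ _ 1
  -- Subtracting `1 ⊗ m(-)` makes the lowering operator preserve the kernel of the action map `m`.
  -- Its commutator with the total differential is then `t ↦ t - 1 ⊗ m t`, the identity on that
  -- kernel.
  let S : Module.End k (TruncPoly k n ⊗[k] Y) :=
    LinearMap.rTensor Y (lower k n) - ι ∘ₗ m ∘ₗ LinearMap.rTensor Y (lower k n)
  have hS : ∀ c y, S (c ⊗ₜ y) = lower k n c ⊗ₜ y - 1 ⊗ₜ ℓ (lower k n c) y := fun c y => by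
    change lower k n c ⊗ₜ y - 1 ⊗ₜ m (lower k n c ⊗ₜ y) = _
    rw [hmt]
  have key : ∀ t, (LinearMap.rTensor Y (PDGAlgebra.d (p := p) (k := k) (A := TruncPoly k n))
      + LinearMap.lTensor (TruncPoly k n) dY) (S t)
      - S ((LinearMap.rTensor Y (PDGAlgebra.d (p := p) (k := k) (A := TruncPoly k n))
      + LinearMap.lTensor (TruncPoly k n) dY) t) = t - 1 ⊗ₜ m t := by
    intro t
    induction t using TensorProduct.induction_on with
    | zero => simp
    | add a b ha hb =>
      simp only [map_add, TensorProduct.tmul_add] at *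
      rw [add_sub_add_comm, ha, hb, add_sub_add_comm]
    | tmul c y =>
      have hc : (PDGAlgebra.d (p := p) (k := k) (lower k n c)
          - lower k n (PDGAlgebra.d (p := p) (k := k) c)) ⊗ₜ[k] y
          - 1 ⊗ₜ[k] ℓ (PDGAlgebra.d (p := p) (k := k) (lower k n c)
          - lower k n (PDGAlgebra.d (p := p) (k := k) c)) y
          = c ⊗ₜ y - 1 ⊗ₜ ℓ c y := by
        have : ∀ c : TruncPoly k n, ∀ f g : TruncPoly k n →ₗ[k] TruncPoly k n ⊗[k] Y,
          f = g → f c = g c := fun c f g h => by rw [h]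
        let T : TruncPoly k n →ₗ[k] TruncPoly k n ⊗[k] Y :=
          (TensorProduct.mk k (TruncPoly k n) Y).flip y
            - TensorProduct.mk k (TruncPoly k n) Y 1 ∘ₗ (ℓ.toLinearMap.flip y)
        refine this c (T ∘ₗ (PDGAlgebra.d (p := p) ∘ₗ lower k n - lower k n ∘ₗ PDGAlgebra.d (p := p)))
          T (linearMap_ext fun j hj => ?_)
        change T (PDGAlgebra.d (p := p) (k := k) (lower k n (x k n ^ j))
          - lower k n (PDGAlgebra.d (p := p) (k := k) (x k n ^ j))) = _
        rw [d_lower_sub h hj]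
        split_ifs with h0
        · subst h0
          simp [T]
        · rfl
      rw [hmt, ← hc, hS, map_sub]
      simp only [LinearMap.add_apply, LinearMap.rTensor_tmul, LinearMap.lTensor_tmul, map_add, hS,
        hℓ, TensorProduct.sub_tmul, TensorProduct.tmul_sub, TensorProduct.tmul_add,
        LinearMap.sub_apply, map_sub, PDGBimod.d_one, TensorProduct.zero_tmul]
      abel
  refine AcyclicOn.of_commutator (s := S) ?_ ?_
  · intro t _
    have : m ∘ₗ S = 0 := TensorProduct.ext' fun c y => by
      rw [LinearMap.comp_apply, hS, map_sub, hmt, hmt, map_one]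
      simp
    exact LinearMap.congr_fun this t
  · intro t ht
    rw [key, LinearMap.mem_ker.1 ht, TensorProduct.tmul_zero, sub_zero]

end TruncPoly

/-! ### Modules over `k[x]/(x ^ n)` and induction from `k[x]/(x ^ a)` -/

section TruncModules

theorem tensor_d_mul {p : ℕ} {k : Type u} [Field k] {Λ V : Type u} [Ring Λ] [Algebra k Λ] [PDGAlgebra p k Λ] [AddCommGroup V]
    [Module k V] (d : Module.End k V) (x : Λ) (hx : PDGAlgebra.d (p := p) (k := k) x = x ^ 2)
    (t : Λ ⊗[k] V) :
    (LinearMap.rTensor V (PDGAlgebra.d (p := p) (k := k) (A := Λ)) + LinearMap.lTensor Λ d)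
      (LinearMap.rTensor V (LinearMap.mulLeft k x) t)
    = LinearMap.rTensor V (LinearMap.mulLeft k x)
      ((LinearMap.rTensor V (PDGAlgebra.d (p := p) (k := k) (A := Λ)) + LinearMap.lTensor Λ d) t)
      + LinearMap.rTensor V (LinearMap.mulLeft k x)
        (LinearMap.rTensor V (LinearMap.mulLeft k x) t) := by
  induction t using TensorProduct.induction_on with
  | zero => simp
  | add a b ha hb => simp only [map_add, ha, hb]; abel
  | tmul c v =>
    simp only [LinearMap.add_apply, LinearMap.rTensor_tmul, LinearMap.lTensor_tmul,
      LinearMap.mulLeft_apply, PDGAlgebra.d_mul, hx, TensorProduct.add_tmul, map_add, pow_two,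
      mul_assoc]
    abel

variable {p : ℕ} [hp : Fact p.Prime] {k : Type u} [Field k] [CharP k p] {n : ℕ}

theorem lift_leibniz {V : Type u} [AddCommGroup V] [Module k V] (d x : Module.End k V)
    (hx : x ^ n = 0) (h : ∀ v, d (x v) = x (d v) + x (x v)) (b : TruncPoly k n) : ∀ v,
    d (TruncPoly.lift x hx b v) = TruncPoly.lift x hx (PDGAlgebra.d (p := p) (k := k) b) v
      + TruncPoly.lift x hx b (d v) := by
  induction b using TruncPoly.induction with
  | x => intro v; rw [TruncPoly.lift_x, TruncPoly.d_gen, map_pow, TruncPoly.lift_x, h, add_comm]; rfl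
  | algebraMap r =>
    intro v
    rw [Algebra.algebraMap_eq_smul_one, map_smul, map_smul, PDGBimod.d_one]
    simp
  | add a b ha hb =>
    intro v
    simp only [map_add, LinearMap.add_apply, ha, hb]
    abel
  | mul a b ha hb =>
    intro v
    simp only [map_mul, PDGAlgebra.d_mul, map_add, LinearMap.add_apply, Module.End.mul_apply,
      ha, hb]
    abel

/-- A module over `k[x]/(x ^ n)` given by the action of `x`. -/
noncomputable abbrev LMod.ofX (n : ℕ) {V : Type u} [AddCommGroup V] [Module k V] (d x : Module.End k V)
    (hx : x ^ n = 0) (h : ∀ v, d (x v) = x (d v) + x (x v)) (hd : d ^ p = 0) :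
    LMod p k (TruncPoly k n) where
  carrier := V
  lact := TruncPoly.lift x hx
  d := d
  d_lact := lift_leibniz d x hx h
  d_pow := hd

theorem LMod.ofX_x {V : Type u} [AddCommGroup V] [Module k V] {d x : Module.End k V}
    {hx : x ^ n = 0} {h : ∀ v, d (x v) = x (d v) + x (x v)} {hd : d ^ p = 0} (v : V) :
    (LMod.ofX n d x hx h hd).lact (TruncPoly.x k n) v = x v := by
  change TruncPoly.lift x hx (TruncPoly.x k n) v = _
  rw [TruncPoly.lift_x]

/-- A linear map commuting with `x` is a morphism of modules over `k[x]/(x ^ n)`. -/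
noncomputable abbrev LLin.ofX {Y Y' : LMod p k (TruncPoly k n)} (f : Y →ₗ[k] Y')
    (hf : ∀ y, f (Y.lact (TruncPoly.x k n) y) = Y'.lact (TruncPoly.x k n) (f y)) : LLin Y Y' where
  lin := f
  map_lact b := by
    induction b using TruncPoly.induction with
    | x => exact hf
    | algebraMap r => intro y; simp [Algebra.algebraMap_eq_smul_one]
    | add a b ha hb => intro y; simp only [map_add, LinearMap.add_apply, ha, hb]
    | mul a b ha hb => intro y; simp only [map_mul, Module.End.mul_apply, ha, hb]

/-- A complex as a module on which `x` acts by zero. -/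
noncomputable abbrev LMod.triv (n : ℕ) [NeZero n] {V : Type u} [AddCommGroup V] [Module k V]
    (d : Module.End k V) (hd : d ^ p = 0) : LMod p k (TruncPoly k n) :=
  LMod.ofX n d 0 (zero_pow (NeZero.ne n)) (by simp) hd

theorem lift_tensor_d {p : ℕ} {k : Type u} [Field k] {Λ V : Type u} [Ring Λ] [Algebra k Λ]
    [PDGAlgebra p k Λ] [AddCommGroup V] [Module k V] (ℓ : Λ →ₐ[k] Module.End k V)
    (d : Module.End k V)
    (hℓ : ∀ c y, d (ℓ c y) = ℓ (PDGAlgebra.d (p := p) (k := k) c) y + ℓ c (d y)) (t : Λ ⊗[k] V) :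
    TensorProduct.lift ℓ.toLinearMap
      ((LinearMap.rTensor V (PDGAlgebra.d (p := p) (k := k) (A := Λ)) + LinearMap.lTensor Λ d) t)
    = d (TensorProduct.lift ℓ.toLinearMap t) := by
  induction t using TensorProduct.induction_on with
  | zero => simp
  | add a b ha hb => simp only [map_add, ha, hb]
  | tmul c y =>
    simp only [LinearMap.add_apply, LinearMap.rTensor_tmul, LinearMap.lTensor_tmul, map_add,
      TensorProduct.lift.tmul, AlgHom.toLinearMap_apply, hℓ]

theorem tensor_d_pow {Λ V : Type u} [AddCommGroup Λ] [Module k Λ] [AddCommGroup V] [Module k V]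
    {dΛ : Module.End k Λ} {d : Module.End k V} (hΛ : dΛ ^ p = 0) (hd : d ^ p = 0) :
    (LinearMap.rTensor V dΛ + LinearMap.lTensor Λ d) ^ p = 0 := by
  have hcomm : Commute (LinearMap.rTensor V dΛ) (LinearMap.lTensor Λ d) := by
    ext x y; simp
  rw [add_pow_prime_of_commute hp.out hcomm, LinearMap.rTensor_pow, LinearMap.lTensor_pow, hΛ, hd]
  simp

theorem tensor_mulLeft_pow {Λ V : Type u} [Ring Λ] [Algebra k Λ] [AddCommGroup V] [Module k V]
    {x : Λ} (hx : x ^ n = 0) :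
    LinearMap.rTensor V (LinearMap.mulLeft k x) ^ n = 0 := by
  rw [LinearMap.rTensor_pow, LinearMap.pow_mulLeft, hx, LinearMap.mulLeft_zero_eq_zero,
    LinearMap.rTensor_zero]

/-- The module `k[x]/(x ^ a) ⊗ V` over `k[x]/(x ^ n)`, where `a ≤ n`. -/
noncomputable abbrev LMod.ind (n a : ℕ) (ha : a ≤ n) {V : Type u} [AddCommGroup V] [Module k V]
    (d : Module.End k V) (hd : d ^ p = 0) : LMod p k (TruncPoly k n) :=
  LMod.ofX n (V := TruncPoly k a ⊗[k] V)
    (LinearMap.rTensor V (PDGAlgebra.d (p := p) (k := k) (A := TruncPoly k a))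
      + LinearMap.lTensor (TruncPoly k a) d)
    (LinearMap.rTensor V (LinearMap.mulLeft k (TruncPoly.x k a)))
    (tensor_mulLeft_pow (TruncPoly.pow_eq_zero ha))
    (tensor_d_mul d _ TruncPoly.d_gen) (tensor_d_pow PDGAlgebra.d_pow hd)

/-- The action of `k[x]/(x ^ a)` on a module over `k[x]/(x ^ n)` killed by `x ^ a`. -/
noncomputable def LMod.descend (Y : LMod p k (TruncPoly k n)) {a : ℕ}
    (hY : ∀ y, Y.lact (TruncPoly.x k n ^ a) y = 0) : TruncPoly k a →ₐ[k] Module.End k Y :=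
  TruncPoly.lift (Y.lact (TruncPoly.x k n)) (by rw [← map_pow]; exact LinearMap.ext hY)

theorem LMod.descend_x (Y : LMod p k (TruncPoly k n)) {a : ℕ}
    (hY : ∀ y, Y.lact (TruncPoly.x k n ^ a) y = 0) :
    Y.descend hY (TruncPoly.x k a) = Y.lact (TruncPoly.x k n) := TruncPoly.lift_x k a _ _

theorem LMod.d_x (Y : LMod p k (TruncPoly k n)) (y : Y) :
    Y.d (Y.lact (TruncPoly.x k n) y) = Y.lact (TruncPoly.x k n) (Y.d y)
      + Y.lact (TruncPoly.x k n) (Y.lact (TruncPoly.x k n) y) := by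
  rw [Y.d_lact, TruncPoly.d_gen, map_pow, pow_two, add_comm]; rfl

/-- The action map. -/
noncomputable abbrev LMod.counit (Y : LMod p k (TruncPoly k n)) {a : ℕ} (ha : a ≤ n)
    (hY : ∀ y, Y.lact (TruncPoly.x k n ^ a) y = 0) : LLin (LMod.ind n a ha Y.d Y.d_pow) Y :=
  LLin.ofX (TensorProduct.lift (Y.descend hY).toLinearMap) (fun t => by
    rw [LMod.ofX_x]
    induction t using TensorProduct.induction_on with
    | zero => simp
    | add a b ha hb => simp only [map_add, ha, hb]
    | tmul c y =>
      rw [LinearMap.rTensor_tmul, TensorProduct.lift.tmul, TensorProduct.lift.tmul,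
        LinearMap.mulLeft_apply, AlgHom.toLinearMap_apply, AlgHom.toLinearMap_apply, map_mul,
        LMod.descend_x]
      rfl)

theorem LMod.descend_d (Y : LMod p k (TruncPoly k n)) {a : ℕ}
    (hY : ∀ y, Y.lact (TruncPoly.x k n ^ a) y = 0) (c : TruncPoly k a) (y : Y) :
    Y.d (Y.descend hY c y) = Y.descend hY (PDGAlgebra.d (p := p) (k := k) c) y
      + Y.descend hY c (Y.d y) :=
  lift_leibniz Y.d _ _ Y.d_x c y

theorem LMod.counit_isChain (Y : LMod p k (TruncPoly k n)) {a : ℕ} (ha : a ≤ n)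
    (hY : ∀ y, Y.lact (TruncPoly.x k n ^ a) y = 0) : (Y.counit ha hY).IsChain :=
  lift_tensor_d (Y.descend hY) Y.d (Y.descend_d hY)

theorem LMod.counit_surjective (Y : LMod p k (TruncPoly k n)) {a : ℕ} (ha : a ≤ n)
    (hY : ∀ y, Y.lact (TruncPoly.x k n ^ a) y = 0) : Function.Surjective (Y.counit ha hY).lin :=
  fun y => ⟨(1 : TruncPoly k a) ⊗ₜ y, by
    rw [TensorProduct.lift.tmul, AlgHom.toLinearMap_apply, map_one]; rfl⟩

/-- The induced module remembers only the complex underlying `Y`. So when `a = 1` in `k`, a module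
killed by `x ^ a` and the trivial module on the same complex yield the same cohomology after
tensoring with a good module. -/
theorem LMod.counit_acyclicOn (Y : LMod p k (TruncPoly k n)) {a : ℕ} (ha : a ≤ n)
    (hY : ∀ y, Y.lact (TruncPoly.x k n ^ a) y = 0) (h : (a : k) = 1) :
    AcyclicOn p (LMod.ind n a ha Y.d Y.d_pow).d (LinearMap.ker (Y.counit ha hY).lin) :=
  TruncPoly.acyclicOn_ker_lift h (Y.descend hY) Y.d (Y.descend_d hY)

end TruncModules
end PDG

namespace PDG

/-! ### Finiteness and dimension arguments for a nilpotent operator -/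

section TwoStep

variable {p : ℕ} {k V W : Type u} [Field k] [AddCommGroup V] [Module k V] [AddCommGroup W]
  [Module k W]

theorem restrict_pow_apply_coe {d : Module.End k V} {N : Submodule k V} (hN : ∀ u ∈ N, d u ∈ N)
    (a : ℕ) (u : N) : ((((d.restrict hN) ^ a) u : N) : V) = (d ^ a) u :=
  map_pow_apply (f := N.subtype) (fun _ => rfl) a u

/-- If `ε v = 1` then `δ v` lies in the kernel of `ε` and is killed by `δ^(p-1)`. By exactness there
it equals `δ w` for some `w` in the kernel, and `v - w` is the cocycle. -/
theorem exists_cocycle_of_acyclic_ker [hp : Fact p.Prime] {δ : Module.End k V} {ε : V →ₗ[k] k}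
    (hε : ∀ v, ε (δ v) = 0) (h1 : ∃ v, ε v = 1) (hacy : AcyclicOn p δ (LinearMap.ker ε))
    (hδ : δ ^ p = 0) : ∃ v, ε v = 1 ∧ δ v = 0 := by
  obtain ⟨v, hv⟩ := h1
  obtain ⟨w, hw, hwv⟩ := hacy.exact (fun u _ => hε u) (a := p - 1) (by omega) (δ v) (hε v)
    (by rw [← Module.End.mul_apply, ← pow_succ, Nat.sub_add_cancel hp.out.one_lt.le, hδ]; rfl)
  rw [Nat.sub_sub_self hp.out.one_lt.le, pow_one] at hwv
  exact ⟨v - w, by rw [map_sub, hv, LinearMap.mem_ker.1 hw, sub_zero], by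
    rw [map_sub, hwv, sub_self]⟩

/-- Let `R = im x`. The sequence `R → V → W` with `δ₁` yields a connecting map `H_1(W) → H_(p-1)(R)`
that is onto with non-zero kernel. The sequence `W → V → R`, with `x ^ (n - 1)` and `x` as maps and
`δ₂` in the middle, yields a map `H_(p-1)(R) → H_1(W)` that is onto. Finite dimensions would have to
satisfy contradictory inequalities. The relation `δ₁ x = x δ₂` gives `R` the same differential in
both sequences. -/
theorem not_finite_coh_of_two_step [hp : Fact p.Prime] {n : ℕ} {x δ₁ δ₂ : Module.End k V}
    {δW : Module.End k W} {ρ : V →ₗ[k] W} {ε : V →ₗ[k] k}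
    (hker : ∀ v, x v = 0 ↔ ∃ w, (x ^ (n - 1)) w = v)
    (hker' : ∀ v, (x ^ (n - 1)) v = 0 ↔ ∃ w, x w = v)
    (h12 : ∀ v, δ₁ (x v) = x (δ₂ v)) (h21 : ∀ v, δ₂ ((x ^ (n - 1)) v) = (x ^ (n - 1)) (δ₁ v))
    (h1p : δ₁ ^ p = 0) (h2p : δ₂ ^ p = 0) (hρ : Function.Surjective ρ)
    (hρx : ∀ v, ρ v = 0 ↔ ∃ w, x w = v) (hρd : ∀ v, ρ (δ₁ v) = δW (ρ v))
    (hεx : ∀ v, ε (x v) = 0) (hεd : ∀ v, ε (δ₁ v) = 0) (hε1 : ∃ v, ε v = 1)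
    (hacy : AcyclicOn p δ₁ (LinearMap.ker ε))
    (hlast : ∀ v, δ₂ ((x ^ (n - 1)) v) = 0 → ∃ w, (δ₂ ^ (p - 1)) w = (x ^ (n - 1)) v) :
    ¬ Module.Finite k (Coh p δW 1) := by
  intro hfin
  have hp1 := hp.out.one_lt
  have hR : ∀ u ∈ LinearMap.range x, δ₁ u ∈ LinearMap.range x := by
    rintro _ ⟨v, rfl⟩
    exact ⟨δ₂ v, (h12 v).symm⟩
  obtain ⟨v₀, hv₀, hdv₀⟩ := exists_cocycle_of_acyclic_ker hεd hε1 hacy h1p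
  have hA := Coh.finrank_lt (dV := δ₁.restrict hR) (dW := δ₁) (dZ := δW)
    (i := (LinearMap.range x).subtype) (q := ρ) (fun _ => rfl) hρd Subtype.val_injective hρ
    (fun w => (hρx w).trans ⟨fun ⟨v, hv⟩ => ⟨⟨w, v, hv⟩, rfl⟩, fun ⟨v, hv⟩ => by
      obtain ⟨⟨_, v', rfl⟩, rfl⟩ := v, hv
      exact ⟨v', rfl⟩⟩) (a := 1) hp1.le h1p
    (by
      rintro ⟨_, v, rfl⟩ hv
      have h0 := congrArg Subtype.val hv
      rw [restrict_pow_apply_coe] at h0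
      obtain ⟨w, _, hw⟩ := hacy.exact (fun u _ => hεd u) (a := p - 1) (by omega) (x v) (hεx v) h0
      rw [Nat.sub_sub_self hp1.le] at hw
      exact ⟨w, hw⟩)
    (w₀ := v₀) (by rw [pow_one, hdv₀])
    (by
      intro z hz
      obtain ⟨z, rfl⟩ := hρ z
      -- If the class of `v₀` were a coboundary, `v₀` would be `δ₁^(p-1)` of something modulo `im
      -- x`. As `p - 1 > 0`, applying `ε` gives `1 = 0`.
      rw [← map_pow_apply hρd, ← sub_eq_zero, ← map_sub, hρx] at hz
      obtain ⟨w, hw⟩ := hz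
      have h3 := congrArg ε hw
      obtain ⟨q, hq⟩ : ∃ q, p - 1 = q + 1 := ⟨p - 2, by omega⟩
      rw [hεx, map_sub, hv₀, hq, pow_succ', Module.End.mul_apply, hεd, zero_sub] at h3
      exact one_ne_zero (neg_eq_zero.1 h3.symm))
    hfin
  obtain ⟨hAf, hAlt⟩ := hA
  -- the map `W → V` induced by `x ^ (n - 1)`
  obtain ⟨σ, hσ⟩ := LinearMap.exists_rightInverse_of_surjective ρ (LinearMap.range_eq_top.2 hρ)
  have hσ : ∀ w, ρ (σ w) = w := fun w => LinearMap.congr_fun hσ w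
  let ι : W →ₗ[k] V := (x ^ (n - 1)) ∘ₗ σ
  have hι : ∀ v, ι (ρ v) = (x ^ (n - 1)) v := by
    intro v
    rw [← sub_eq_zero]
    change (x ^ (n - 1)) (σ (ρ v)) - _ = 0
    rw [← map_sub, hker', ← hρx, map_sub, hσ, sub_self]
  have hιd : ∀ w, ι (δW w) = δ₂ (ι w) := by
    intro w
    obtain ⟨v, rfl⟩ := hρ w
    rw [← hρd, hι, hι, h21]
  -- The connecting map is onto because `hlast` makes every cocycle coming from `W` a coboundary in
  -- the middle term.
  have hB := Coh.finrank_le (dV := δW) (dW := δ₂) (dZ := δ₁.restrict hR) (i := ι)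
    (q := x.rangeRestrict) hιd (fun w => Subtype.ext (h12 w).symm)
    (by
      rw [← LinearMap.ker_eq_bot, LinearMap.ker_eq_bot']
      intro w hw
      obtain ⟨v, rfl⟩ := hρ w
      rwa [hι, hker', ← hρx] at hw)
    x.surjective_rangeRestrict
    (fun w => by
      have : x.rangeRestrict w = 0 ↔ x w = 0 := by
        rw [← Subtype.coe_inj]; rfl
      rw [this, hker]
      constructor
      · rintro ⟨v, hv⟩; exact ⟨ρ v, by rw [hι, hv]⟩
      · rintro ⟨v, hv⟩
        obtain ⟨v, rfl⟩ := hρ v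
        exact ⟨v, by rw [← hι, hv]⟩) (a := p - 1) (by omega) h2p
    (by
      intro w hw
      rw [Nat.sub_sub_self hp1.le, pow_one] at hw
      obtain ⟨v, rfl⟩ := hρ w
      rw [hι]
      refine hlast v ?_
      rw [← hι, ← hιd, hw, map_zero])
    hAf
  have hcast : ∀ q, q = 1 → Module.finrank k (Coh p δW q) = Module.finrank k (Coh p δW 1) := by
    rintro _ rfl; rfl
  rw [hcast _ (Nat.sub_sub_self hp1.le)] at hB
  exact absurd hAlt (not_lt.2 hB)

/-- Filter `V` by the images of `x ^ j`. Each subquotient is a copy of `W`, and since `δ` commutes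
with `x ^ j` modulo `x ^ (j + 1)` it induces `δW` there. Downward induction from `x ^ n = 0`
finishes. -/
theorem finite_coh_of_nilpotent {n : ℕ} (hp : 1 ≤ p) (hn : 1 ≤ n) {x δ : Module.End k V}
    {δW : Module.End k W} {ρ : V →ₗ[k] W} (hxn : x ^ n = 0)
    (hker' : ∀ v, (x ^ (n - 1)) v = 0 → ∃ w, x w = v)
    (hxd : ∀ j v, ∃ v', δ ((x ^ j) v) = (x ^ j) (δ v) + (x ^ (j + 1)) v') (hδ : δ ^ p = 0)
    (hρ : Function.Surjective ρ) (hρx : ∀ v, ρ v = 0 ↔ ∃ w, x w = v)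
    (hρd : ∀ v, ρ (δ v) = δW (ρ v)) (hfin : Module.Finite k (Coh p δW 1)) :
    Module.Finite k (Coh p δ 1) := by
  have hR : ∀ j, ∀ u ∈ LinearMap.range (x ^ j), δ u ∈ LinearMap.range (x ^ j) := by
    rintro j _ ⟨v, rfl⟩
    obtain ⟨v', hv'⟩ := hxd j v
    exact ⟨δ v + x v', by rw [map_add, hv', pow_succ x j]; rfl⟩
  have key : ∀ m j, j + m = n → 1 ≤ j → Module.Finite k (Coh p (δ.restrict (hR j)) 1) := by
    intro m
    induction m with
    | zero =>
      intro j hj _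
      have : Subsingleton (LinearMap.range (x ^ j)) := by
        rw [show j = n from hj, hxn, LinearMap.range_zero]
        infer_instance
      infer_instance
    | succ m ih =>
      intro j hj hj1
      have ih := ih (j + 1) (by omega) (by omega)
      have hle : LinearMap.range (x ^ (j + 1)) ≤ LinearMap.range (x ^ j) := by
        rintro _ ⟨v, rfl⟩
        exact ⟨x v, by rw [pow_succ]; rfl⟩
      obtain ⟨τ, hτ⟩ := LinearMap.exists_rightInverse_of_surjective (x ^ j).rangeRestrict
        (LinearMap.range_eq_top.2 (x ^ j).surjective_rangeRestrict)
      have hτ : ∀ u : LinearMap.range (x ^ j), (x ^ j) (τ u) = u := fun u =>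
        congrArg Subtype.val (LinearMap.congr_fun hτ u)
      -- This is `x ^ j v ↦ ρ v`; it does not depend on `v`, since the kernel of `x ^ j` with `j ≤ n
      -- - 1` lies in that of `x ^ (n - 1)`, which `ρ` kills.
      let L : LinearMap.range (x ^ j) →ₗ[k] W := ρ ∘ₗ τ
      have hL : ∀ v (u : LinearMap.range (x ^ j)), (u : V) = (x ^ j) v → L u = ρ v := by
        intro v u hu
        rw [← sub_eq_zero]
        change ρ (τ u) - ρ v = 0
        rw [← map_sub, hρx]
        apply hker'
        rw [show n - 1 = (n - 1 - j) + j by omega, pow_add_apply, map_sub (x ^ j), hτ, hu,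
          sub_self, map_zero]
      refine Coh.finite_of_exact (dV := δ.restrict (hR (j + 1))) (dW := δ.restrict (hR j))
        (dZ := δW) (i := Submodule.inclusion hle) (q := L) (fun _ => rfl) ?_
        (Submodule.inclusion_injective hle) ?_ ?_ hp (restrict_pow_eq_zero hδ _) ih hfin
      · rintro ⟨_, v, rfl⟩
        obtain ⟨v', hv'⟩ := hxd j v
        rw [hL v ⟨_, v, rfl⟩ rfl, hL (δ v + x v') _ (by
          rw [map_add, ← Module.End.mul_apply (x ^ j) x, ← pow_succ, ← hv']; rfl), map_add, hρd,
          (hρx (x v')).2 ⟨v', rfl⟩, add_zero]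
      · intro w
        obtain ⟨v, rfl⟩ := hρ w
        exact ⟨⟨_, v, rfl⟩, hL v _ rfl⟩
      · rintro ⟨_, v, rfl⟩
        rw [hL v ⟨_, v, rfl⟩ rfl, hρx]
        constructor
        · rintro ⟨w, rfl⟩
          exact ⟨⟨(x ^ (j + 1)) w, w, rfl⟩, Subtype.ext (by
            change (x ^ (j + 1)) w = (x ^ j) (x w)
            rw [pow_succ]; rfl)⟩
        · rintro ⟨⟨_, w, rfl⟩, hw⟩
          have hw := congrArg Subtype.val hw
          change (x ^ (j + 1)) w = (x ^ j) v at hw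
          obtain ⟨w', hw'⟩ := hker' (x w - v) (by
            rw [show n - 1 = (n - 1 - j) + j by omega, pow_add_apply, map_sub (x ^ j), ← hw, pow_succ]
            simp)
          exact ⟨w - w', by rw [map_sub, hw']; abel⟩
  have hK := key (n - 1) 1 (by omega) le_rfl
  refine Coh.finite_of_exact (dV := δ.restrict (hR 1)) (dW := δ)
    (dZ := δW) (i := (LinearMap.range (x ^ 1)).subtype) (q := ρ) (fun _ => rfl) hρd
    Subtype.val_injective hρ ?_ hp hδ hK hfin
  intro w
  rw [hρx]
  constructor
  · rintro ⟨v, rfl⟩; exact ⟨⟨x v, v, by rw [pow_one]⟩, rfl⟩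
  · rintro ⟨⟨_, v, rfl⟩, rfl⟩; exact ⟨v, by rw [pow_one]; rfl⟩

theorem exists_gproj_eq_zero {gr : ℤ → Submodule k V} (h : DirectSum.IsInternal gr) (u : V) :
    ∃ e : ℤ, ∀ i < e, gproj h i u = 0 := by
  have hu : u ∈ ⨆ i, gr i := by rw [iSup_eq_top_of_isInternal h]; trivial
  induction hu using Submodule.iSup_induction' with
  | mem i u hu => exact ⟨i, fun j hj => by rw [gproj_of_mem h hu, if_neg hj.ne']⟩
  | zero => exact ⟨0, fun _ _ => map_zero _⟩
  | add u v _ _ hu hv =>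
    obtain ⟨e, he⟩ := hu
    obtain ⟨f, hf⟩ := hv
    exact ⟨min e f, fun i hi => by
      rw [map_add, he i (lt_of_lt_of_le hi (min_le_left _ _)),
        hf i (lt_of_lt_of_le hi (min_le_right _ _)), add_zero]⟩

/-- Finitely many classes have representatives whose components all lie in degrees at least `e`. A
homogeneous cocycle of smaller degree differs from such a representative by a coboundary, and
comparing components of its own degree makes it a coboundary. -/
theorem exists_bound_of_finite_coh {gr : ℤ → Submodule k V} (h : DirectSum.IsInternal gr)
    {δ : Module.End k V} (hδ : ∀ i, ∀ u ∈ gr i, δ u ∈ gr (i + 2))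
    (hfin : Module.Finite k (Coh p δ 1)) :
    ∃ e : ℤ, ∀ i j : ℤ, i < e → j + 2 * ((p - 1 : ℕ) : ℤ) = i → ∀ u ∈ gr i, δ u = 0 →
      ∃ v ∈ gr j, (δ ^ (p - 1)) v = u := by
  have key : ∃ e : ℤ, ∀ c ∈ (⊤ : Submodule k (Coh p δ 1)), ∃ u hu, c = Coh.mk p δ 1 u hu ∧
      ∀ i < e, gproj h i u = 0 := by
    refine Submodule.fg_induction (R := k) (M := Coh p δ 1) (motive := fun N _ => ∃ e : ℤ, ∀ c ∈ N, ∃ u hu,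
      c = Coh.mk p δ 1 u hu ∧ ∀ i < e, gproj h i u = 0) ?_ ?_ ⊤ hfin.fg_top
    · intro c
      obtain ⟨u, hu, rfl⟩ := Coh.exists_mk c
      obtain ⟨e, he⟩ := exists_gproj_eq_zero h u
      refine ⟨e, fun c hc => ?_⟩
      obtain ⟨a, rfl⟩ := Submodule.mem_span_singleton.1 hc
      exact ⟨a • u, by rw [map_smul, hu, smul_zero], rfl, fun i hi => by
        rw [map_smul, he i hi, smul_zero]⟩
    · rintro N N' _ _ ⟨e, he⟩ ⟨f, hf⟩
      refine ⟨min e f, fun c hc => ?_⟩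
      obtain ⟨a, ha, b, hb, rfl⟩ := Submodule.mem_sup.1 hc
      obtain ⟨u, hu, rfl, hu'⟩ := he a ha
      obtain ⟨v, hv, rfl, hv'⟩ := hf b hb
      exact ⟨u + v, by rw [map_add, hu, hv, add_zero], rfl, fun i hi => by
        rw [map_add, hu' i (lt_of_lt_of_le hi (min_le_left _ _)),
          hv' i (lt_of_lt_of_le hi (min_le_right _ _)), add_zero]⟩
  obtain ⟨e, he⟩ := key
  refine ⟨e, fun i j hi hj u hu hu0 => ?_⟩
  obtain ⟨w, hw, hcw, hw'⟩ := he (Coh.mk p δ 1 u (by rw [pow_one, hu0])) trivial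
  have h3 : Coh.mk p δ 1 (u - w) (by rw [map_sub, hw, pow_one, hu0, sub_zero]) = 0 := by
    have : Coh.mk p δ 1 (u - w) (by rw [map_sub, hw, pow_one, hu0, sub_zero])
      = Coh.mk p δ 1 u (by rw [pow_one, hu0]) - Coh.mk p δ 1 w hw := rfl
    rw [this, hcw, sub_self]
  obtain ⟨v, hv⟩ := (Coh.mk_eq_zero _).1 h3
  refine ⟨gproj h j v, gproj_mem h j v, ?_⟩
  have hpow : ∀ i, ∀ m ∈ gr i, (δ ^ (p - 1)) m ∈ gr (i + 2 * ((p - 1 : ℕ) : ℤ)) :=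
    fun i m hm => pow_mem_of_degree_two hδ _ hm rfl
  rw [map_gproj h h (δ ^ (p - 1)) _ hpow, hv, hj, map_sub, hw' i hi, sub_zero, gproj_of_mem h hu,
    if_pos rfl]

end TwoStep

/-! ### Good modules over `k[x]/(x ^ n)` -/

section Flat

theorem TruncPoly.lift_mulLeft {k : Type u} [Field k] {n : ℕ} (b c : TruncPoly k n) :
    TruncPoly.lift (LinearMap.mulLeft k (TruncPoly.x k n))
      (by rw [LinearMap.pow_mulLeft, TruncPoly.x_pow, LinearMap.mulLeft_zero_eq_zero]) b c
      = b * c := by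
  induction b using TruncPoly.induction generalizing c with
  | x => rw [TruncPoly.lift_x]; rfl
  | algebraMap r => simp [Algebra.algebraMap_eq_smul_one]
  | add a b ha hb => rw [map_add, LinearMap.add_apply, ha, hb, add_mul]
  | mul a b ha hb => rw [map_mul, Module.End.mul_apply, hb, ha, mul_assoc]

variable {p : ℕ} [hp : Fact p.Prime] {k : Type u} [Field k] [CharP k p] {n : ℕ}

/-- The action of `x` on a right module over `k[x]/(x ^ n)`. -/
noncomputable abbrev RMod.xAct (P : RMod p k (TruncPoly k n)) : Module.End k P :=
  P.ract (op (TruncPoly.x k n))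

theorem RMod.xAct_pow (P : RMod p k (TruncPoly k n)) (j : ℕ) :
    P.xAct ^ j = P.ract (op (TruncPoly.x k n ^ j)) := by
  rw [RMod.xAct, ← map_pow, op_pow]

theorem RMod.xAct_pow_eq_zero (P : RMod p k (TruncPoly k n)) : P.xAct ^ n = 0 := by
  rw [P.xAct_pow, TruncPoly.x_pow, op_zero, map_zero]

theorem RMod.d_xAct (P : RMod p k (TruncPoly k n)) (u : P) :
    P.d (P.xAct u) = P.xAct (P.d u) + P.xAct (P.xAct u) := by
  rw [P.d_ract, TruncPoly.d_gen, ← P.xAct_pow, pow_two]; rfl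

variable [NeZero n]

theorem LMod.triv_x {V : Type u} [AddCommGroup V] [Module k V] {d : Module.End k V}
    {hd : d ^ p = 0} (v : V) : (LMod.triv n d hd).lact (TruncPoly.x k n) v = (0 : V) :=
  LMod.ofX_x v

/-- The ground field as a module over `k[x]/(x ^ n)`. -/
noncomputable abbrev LMod.one (p : ℕ) [hp : Fact p.Prime] (k : Type u) [Field k] [CharP k p] (n : ℕ)
    [NeZero n] : LMod p k (TruncPoly k n) :=
  LMod.triv n (V := k) 0 (zero_pow hp.out.ne_zero)

/-- The map `u ↦ u ⊗ 1`. -/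
noncomputable def RMod.toOne (P : RMod p k (TruncPoly k n)) : P →ₗ[k] rtens P (LMod.one p k n) :=
  (rbal P (LMod.one p k n)).mkQ ∘ₗ (TensorProduct.mk k P k).flip 1

theorem RMod.toOne_apply (P : RMod p k (TruncPoly k n)) (u : P) :
    P.toOne u = rtmul P (LMod.one p k n) u (1 : k) := rfl

theorem RMod.toOne_surjective (P : RMod p k (TruncPoly k n)) : Function.Surjective P.toOne := by
  intro t
  induction t using rtens_induction with
  | zero => exact ⟨0, map_zero _⟩
  | tmul x c =>
    refine ⟨(c : k) • x, ?_⟩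
    rw [map_smul, RMod.toOne_apply, ← rtmul_smul_right]
    congr 1
    exact mul_one (c : k)
  | add s t hs ht =>
    obtain ⟨a, rfl⟩ := hs
    obtain ⟨b, rfl⟩ := ht
    exact ⟨a + b, map_add _ _ _⟩

theorem RMod.toOne_d (P : RMod p k (TruncPoly k n)) (u : P) :
    P.toOne (P.d u) = rtD P (LMod.one p k n) (P.toOne u) := by
  rw [RMod.toOne_apply, RMod.toOne_apply, rtD_tmul]
  change _ = _ + rtmul P (LMod.one p k n) u (0 : k)
  rw [rtmul_zero_right, add_zero]

theorem RMod.toOne_eq_zero (P : RMod p k (TruncPoly k n)) (u : P) :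
    P.toOne u = 0 ↔ ∃ w, P.xAct w = u := by
  constructor
  · intro h
    let R := LinearMap.range P.xAct
    let φ : rtens P (LMod.one p k n) →ₗ[k] P ⧸ R :=
      rlift (R.mkQ ∘ₗ (TensorProduct.rid k P).toLinearMap) (fun u b c => by
        change R.mkQ ((c : k) • P.ract (op b) u) = R.mkQ (((LMod.one p k n).lact b c : k) • u)
        induction b using TruncPoly.induction generalizing u c with
        | x =>
          rw [LMod.triv_x]
          rw [zero_smul, map_zero, ← map_smul]
          exact (Submodule.Quotient.mk_eq_zero _).2 ⟨_, rfl⟩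
        | algebraMap r =>
          have h1 : P.ract (op (algebraMap k _ r)) u = r • u := by
            simp [Algebra.algebraMap_eq_smul_one]
          have h2 : (LMod.one p k n).lact (algebraMap k _ r) c = r • c := by
            simp [Algebra.algebraMap_eq_smul_one]
          rw [h1, h2, smul_smul, mul_comm]
          rfl
        | add a b ha hb =>
          rw [MulOpposite.op_add, map_add, map_add, LinearMap.add_apply, LinearMap.add_apply, smul_add,
            map_add, ha, hb, ← map_add]
          congr 1
          exact (add_smul _ _ _).symm
        | mul a b ha hb =>
          rw [MulOpposite.op_mul, map_mul, map_mul, Module.End.mul_apply, Module.End.mul_apply, hb, ha])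
    have := congrArg φ h
    rw [map_zero] at this
    change R.mkQ ((1 : k) • u) = 0 at this
    rw [one_smul] at this
    exact (Submodule.Quotient.mk_eq_zero _).1 this
  · rintro ⟨w, rfl⟩
    rw [RMod.toOne_apply, rtmul_balanced, LMod.triv_x]
    exact rtmul_zero_right _ _ _

/-- Tensor the injection `k → C`, `1 ↦ x ^ (n - 1)`, with `P`. The element `u ⊗ 1` goes to `u ⊗ x ^
(n - 1) = u x ^ (n - 1) ⊗ 1 = 0`, so it vanishes in `P ⊗_C k = P/Px`. -/
theorem Good.mem_range_xAct {P : RMod p k (TruncPoly k n)} (hP : Good P) {u : P}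
    (hu : (P.xAct ^ (n - 1)) u = 0) : ∃ w, P.xAct w = u := by
  have hn := NeZero.pos n
  let Y : LMod p k (TruncPoly k n) := LMod.ofX n (V := TruncPoly k n) (PDGAlgebra.d (p := p))
    (LinearMap.mulLeft k (TruncPoly.x k n))
    (by rw [LinearMap.pow_mulLeft, TruncPoly.x_pow, LinearMap.mulLeft_zero_eq_zero])
    (fun v => by
      rw [LinearMap.mulLeft_apply, PDGAlgebra.d_mul, TruncPoly.d_gen, add_comm, pow_two, mul_assoc]
      rfl) PDGAlgebra.d_pow
  let f : LLin (LMod.one p k n) Y := LLin.ofX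
    (LinearMap.toSpanSingleton k (TruncPoly k n) (TruncPoly.x k n ^ (n - 1))) (fun y => by
      rw [LMod.triv_x, LMod.ofX_x, LinearMap.mulLeft_apply]
      change (0 : k) • TruncPoly.x k n ^ (n - 1) = _ * ((y : k) • TruncPoly.x k n ^ (n - 1))
      rw [zero_smul, mul_smul_comm, ← pow_succ', Nat.sub_add_cancel hn, TruncPoly.x_pow, smul_zero])
  have hf : Function.Injective f.lin := by
    rw [← LinearMap.ker_eq_bot, LinearMap.ker_eq_bot']
    intro c hc
    change (c : k) • TruncPoly.x k n ^ (n - 1) = 0 at hc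
    have := (TruncPoly.powBasis k n).ne_zero ⟨n - 1, by omega⟩
    rw [TruncPoly.powBasis_apply] at this
    exact (smul_eq_zero.1 hc).resolve_right this
  rw [← P.toOne_eq_zero]
  refine hP.inj f hf ?_
  rw [map_zero, RMod.toOne_apply, rmap_tmul]
  have h1 : f.lin (1 : k) = Y.lact (TruncPoly.x k n ^ (n - 1)) (1 : TruncPoly k n) := by
    refine (one_smul _ _).trans ?_
    exact ((TruncPoly.lift_mulLeft _ _).trans (mul_one _)).symm
  rw [h1, ← rtmul_balanced, ← P.xAct_pow]
  change rtmul P Y ((P.xAct ^ (n - 1)) u) _ = 0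
  rw [hu, rtmul_zero_left]

/-- If `u = x ^ j w` is killed by `x` and `j + 1 ≤ n - 1`, then `x ^ (n - 1) w = 0`, so `w` itself
is divisible by `x`. Repeat until `j = n - 1`. -/
theorem Good.mem_range_xAct_pow {P : RMod p k (TruncPoly k n)} (hP : Good P) {u : P}
    (hu : P.xAct u = 0) : ∃ w, (P.xAct ^ (n - 1)) w = u := by
  suffices H : ∀ j ≤ n - 1, ∃ w, (P.xAct ^ j) w = u from H _ le_rfl
  intro j
  induction j with
  | zero => exact fun _ => ⟨u, rfl⟩
  | succ j ih =>
    intro hj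
    obtain ⟨w, rfl⟩ := ih (by omega)
    obtain ⟨w', rfl⟩ := hP.mem_range_xAct (u := w) (by
      rw [show n - 1 = (n - 1 - (j + 1)) + (j + 1) by omega, pow_add_apply, pow_succ',
        Module.End.mul_apply, hu, map_zero])
    exact ⟨w', by rw [pow_succ]; rfl⟩

end Flat
end PDG

/-! ### Infinite cohomology in the case `n ≤ p` -/

namespace PDG

-- Formally `(d + x) ^ p = x ^ p ∏ (θ + i + 1)` and `d ^ p = x ^ p ∏ (θ + i)` over `i < p`; shifting
-- by one permutes the residues modulo `p`.
open Polynomial in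
theorem shiftD_one_pow {k R : Type u} [Field k] [Ring R] [Algebra k R] {d x : R}
    (h : d * x = x * d + x * x) (p : ℕ) [CharP k p] : shiftD d x (1 : k) ^ p = d ^ p := by
  have h0 : d ^ p = shiftD d x (0 : k) ^ p := by rw [shiftD_zero]
  rw [h0, ← shiftProd_const, ← shiftProd_const, shiftProd_eq h, shiftProd_eq h]
  congr 1
  have h1 := Finset.prod_range_succ (fun i : ℕ => (X + C (i : k) : k[X])) p
  rw [Finset.prod_range_succ'] at h1
  simp only [CharP.cast_eq_zero, Nat.cast_zero, C_0, add_zero] at h1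
  refine (mul_right_cancel₀ X_ne_zero ?_).trans (mul_right_cancel₀ X_ne_zero h1) |>.trans ?_
  · simp only [Nat.cast_succ]
  · simp only [add_zero]

theorem d_mul_mulLeft {p : ℕ} {k Λ : Type u} [Field k] [Ring Λ] [Algebra k Λ] [PDGAlgebra p k Λ]
    {x : Λ} (hx : PDGAlgebra.d (p := p) (k := k) x = x ^ 2) :
    PDGAlgebra.d (p := p) (k := k) (A := Λ) * LinearMap.mulLeft k x
      = LinearMap.mulLeft k x * PDGAlgebra.d (p := p) (k := k)
        + LinearMap.mulLeft k x * LinearMap.mulLeft k x := by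
  refine LinearMap.ext fun c => ?_
  simp only [Module.End.mul_apply, LinearMap.add_apply, LinearMap.mulLeft_apply, PDGAlgebra.d_mul,
    hx, pow_two, mul_assoc]
  rw [add_comm]

section Small

variable {p : ℕ} [hp : Fact p.Prime] {k : Type u} [Field k] [CharP k p] {n : ℕ}

theorem RMod.d_mul_xAct (P : RMod p k (TruncPoly k n)) :
    P.d * P.xAct = P.xAct * P.d + P.xAct * P.xAct := LinearMap.ext P.d_xAct

theorem RMod.d_xAct_pow (P : RMod p k (TruncPoly k n)) (j : ℕ) (u : P) :
    P.d ((P.xAct ^ j) u) = (P.xAct ^ j) (P.d u) + (P.xAct ^ (j + 1)) ((j : k) • u) := by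
  rw [P.xAct_pow, P.xAct_pow, P.d_ract, TruncPoly.d_pow, op_smul, map_smul, map_smul]
  rfl

theorem RMod.sub_xAct_pow (P : RMod p k (TruncPoly k n)) : (P.d - P.xAct) ^ p = 0 := by
  have h := shiftD_neg_one_pow_succ (k := k) P.d_mul_xAct (p - 1)
  have hp1 := Nat.sub_add_cancel hp.out.one_lt.le
  have h2 : ((p - 1 : ℕ) : k) + 1 = 0 := by
    rw [← Nat.cast_succ, Nat.succ_eq_add_one, hp1, CharP.cast_eq_zero]
  rw [h2, neg_zero, shiftD_zero, ← pow_succ', hp1, P.d_pow] at h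
  rw [← h, shiftD, neg_one_smul, sub_eq_add_neg]

theorem RMod.add_xAct_pow (P : RMod p k (TruncPoly k n)) : (P.d + P.xAct) ^ p = 0 := by
  have h := shiftD_one_pow (k := k) P.d_mul_xAct p
  rwa [shiftD, one_smul, P.d_pow] at h

/-- The algebra `k[x]/(x ^ n)` with differential `d + x`. -/
noncomputable abbrev LMod.twist (p : ℕ) [hp : Fact p.Prime] (k : Type u) [Field k] [CharP k p]
    (n : ℕ) : LMod p k (TruncPoly k n) :=
  LMod.ofX n (V := TruncPoly k n)
    (PDGAlgebra.d (p := p) (k := k) + LinearMap.mulLeft k (TruncPoly.x k n))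
    (LinearMap.mulLeft k (TruncPoly.x k n))
    (by rw [LinearMap.pow_mulLeft, TruncPoly.x_pow, LinearMap.mulLeft_zero_eq_zero])
    (fun v => by
      have := LinearMap.congr_fun (d_mul_mulLeft (p := p) (k := k) (x := TruncPoly.x k n) TruncPoly.d_gen) v
      simp only [Module.End.mul_apply, LinearMap.add_apply] at this
      rw [LinearMap.add_apply, LinearMap.add_apply, this, map_add])
    (by
      have h := shiftD_one_pow (k := k) (d_mul_mulLeft (p := p) (k := k) (x := TruncPoly.x k n) TruncPoly.d_gen) p
      rwa [shiftD, one_smul, PDGAlgebra.d_pow] at h)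

theorem LMod.twist_acyclicOn (hn : (n : k) = 0) (hn2 : 2 ≤ n) :
    AcyclicOn p (LMod.twist p k n).d ⊤ := by
  refine AcyclicOn.of_commutator (s := TruncPoly.lower k n) (fun _ _ => trivial) fun u _ => ?_
  have h : (PDGAlgebra.d (p := p) (k := k) + LinearMap.mulLeft k (TruncPoly.x k n)) ∘ₗ
      TruncPoly.lower k n - TruncPoly.lower k n ∘ₗ
        (PDGAlgebra.d (p := p) (k := k) + LinearMap.mulLeft k (TruncPoly.x k n)) = LinearMap.id :=
    TruncPoly.linearMap_ext fun j hj => TruncPoly.d_add_lower_sub hn hn2 hj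
  exact LinearMap.congr_fun h u

/-- The map `u ⊗ c ↦ u c`. -/
noncomputable def RMod.unitor (P : RMod p k (TruncPoly k n)) : rtens P (LMod.twist p k n) →ₗ[k] P :=
  rlift (TensorProduct.lift
    (P.ract.toLinearMap ∘ₗ (MulOpposite.opLinearEquiv k).toLinearMap).flip) (fun u b c => by
      have h : (LMod.twist p k n).lact b c = b * (c : TruncPoly k n) := TruncPoly.lift_mulLeft b c
      rw [h, TensorProduct.lift.tmul, TensorProduct.lift.tmul]
      change P.ract (op (c : TruncPoly k n)) (P.ract (op b) u) = P.ract (op (b * c)) u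
      rw [MulOpposite.op_mul, map_mul]
      rfl)

theorem RMod.unitor_rtmul (P : RMod p k (TruncPoly k n)) (u : P) (c : TruncPoly k n) :
    P.unitor (rtmul P (LMod.twist p k n) u c) = P.ract (op c) u := rfl

theorem RMod.unitor_d (P : RMod p k (TruncPoly k n)) (t : rtens P (LMod.twist p k n)) :
    P.unitor (rtD _ _ t) = (P.d + P.xAct) (P.unitor t) := by
  refine LinearMap.congr_fun (f := P.unitor ∘ₗ rtD _ _) (g := (P.d + P.xAct) ∘ₗ P.unitor)
    (rtens_ext fun u (c : TruncPoly k n) => ?_) t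
  rw [LinearMap.comp_apply, LinearMap.comp_apply, rtD_tmul, map_add, unitor_rtmul, unitor_rtmul,
    unitor_rtmul]
  change _ + P.ract (op (PDGAlgebra.d (p := p) (k := k) c + TruncPoly.x k n * c)) u = _
  rw [LinearMap.add_apply, P.d_ract, MulOpposite.op_add, map_add,
    LinearMap.add_apply, mul_comm, MulOpposite.op_mul, map_mul, Module.End.mul_apply, add_assoc]

variable [NeZero n]

/-- The operator `d + x` on `P` is the total differential on `P ⊗_C C` with `C` carrying `d + x`.
That complex is acyclic when `p` divides `n`, and goodness is applied to its map to zero. -/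
theorem Good.acyclicOn_add_xAct {P : RMod p k (TruncPoly k n)} (hP : Good P) (hn : (n : k) = 0)
    (hn2 : 2 ≤ n) : AcyclicOn p (P.d + P.xAct) ⊤ := by
  let f : LLin (LMod.twist p k n) (LMod.triv n (V := PUnit.{u + 1}) (0 : Module.End k _)
    (zero_pow hp.out.ne_zero)) := LLin.ofX 0 (fun _ => rfl)
  have h := hP.acy f (fun _ => rfl) (fun y => ⟨0, rfl⟩) (fun u _ hu0 => by
    obtain ⟨v, -, hv⟩ := LMod.twist_acyclicOn hn hn2 u trivial hu0
    exact ⟨v, rfl, hv⟩)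
  intro u _ hu
  obtain ⟨t, -, ht⟩ := h (rtmul P (LMod.twist p k n) u (1 : TruncPoly k n))
    (rtmul_zero_right P _ _) (by
      rw [rtD_tmul]
      change _ + rtmul P (LMod.twist p k n) u (PDGAlgebra.d (p := p) (k := k) (1 : TruncPoly k n)
        + TruncPoly.x k n * 1) = 0
      have h3 : TruncPoly.x k n * 1 = (LMod.twist p k n).lact (TruncPoly.x k n)
        (1 : TruncPoly k n) := (TruncPoly.lift_mulLeft _ _).symm
      rw [PDGBimod.d_one, zero_add, h3, ← rtmul_balanced, ← rtmul_add_left]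
      change rtmul P (LMod.twist p k n) ((P.d + P.xAct) u) _ = 0
      rw [hu, rtmul_zero_left])
  refine ⟨P.unitor t, trivial, ?_⟩
  rw [← map_pow_apply P.unitor_d, ht, RMod.unitor_rtmul, MulOpposite.op_one, map_one]
  rfl

/-- `ε` exhibits `P` as a flat resolution of the ground field. -/
structure Augmented (P : RMod p k (TruncPoly k n)) (ε : P →ₗ[k] k) : Prop where
  good : Good P
  map_x : ∀ u, ε (P.xAct u) = 0
  map_d : ∀ u, ε (P.d u) = 0
  exists_one : ∃ u, ε u = 1
  acyclic : AcyclicOn p P.d (LinearMap.ker ε)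

/-- If `P/Px` had finite cohomology, so would `(P, d - x)`, by the filtration by powers of `x`. Then
`d - x` is acyclic in all low degrees, which starts the induction of `acyclic_sub_of_acyclic` on the
augmentation kernel. Here `n ≤ p - 1` supplies `x^(p-1) = 0`. -/
theorem Augmented.acyclic_sub {P : RMod p k (TruncPoly k n)} {ε : P →ₗ[k] k} (h : Augmented P ε)
    {gr : ℤ → Submodule k P} (hi : DirectSum.IsInternal gr)
    (hd : ∀ i, ∀ u ∈ gr i, P.d u ∈ gr (i + 2)) (hx : ∀ i, ∀ u ∈ gr i, P.xAct u ∈ gr (i + 2))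
    (hε : ∀ v j, ε v = 0 → ε (gproj hi j v) = 0) (hneg : ∀ i < 0, ∀ u ∈ gr i, ε u = 0)
    (hn2 : 2 ≤ n) (hnp : n ≤ p - 1)
    (hfin : Module.Finite k (Coh p (rtD P (LMod.one p k n)) 1)) :
    AcyclicOn p (P.d - P.xAct) (LinearMap.ker ε) := by
  have hp1 := hp.out.one_lt
  have hD : ∀ i, ∀ u ∈ gr i, (P.d - P.xAct) u ∈ gr (i + 2) :=
    fun i u hu => sub_mem (hd i u hu) (hx i u hu)
  have hcast : ((p - 1 : ℕ) : ℤ) = p - 1 := by omega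
  have hfin' : Module.Finite k (Coh p (P.d - P.xAct) 1) := by
    refine finite_coh_of_nilpotent hp1.le (by omega) (x := P.xAct) (ρ := P.toOne)
      P.xAct_pow_eq_zero (fun v hv => h.good.mem_range_xAct hv) ?_ P.sub_xAct_pow
      P.toOne_surjective P.toOne_eq_zero ?_ hfin
    · intro j v
      refine ⟨(j : k) • v, ?_⟩
      have h1 : P.xAct ((P.xAct ^ j) v) = (P.xAct ^ j) (P.xAct v) := by
        rw [← Module.End.mul_apply, ← pow_succ', pow_succ]; rfl
      rw [LinearMap.sub_apply, LinearMap.sub_apply, P.d_xAct_pow, map_sub, h1]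
      abel
    · intro v
      rw [LinearMap.sub_apply, map_sub, (P.toOne_eq_zero (P.xAct v)).2 ⟨v, rfl⟩, sub_zero,
        P.toOne_d]
  obtain ⟨e, he⟩ := exists_bound_of_finite_coh hi hD hfin'
  let N : ℤ → Submodule k P := fun i => gr i ⊓ LinearMap.ker ε
  have hdε : ∀ u, ε ((P.d ^ (p - 1)) u) = 0 := by
    intro u
    rw [show p - 1 = (p - 2) + 1 by omega, pow_succ']
    exact h.map_d _
  have key := acyclic_sub_of_acyclic (k := k) (N := N) p P.d_mul_xAct
    (fun i u hu => ⟨hd i u hu.1, h.map_d u⟩) (fun i u hu => ⟨hx i u hu.1, h.map_x u⟩)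
    (fun i u _ => by
      rw [show p - 1 = (p - 1 - n) + n by omega, pow_add, P.xAct_pow_eq_zero, mul_zero]; rfl)
    (fun i j hij u hu hu0 => by
      obtain ⟨v, hv, hvu⟩ := h.acyclic u hu.2 hu0
      refine ⟨gproj hi j v, ⟨gproj_mem hi j v, hε v j hv⟩, ?_⟩
      rw [map_gproj hi hi (P.d ^ (p - 1)) (2 * (p - 1))
        (fun i m hm => pow_mem_of_degree_two hd _ hm (by rw [hcast])), hvu, hij,
        gproj_of_mem hi hu.1, if_pos rfl]) (min e 0)
    (fun i j hie hij u hu hu0 => by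
      obtain ⟨v, hv, hvu⟩ := he i j (lt_of_lt_of_le hie (min_le_left _ _)) (by rw [hcast, hij])
        u hu.1 hu0
      -- Starting the induction below degree zero ensures that the primitive lies in the kernel of
      -- `ε`, which vanishes on negative degrees.
      refine ⟨v, ⟨hv, hneg j ?_ v hv⟩, hvu⟩
      have := lt_of_lt_of_le hie (min_le_right _ _)
      omega)
  intro u hu hu0
  suffices hS : u ∈ (LinearMap.ker ε).map ((P.d - P.xAct) ^ (p - 1)) from hS
  refine mem_of_gproj_mem hi _ fun i => ?_
  obtain ⟨v, hv, hvu⟩ := key i (i - 2 * (p - 1)) (by ring) (gproj hi i u)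
    ⟨gproj_mem hi i u, hε u i hu⟩ (by rw [map_gproj hi hi _ 2 hD, hu0, map_zero])
  exact ⟨v, hv.2, hvu⟩

/-- Both pairs `(d - x, d)` and `(d, d + x)` satisfy `δ₁ x = x δ₂` and induce the given differential
on `P/Px`. The first is used for `n < p`. For `n = p` the power `x^(p-1)` need not vanish, but `d +
x` is acyclic on all of `P`, and the second pair applies. -/
theorem Augmented.not_finite_of_le {P : RMod p k (TruncPoly k n)} {ε : P →ₗ[k] k}
    (h : Augmented P ε) {gr : ℤ → Submodule k P} (hi : DirectSum.IsInternal gr)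
    (hd : ∀ i, ∀ u ∈ gr i, P.d u ∈ gr (i + 2)) (hx : ∀ i, ∀ u ∈ gr i, P.xAct u ∈ gr (i + 2))
    (hε : ∀ v j, ε v = 0 → ε (gproj hi j v) = 0) (hneg : ∀ i < 0, ∀ u ∈ gr i, ε u = 0)
    (hn2 : 2 ≤ n) (hnp : n ≤ p) :
    ¬ Module.Finite k (Coh p (rtD P (LMod.one p k n)) 1) := by
  intro hfin
  have hp1 := hp.out.one_lt
  have hker : ∀ v, P.xAct v = 0 ↔ ∃ w, (P.xAct ^ (n - 1)) w = v := fun v =>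
    ⟨h.good.mem_range_xAct_pow, by
      rintro ⟨w, rfl⟩
      rw [← Module.End.mul_apply, ← pow_succ', Nat.sub_add_cancel (by omega), P.xAct_pow_eq_zero]
      rfl⟩
  have hker' : ∀ v, (P.xAct ^ (n - 1)) v = 0 ↔ ∃ w, P.xAct w = v := fun v =>
    ⟨h.good.mem_range_xAct, by
      rintro ⟨w, rfl⟩
      rw [← Module.End.mul_apply, ← pow_succ, Nat.sub_add_cancel (by omega), P.xAct_pow_eq_zero]
      rfl⟩
  have hdx : ∀ v, P.d ((P.xAct ^ (n - 1)) v) = (P.xAct ^ (n - 1)) (P.d v) := by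
    intro v
    rw [P.d_xAct_pow, Nat.sub_add_cancel (by omega), P.xAct_pow_eq_zero, LinearMap.zero_apply,
      add_zero]
  have hx1 : ∀ v, (P.xAct ^ (n - 1)) (P.xAct v) = 0 := fun v => (hker' _).2 ⟨v, rfl⟩
  have hx2 : ∀ v, P.xAct ((P.xAct ^ (n - 1)) v) = 0 := fun v => (hker _).2 ⟨v, rfl⟩
  rcases hnp.lt_or_eq with hlt | heq
  · have hacy := h.acyclic_sub hi hd hx hε hneg hn2 (by omega) hfin
    refine not_finite_coh_of_two_step (x := P.xAct) (δ₁ := P.d - P.xAct) (δ₂ := P.d)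
      (ρ := P.toOne) (ε := ε) hker hker' ?_ ?_ P.sub_xAct_pow P.d_pow P.toOne_surjective
      P.toOne_eq_zero ?_ h.map_x ?_ h.exists_one hacy ?_ hfin
    · intro v; rw [LinearMap.sub_apply, P.d_xAct, add_sub_cancel_right]
    · intro v; rw [hdx, LinearMap.sub_apply, map_sub, hx1, sub_zero]
    · intro v
      rw [LinearMap.sub_apply, map_sub, (P.toOne_eq_zero (P.xAct v)).2 ⟨v, rfl⟩, sub_zero,
        P.toOne_d]
    · intro v; rw [LinearMap.sub_apply, map_sub, h.map_d, h.map_x, sub_zero]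
    · intro v hv
      obtain ⟨w, -, hw⟩ := h.acyclic ((P.xAct ^ (n - 1)) v) (by
        rw [show n - 1 = (n - 2) + 1 by omega, pow_succ']
        exact h.map_x _) hv
      exact ⟨w, hw⟩
  · have hacy := h.good.acyclicOn_add_xAct (by rw [heq, CharP.cast_eq_zero]) hn2
    refine not_finite_coh_of_two_step (x := P.xAct) (δ₁ := P.d) (δ₂ := P.d + P.xAct)
      (ρ := P.toOne) (ε := ε) hker hker' ?_ ?_ P.d_pow P.add_xAct_pow P.toOne_surjective
      P.toOne_eq_zero P.toOne_d h.map_x h.map_d h.exists_one h.acyclic ?_ hfin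
    · intro v; rw [P.d_xAct, LinearMap.add_apply, map_add]
    · intro v; rw [LinearMap.add_apply, hdx, hx2, add_zero]
    · intro v hv
      obtain ⟨w, -, hw⟩ := hacy ((P.xAct ^ (n - 1)) v) trivial hv
      exact ⟨w, hw⟩

end Small
end PDG

namespace PDG

/-! ### Preparations for the descent: projections, kernels and induced modules -/

section Descent

/-- If every element of `ker d^b` were in `im d^(p-b)` for one `b`, the complex would be acyclic.
Write a cocycle as `d^i w` with `i` as large as possible. For `i < b` the element `w` lies in `ker
d^b`, and `i` grows by `p - b`; for `i ≥ b` the same applied to `d^(i+1-b) w` reaches the exponent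
`p - 1` at once. -/
theorem exists_not_coboundary {p : ℕ} {k V : Type u} [Field k] [AddCommGroup V] [Module k V]
    {d : Module.End k V} (h : ¬ AcyclicOn p d ⊤) {b : ℕ} (hb : 0 < b) (hbp : b < p) :
    ∃ u, (d ^ b) u = 0 ∧ ∀ w, (d ^ (p - b)) w ≠ u := by
  by_contra! hcon
  refine h fun u _ hu => ?_
  have key : ∀ j, j ≤ p - 1 → ∃ i w, j ≤ i ∧ i ≤ p - 1 ∧ (d ^ i) w = u := by
    intro j
    induction j with
    | zero => exact fun _ => ⟨0, u, le_rfl, Nat.zero_le _, rfl⟩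
    | succ j ih =>
      intro hj
      obtain ⟨i, w, hji, hip, rfl⟩ := ih (by omega)
      clear ih
      by_cases hi : j < i
      · exact ⟨i, w, hi, hip, rfl⟩
      obtain rfl : i = j := by omega
      by_cases hib : i + 1 ≤ b
      · obtain ⟨w', rfl⟩ := hcon w (by
          rw [show b = (b - (i + 1)) + (1 + i) by omega, pow_add_apply, pow_add_apply, pow_one, hu,
            map_zero])
        exact ⟨i + (p - b), w', by omega, by omega, pow_add_apply _ _ _ _⟩
      · have e1 : p - 1 = (b - 1) + (p - b) := by omega
        have e2 : b - 1 + (i + 1 - b) = i := by omega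
        obtain ⟨w', hw'⟩ := hcon ((d ^ (i + 1 - b)) w) (by
          rw [← pow_add_apply, show b + (i + 1 - b) = 1 + i by omega, pow_add_apply, pow_one, hu])
        refine ⟨p - 1, w', by omega, le_rfl, ?_⟩
        rw [e1, pow_add_apply, hw', ← pow_add_apply, e2]
  obtain ⟨i, w, h1, h2, h3⟩ := key (p - 1) le_rfl
  obtain rfl : i = p - 1 := le_antisymm h2 h1
  exact ⟨w, trivial, h3⟩

variable {p : ℕ} [hp : Fact p.Prime] {k : Type u} [Field k] [CharP k p] {n : ℕ}

instance (k : Type u) [Field k] (n : ℕ) : Module.Finite k (TruncPoly k n) :=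
  Module.Finite.of_basis (TruncPoly.powBasis k n)

theorem TruncPoly.finrank_eq (k : Type u) [Field k] (n : ℕ) :
    Module.finrank k (TruncPoly k n) = n := by
  rw [Module.finrank_eq_card_basis (TruncPoly.powBasis k n), Fintype.card_fin]

/-- The quotient map `k[x]/(x ^ n) → k[x]/(x ^ a)`. -/
noncomputable def TruncPoly.proj (k : Type u) [Field k] {n a : ℕ} (ha : a ≤ n) :
    TruncPoly k n →ₐ[k] TruncPoly k a :=
  TruncPoly.lift (TruncPoly.x k a) (TruncPoly.pow_eq_zero ha)

theorem TruncPoly.proj_pow (k : Type u) [Field k] {n a : ℕ} (ha : a ≤ n) (j : ℕ) :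
    TruncPoly.proj k ha (TruncPoly.x k n ^ j) = TruncPoly.x k a ^ j := by
  rw [map_pow, TruncPoly.proj, TruncPoly.lift_x]

theorem TruncPoly.proj_surjective (k : Type u) [Field k] {n a : ℕ} (ha : a ≤ n) :
    Function.Surjective (TruncPoly.proj k ha) := by
  intro c
  induction c using TruncPoly.induction with
  | x => exact ⟨TruncPoly.x k n, by rw [TruncPoly.proj, TruncPoly.lift_x]⟩
  | algebraMap r => exact ⟨algebraMap k _ r, AlgHom.commutes _ r⟩
  | add a b ha hb =>
    obtain ⟨a, rfl⟩ := ha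
    obtain ⟨b, rfl⟩ := hb
    exact ⟨a + b, map_add _ _ _⟩
  | mul a b ha hb =>
    obtain ⟨a, rfl⟩ := ha
    obtain ⟨b, rfl⟩ := hb
    exact ⟨a * b, map_mul _ _ _⟩

theorem TruncPoly.proj_d {a : ℕ} (ha : a ≤ n) (c : TruncPoly k n) :
    TruncPoly.proj k ha (PDGAlgebra.d (p := p) (k := k) c)
      = PDGAlgebra.d (p := p) (k := k) (TruncPoly.proj k ha c) := by
  have h : (TruncPoly.proj k ha).toLinearMap ∘ₗ PDGAlgebra.d (p := p)
      = PDGAlgebra.d (p := p) ∘ₗ (TruncPoly.proj k ha).toLinearMap :=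
    TruncPoly.linearMap_ext fun j _ => by
      simp only [LinearMap.comp_apply, AlgHom.toLinearMap_apply, TruncPoly.d_pow, map_smul,
        TruncPoly.proj_pow]
  exact LinearMap.congr_fun h c

/-- Multiplication by `x ^ a` on `k[x]/(x ^ n)` factors through `k[x]/(x ^ a)` when `n ≤ 2 a`. -/
theorem TruncPoly.exists_mul_eq (k : Type u) [Field k] {n a : ℕ} (ha : a ≤ n) (h : n ≤ 2 * a) :
    ∃ θ : TruncPoly k a →ₗ[k] TruncPoly k n, θ ∘ₗ (TruncPoly.proj k ha).toLinearMap
      = LinearMap.mulLeft k (TruncPoly.x k n ^ a) := by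
  refine ⟨(TruncPoly.powBasis k a).constr k fun j => TruncPoly.x k n ^ (a + (j : ℕ)),
    TruncPoly.linearMap_ext fun j _ => ?_⟩
  rw [LinearMap.comp_apply, AlgHom.toLinearMap_apply, TruncPoly.proj_pow, LinearMap.mulLeft_apply,
    ← pow_add]
  by_cases hj : j < a
  · have := (TruncPoly.powBasis k a).constr_basis k
      (fun j : Fin a => TruncPoly.x k n ^ (a + (j : ℕ))) ⟨j, hj⟩
    rwa [TruncPoly.powBasis_apply] at this
  · rw [TruncPoly.pow_eq_zero (by omega : a ≤ j), map_zero, TruncPoly.pow_eq_zero (by omega)]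

/-- The kernel of a morphism of modules. -/
noncomputable abbrev LMod.ker {Y Y' : LMod p k (TruncPoly k n)} (f : LLin Y Y') (hf : f.IsChain) :
    LMod p k (TruncPoly k n) :=
  LMod.ofX n (V := LinearMap.ker f.lin)
    (Y.d.restrict fun y hy => by
      rw [LinearMap.mem_ker] at *; rw [hf, hy, map_zero])
    ((Y.lact (TruncPoly.x k n)).restrict fun y hy => by
      rw [LinearMap.mem_ker] at *; rw [f.map_lact, hy, map_zero])
    (by
      rw [Module.End.pow_restrict, LinearMap.ext_iff]
      intro y
      refine Subtype.ext ?_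
      rw [LinearMap.coe_restrict_apply, ← map_pow, TruncPoly.x_pow, map_zero]
      rfl)
    (fun y => Subtype.ext (Y.d_x y))
    (restrict_pow_eq_zero Y.d_pow _)

/-- The inclusion of the kernel. -/
noncomputable abbrev LMod.kerIncl {Y Y' : LMod p k (TruncPoly k n)} (f : LLin Y Y')
    (hf : f.IsChain) : LLin (LMod.ker f hf) Y :=
  LLin.ofX (LinearMap.ker f.lin).subtype fun y => by rw [LMod.ofX_x]; rfl

variable {V : Type u} [AddCommGroup V] [Module k V] {dV : Module.End k V} (hdV : dV ^ p = 0)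

/-- The quotient map `k[x]/(x ^ n) ⊗ V → k[x]/(x ^ a) ⊗ V`. -/
noncomputable abbrev LMod.indProj {a : ℕ} (ha : a ≤ n) :
    LLin (LMod.ind n n le_rfl dV hdV) (LMod.ind n a ha dV hdV) :=
  LLin.ofX (LinearMap.rTensor V (TruncPoly.proj k ha).toLinearMap) fun t => by
    rw [LMod.ofX_x, LMod.ofX_x, ← LinearMap.comp_apply, ← LinearMap.comp_apply,
      ← LinearMap.rTensor_comp, ← LinearMap.rTensor_comp]
    congr 2
    refine LinearMap.ext fun c => ?_
    simp only [LinearMap.comp_apply, LinearMap.mulLeft_apply, AlgHom.toLinearMap_apply, map_mul,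
      TruncPoly.proj, TruncPoly.lift_x]

theorem LMod.indProj_isChain {a : ℕ} (ha : a ≤ n) : (LMod.indProj hdV ha).IsChain := by
  intro t
  change LinearMap.rTensor V (TruncPoly.proj k ha).toLinearMap ((_ + _ : Module.End k _) t)
    = (_ + _ : Module.End k _) (LinearMap.rTensor V (TruncPoly.proj k ha).toLinearMap t)
  induction t using TensorProduct.induction_on with
  | zero => simp
  | add a b ha hb => simp only [map_add, ha, hb]
  | tmul c v =>
    simp only [LinearMap.add_apply, LinearMap.rTensor_tmul, LinearMap.lTensor_tmul, map_add,
      AlgHom.toLinearMap_apply, TruncPoly.proj_d]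

theorem LMod.ind_lact (b : TruncPoly k n) (t : TruncPoly k n ⊗[k] V) :
    (LMod.ind n n le_rfl dV hdV).lact b t = LinearMap.rTensor V (LinearMap.mulLeft k b) t := by
  induction b using TruncPoly.induction generalizing t with
  | x => exact LMod.ofX_x _
  | algebraMap r =>
    rw [Algebra.algebraMap_eq_smul_one, map_smul, map_one]
    have : LinearMap.mulLeft k (r • (1 : TruncPoly k n)) = r • LinearMap.id := by
      refine LinearMap.ext fun c => ?_
      simp
    rw [this, LinearMap.rTensor_smul, LinearMap.rTensor_id]
    rfl
  | add a b ha hb =>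
    rw [map_add, LinearMap.add_apply, ha, hb, ← LinearMap.add_apply, ← LinearMap.rTensor_add]
    congr 2
    refine LinearMap.ext fun c => ?_
    simp [add_mul]
  | mul a b ha hb =>
    rw [map_mul, Module.End.mul_apply, hb, ha, ← LinearMap.rTensor_comp_apply]
    congr 2
    refine LinearMap.ext fun c => ?_
    simp

/-- The right action of `k[x]/(x ^ n)` as a linear map on the tensor product. -/
noncomputable def RMod.actMap (P : RMod p k (TruncPoly k n)) : P ⊗[k] TruncPoly k n →ₗ[k] P :=
  TensorProduct.lift (P.ract.toLinearMap ∘ₗ (MulOpposite.opLinearEquiv k).toLinearMap).flip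

theorem RMod.actMap_tmul (P : RMod p k (TruncPoly k n)) (u : P) (c : TruncPoly k n) :
    P.actMap (u ⊗ₜ c) = P.ract (op c) u := rfl

/-- The map `u ⊗ (c ⊗ v) ↦ u c ⊗ v`. -/
noncomputable def RMod.fromInd (P : RMod p k (TruncPoly k n)) :
    rtens P (LMod.ind n n le_rfl dV hdV) →ₗ[k] P ⊗[k] V :=
  rlift (LinearMap.rTensor V P.actMap ∘ₗ
    (TensorProduct.assoc k P (TruncPoly k n) V).symm.toLinearMap) (fun u b t => by
      rw [LMod.ind_lact]
      induction t using TensorProduct.induction_on with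
      | zero => simp
      | add s t hs ht =>
        rw [TensorProduct.tmul_add, map_add, hs, ht, ← map_add, ← TensorProduct.tmul_add, ← map_add]
      | tmul c v =>
        simp only [LinearMap.comp_apply, LinearEquiv.coe_coe, TensorProduct.assoc_symm_tmul,
          LinearMap.rTensor_tmul, RMod.actMap_tmul, LinearMap.mulLeft_apply, MulOpposite.op_mul,
          map_mul, Module.End.mul_apply])

/-- The map `u ⊗ v ↦ u ⊗ (1 ⊗ v)`. -/
noncomputable def RMod.toInd (P : RMod p k (TruncPoly k n)) :
    P ⊗[k] V →ₗ[k] rtens P (LMod.ind n n le_rfl dV hdV) :=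
  (rbal P (LMod.ind n n le_rfl dV hdV)).mkQ ∘ₗ
    LinearMap.lTensor P (TensorProduct.mk k (TruncPoly k n) V 1)

theorem RMod.fromInd_rtmul (P : RMod p k (TruncPoly k n)) (u : P) (c : TruncPoly k n) (v : V) :
    P.fromInd hdV (rtmul P (LMod.ind n n le_rfl dV hdV) u (c ⊗ₜ[k] v : TruncPoly k n ⊗[k] V))
      = P.ract (op c) u ⊗ₜ v := rfl

theorem RMod.toInd_tmul (P : RMod p k (TruncPoly k n)) (u : P) (v : V) :
    P.toInd hdV (u ⊗ₜ v) = rtmul P (LMod.ind n n le_rfl dV hdV) u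
      ((1 : TruncPoly k n) ⊗ₜ[k] v : TruncPoly k n ⊗[k] V) := rfl

theorem RMod.fromInd_toInd (P : RMod p k (TruncPoly k n)) (t : P ⊗[k] V) :
    P.fromInd hdV (P.toInd hdV t) = t := by
  induction t using TensorProduct.induction_on with
  | zero => simp
  | add s t hs ht => rw [map_add, map_add, hs, ht]
  | tmul u v => rw [RMod.toInd_tmul, RMod.fromInd_rtmul, MulOpposite.op_one, map_one]; rfl

theorem RMod.toInd_fromInd (P : RMod p k (TruncPoly k n))
    (t : rtens P (LMod.ind n n le_rfl dV hdV)) : P.toInd hdV (P.fromInd hdV t) = t := by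
  refine LinearMap.congr_fun (f := P.toInd hdV ∘ₗ P.fromInd hdV) (g := LinearMap.id)
    (rtens_ext fun u t => ?_) t
  let L : TruncPoly k n ⊗[k] V →ₗ[k] rtens P (LMod.ind n n le_rfl dV hdV) :=
    (rbal P (LMod.ind n n le_rfl dV hdV)).mkQ ∘ₗ
      TensorProduct.mk k P (LMod.ind n n le_rfl dV hdV) u
  have h : P.toInd hdV ∘ₗ P.fromInd hdV ∘ₗ L = L := TensorProduct.ext' fun c v => by
    change P.toInd hdV (P.fromInd hdV (rtmul P (LMod.ind n n le_rfl dV hdV) u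
      (c ⊗ₜ[k] v : TruncPoly k n ⊗[k] V))) = rtmul P (LMod.ind n n le_rfl dV hdV) u
      (c ⊗ₜ[k] v : TruncPoly k n ⊗[k] V)
    rw [RMod.fromInd_rtmul, RMod.toInd_tmul, rtmul_balanced, LMod.ind_lact,
      LinearMap.rTensor_tmul, LinearMap.mulLeft_apply, mul_one]
  exact LinearMap.congr_fun h t

theorem RMod.toInd_d (P : RMod p k (TruncPoly k n)) (t : P ⊗[k] V) :
    P.toInd hdV ((LinearMap.rTensor V P.d + LinearMap.lTensor P dV) t)
      = rtD P (LMod.ind n n le_rfl dV hdV) (P.toInd hdV t) := by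
  induction t using TensorProduct.induction_on with
  | zero => simp
  | add s t hs ht => simp only [map_add, hs, ht]
  | tmul u v =>
    rw [RMod.toInd_tmul, rtD_tmul, LinearMap.add_apply, map_add, LinearMap.rTensor_tmul,
      LinearMap.lTensor_tmul, RMod.toInd_tmul, RMod.toInd_tmul]
    congr 2
    change _ = (_ + _ : Module.End k _) _
    rw [LinearMap.add_apply, LinearMap.rTensor_tmul, LinearMap.lTensor_tmul, PDGBimod.d_one,
      TensorProduct.zero_tmul, zero_add]

/-- A cocycle `u₀` with `ε u₀ = 1` splits `P` into the line of `u₀` and `ker ε`. Extending a partner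
on `ker ε` by zero on that line gives an operator `S` with `[d, S] = 1 - u₀ ε`, and `S ⊗ 1` is a
partner on the kernel of `ε ⊗ 1`. -/
theorem Augmented.acyclicOn_ker_rTensor {P : RMod p k (TruncPoly k n)} {ε : P →ₗ[k] k}
    (h : Augmented P ε) (dV : Module.End k V) :
    AcyclicOn p (LinearMap.rTensor V P.d + LinearMap.lTensor P dV)
      (LinearMap.ker ((TensorProduct.lid k V).toLinearMap ∘ₗ LinearMap.rTensor V ε)) := by
  obtain ⟨u₀, hu₀, hdu₀⟩ := exists_cocycle_of_acyclic_ker h.map_d h.exists_one h.acyclic P.d_pow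
  have hN : ∀ u ∈ LinearMap.ker ε, P.d u ∈ LinearMap.ker ε := fun u _ => h.map_d u
  obtain ⟨s, hs⟩ := exists_commutator (restrict_pow_eq_zero P.d_pow hN)
    ((acyclicOn_iff_restrict hN).1 h.acyclic)
  let pr : P →ₗ[k] LinearMap.ker ε :=
    (LinearMap.id - LinearMap.toSpanSingleton k P u₀ ∘ₗ ε).codRestrict _ fun u => by
      rw [LinearMap.mem_ker]
      change ε (u - ε u • u₀) = 0
      rw [map_sub, map_smul, hu₀, smul_eq_mul, mul_one, sub_self]
  have hpr : ∀ u, (pr u : P) = u - ε u • u₀ := fun u => rfl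
  have hprd : ∀ u, pr (P.d u) = (P.d.restrict hN) (pr u) := fun u => Subtype.ext (by
    rw [hpr, LinearMap.coe_restrict_apply, hpr, h.map_d, map_sub, map_smul, hdu₀, zero_smul,
      smul_zero])
  let S : Module.End k P := (LinearMap.ker ε).subtype ∘ₗ s ∘ₗ pr
  have hS : ∀ u, P.d (S u) - S (P.d u) = u - ε u • u₀ := by
    intro u
    have h1 := congrArg Subtype.val (hs (pr u))
    rw [hpr] at h1
    rw [← h1]
    change _ - ((s (pr (P.d u)) : LinearMap.ker ε) : P) = _
    rw [hprd]
    rfl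
  refine AcyclicOn.of_commutator (s := LinearMap.rTensor V S) ?_ ?_
  · intro t _
    have : (TensorProduct.lid k V).toLinearMap ∘ₗ LinearMap.rTensor V ε ∘ₗ LinearMap.rTensor V S
        = 0 := TensorProduct.ext' fun u v => by
      simp only [LinearMap.comp_apply, LinearMap.rTensor_tmul]
      rw [show ε (S u) = 0 from LinearMap.mem_ker.1 (s (pr u)).2]
      simp
    exact LinearMap.congr_fun this t
  · intro t ht
    have key : ∀ t : P ⊗[k] V, (LinearMap.rTensor V P.d + LinearMap.lTensor P dV)
        (LinearMap.rTensor V S t) - LinearMap.rTensor V S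
          ((LinearMap.rTensor V P.d + LinearMap.lTensor P dV) t)
        = t - u₀ ⊗ₜ (TensorProduct.lid k V (LinearMap.rTensor V ε t)) := by
      intro t
      induction t using TensorProduct.induction_on with
      | zero => simp
      | add a b ha hb =>
        simp only [map_add, TensorProduct.tmul_add] at *
        rw [add_sub_add_comm, ha, hb, add_sub_add_comm]
      | tmul u v =>
        simp only [LinearMap.add_apply, LinearMap.rTensor_tmul, LinearMap.lTensor_tmul, map_add,
          TensorProduct.lid_tmul]
        rw [add_sub_add_right_eq_sub, ← TensorProduct.sub_tmul, hS, TensorProduct.sub_tmul,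
          TensorProduct.smul_tmul]
    rw [key, show TensorProduct.lid k V (LinearMap.rTensor V ε t) = 0 from ht,
      TensorProduct.tmul_zero, sub_zero]

variable [NeZero n]

theorem LMod.triv_pow_lact {a : ℕ} (ha : 0 < a) (v : V) :
    (LMod.triv n dV hdV).lact (TruncPoly.x k n ^ a) v = (0 : V) := by
  obtain ⟨a, rfl⟩ : ∃ b, a = b + 1 := ⟨a - 1, by omega⟩
  rw [pow_succ', map_mul, Module.End.mul_apply, LMod.triv_x]

/-- The map `u ⊗ v ↦ ε u • v`. -/
noncomputable def Augmented.eval {P : RMod p k (TruncPoly k n)} {ε : P →ₗ[k] k}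
    (h : Augmented P ε) : rtens P (LMod.triv n dV hdV) →ₗ[k] V :=
  rlift ((TensorProduct.lid k V).toLinearMap ∘ₗ LinearMap.rTensor V ε) (fun u b v => by
    change ε (P.ract (op b) u) • (v : V) = ε u • ((LMod.triv n dV hdV).lact b v : V)
    induction b using TruncPoly.induction generalizing u v with
    | x => rw [LMod.triv_x, smul_zero]; exact (congrArg (· • (v : V)) (h.map_x u)).trans (zero_smul _ _)
    | algebraMap r =>
      have h1 : P.ract (op (algebraMap k _ r)) u = r • u := by
        simp [Algebra.algebraMap_eq_smul_one]
      have h2 : (LMod.triv n dV hdV).lact (algebraMap k _ r) v = r • v := by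
        simp [Algebra.algebraMap_eq_smul_one]
      rw [h1, h2, map_smul, smul_eq_mul, mul_comm]
      exact mul_smul (ε u) r (v : V)
    | add a b ha hb =>
      rw [MulOpposite.op_add, map_add, map_add, LinearMap.add_apply, LinearMap.add_apply, map_add,
        add_smul, ha, hb]
      exact (smul_add _ _ _).symm
    | mul a b ha hb =>
      rw [MulOpposite.op_mul, map_mul, map_mul, Module.End.mul_apply, Module.End.mul_apply, hb, ha])

theorem Augmented.eval_rtmul {P : RMod p k (TruncPoly k n)} {ε : P →ₗ[k] k}
    (h : Augmented P ε) (u : P) (v : V) :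
    h.eval hdV (rtmul P (LMod.triv n dV hdV) u v) = ε u • v := rfl

theorem Augmented.eval_d {P : RMod p k (TruncPoly k n)} {ε : P →ₗ[k] k}
    (h : Augmented P ε) (t : rtens P (LMod.triv n dV hdV)) :
    h.eval hdV (rtD _ _ t) = dV (h.eval hdV t) := by
  refine LinearMap.congr_fun (f := h.eval hdV ∘ₗ rtD _ _) (g := dV ∘ₗ h.eval hdV)
    (rtens_ext fun u (v : V) => ?_) t
  rw [LinearMap.comp_apply, LinearMap.comp_apply, rtD_tmul, map_add]
  have h1 := h.eval_rtmul hdV (P.d u) v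
  have h2 := h.eval_rtmul hdV u (dV v)
  have h3 := h.eval_rtmul hdV u v
  rw [h1, h.map_d, zero_smul, zero_add, h3, map_smul]
  exact h2

end Descent
end PDG

namespace PDG

/-! ### The descent and the proof of infinite cohomology -/

section Descent

variable {p : ℕ} [hp : Fact p.Prime] {k : Type u} [Field k] [CharP k p] {n : ℕ}
  {V : Type u} [AddCommGroup V] [Module k V] {dV : Module.End k V} (hdV : dV ^ p = 0)

/-- The kernel of `k[x]/(x ^ n) ⊗ V → k[x]/(x ^ a) ⊗ V`. -/
noncomputable abbrev LMod.indKer {a : ℕ} (ha : a ≤ n) : LMod p k (TruncPoly k n) :=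
  LMod.ker (LMod.indProj hdV ha) (LMod.indProj_isChain hdV ha)

/-- If `n ≤ 2 a`, multiplication by `x ^ a` on `k[x]/(x ^ n)` factors through `k[x]/(x ^ a)`, so it
annihilates the kernel of the projection. -/
theorem LMod.indKer_pow_lact {a : ℕ} (ha : a ≤ n) (h2a : n ≤ 2 * a)
    (y : LMod.indKer hdV ha) : (LMod.indKer hdV ha).lact (TruncPoly.x k n ^ a) y = 0 := by
  let inc := LMod.kerIncl (LMod.indProj hdV ha) (LMod.indProj_isChain hdV ha)
  have hinc : Function.Injective inc.lin := Subtype.val_injective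
  apply hinc
  rw [inc.map_lact, map_zero, LMod.ind_lact]
  obtain ⟨θ, hθ⟩ := TruncPoly.exists_mul_eq k ha h2a
  rw [← hθ, LinearMap.rTensor_comp_apply]
  have h0 : LinearMap.rTensor V (TruncPoly.proj k ha).toLinearMap (inc.lin y) = 0 := y.2
  rw [h0, map_zero]

theorem LMod.finrank_indKer [Module.Finite k V] {a : ℕ} (ha : a ≤ n) :
    Module.finrank k (LMod.indKer hdV ha) = (n - a) * Module.finrank k V := by
  have h := LinearMap.finrank_range_add_finrank_ker (LMod.indProj hdV ha).lin
  have hs : Function.Surjective (LMod.indProj hdV ha).lin :=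
    LinearMap.rTensor_surjective V (TruncPoly.proj_surjective k ha)
  rw [LinearMap.range_eq_top.2 hs, finrank_top] at h
  have h1 : Module.finrank k (TruncPoly k n ⊗[k] V) = n * Module.finrank k V := by
    rw [Module.finrank_tensorProduct, TruncPoly.finrank_eq]
  have h2 : Module.finrank k (TruncPoly k a ⊗[k] V) = a * Module.finrank k V := by
    rw [Module.finrank_tensorProduct, TruncPoly.finrank_eq]
  have h3 : a * Module.finrank k V + Module.finrank k (LMod.indKer hdV ha)
      = n * Module.finrank k V := by
    rw [← h1, ← h2]; exact h
  rw [Nat.sub_mul]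
  omega

/-- The comparison of cohomology induced by a surjection with acyclic kernel. -/
theorem Good.coh_bijective {B : Type u} [Ring B] [Algebra k B] [PDGAlgebra p k B] {P : RMod p k B}
    (hP : Good P) {Y Y' : LMod p k B} (f : LLin Y Y')
    (hf : f.IsChain) (hs : Function.Surjective f.lin)
    (hk : AcyclicOn p Y.d (LinearMap.ker f.lin)) {b : ℕ} (hb : b ≤ p) :
    Function.Bijective (Coh.mapChain p b (rmap (RLin.id P) f) (rmap_d (RLin.id_isChain P) hf)) :=
  Coh.mapChain_bijective _ (rmap_surjective _ _ (fun x => ⟨x, rfl⟩) hs) (hP.acy f hf hs hk) hb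
    (rtD_pow P Y)

theorem Good.finite_coh_iff {B : Type u} [Ring B] [Algebra k B] [PDGAlgebra p k B] {P : RMod p k B}
    (hP : Good P) {Y Y' : LMod p k B} (f : LLin Y Y')
    (hf : f.IsChain) (hs : Function.Surjective f.lin)
    (hk : AcyclicOn p Y.d (LinearMap.ker f.lin)) {b : ℕ} (hb : b ≤ p) :
    Module.Finite k (Coh p (rtD P Y) b) ↔ Module.Finite k (Coh p (rtD P Y') b) :=
  let e := LinearEquiv.ofBijective _ (hP.coh_bijective f hf hs hk hb)
  ⟨fun _ => Module.Finite.equiv e, fun _ => Module.Finite.equiv e.symm⟩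

theorem Good.finrank_coh_eq {B : Type u} [Ring B] [Algebra k B] [PDGAlgebra p k B] {P : RMod p k B}
    (hP : Good P) {Y Y' : LMod p k B} (f : LLin Y Y')
    (hf : f.IsChain) (hs : Function.Surjective f.lin)
    (hk : AcyclicOn p Y.d (LinearMap.ker f.lin)) {b : ℕ} (hb : b ≤ p) :
    Module.finrank k (Coh p (rtD P Y) b) = Module.finrank k (Coh p (rtD P Y') b) :=
  (LinearEquiv.ofBijective _ (hP.coh_bijective f hf hs hk hb)).finrank_eq

variable [NeZero n]

/-- Strong induction on the dimension `N` of the cohomology. In the sequence `K → k[x]/(x ^ n) ⊗ V →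
k[x]/(x ^ a) ⊗ V` tensored with `P`, the middle term has the cohomology of `V`, and its classes
survive to the right because evaluation factors through the quotient. So the connecting map is onto
with non-zero kernel, and the trivial module on `K` has smaller cohomology. The complex `V` and the
index `b` must vary in the induction: the connecting map exchanges `b` and `p - b`. -/
theorem Augmented.not_finite_triv {P : RMod p k (TruncPoly k n)} {ε : P →ₗ[k] k}
    (h : Augmented P ε) {a : ℕ} (ha1 : (a : k) = 1) (han : a ≤ n) (h2a : n ≤ 2 * a)
    (hna : ¬ p ∣ n - a) (N : ℕ) : ∀ (V : Type u) [AddCommGroup V] [Module k V] [Module.Finite k V]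
      (dV : Module.End k V) (hdV : dV ^ p = 0), ¬ p ∣ Module.finrank k V → ∀ b, 0 < b → b < p →
      Module.Finite k (Coh p (rtD P (LMod.triv n dV hdV)) b) →
      Module.finrank k (Coh p (rtD P (LMod.triv n dV hdV)) b) = N → False := by
  induction N using Nat.strong_induction_on with
  | _ N ih =>
  intro V _ _ _ dV hdV hV b hb hbp hfin hN
  have ha0 : 0 < a := Nat.pos_of_ne_zero (by rintro rfl; simp at ha1)
  -- the counit of `triv V`
  let T := LMod.triv n dV hdV
  have hT : ∀ v : T, T.lact (TruncPoly.x k n ^ a) v = 0 := LMod.triv_pow_lact hdV ha0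
  let c := T.counit han hT
  have hc := T.counit_isChain han hT
  have hcs := T.counit_surjective han hT
  have hck := T.counit_acyclicOn han hT ha1
  -- the kernel
  let K := LMod.indKer hdV han
  have hK : ∀ y : K, K.lact (TruncPoly.x k n ^ a) y = 0 := LMod.indKer_pow_lact hdV han h2a
  let K₀ := LMod.triv n K.d K.d_pow
  have hK₀ : ∀ v : K₀, K₀.lact (TruncPoly.x k n ^ a) v = 0 := LMod.triv_pow_lact K.d_pow ha0
  let inc := LMod.kerIncl (LMod.indProj hdV han) (LMod.indProj_isChain hdV han)
  let q := LMod.indProj hdV han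
  have hqs : Function.Surjective q.lin :=
    LinearMap.rTensor_surjective V (TruncPoly.proj_surjective k han)
  have hexact : ∀ t, rmap (RLin.id P) q t = 0 ↔ ∃ s, rmap (RLin.id P) inc s = t :=
    rmap_exact P inc q hqs fun y => ⟨fun hy => ⟨⟨y, hy⟩, rfl⟩, fun ⟨y', hy'⟩ => hy' ▸ y'.2⟩
  -- the complex in the middle
  let D := LinearMap.rTensor V P.d + LinearMap.lTensor P dV
  have hD : D ^ p = 0 := tensor_d_pow P.d_pow hdV
  let e : P ⊗[k] V →ₗ[k] V := (TensorProduct.lid k V).toLinearMap ∘ₗ LinearMap.rTensor V ε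
  have hacy : AcyclicOn p D (LinearMap.ker e) := h.acyclicOn_ker_rTensor dV
  have he : ∀ u v, e (u ⊗ₜ v) = ε u • v := fun u v => rfl
  have hed : ∀ t, e (D t) = dV (e t) := by
    intro t
    refine LinearMap.congr_fun (f := e ∘ₗ D) (g := dV ∘ₗ e) (TensorProduct.ext' fun u v => ?_) t
    simp only [LinearMap.comp_apply, D, LinearMap.add_apply, LinearMap.rTensor_tmul,
      LinearMap.lTensor_tmul, map_add, he, h.map_d, zero_smul, zero_add, map_smul]
  have hes : Function.Surjective e := by
    obtain ⟨u, hu⟩ := h.exists_one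
    exact fun v => ⟨u ⊗ₜ v, by rw [he, hu, one_smul]⟩
  let Q : P ⊗[k] V →ₗ[k] rtens P (LMod.ind n a han dV hdV) :=
    rmap (RLin.id P) q ∘ₗ P.toInd hdV
  let I : rtens P K →ₗ[k] P ⊗[k] V := P.fromInd hdV ∘ₗ rmap (RLin.id P) inc
  have hI : ∀ t, P.toInd hdV (I t) = rmap (RLin.id P) inc t := fun t => P.toInd_fromInd hdV _
  have hinj : Function.Injective (P.toInd hdV) :=
    Function.LeftInverse.injective (P.fromInd_toInd hdV)
  have hId : ∀ t, I (rtD P K t) = D (I t) := by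
    intro t
    apply hinj
    rw [hI, P.toInd_d, hI, rmap_d (RLin.id_isChain P) (fun _ => rfl)]
  have hQd : ∀ t, Q (D t) = rtD _ _ (Q t) := by
    intro t
    change rmap (RLin.id P) q (P.toInd hdV (D t)) = rtD _ _ (rmap (RLin.id P) q (P.toInd hdV t))
    rw [P.toInd_d, rmap_d (RLin.id_isChain P) (LMod.indProj_isChain hdV han)]
  have hIinj : Function.Injective I := by
    intro s t hst
    refine h.good.inj inc Subtype.val_injective ?_
    rw [← hI, hst, hI]
  have hQs : Function.Surjective Q := by
    intro t
    obtain ⟨s, rfl⟩ := rmap_surjective (RLin.id P) q (fun x => ⟨x, rfl⟩) hqs t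
    exact ⟨P.fromInd hdV s, congrArg (rmap (RLin.id P) q) (P.toInd_fromInd hdV s)⟩
  have hIQ : ∀ w, Q w = 0 ↔ ∃ s, I s = w := by
    intro w
    refine (hexact (P.toInd hdV w)).trans ⟨?_, ?_⟩
    · rintro ⟨s, hs⟩; exact ⟨s, hinj ((hI s).trans hs)⟩
    · rintro ⟨s, rfl⟩; exact ⟨s, (hI s).symm⟩
  -- evaluation
  let E : rtens P (LMod.ind n a han dV hdV) →ₗ[k] V := h.eval hdV ∘ₗ rmap (RLin.id P) c
  have hEd : ∀ t, E (rtD _ _ t) = dV (E t) := by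
    intro t
    change h.eval hdV (rmap (RLin.id P) c _) = dV (h.eval hdV (rmap (RLin.id P) c t))
    rw [rmap_d (RLin.id_isChain P) hc, h.eval_d]
  have hEQ : ∀ w, E (Q w) = e w := by
    intro w
    refine LinearMap.congr_fun (f := E ∘ₗ Q) (g := e) (TensorProduct.ext' fun u v => ?_) w
    have h1 : c.lin (q.lin ((1 : TruncPoly k n) ⊗ₜ[k] v : TruncPoly k n ⊗[k] V)) = v := by
      change TensorProduct.lift _ (LinearMap.rTensor V _ (_ ⊗ₜ _)) = _
      rw [LinearMap.rTensor_tmul, TensorProduct.lift.tmul, AlgHom.toLinearMap_apply,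
        AlgHom.toLinearMap_apply, map_one, map_one]
      rfl
    change h.eval hdV (rtmul P T u (c.lin (q.lin ((1 : TruncPoly k n) ⊗ₜ[k] v)))) = ε u • v
    rw [h1]
    rfl
  -- a class of `V` which is not a coboundary
  have hVacy : ¬ AcyclicOn p dV ⊤ := fun hac => hV (dvd_finrank_of_acyclic hdV hac)
  obtain ⟨v, hv0, hv⟩ := exists_not_coboundary hVacy hb hbp
  -- The class of `V` is lifted to a cocycle of `P ⊗ V`; it agrees with `v` only up to a coboundary
  -- `d^(p-b) v'`.
  obtain ⟨y, hy⟩ := (Coh.mapChain_bijective hed hes hacy hbp.le hD).2 (Coh.mk p dV b v hv0)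
  obtain ⟨w₀, hw₀, rfl⟩ := Coh.exists_mk y
  rw [Coh.mapChain_mk] at hy
  have hw₀v : ∃ v', (dV ^ (p - b)) v' = e w₀ - v := by
    refine (Coh.mk_eq_zero (p := p) (d := dV) (a := b) (u := e w₀ - v) (by
      rw [map_sub, hv0, sub_zero, ← map_pow_apply hed, hw₀, map_zero])).1 ?_
    exact sub_eq_zero.2 hy
  obtain ⟨v', hv'⟩ := hw₀v
  have hfin' := (h.good.finite_coh_iff c hc hcs hck hbp.le).2 hfin
  have hlt := Coh.finrank_lt (dV := rtD P K) (dW := D) (dZ := rtD _ _) (i := I) (q := Q) hId hQd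
    hIinj hQs hIQ hbp.le hD (w₀ := w₀)
    (by
      intro s hs
      -- The image of `P ⊗_C K` lies in the kernel of `e`, where the total differential is acyclic.
      -- So its cocycles bound in the middle term and the connecting map is onto.
      have h1 : e (I s) = 0 := by rw [← hEQ, (hIQ (I s)).2 ⟨s, rfl⟩, map_zero]
      obtain ⟨w, -, hw⟩ := hacy.exact (fun u hu => by
        rw [LinearMap.mem_ker] at *; rw [hed, hu, map_zero]) (a := p - b) (by omega) (I s) h1 (by
        rw [← map_pow_apply hId, hs, map_zero])
      rw [Nat.sub_sub_self hbp.le] at hw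
      exact ⟨w, hw⟩) hw₀
    (by
      intro z hz
      -- Evaluating a primitive of the image of `w₀` and correcting it by `v'` would exhibit `v` as
      -- a coboundary in `V`.
      have h1 := congrArg E hz
      rw [hEQ, map_pow_apply hEd] at h1
      refine hv (E z - v') ?_
      rw [map_sub, h1, hv']
      abel) hfin'
  obtain ⟨hKfin, hKlt⟩ := hlt
  -- comparison of `K` with the trivial module
  have hbp' : p - b ≤ p := Nat.sub_le _ _
  have hf1 := (h.good.finite_coh_iff (K.counit han hK) (K.counit_isChain han hK)
    (K.counit_surjective han hK) (K.counit_acyclicOn han hK ha1) hbp').2 hKfin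
  have hr1 := h.good.finrank_coh_eq (K.counit han hK) (K.counit_isChain han hK)
    (K.counit_surjective han hK) (K.counit_acyclicOn han hK ha1) hbp'
  have hf2 := (h.good.finite_coh_iff (K₀.counit han hK₀) (K₀.counit_isChain han hK₀)
    (K₀.counit_surjective han hK₀) (K₀.counit_acyclicOn han hK₀ ha1) hbp').1 hf1
  have hr2 := h.good.finrank_coh_eq (K₀.counit han hK₀) (K₀.counit_isChain han hK₀)
    (K₀.counit_surjective han hK₀) (K₀.counit_acyclicOn han hK₀ ha1) hbp'
  have hr3 := h.good.finrank_coh_eq c hc hcs hck hbp.le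
  -- Both `K` and the trivial module `K₀` are images of the same induced module under counits with
  -- acyclic kernels, so their cohomologies after tensoring agree. The dimension `(n - a) dim V` is
  -- again prime to `p`.
  refine ih _ ?_ K K.d K.d_pow ?_ (p - b) (by omega) (by omega) hf2 rfl
  · rw [← hN, ← hr2, hr1, ← hr3]
    exact hKlt
  · have := LMod.finrank_indKer hdV han
    rw [this, hp.out.dvd_mul]
    exact fun h => h.elim hna hV

theorem Augmented.not_finite {P : RMod p k (TruncPoly k n)} {ε : P →ₗ[k] k}
    (h : Augmented P ε) {gr : ℤ → Submodule k P} (hi : DirectSum.IsInternal gr)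
    (hd : ∀ i, ∀ u ∈ gr i, P.d u ∈ gr (i + 2)) (hx : ∀ i, ∀ u ∈ gr i, P.xAct u ∈ gr (i + 2))
    (hε : ∀ v j, ε v = 0 → ε (gproj hi j v) = 0) (hneg : ∀ i < 0, ∀ u ∈ gr i, ε u = 0)
    (hn : ¬ p ∣ n - 1) : ¬ Module.Finite k (Coh p (rtD P (LMod.one p k n)) 1) := by
  have hp1 := hp.out.one_lt
  have hn1 : n - 1 ≠ 0 := by rintro h0; rw [h0] at hn; exact hn (dvd_zero _)
  rcases le_or_gt n p with hle | hlt
  · exact h.not_finite_of_le hi hd hx hε hneg (by omega) hle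
  · intro hfin
    have hr := Nat.mod_lt (n - 1) hp.out.pos
    have hr0 : (n - 1) % p ≠ 0 := fun h0 => hn (Nat.dvd_of_mod_eq_zero h0)
    have hdm := Nat.div_add_mod (n - 1) p
    have hq : p * 1 ≤ p * ((n - 1) / p) := Nat.mul_le_mul_left _ (by
      rw [Nat.one_le_div_iff hp.out.pos]; omega)
    -- The largest `a ≤ n` with `a = 1` modulo `p`. Since `n > p` the quotient is at least one, so
    -- `n ≤ 2 a`; and `n - a` is the remainder of `n - 1` modulo `p`, which is not zero. The descent
    -- starts from `V = k` and `b = 1`.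
    refine h.not_finite_triv (a := p * ((n - 1) / p) + 1) (by simp) (by omega) (by omega) ?_ _ k 0
      (zero_pow hp.out.ne_zero) (by rw [Module.finrank_self]; exact hp.out.one_lt.ne' ∘
        Nat.dvd_one.1) 1 one_pos hp1 hfin rfl
    rw [show n - (p * ((n - 1) / p) + 1) = (n - 1) % p by omega]
    exact fun hdvd => hr0 (Nat.eq_zero_of_dvd_of_lt hdvd hr)

end Descent
end PDG

namespace PDG

namespace AShriek

variable {p : ℕ} [hp : Fact p.Prime] {k : Type u} [Field k] [CharP k p] {n : ℕ}

theorem character_vertex {k : Type u} [Field k] {n : ℕ} (i : Fin n) : character k i (vertex k i) = 1 :=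
  (lift_gen k _ _ (.vertex i)).trans (if_pos rfl)

theorem character_d (i : Fin n) (a : AShriek k n) :
    character k i (PDGAlgebra.d (p := p) (k := k) a) = 0 := by
  have h := (simple k p i).d_lact a (1 : k)
  have h1 : character k i (PDGAlgebra.d (p := p) (k := k) a) * 1
    + character k i a * (0 : k) = 0 := h.symm
  rwa [mul_one, mul_zero, add_zero] at h1

end AShriek

/-! ### The corner `(1)X` of a bar resolution and the trivial summands -/

namespace PDGBimod
open AShriek

variable {p : ℕ} [hp : Fact p.Prime] {k : Type u} [Field k] [CharP k p] {n : ℕ} [NeZero n]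

/-- The subspace `(1)X`. -/
noncomputable def corner (X : PDGBimod p k (AShriek k n) (TruncPoly k n)) : Submodule k X :=
  LinearMap.ker (X.lact (vertex k 0) - LinearMap.id)

theorem mem_corner {X : PDGBimod p k (AShriek k n) (TruncPoly k n)} {x : X} :
    x ∈ corner X ↔ X.lact (vertex k 0) x = x := by
  rw [corner, LinearMap.mem_ker, LinearMap.sub_apply, sub_eq_zero]; rfl

theorem lact_mem_corner (X : PDGBimod p k (AShriek k n) (TruncPoly k n)) (x : X) :
    X.lact (vertex k 0) x ∈ corner X := by
  rw [mem_corner, ← Module.End.mul_apply, ← map_mul, vertex_mul_self]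

theorem d_lact_vertex (X : PDGBimod p k (AShriek k n) (TruncPoly k n)) (x : X) :
    X.d (X.lact (vertex k 0) x) = X.lact (vertex k 0) (X.d x) := by
  rw [X.d_lact, d_vertex, map_zero, LinearMap.zero_apply, zero_add]

/-- The right module `(1)X`. -/
noncomputable abbrev cornerMod (X : PDGBimod p k (AShriek k n) (TruncPoly k n)) :
    RMod p k (TruncPoly k n) :=
  X.toR.sub (corner X)
    (fun x hx => by
      change X.d x ∈ corner X
      rw [mem_corner] at *
      rw [← d_lact_vertex, hx])
    (fun b x hx => by
      change X.ract b x ∈ corner X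
      rw [mem_corner] at *
      rw [X.lact_ract, hx])

/-- The inclusion of `(1)X`. -/
noncomputable abbrev cornerIncl (X : PDGBimod p k (AShriek k n) (TruncPoly k n)) :
    RLin (cornerMod X) X.toR := X.toR.subIncl (corner X) _ _

theorem cornerIncl_isChain (X : PDGBimod p k (AShriek k n) (TruncPoly k n)) :
    (cornerIncl X).IsChain := fun _ => rfl

/-- The projection onto `(1)X`. -/
noncomputable abbrev cornerProj (X : PDGBimod p k (AShriek k n) (TruncPoly k n)) :
    RLin X.toR (cornerMod X) where
  lin := (X.lact (vertex k 0)).codRestrict (corner X) (lact_mem_corner X)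
  map_ract b x := Subtype.ext (X.lact_ract _ b x)

theorem cornerProj_isChain (X : PDGBimod p k (AShriek k n) (TruncPoly k n)) :
    (cornerProj X).IsChain := fun x => Subtype.ext (d_lact_vertex X x).symm

theorem cornerProj_incl (X : PDGBimod p k (AShriek k n) (TruncPoly k n)) (x : cornerMod X) :
    (cornerProj X).lin ((cornerIncl X).lin x) = x := Subtype.ext (mem_corner.1 x.2)

/-- The augmentation `(1)X → (1)A(n) → k`. -/
noncomputable def cornerAug {X : PDGBimod p k (AShriek k n) (TruncPoly k n)}
    (π : X ⟶ columnLast p k n) : cornerMod X →ₗ[k] k :=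
  columnCoeff k n ∘ₗ (endingAtLast k n).subtype ∘ₗ π.lin ∘ₗ (cornerIncl X).lin

theorem cornerAug_apply {X : PDGBimod p k (AShriek k n) (TruncPoly k n)}
    (π : X ⟶ columnLast p k n) (u : cornerMod X) :
    cornerAug π u = columnCoeff k n (π.lin u.1 : endingAtLast k n).1 := rfl

theorem cornerAug_eq_zero {X : PDGBimod p k (AShriek k n) (TruncPoly k n)}
    (π : X ⟶ columnLast p k n) (u : cornerMod X) : cornerAug π u = 0 ↔ π.lin u.1 = 0 := by
  constructor
  · intro h
    apply Subtype.ext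
    refine eq_zero_of_columnCoeff k ?_ (π.lin u.1 : endingAtLast k n).2 h
    have := π.map_lact (vertex k 0) u.1
    rw [mem_corner.1 u.2] at this
    exact (congrArg Subtype.val this).symm
  · intro h
    rw [cornerAug_apply, h]
    exact map_zero _

/-- The idempotent at the first vertex makes `(1)X` a chain retract of `X` as a right module, so it
inherits goodness. Since `(1)A(n)` is the line of the full ascent, `π` restricts there to `ε`, and
`ker ε` is the corner of the acyclic complex `ker π`. -/
theorem IsBarResolution.augmented {X : PDGBimod p k (AShriek k n) (TruncPoly k n)}
    {π : X ⟶ columnLast p k n} (h : IsBarResolution π) : Augmented (cornerMod X) (cornerAug π) where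
  good := h.propertyP.good.of_retract (cornerIncl X) (cornerProj X) (cornerIncl_isChain X)
    (cornerProj_isChain X) (cornerProj_incl X)
  map_x u := by
    have h1 := π.map_ract (op (TruncPoly.x k n)) u.1
    have h2 : ((columnLast p k n).ract (op (TruncPoly.x k n)) (π.lin u.1) : endingAtLast k n).1
      = (π.lin u.1 : endingAtLast k n).1 * ofTrunc k n (TruncPoly.x k n) := rfl
    rw [cornerAug_apply]
    refine (congrArg (fun z : endingAtLast k n => columnCoeff k n z.1) h1).trans ?_
    rw [h2, ofTrunc_x, columnCoeff_mul_loop]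
  map_d u :=
    (congrArg (fun z : endingAtLast k n => columnCoeff k n z.1) (π.map_d u.1)).trans
      (columnCoeff_d (p := p) k (π.lin u.1 : endingAtLast k n).1)
  exists_one := by
    obtain ⟨x, hx⟩ := h.surjective (⟨upPath k n 0 (n - 1), by
      rw [mem_ending, vertex_last, upPath_mul_ve, if_pos (by omega)]⟩ : endingAtLast k n)
    refine ⟨(cornerProj X).lin x, ?_⟩
    have h1 := π.map_lact (vertex k 0) x
    refine (congrArg (fun z : endingAtLast k n => columnCoeff k n z.1) h1).trans ?_
    change columnCoeff k n (vertex k 0 * (π.lin x : endingAtLast k n).1) = 1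
    rw [hx]
    change columnCoeff k n (vertex k 0 * upPath k n 0 (n - 1)) = 1
    rw [vertex_zero, ve_mul_upPath, if_pos rfl, columnCoeff_upPath]
  acyclic := by
    intro u hu hdu
    obtain ⟨v, hv, hvu⟩ := kerAcyclic_of_quasiIso π h.quasiIso h.surjective u.1
      ((cornerAug_eq_zero π u).1 hu) (congrArg Subtype.val hdu)
    refine ⟨(cornerProj X).lin v, ?_, ?_⟩
    · rw [LinearMap.mem_ker, cornerAug_eq_zero]
      refine (π.map_lact (vertex k 0) v).trans ?_
      rw [LinearMap.mem_ker.1 hv, map_zero]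
    · rw [← map_pow_apply (cornerProj_isChain X), hvu]
      exact cornerProj_incl X u

theorem internal_corner (X : PDGBimod p k (AShriek k n) (TruncPoly k n)) :
    DirectSum.IsInternal (fun i : ℤ => (X.gr i).comap (corner X).subtype) :=
  isInternal_comap X.internal (corner X) (cornerProj X).lin (fun w => Subtype.ext (mem_corner.1 w.2))
    (fun i m hm => by
      have := X.lact_mem (vertex_mem (p := p) (k := k) (0 : Fin n)) hm
      rwa [zero_add] at this)

theorem IsBarResolution.not_finite_corner {X : PDGBimod p k (AShriek k n) (TruncPoly k n)}
    {π : X ⟶ columnLast p k n} (h : IsBarResolution π) (hn : ¬ p ∣ n - 1) :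
    ¬ Module.Finite k (Coh p (rtD (cornerMod X) (LMod.one p k n)) 1) := by
  refine h.augmented.not_finite (internal_corner X) (fun i u hu => X.d_mem hu)
    (fun i u hu => X.ract_mem (monomialGrading_gen (fun _ : Unit => TruncPoly.x k n) (fun _ => 2) ())
      hu) ?_ ?_ hn
  · intro v j hv
    rw [cornerAug_eq_zero] at *
    have h1 : ((gproj (internal_corner X) j v : corner X) : X) = gproj X.internal j v.1 := by
      have := map_gproj (internal_corner X) X.internal (corner X).subtype 0
        (fun i m hm => by rw [add_zero]; exact hm) j v
      rwa [add_zero] at this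
    rw [h1, π.map_gproj, hv, map_zero]
  · intro i hi u hu
    rw [cornerAug_eq_zero]
    exact Subtype.ext (gr_eq_bot_of_neg (p := p) k hi (π.map_mem hu))

/-- Tensoring a bar resolution of `A(n)` with a module which contains the trivial module as a direct
summand yields infinite-dimensional cohomology. -/
theorem IsBarResolution.not_finite {X : PDGBimod p k (AShriek k n) (TruncPoly k n)}
    {π : X ⟶ columnLast p k n} (h : IsBarResolution π) (hn : ¬ p ∣ n - 1)
    {Y : LMod p k (TruncPoly k n)} (y : Y) (hy : Y.lact (TruncPoly.x k n) y = 0) (hdy : Y.d y = 0)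
    (ψ : Y →ₗ[k] k) (hψ : ∀ z, ψ (Y.lact (TruncPoly.x k n) z) = 0) (hdψ : ∀ z, ψ (Y.d z) = 0)
    (hψy : ψ y = 1) : ¬ Module.Finite k (Coh p (rtD X.toR Y) 1) := by
  intro hfin
  let i : LLin (LMod.one p k n) Y := LLin.ofX (LinearMap.toSpanSingleton k Y y) (fun c => by
    rw [LMod.triv_x]
    change (0 : k) • y = Y.lact (TruncPoly.x k n) ((c : k) • y)
    rw [zero_smul, map_smul, hy, smul_zero])
  let r : LLin Y (LMod.one p k n) := LLin.ofX (Y' := LMod.one p k n) ψ (fun c => by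
    rw [LMod.triv_x, hψ])
  have hi : i.IsChain := fun c => by
    change (0 : k) • y = Y.d ((c : k) • y)
    rw [zero_smul, map_smul, hdy, smul_zero]
  have hr : r.IsChain := fun c => hdψ c
  have hri : ∀ c, r.lin (i.lin c) = c := fun c => by
    change ψ ((c : k) • y) = (c : k)
    rw [map_smul, hψy, smul_eq_mul, mul_one]
  have hI := rmap_d (cornerIncl_isChain X) hi
  have hR := rmap_d (cornerProj_isChain X) hr
  -- The retracts `(1)X` of `X` and `k` of `Y` make `(1)X ⊗_C k` a chain retract of `X ⊗_C Y`, so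
  -- its cohomology injects.
  refine h.not_finite_corner hn (Module.Finite.of_injective
    (Coh.mapChain p 1 (rmap (cornerIncl X) i) hI) ?_)
  rw [← LinearMap.ker_eq_bot, LinearMap.ker_eq_bot']
  intro c hc
  obtain ⟨u, hu, rfl⟩ := c.exists_mk
  rw [Coh.mapChain_mk, Coh.mk_eq_zero] at hc
  rw [Coh.mk_eq_zero]
  obtain ⟨w, hw⟩ := hc
  refine ⟨rmap (cornerProj X) r w, ?_⟩
  rw [← map_pow_apply hR, hw, rmap_rmap _ _ _ _ (RLin.id _) (LLin.id _) (cornerProj_incl X) hri,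
    rmap_eq_self _ _ (fun _ => rfl) (fun _ => rfl)]

theorem rowLast_x (a : rowLast p k n) : ((rowLast p k n).lact (TruncPoly.x k n) a : startingAtLast k n).1
    = loop k n * (a : startingAtLast k n).1 := by
  rw [← ofTrunc_x]; rfl

/-- The descending path, as an element of `(n)A`. -/
noncomputable def rowPath : startingAtLast k n := ⟨downPath k n 0 (n - 1), vertex_mul_downPath k⟩

/-- The trivial summand of `(n)A` is spanned by the full descent, a cocycle killed by `x`;
`rowCoeff` retracts onto it, since it vanishes on multiples of `x` and on differentials. -/
theorem IsBarResolution.not_finite_jwBimod {X : PDGBimod p k (AShriek k n) (TruncPoly k n)}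
    {π : X ⟶ columnLast p k n} (h : IsBarResolution π) (hn : ¬ p ∣ n - 1) :
    ¬ Module.Finite k (Coh p (jwBimod X).d 1) := by
  refine h.not_finite hn (Y := (rowLast p k n).toL) (rowPath : startingAtLast k n) ?_ ?_
    (rowCoeff k n ∘ₗ (startingAtLast k n).subtype) ?_ ?_ ?_
  · exact Subtype.ext ((rowLast_x _).trans (loop_mul_downPath k))
  · exact Subtype.ext (d_downPath k)
  · intro z
    refine (congrArg (rowCoeff k n) (rowLast_x z)).trans (rowCoeff_loop_mul k _)
  · intro z
    exact rowCoeff_d (p := p) k _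
  · exact rowCoeff_downPath k

theorem character_loop : character k (last n) (loop k n) = 0 := by
  rw [loop, map_sum]
  refine Finset.sum_eq_zero fun j _ => ?_
  have : character k (last n) (arrow k (last n) j) = 0 := lift_gen k _ _ (.arrow _ j)
  rw [map_mul, this, zero_mul]

/-- The map `(n)A ⊗_A L_n → k` induced by the character of `L_n`. -/
noncomputable def rowSimple :
    tensorCarrier (rowLast p k n) (simple k p (last n)) →ₗ[k] k :=
  (balanced (rowLast p k n) (simple k p (last n))).liftQ
    (TensorProduct.lift (LinearMap.mul k k ∘ₗ (character k (last n)).toLinearMap ∘ₗ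
      (startingAtLast k n).subtype)) (by
    refine Submodule.span_le.2 ?_
    rintro _ ⟨a, b, c, rfl⟩
    change _ = _
    rw [map_sub, sub_eq_zero, TensorProduct.lift.tmul, TensorProduct.lift.tmul]
    exact (congrArg (· * (show k from c)) (map_mul (character k (last n)) _ b)).trans
      (mul_assoc _ _ (show k from c)))

theorem rowSimple_tmul (a : startingAtLast k n) (c : k) :
    rowSimple (p := p) (tmul (rowLast p k n) (simple k p (last n)) a c)
      = character k (last n) a.1 * c := rfl

/-- The trivial summand of `(n)A ⊗_A L_n` is spanned by `(n) ⊗ 1`. The action of `x` on `(n)` equals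
right multiplication by the loop, which moves across the tensor sign and kills `L_n`. -/
theorem IsBarResolution.not_finite_simple {X : PDGBimod p k (AShriek k n) (TruncPoly k n)}
    {π : X ⟶ columnLast p k n} (h : IsBarResolution π) (hn : ¬ p ∣ n - 1) :
    ¬ Module.Finite k (Coh p ((jonesWenzl X).obj (simple k p (last n))).d 1) := by
  let R := rowLast p k n
  let S := simple k p (last n)
  let e : startingAtLast k n := ⟨vertex k (last n), vertex_mul_self k _⟩
  refine h.not_finite hn (Y := (R.tensor S).toL) (tmul R S e (1 : k)) ?_ ?_ rowSimple ?_ ?_ ?_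
  · have h1 : R.lact (TruncPoly.x k n) e = R.ract (op (loop k n)) e :=
      Subtype.ext ((rowLast_x e).trans (by
        change loop k n * vertex k (last n) = vertex k (last n) * loop k n
        rw [loop_mul_vertex, vertex_mul_loop]))
    change tmul R S (R.lact (TruncPoly.x k n) e) (1 : k) = 0
    refine (congrArg (tmul R S · (1 : k)) h1).trans ((tmul_balanced R S e (loop k n) (1 : k)).trans ?_)
    have h2 : S.lact (loop k n) (1 : k) = 0 := by
      change character k (last n) (loop k n) * (1 : k) = 0
      rw [character_loop, zero_mul]
    rw [h2]
    exact rtmul_zero_right R.toR S.toL e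
  · have h1 : R.d e = 0 := Subtype.ext (d_vertex _)
    change tmul R S (R.d e) (1 : k) + tmul R S e (0 : k) = 0
    rw [h1]
    exact (congrArg₂ (· + ·) (rtmul_zero_left R.toR S.toL _) (rtmul_zero_right R.toR S.toL e)).trans
      (add_zero _)
  · intro z
    refine LinearMap.congr_fun (f := rowSimple ∘ₗ (R.tensor S).lact (TruncPoly.x k n)) (g := 0)
      (tensor_ext (X := R) (Y := S) fun a c => ?_) z
    change rowSimple (p := p) (tmul R S (R.lact (TruncPoly.x k n) a) c) = 0
    refine (rowSimple_tmul _ _).trans ?_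
    rw [rowLast_x, map_mul, character_loop, zero_mul]
    exact zero_mul (show k from c)
  · intro z
    refine LinearMap.congr_fun (f := rowSimple ∘ₗ (R.tensor S).d) (g := 0)
      (tensor_ext (X := R) (Y := S) fun a c => ?_) z
    change rowSimple (p := p) (tmul R S (R.d a) c + tmul R S a (0 : k)) = 0
    rw [map_add]
    refine (congrArg₂ (· + ·) (rowSimple_tmul _ _) (rowSimple_tmul _ _)).trans ?_
    rw [mul_zero, add_zero]
    refine (congrArg (· * (show k from c)) (character_d (p := p) (last n) (a : startingAtLast k n).1)).trans ?_
    exact zero_mul (show k from c)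
  · refine (rowSimple_tmul _ _).trans ?_
    rw [character_vertex, mul_one]

/-- A finitely generated bimodule over finite-dimensional algebras is finite-dimensional. -/
theorem IsFiniteCell.finite {A B : Type u} [Ring A] [Algebra k A] [PDGAlgebra p k A] [Ring B]
    [Algebra k B] [PDGAlgebra p k B] [Module.Finite k A] [Module.Finite k B]
    {K : PDGBimod p k A B} (h : IsFiniteCell K) : Module.Finite k K := by
  obtain ⟨-, s, hs⟩ := h
  let φ : K → (A ⊗[k] B →ₗ[k] K) := fun x => TensorProduct.lift
    ((LinearMap.lcomp k K (K.ract.toLinearMap.flip x ∘ₗ (opLinearEquiv k).toLinearMap) ∘ₗ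
      K.lact.toLinearMap))
  have h1 : (⨆ x ∈ s, LinearMap.range (φ x)) = ⊤ := by
    rw [eq_top_iff, ← hs]
    refine Submodule.span_le.2 ?_
    rintro _ ⟨a, b, x, hx, rfl⟩
    exact Submodule.mem_iSup_of_mem x (Submodule.mem_iSup_of_mem hx ⟨a ⊗ₜ b, rfl⟩)
  refine ⟨?_⟩
  rw [← h1]
  exact Submodule.fg_biSup s _ fun x _ => by
    rw [← Submodule.map_top]
    exact Module.Finite.fg_top.map _

end PDGBimod
end PDG

namespace PDG

namespace PDGBimod

/-! ### The negative statements -/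

section Infinite
open AShriek
variable {p : ℕ} [hp : Fact p.Prime] {k : Type u} [Field k] [CharP k p] {n : ℕ} [NeZero n]

/-- A finite cell bimodule `K` is finite-dimensional because `A` is, and so is `K ⊗_A L_n`. An
isomorphism in the derived category, or one of functors evaluated at `L_n`, would transport this
finiteness. -/
theorem IsBarResolution.not_finiteCell {X : PDGBimod p k (AShriek k n) (TruncPoly k n)}
    {π : X ⟶ columnLast p k n} (h : IsBarResolution π) (hn : ¬ p ∣ n - 1)
    {K : PDGBimod p k (AShriek k n) (AShriek k n)} (hK : IsFiniteCell K) :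
    IsEmpty ((toD p k _ _).obj (jwBimod X) ≅ (toD p k _ _).obj K) ∧
      ¬ Represents K (jonesWenzl X) := by
  have hfin := hK.finite
  refine ⟨⟨fun e => h.not_finite_jwBimod hn (finite_coh_of_iso e 1 inferInstance)⟩, ?_⟩
  rintro ⟨η⟩
  have : Module.Finite k (K.tensor (simple k p (last n))) := by
    have : Module.Finite k (simple k p (last n)) := inferInstanceAs (Module.Finite k k)
    exact inferInstanceAs (Module.Finite k (_ ⧸ balanced K (simple k p (last n))))
  exact h.not_finite_simple hn (finite_coh_of_iso (η.app (simple k p (last n))) 1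
    (inferInstanceAs (Module.Finite k (Coh p (K.tensor (simple k p (last n))).d 1))))

end Infinite

/-! ### Sub-bimodules, sums of shifted copies, and tensor products of morphisms -/

section TensorHom
variable {p : ℕ} {k A B C : Type u} [Field k] [Ring A] [Algebra k A] [PDGAlgebra p k A]
  [Ring B] [Algebra k B] [PDGAlgebra p k B] [Ring C] [Algebra k C] [PDGAlgebra p k C]

/-- Shifts of retracts are retracts. -/
def retractShift {X Y : PDGBimod p k A B} (f : Retract X Y) (s : ℤ) :
    Retract (X.shift s) (Y.shift s) where
  i := ⟨f.i.lin, f.i.map_lact, f.i.map_ract, fun h => f.i.map_mem h, f.i.map_d⟩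
  r := ⟨f.r.lin, f.r.map_lact, f.r.map_ract, fun h => f.r.map_mem h, f.r.map_d⟩
  retract := Hom.ext (show f.r.lin ∘ₗ f.i.lin = LinearMap.id from congrArg Hom.lin f.retract)

/-- Sub-bimodules which are graded direct summands. -/
def sub (X : PDGBimod p k A B) (N : Submodule k X) (π : X →ₗ[k] N) (hπ : ∀ w : N, π w = w)
    (hgr : ∀ i, ∀ m ∈ X.gr i, (π m : X) ∈ X.gr i) (hl : ∀ a, ∀ x ∈ N, X.lact a x ∈ N)
    (hr : ∀ b, ∀ x ∈ N, X.ract b x ∈ N) (hd : ∀ x ∈ N, X.d x ∈ N) : PDGBimod p k A B where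
  carrier := N
  gr i := (X.gr i).comap N.subtype
  internal := isInternal_comap X.internal N π hπ hgr
  lact := AlgHom.ofLinearMap
    { toFun := fun b => (X.lact b).restrict (hl b)
      map_add' := fun a b => by ext m; simp
      map_smul' := fun c a => by ext m; simp }
    (by ext m; simp) (fun a b => by ext m; simp)
  ract := AlgHom.ofLinearMap
    { toFun := fun b => (X.ract b).restrict (hr b)
      map_add' := fun a b => by ext m; simp
      map_smul' := fun c a => by ext m; simp }
    (by ext m; simp) (fun a b => by ext m; simp)
  lact_ract a b m := Subtype.ext (X.lact_ract a b m)
  lact_mem ha hm := X.lact_mem ha hm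
  ract_mem ha hm := X.ract_mem ha hm
  d := X.d.restrict hd
  d_mem hm := X.d_mem hm
  d_lact a m := Subtype.ext (X.d_lact a m)
  d_ract b m := Subtype.ext (X.d_ract b m)
  d_pow := restrict_pow_eq_zero X.d_pow hd

section Finsupp
variable {J : Type u} (E : PDGBimod p k A B) (deg : J → ℤ)

/-- The grading of a sum of copies of `E`, shifted by `deg`. -/
def finsuppGr (i : ℤ) : Submodule k (J →₀ E) where
  carrier := {f | ∀ j, f j ∈ E.gr (i - deg j)}
  add_mem' hf hg j := add_mem (hf j) (hg j)
  zero_mem' _ := zero_mem _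
  smul_mem' c _ hf j := Submodule.smul_mem _ c (hf j)

theorem single_mem_finsuppGr {i : ℤ} {j : J} {e : E} (he : e ∈ E.gr (i - deg j)) :
    Finsupp.single j e ∈ finsuppGr E deg i := by
  classical
  intro l
  rw [Finsupp.single_apply]
  split_ifs with h
  · exact h ▸ he
  · exact zero_mem _

theorem finsupp_internal : DirectSum.IsInternal (finsuppGr E deg) := by
  refine isInternal_of_coaction _ ?_ (Finsupp.lsum k fun j =>
    Finsupp.mapRange.linearMap (Finsupp.lsingle j) ∘ₗ
      Finsupp.lmapDomain E k (fun i => i + deg j) ∘ₗ coaction E.gr E.internal) ?_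
  · rw [eq_top_iff]
    rintro f -
    induction f using Finsupp.induction_linear with
    | zero => exact zero_mem _
    | add f g hf hg => exact add_mem hf hg
    | single j e =>
      refine E.homogeneous_induction
        (motive := fun e => Finsupp.single j e ∈ ⨆ i, finsuppGr E deg i) (fun i e he => ?_)
        (fun x y hx hy => ?_) e
      · exact Submodule.mem_iSup_of_mem (i + deg j)
          (single_mem_finsuppGr E deg (by rwa [add_sub_cancel_right]))
      · rw [Finsupp.single_add]; exact add_mem hx hy
  · intro i f hf
    rw [Finsupp.lsum_apply]
    have h : ∀ j, (Finsupp.mapRange.linearMap (Finsupp.lsingle j) ∘ₗ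
        Finsupp.lmapDomain E k (fun i => i + deg j) ∘ₗ coaction E.gr E.internal) (f j)
        = Finsupp.lsingle (R := k) i (Finsupp.single j (f j)) := by
      intro j
      rw [LinearMap.comp_apply, LinearMap.comp_apply, coaction_of_mem _ _ _ _ (hf j),
        Finsupp.lmapDomain_apply, Finsupp.mapDomain_single, sub_add_cancel]
      simp
    simp only [Finsupp.sum, h]
    rw [← map_sum]
    exact congrArg (Finsupp.single i) f.sum_single

/-- A sum of shifted copies of `E` with a twisted differential `D`. -/
noncomputable def finsupp (D : Module.End k (J →₀ E))
    (hmem : ∀ i, ∀ f ∈ finsuppGr E deg i, D f ∈ finsuppGr E deg (i + 2))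
    (hl : ∀ a f, D (Finsupp.mapRange.linearMap (E.lact a) f)
      = Finsupp.mapRange.linearMap (E.lact (PDGAlgebra.d (p := p) (k := k) a)) f
        + Finsupp.mapRange.linearMap (E.lact a) (D f))
    (hr : ∀ b f, D (Finsupp.mapRange.linearMap (E.ract (op b)) f)
      = Finsupp.mapRange.linearMap (E.ract (op b)) (D f)
        + Finsupp.mapRange.linearMap (E.ract (op (PDGAlgebra.d (p := p) (k := k) b))) f)
    (hD : D ^ p = 0) : PDGBimod p k A B where
  carrier := J →₀ E
  gr := finsuppGr E deg
  internal := finsupp_internal E deg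
  lact := AlgHom.ofLinearMap
    { toFun := fun a => Finsupp.mapRange.linearMap (E.lact a)
      map_add' := fun a b => by ext j m : 2; simp
      map_smul' := fun c a => by ext j m : 2; simp }
    (by ext j m : 2; simp) (fun a b => by ext j m : 2; simp)
  ract := AlgHom.ofLinearMap
    { toFun := fun a => Finsupp.mapRange.linearMap (E.ract a)
      map_add' := fun a b => by ext j m : 2; simp
      map_smul' := fun c a => by ext j m : 2; simp }
    (by ext j m : 2; simp) (fun a b => by ext j m : 2; simp)
  lact_ract a b f := Finsupp.ext fun j => E.lact_ract a b (f j)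
  lact_mem {i j a f} ha hf l := by
    rw [add_sub_assoc]
    exact E.lact_mem ha (hf l)
  ract_mem {i j a f} ha hf l := by
    rw [add_sub_right_comm]
    exact E.ract_mem ha (hf l)
  d := D
  d_mem hm := hmem _ _ hm
  d_lact := hl
  d_ract := hr
  d_pow := hD

theorem mapRange_pow (a : ℕ) : (Finsupp.mapRange.linearMap E.d : Module.End k (J →₀ E)) ^ a
    = Finsupp.mapRange.linearMap (E.d ^ a) := by
  induction a with
  | zero => exact Finsupp.mapRange.linearMap_id.symm
  | succ a ih =>
    rw [pow_succ, ih]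
    exact (Finsupp.mapRange.linearMap_comp _ _).symm

end Finsupp

variable [hp : Fact p.Prime] [CharP k p]

/-- The linear map underlying a tensor product of morphisms. -/
def tensorHomLin {X X' : PDGBimod p k A B} {Y Y' : PDGBimod p k B C} (f : X ⟶ X') (g : Y ⟶ Y') :
    tensorCarrier X Y →ₗ[k] tensorCarrier X' Y' :=
  tensorMap (TensorProduct.map f.lin g.lin) (fun x b y => by
    rw [map_sub, TensorProduct.map_tmul, TensorProduct.map_tmul, f.map_ract, g.map_lact]
    exact mem_balanced X' Y' _ b _)

/-- The tensor product of two morphisms. -/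
def tensorHom {X X' : PDGBimod p k A B} {Y Y' : PDGBimod p k B C} (f : X ⟶ X') (g : Y ⟶ Y') :
    X.tensor Y ⟶ X'.tensor Y' where
  lin := tensorHomLin f g
  map_lact a := LinearMap.congr_fun (f := tensorHomLin f g ∘ₗ tensorLact X Y a)
    (g := tensorLact X' Y' a ∘ₗ tensorHomLin f g)
    (tensor_ext fun x y => congrArg (tmul X' Y' · (g.lin y)) (f.map_lact a x))
  map_ract c := LinearMap.congr_fun (f := tensorHomLin f g ∘ₗ tensorRact X Y c)
    (g := tensorRact X' Y' c ∘ₗ tensorHomLin f g)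
    (tensor_ext fun x y => congrArg (tmul X' Y' (f.lin x)) (g.map_ract c y))
  map_mem {i t} ht := by
    have : tensorGr X Y i ≤ (tensorGr X' Y' i).comap (tensorHomLin f g) := by
      refine Submodule.span_le.2 ?_
      rintro _ ⟨a, b, x, y, hx, hy, hab, rfl⟩
      exact tmul_mem X' Y' (f.map_mem hx) (g.map_mem hy) hab
    exact this ht
  map_d := LinearMap.congr_fun (f := tensorHomLin f g ∘ₗ tensorD X Y)
    (g := tensorD X' Y' ∘ₗ tensorHomLin f g)
    (tensor_ext fun x y => congrArg₂ (· + ·) (congrArg (tmul X' Y' · (g.lin y)) (f.map_d x))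
      (congrArg (tmul X' Y' (f.lin x)) (g.map_d y)))

/-- Tensor products of retracts are retracts. -/
def retractTensor {X X' : PDGBimod p k A B} {Y Y' : PDGBimod p k B C} (f : Retract X X')
    (g : Retract Y Y') : Retract (X.tensor Y) (X'.tensor Y') where
  i := tensorHom f.i g.i
  r := tensorHom f.r g.r
  retract := Hom.ext (tensor_ext (X := X) (Y := Y)
    (f := (tensorHom f.r g.r).lin ∘ₗ (tensorHom f.i g.i).lin) (g := LinearMap.id) fun x y =>
      congrArg₂ (tmul X Y) (LinearMap.congr_fun (congrArg Hom.lin f.retract) x)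
        (LinearMap.congr_fun (congrArg Hom.lin g.retract) y))

section Finsupp
variable {J : Type u} (E : PDGBimod p k A B) (deg : J → ℤ)

/-- A direct sum of shifted copies of `E`. -/
noncomputable def copies : PDGBimod p k A B :=
  finsupp E deg (Finsupp.mapRange.linearMap E.d)
    (fun i f hf j => by
      rw [add_sub_right_comm]
      exact E.d_mem (hf j))
    (fun a f => Finsupp.ext fun j => E.d_lact a (f j))
    (fun a f => Finsupp.ext fun j => E.d_ract a (f j))
    (by
      rw [mapRange_pow, E.d_pow]
      ext j m : 2
      simp)

variable {E}

theorem isSumOfSummands_copies (h : Nonempty (Retract E (free p k A B))) :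
    IsSumOfSummands (copies E deg) := by
  classical
  refine ⟨J, fun j => E.shift (deg j), fun j => ⟨(Finsupp.lsingle j : E →ₗ[k] (J →₀ E)), ?_, ?_, ?_, ?_⟩, ?_, fun j => ⟨deg j, ?_⟩⟩
  · intro a m
    exact (Finsupp.mapRange_single (hf := map_zero (E.lact a))).symm
  · intro b m
    exact (Finsupp.mapRange_single (hf := map_zero (E.ract b))).symm
  · intro i m hm
    exact single_mem_finsuppGr E deg hm
  · intro m
    exact (Finsupp.mapRange_single (hf := map_zero E.d)).symm
  · have h1 := (finsuppLEquivDirectSum k E J).symm.bijective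
    have h2 : DirectSum.toModule k J (J →₀ E) (fun j => Finsupp.lsingle j)
        = (finsuppLEquivDirectSum k E J).symm.toLinearMap := by
      refine DirectSum.linearMap_ext (R := k) fun j => LinearMap.ext fun m => ?_
      simp
    have h3 : Function.Bijective
        (DirectSum.toModule k J (J →₀ E) (fun j => Finsupp.lsingle (R := k) j)) := by
      rw [h2]; exact h1
    exact h3
  · exact h.map fun r => retractShift r (deg j)

end Finsupp

theorem PropertyP.of_iso {K K' : PDGBimod p k A B} (e : K ≅ K') (h : PropertyP K) :
    PropertyP K' := by
  obtain ⟨F, ι, G, q, hinj, hmono, hex, hq, h0, hker, hG⟩ := h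
  have h1 : ∀ x, e.inv.lin (e.hom.lin x) = x := fun x =>
    LinearMap.congr_fun (congrArg Hom.lin e.hom_inv_id) x
  have h2 : ∀ x, e.hom.lin (e.inv.lin x) = x := fun x =>
    LinearMap.congr_fun (congrArg Hom.lin e.inv_hom_id) x
  have hi : Function.Injective e.hom.lin := Function.LeftInverse.injective h1
  have hr : ∀ i, LinearMap.range (ι i ≫ e.hom).lin = (LinearMap.range (ι i).lin).map e.hom.lin :=
    fun i => LinearMap.range_comp _ _
  refine ⟨F, fun i => ι i ≫ e.hom, G, q, fun i => hi.comp (hinj i), fun i => ?_, fun x => ?_, hq, h0,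
    fun i x => ?_, hG⟩
  · rw [hr, hr]; exact Submodule.map_mono (hmono i)
  · obtain ⟨i, hi⟩ := hex (e.inv.lin x)
    exact ⟨i, by rw [hr]; exact ⟨_, hi, h2 x⟩⟩
  · rw [hker, hr]
    refine ⟨Submodule.mem_map_of_mem, ?_⟩
    rintro ⟨y, hy, hyx⟩
    exact hi hyx ▸ hy

end TensorHom
end PDGBimod
end PDG

namespace PDG

theorem mem_of_mem_supported {k E W : Type*} [Field k] [AddCommGroup E] [Module k E] [AddCommGroup W]
    [Module k W] {J : Type*} {s : Set J} (φ : (J →₀ E) →ₗ[k] W) (S : Submodule k W)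
    (h : ∀ j ∈ s, ∀ e, φ (Finsupp.single j e) ∈ S) {f : J →₀ E} (hf : f ∈ Finsupp.supported E k s) :
    φ f ∈ S := by
  rw [← f.sum_single, Finsupp.sum, map_sum]
  exact Submodule.sum_mem _ fun j hj => h j (hf hj) _

namespace PDGBimod
variable {p : ℕ} {k A B : Type u} [Field k] [Ring A] [Algebra k A] [PDGAlgebra p k A]
  [Ring B] [Algebra k B] [PDGAlgebra p k B] [hp : Fact p.Prime] [CharP k p]

/-! ### Property (P) for triangular differentials -/

section Triangular
variable {J : Type u} {E : PDGBimod p k A B} {deg : J → ℤ} {D : Module.End k (J →₀ E)}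
    (hmem : ∀ i, ∀ f ∈ finsuppGr E deg i, D f ∈ finsuppGr E deg (i + 2))
    (hl : ∀ a f, D (Finsupp.mapRange.linearMap (E.lact a) f)
      = Finsupp.mapRange.linearMap (E.lact (PDGAlgebra.d (p := p) (k := k) a)) f
        + Finsupp.mapRange.linearMap (E.lact a) (D f))
    (hr : ∀ b f, D (Finsupp.mapRange.linearMap (E.ract (op b)) f)
      = Finsupp.mapRange.linearMap (E.ract (op b)) (D f)
        + Finsupp.mapRange.linearMap (E.ract (op (PDGAlgebra.d (p := p) (k := k) b))) f)
    (hD : D ^ p = 0)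

/-- A sum of summands of free modules with a triangular differential has property (P). -/
theorem propertyP_finsupp (h : Nonempty (Retract E (free p k A B))) (rank : J → ℕ)
    (htri : ∀ j e, D (Finsupp.single j e) - Finsupp.single j (E.d e)
      ∈ Finsupp.supported E k {l | rank l < rank j}) :
    PropertyP (finsupp E deg D hmem hl hr hD) := by
  classical
  let K := finsupp E deg D hmem hl hr hD
  -- The filtration is by rank. Off the diagonal `D` strictly lowers the rank, so it preserves each
  -- stage, and on the subquotients only the differential of `E` remains.
  let N : ℕ → Submodule k (J →₀ E) := fun i => Finsupp.supported E k {j | rank j ≤ i}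
  have hmono : ∀ i, N i ≤ N (i + 1) := fun i =>
    Finsupp.supported_mono fun l (hl : rank l ≤ i) => show rank l ≤ i + 1 by omega
  have hres : ∀ i (f : J →₀ E) (j : J), (Finsupp.restrictDom E k {j | rank j ≤ i} f : J →₀ E) j
      = if rank j ≤ i then f j else 0 := by
    intro i f j
    rw [Finsupp.restrictDom_apply, Finsupp.filter_apply]
    rfl
  have hact : ∀ i (φ : Module.End k E) (x : J →₀ E), x ∈ N i →
      Finsupp.mapRange.linearMap φ x ∈ N i := by
    intro i φ x hx j hj
    refine hx ?_
    rw [Finset.mem_coe, Finsupp.mem_support_iff] at *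
    intro h0
    exact hj ((congrArg φ h0).trans (map_zero φ))
  have hNd : ∀ i, ∀ x ∈ N i, D x ∈ N i := by
    intro i x hx
    refine mem_of_mem_supported D (N i) (fun j hj e => ?_) hx
    have h3 : Finsupp.single j (E.d e) ∈ N i := Finsupp.single_mem_supported k _ hj
    exact (Submodule.sub_mem_iff_left _ h3).1 (Finsupp.supported_mono
      (fun l (hl : rank l < rank j) => (hl.le.trans hj : rank l ≤ i)) (htri j e))
  have hproj : ∀ i (w : N i), (Finsupp.restrictDom E k {j | rank j ≤ i} w.1 : N i) = w := by
    intro i w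
    refine Subtype.ext (Finsupp.ext fun j => ?_)
    rw [hres]
    split_ifs with hj
    · rfl
    · by_contra h0
      exact hj (w.2 (Finsupp.mem_support_iff.2 (Ne.symm h0)))
  have hgr : ∀ i l, ∀ f ∈ finsuppGr E deg l,
      (Finsupp.restrictDom E k {j | rank j ≤ i} f : J →₀ E) ∈ finsuppGr E deg l := by
    intro i l f hf j
    rw [hres]
    split_ifs
    · exact hf j
    · exact zero_mem _
  let F : ℕ → PDGBimod p k A B := fun i => K.sub (N i) (Finsupp.restrictDom E k {j | rank j ≤ i})
    (hproj i) (hgr i)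
    (fun a x hx => hact i _ x hx) (fun b x hx => hact i _ x hx) (hNd i)
  let ι : ∀ i, F i ⟶ K := fun i => ⟨(N i).subtype, fun _ _ => rfl, fun _ _ => rfl, fun hm => hm,
    fun _ => rfl⟩
  have hrange : ∀ i, LinearMap.range (ι i).lin = N i := fun i => Submodule.range_subtype _
  let G : ℕ → PDGBimod p k A B := fun i =>
    copies (J := {j | rank j = i}) E (fun j => deg j.1)
  let Q : ∀ i, (J →₀ E) →ₗ[k] ({j | rank j = i} →₀ E) := fun i =>
    Finsupp.lsubtypeDomain {j | rank j = i}
  have hQ : ∀ i f j, Q i f j = f j.1 := fun i f j => rfl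
  have hQd : ∀ i (x : N i), Q i (D x.1) = Finsupp.mapRange.linearMap E.d (Q i x.1) := by
    intro i x
    have h1 : (Q i ∘ₗ (D - Finsupp.mapRange.linearMap E.d)) x.1 ∈ (⊥ : Submodule k _) := by
      refine mem_of_mem_supported _ _ (fun j (hj : rank j ≤ i) e => ?_) x.2
      rw [Submodule.mem_bot, LinearMap.comp_apply, LinearMap.sub_apply]
      refine Finsupp.ext fun l => ?_
      rw [hQ]
      by_contra h0
      have h2 := htri j e (Finsupp.mem_support_iff.2 (by
        intro h3
        refine h0 (Eq.trans ?_ h3)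
        rw [Finsupp.mapRange.linearMap_apply, Finsupp.mapRange_single]))
      have h3 : rank l.1 = i := l.2
      have h4 : rank l.1 < rank j := h2
      omega
    rw [Submodule.mem_bot, LinearMap.comp_apply, LinearMap.sub_apply, map_sub, sub_eq_zero] at h1
    exact h1.trans (Finsupp.ext fun j => rfl)
  let q : ∀ i, F i ⟶ G i := fun i => ⟨Q i ∘ₗ (N i).subtype, fun a x => Finsupp.ext fun j => rfl,
    fun a x => Finsupp.ext fun j => rfl, fun {l x} hx j => hx j.1, hQd i⟩
  have hker : ∀ i (x : N i), Q i x.1 = 0 ↔ ∀ j, rank j = i → x.1 j = 0 := by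
    intro i x
    constructor
    · intro h0 j hj
      exact DFunLike.congr_fun h0 (⟨j, hj⟩ : {j | rank j = i})
    · intro h0
      exact Finsupp.ext fun j => h0 j.1 j.2
  have hle : ∀ i (x : N i) j, x.1 j ≠ 0 → rank j ≤ i := fun i x j hj =>
    x.2 (Finsupp.mem_support_iff.2 hj)
  refine ⟨F, ι, G, q, fun i => (N i).subtype_injective, fun i => ?_, fun x => ?_, fun i y => ?_,
    fun x hx => ?_, fun i x => ?_, fun i => isSumOfSummands_copies _ h⟩
  · rw [hrange, hrange]; exact hmono i
  · refine ⟨(show J →₀ E from x).support.sup rank, ?_⟩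
    rw [hrange]
    exact fun j hj => Finset.le_sup (f := rank) hj
  · let y' : J →₀ E := Finsupp.mapDomain Subtype.val (show {j | rank j = i} →₀ E from y)
    have hy' : y' ∈ N i := by
      intro j hj
      obtain ⟨l, hl, rfl⟩ := Finset.mem_image.1 (Finsupp.mapDomain_support hj)
      exact l.2.le
    exact ⟨⟨y', hy'⟩, Finsupp.ext fun j => Finsupp.mapDomain_apply Subtype.val_injective _ j⟩
  · have hx' := (hker 0 x).1 hx
    refine Subtype.ext (Finsupp.ext fun j => ?_)
    by_contra h0
    exact h0 (hx' j (Nat.le_zero.1 (hle 0 x j h0)))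
  · rw [hrange]
    refine (hker (i + 1) x).trans ⟨fun h0 j hj => ?_, fun hx j hj => ?_⟩
    · have h1 := Finsupp.mem_support_iff.1 hj
      have h2 := hle _ x j h1
      have h3 : rank j ≠ i + 1 := fun h3 => h1 (h0 j h3)
      exact show rank j ≤ i by omega
    · by_contra h0
      have : rank j ≤ i := hx (Finsupp.mem_support_iff.2 h0)
      omega

end Triangular

theorem propertyP_of_retract {E : PDGBimod p k A B} (h : Nonempty (Retract E (free p k A B))) :
    PropertyP E := by
  have hmap : ∀ φ : Module.End k E, ∀ f : PUnit.{u + 1} →₀ E, ∀ j,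
      Finsupp.mapRange.linearMap φ f j = φ (f j) := fun _ _ _ => rfl
  refine PropertyP.of_iso (K := copies (J := PUnit.{u + 1}) E (fun _ => 0))
    ⟨⟨Finsupp.lapply PUnit.unit, fun _ _ => rfl, fun _ _ => rfl, fun {i f} hf => ?_, fun _ => rfl⟩,
      ⟨Finsupp.lsingle PUnit.unit, fun a m => ?_, fun a m => ?_, fun {i f} hf => ?_, fun m => ?_⟩,
      ?_, ?_⟩
    (propertyP_finsupp _ _ _ _ h (fun _ => 0) fun j e => ?_)
  · have := hf PUnit.unit
    rwa [sub_zero] at this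
  · exact (Finsupp.mapRange_single (hf := map_zero (E.lact a))).symm
  · exact (Finsupp.mapRange_single (hf := map_zero (E.ract a))).symm
  · exact single_mem_finsuppGr E _ (by rwa [sub_zero])
  · exact (Finsupp.mapRange_single (hf := map_zero E.d)).symm
  · exact Hom.ext (LinearMap.ext fun f => Finsupp.ext fun j => by cases j; exact Finsupp.single_eq_same)
  · exact Hom.ext (LinearMap.ext fun f => Finsupp.single_eq_same)
  · rw [Finsupp.mapRange.linearMap_apply, Finsupp.mapRange_single, sub_self]
    exact zero_mem _

end PDGBimod
end PDG

/-! ### Construction of the bar resolution -/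

namespace PDG

/-- Left and right multiplication by `D` commute, so in characteristic `p` the `p`-th power of `ad
D` is `ad (D ^ p)`. -/
theorem pow_mul_eq_of_commutator {p : ℕ} [hp : Fact p.Prime] {k V : Type u} [Field k] [CharP k p]
    [AddCommGroup V] [Module k V] (D f : Module.End k V)
    (h : ((LinearMap.mulLeft k D - LinearMap.mulRight k D) ^ p) f = 0) : D ^ p * f = f * D ^ p := by
  have hc : Commute (LinearMap.mulLeft k D - LinearMap.mulRight k D) (LinearMap.mulRight k D) :=
    Commute.sub_left (LinearMap.commute_mulLeft_right D D) (Commute.refl _)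
  have h1 := add_pow_prime_of_commute hp.out hc
  rw [sub_add_cancel] at h1
  have h2 := LinearMap.congr_fun h1 f
  rw [LinearMap.add_apply, h, zero_add, LinearMap.pow_mulLeft, LinearMap.pow_mulRight] at h2
  exact h2

namespace PDGBimod

/-- The letters of the words indexing a bar resolution. -/
structure Letter (p : ℕ) (ι : Type u) : Type u where
  level : Fin (p - 1)
  index : ι

variable {p : ℕ} [hp : Fact p.Prime] {k A C : Type u} [Field k] [CharP k p]
  [Ring A] [Algebra k A] [PDGAlgebra p k A] [Ring C] [Algebra k C] [PDGAlgebra p k C]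

/-- The induced bimodule `M ⊗ C`. -/
abbrev induced (M : PDGBimod p k A C) : PDGBimod p k A C :=
  M.leftPart.tensor (regular p k C).rightPart

section Induced
variable (M : PDGBimod p k A C)

/-- The bilinear map `(m, c) ↦ m ⊗ c`. -/
def induce : M →ₗ[k] C →ₗ[k] induced M :=
  (TensorProduct.mk k M C).compr₂ (balanced M.leftPart (regular p k C).rightPart).mkQ

variable {M} in
/-- The linear map out of `M ⊗ C` defined by a bilinear map. -/
def inducedLift {W : Type u} [AddCommGroup W] [Module k W] (φ : M →ₗ[k] C →ₗ[k] W) :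
    induced M →ₗ[k] W :=
  TensorProduct.lift φ ∘ₗ (tensorBase M.leftPart (regular p k C).rightPart).toLinearMap

theorem inducedLift_induce {W : Type u} [AddCommGroup W] [Module k W] (φ : M →ₗ[k] C →ₗ[k] W) (m : M)
    (c : C) : inducedLift φ (induce M m c) = φ m c := rfl

variable {M} in
theorem induced_ext {W : Type u} [AddCommGroup W] [Module k W] {f g : induced M →ₗ[k] W}
    (h : ∀ m c, f (induce M m c) = g (induce M m c)) : f = g :=
  tensor_ext (X := M.leftPart) (Y := (regular p k C).rightPart) h

theorem d_induce (m : M) (c : C) : (induced M).d (induce M m c)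
    = induce M (M.d m) c + induce M m (PDGAlgebra.d (p := p) (k := k) c) := rfl

theorem induce_mem {a b i : ℤ} {m : M} {c : C} (hm : m ∈ M.gr a)
    (hc : c ∈ PDGAlgebra.gr (p := p) (k := k) b) (h : a + b = i) : induce M m c ∈ (induced M).gr i :=
  tmul_mem M.leftPart (regular p k C).rightPart hm hc h

variable {M} in
theorem mem_of_mem_induced {W : Type u} [AddCommGroup W] [Module k W] {f : induced M →ₗ[k] W}
    {S : Submodule k W} {i : ℤ}
    (h : ∀ a b m c, m ∈ M.gr a → c ∈ PDGAlgebra.gr (p := p) (k := k) b → a + b = i →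
      f (induce M m c) ∈ S) {e : induced M} (he : e ∈ (induced M).gr i) : f e ∈ S := by
  have : (induced M).gr i ≤ S.comap f := by
    refine Submodule.span_le.2 ?_
    rintro _ ⟨a, b, x, y, hx, hy, hab, rfl⟩
    exact h a b x y hx hy hab
  exact this he

end Induced

section Bar
variable (M : PDGBimod p k A C) {ι : Type u} (b : Module.Basis ι k C)

/-- The vector space underlying the bar resolution. -/
abbrev Bar (M : PDGBimod p k A C) (ι : Type u) : Type u := List (Letter p ι) →₀ induced M

variable {M} in
theorem bar_ext {W : Type u} [AddCommGroup W] [Module k W] {f g : Bar M ι →ₗ[k] W}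
    (h : ∀ r m c, f (Finsupp.single r (induce M m c)) = g (Finsupp.single r (induce M m c))) :
    f = g :=
  Finsupp.lhom_ext' fun r => induced_ext fun m c => h r m c

variable {M} in
theorem bar_ext_basis {W : Type u} [AddCommGroup W] [Module k W] {f g : Bar M ι →ₗ[k] W}
    (h : ∀ r m i, f (Finsupp.single r (induce M m (b i))) = g (Finsupp.single r (induce M m (b i)))) :
    f = g :=
  bar_ext fun r m c => LinearMap.congr_fun (b.ext
    (f₁ := f ∘ₗ Finsupp.lsingle r ∘ₗ induce M m) (f₂ := g ∘ₗ Finsupp.lsingle r ∘ₗ induce M m)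
    fun i => h r m i) c

/-- The left action. -/
noncomputable def barL (a : A) : Module.End k (Bar M ι) :=
  Finsupp.mapRange.linearMap ((induced M).lact a)

/-- The right action. -/
noncomputable def barR : C →ₗ[k] Module.End k (Bar M ι) where
  toFun c := Finsupp.mapRange.linearMap ((induced M).ract (op c))
  map_add' c c' := by ext; simp
  map_smul' s c := by ext; simp

variable {M}

theorem barL_single (a : A) (r : List (Letter p ι)) (m : M) (c : C) :
    barL M a (Finsupp.single r (induce M m c)) = Finsupp.single r (induce M (M.lact a m) c) :=
  Finsupp.mapRange_single (hf := map_zero ((induced M).lact a))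

theorem barR_single (c' : C) (r : List (Letter p ι)) (m : M) (c : C) :
    barR M c' (Finsupp.single r (induce M m c)) = Finsupp.single r (induce M m (c * c')) :=
  Finsupp.mapRange_single (hf := map_zero ((induced M).ract (op c')))

theorem barR_mul (c c' : C) (u : Bar M ι) : barR M (c * c') u = barR M c' (barR M c u) :=
  LinearMap.congr_fun (f := barR M (c * c')) (g := barR M c' ∘ₗ barR M c)
    (bar_ext fun r m l => by
      rw [LinearMap.comp_apply, barR_single, barR_single, barR_single, mul_assoc]) u

theorem barR_one (u : Bar M ι) : barR M 1 u = u :=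
  LinearMap.congr_fun (f := barR M 1) (g := LinearMap.id)
    (bar_ext fun r m l => by rw [barR_single, mul_one]; rfl) u

theorem barL_barR (a : A) (c : C) (u : Bar M ι) : barL M a (barR M c u) = barR M c (barL M a u) :=
  LinearMap.congr_fun (f := barL M a ∘ₗ barR M c) (g := barR M c ∘ₗ barL M a)
    (bar_ext fun r m l => by
      rw [LinearMap.comp_apply, LinearMap.comp_apply, barR_single, barL_single, barL_single,
        barR_single]) u

variable (M)

/-- Adding a letter to a word. -/
noncomputable def barS (v : Fin (p - 1)) : Module.End k (Bar M ι) :=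
  Finsupp.lsum k fun r => inducedLift ((b.constr k).toLinearMap ∘ₗ
    LinearMap.pi fun i => Finsupp.lsingle (⟨v, i⟩ :: r) ∘ₗ (induce M).flip 1)

theorem barS_single (v : Fin (p - 1)) (r : List (Letter p ι)) (m : M) (i : ι) :
    barS M b v (Finsupp.single r (induce M m (b i))) = Finsupp.single (⟨v, i⟩ :: r) (induce M m 1) := by
  rw [barS, Finsupp.lsum_single, inducedLift_induce, LinearMap.comp_apply]
  exact b.constr_basis k _ i

/-- The augmentation. -/
noncomputable def barπ (ι : Type u) : Bar M ι →ₗ[k] M :=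
  inducedLift (M.ract.toLinearMap ∘ₗ (opLinearEquiv k).toLinearMap).flip ∘ₗ Finsupp.lapply []

theorem barπ_nil (m : M) (c : C) :
    barπ M ι (Finsupp.single [] (induce M m c)) = M.ract (op c) m := by
  rw [barπ, LinearMap.comp_apply, Finsupp.lapply_apply, Finsupp.single_eq_same]
  rfl

theorem barπ_cons (l : Letter p ι) (r : List (Letter p ι)) (e : induced M) :
    barπ M ι (Finsupp.single (l :: r) e) = 0 := by
  rw [barπ, LinearMap.comp_apply, Finsupp.lapply_apply, Finsupp.single_eq_of_ne (by simp), map_zero]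

/-- The linear section of the augmentation. -/
noncomputable def barι (ι : Type u) : M →ₗ[k] Bar M ι := Finsupp.lsingle [] ∘ₗ (induce M).flip 1

theorem barι_apply (m : M) : barι M ι m = Finsupp.single [] (induce M m 1) := rfl

theorem barπ_barι (m : M) : barπ M ι (barι M ι m) = m := by
  rw [barι_apply, barπ_nil, op_one, map_one]; rfl

/-- The commutator of the differential with `barS`. -/
noncomputable def barT (v : Fin (p - 1)) : Module.End k (Bar M ι) :=
  if h : v.1 + 1 < p - 1 then barS M b ⟨v.1 + 1, h⟩ else LinearMap.id - barι M ι ∘ₗ barπ M ι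

/-- The differential on the generators. -/
noncomputable def barGen : List (Letter p ι) → (M →ₗ[k] Bar M ι)
  | [] => barι M ι ∘ₗ M.d
  | l :: r => barS M b l.level ∘ₗ (barR M (b l.index) ∘ₗ barGen r
        + Finsupp.lsingle r ∘ₗ (induce M).flip (PDGAlgebra.d (p := p) (k := k) (b l.index)))
      + barT M b l.level ∘ₗ Finsupp.lsingle r ∘ₗ (induce M).flip (b l.index)

/-- The differential. -/
noncomputable def barD : Module.End k (Bar M ι) :=
  Finsupp.lsum k fun r => inducedLift ((barR M).flip ∘ₗ barGen M b r
    + ((induce M).compr₂ (Finsupp.lsingle r)).compl₂ (PDGAlgebra.d (p := p) (k := k)))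

theorem barD_single (r : List (Letter p ι)) (m : M) (c : C) :
    barD M b (Finsupp.single r (induce M m c)) = barR M c (barGen M b r m)
      + Finsupp.single r (induce M m (PDGAlgebra.d (p := p) (k := k) c)) := by
  rw [barD, Finsupp.lsum_single, inducedLift_induce]
  rfl

theorem barGen_cons (l : Letter p ι) (r : List (Letter p ι)) (m : M) :
    barGen M b (l :: r) m = barS M b l.level (barD M b (Finsupp.single r (induce M m (b l.index))))
      + barT M b l.level (Finsupp.single r (induce M m (b l.index))) := by
  rw [barD_single]; rfl

theorem barD_single_one (r : List (Letter p ι)) (m : M) :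
    barD M b (Finsupp.single r (induce M m 1)) = barGen M b r m := by
  rw [barD_single, barR_one, d_one, map_zero, Finsupp.single_zero, add_zero]

theorem barD_barR (c : C) (u : Bar M ι) : barD M b (barR M c u)
    = barR M c (barD M b u) + barR M (PDGAlgebra.d (p := p) (k := k) c) u :=
  LinearMap.congr_fun (f := barD M b ∘ₗ barR M c)
    (g := barR M c ∘ₗ barD M b + barR M (PDGAlgebra.d (p := p) (k := k) c)) (bar_ext fun r m l => by
      rw [LinearMap.add_apply, LinearMap.comp_apply, LinearMap.comp_apply, barR_single, barR_single,
        barD_single, barD_single, map_add, barR_single, barR_mul, PDGAlgebra.d_mul, map_add,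
        Finsupp.single_add, add_assoc]) u

/-- A generator on the word `(v, i) :: r` is `S_v` of the element `m ⊗ b i` on the word `r`. The
recursion for `barGen` is dictated by this commutation rule, and linearity over the basis extends it
to all of the complex. -/
theorem barD_barS (v : Fin (p - 1)) (u : Bar M ι) :
    barD M b (barS M b v u) = barS M b v (barD M b u) + barT M b v u :=
  LinearMap.congr_fun (f := barD M b ∘ₗ barS M b v) (g := barS M b v ∘ₗ barD M b + barT M b v)
    (bar_ext_basis b fun r m i => by
      rw [LinearMap.add_apply, LinearMap.comp_apply, LinearMap.comp_apply, barS_single,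
        barD_single_one, barGen_cons]) u

theorem barD_barι (m : M) : barD M b (barι M ι m) = barι M ι (M.d m) := by
  rw [barι_apply, barD_single_one]; rfl

theorem barπ_barR (c : C) (u : Bar M ι) : barπ M ι (barR M c u) = M.ract (op c) (barπ M ι u) :=
  LinearMap.congr_fun (f := barπ M ι ∘ₗ barR M c) (g := M.ract (op c) ∘ₗ barπ M ι)
    (bar_ext fun r m l => by
      rw [LinearMap.comp_apply, LinearMap.comp_apply, barR_single]
      cases r with
      | nil => rw [barπ_nil, barπ_nil, op_mul, map_mul]; rfl
      | cons _ _ => rw [barπ_cons, barπ_cons, map_zero]) u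

theorem barπ_barL (a : A) (u : Bar M ι) : barπ M ι (barL M a u) = M.lact a (barπ M ι u) :=
  LinearMap.congr_fun (f := barπ M ι ∘ₗ barL M a) (g := M.lact a ∘ₗ barπ M ι)
    (bar_ext fun r m l => by
      rw [LinearMap.comp_apply, LinearMap.comp_apply, barL_single]
      cases r with
      | nil => rw [barπ_nil, barπ_nil, M.lact_ract]
      | cons _ _ => rw [barπ_cons, barπ_cons, map_zero]) u

theorem barπ_barS (v : Fin (p - 1)) (u : Bar M ι) : barπ M ι (barS M b v u) = 0 :=
  LinearMap.congr_fun (f := barπ M ι ∘ₗ barS M b v) (g := 0)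
    (bar_ext_basis b fun r m i => by
      rw [LinearMap.comp_apply, barS_single, barπ_cons]; rfl) u

theorem barπ_barT (v : Fin (p - 1)) (u : Bar M ι) : barπ M ι (barT M b v u) = 0 := by
  rw [barT]
  split_ifs
  · exact barπ_barS M b _ u
  · rw [LinearMap.sub_apply, LinearMap.comp_apply, map_sub, barπ_barι]
    exact sub_self _

theorem barπ_barD (u : Bar M ι) : barπ M ι (barD M b u) = M.d (barπ M ι u) :=
  LinearMap.congr_fun (f := barπ M ι ∘ₗ barD M b) (g := M.d ∘ₗ barπ M ι)
    (bar_ext fun r m c => by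
      rw [LinearMap.comp_apply, LinearMap.comp_apply, barD_single, map_add, barπ_barR]
      cases r with
      | nil =>
        rw [barπ_nil, barπ_nil, M.d_ract]
        congr 2
        exact barπ_barι M (M.d m)
      | cons l r =>
        rw [barπ_cons, barπ_cons, barGen_cons, map_add, barπ_barS, barπ_barT, map_zero, add_zero,
          add_zero, map_zero]) u

theorem barL_barS (a : A) (v : Fin (p - 1)) (u : Bar M ι) :
    barL M a (barS M b v u) = barS M b v (barL M a u) :=
  LinearMap.congr_fun (f := barL M a ∘ₗ barS M b v) (g := barS M b v ∘ₗ barL M a)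
    (bar_ext_basis b fun r m i => by
      rw [LinearMap.comp_apply, LinearMap.comp_apply, barS_single, barL_single, barL_single,
        barS_single]) u

theorem barL_barT (a : A) (v : Fin (p - 1)) (u : Bar M ι) :
    barL M a (barT M b v u) = barT M b v (barL M a u) := by
  rw [barT]
  split_ifs
  · exact barL_barS M b a _ u
  · rw [LinearMap.sub_apply, LinearMap.sub_apply, map_sub, LinearMap.comp_apply,
      LinearMap.comp_apply, barπ_barL, barι_apply, barι_apply, barL_single]
    rfl

theorem barGen_lact (a : A) (r : List (Letter p ι)) (m : M) : barGen M b r (M.lact a m)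
    = Finsupp.single r (induce M (M.lact (PDGAlgebra.d (p := p) (k := k) a) m) 1)
      + barL M a (barGen M b r m) := by
  induction r generalizing m with
  | nil =>
    change barι M ι (M.d (M.lact a m)) = _ + barL M a (barι M ι (M.d m))
    rw [M.d_lact, map_add, barι_apply, barι_apply, barι_apply, barL_single]
  | cons l r ih =>
    rw [barGen_cons, barGen_cons, map_add, barL_barS, barL_barT, barL_single, barD_single,
      barD_single, ih, map_add, map_add, barR_single, one_mul, map_add, map_add, barL_barR,
      barL_single, barS_single, map_add]
    abel

theorem barD_barL (a : A) (u : Bar M ι) : barD M b (barL M a u)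
    = barL M (PDGAlgebra.d (p := p) (k := k) a) u + barL M a (barD M b u) :=
  LinearMap.congr_fun (f := barD M b ∘ₗ barL M a)
    (g := barL M (PDGAlgebra.d (p := p) (k := k) a) + barL M a ∘ₗ barD M b) (bar_ext fun r m c => by
      rw [LinearMap.add_apply, LinearMap.comp_apply, LinearMap.comp_apply, barL_single, barL_single,
        barD_single, barD_single, barGen_lact, map_add, map_add, barR_single, one_mul, barL_barR,
        barL_single, add_assoc]) u

/-- Commutation with the differential. -/
theorem barD_commutator (v : Fin (p - 1)) :
    (LinearMap.mulLeft k (barD M b) - LinearMap.mulRight k (barD M b)) (barS M b v) = barT M b v := by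
  refine LinearMap.ext fun u => ?_
  change barD M b (barS M b v u) - barS M b v (barD M b u) = _
  rw [barD_barS, add_sub_cancel_left]

/-- Bracketing with `D` walks through the levels, `S_v ↦ S_(v+1) ↦ ⋯ ↦ S_(p-2) ↦ 1 - ι π`. This
takes `p - 1 - v` steps; one more gives zero, because `ι` and `π` are chain maps. -/
theorem barD_commutator_pow (j : ℕ) (v : Fin (p - 1)) (hj : p - 1 - v ≤ j) :
    ((LinearMap.mulLeft k (barD M b) - LinearMap.mulRight k (barD M b)) ^ (j + 1)) (barS M b v)
      = 0 := by
  induction j generalizing v with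
  | zero => have := v.2; omega
  | succ j ih =>
    rw [pow_succ, Module.End.mul_apply, barD_commutator, barT]
    split_ifs with h
    · exact ih ⟨v.1 + 1, h⟩ (by simp only; omega)
    · rw [pow_succ, Module.End.mul_apply]
      have : (LinearMap.mulLeft k (barD M b) - LinearMap.mulRight k (barD M b))
          (LinearMap.id - barι M ι ∘ₗ barπ M ι) = 0 := by
        refine LinearMap.ext fun u => ?_
        change barD M b (u - barι M ι (barπ M ι u)) - (barD M b u - barι M ι (barπ M ι (barD M b u)))
          = 0
        rw [map_sub, barD_barι, barπ_barD, sub_self]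
      rw [this, map_zero]

theorem barD_pow_barS (v : Fin (p - 1)) (u : Bar M ι) :
    (barD M b ^ p) (barS M b v u) = barS M b v ((barD M b ^ p) u) := by
  refine LinearMap.congr_fun (pow_mul_eq_of_commutator (barD M b) (barS M b v) ?_) u
  have := barD_commutator_pow M b (p - 1) v (Nat.sub_le _ _)
  rwa [Nat.sub_add_cancel hp.out.one_le] at this

/-- By the Leibniz rule the action map intertwines `D` with `D ⊗ 1 + 1 ⊗ d`. In characteristic `p`
the `p`-th power has no mixed terms, and `d ^ p = 0` on `C`. -/
theorem barD_pow_barR (c : C) (u : Bar M ι) :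
    (barD M b ^ p) (barR M c u) = barR M c ((barD M b ^ p) u) := by
  have hcomm : Commute (LinearMap.rTensor C (barD M b))
      (LinearMap.lTensor (R := k) (Bar M ι) (PDGAlgebra.d (p := p) (k := k) (A := C))) := by
    ext x y; simp
  let R : Bar M ι ⊗[k] C →ₗ[k] Bar M ι := TensorProduct.lift (barR M).flip
  have h1 : ∀ t, R ((LinearMap.rTensor C (barD M b) + LinearMap.lTensor (Bar M ι)
      (PDGAlgebra.d (p := p) (k := k) (A := C))) t) = barD M b (R t) := by
    refine LinearMap.congr_fun (f := R ∘ₗ (LinearMap.rTensor C (barD M b) + LinearMap.lTensor (Bar M ι)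
      (PDGAlgebra.d (p := p) (k := k) (A := C)))) (g := barD M b ∘ₗ R)
      (TensorProduct.ext' fun u c => ?_)
    exact (barD_barR M b c u).symm
  have h2 := map_pow_apply h1 p (u ⊗ₜ c)
  rw [add_pow_prime_of_commute hp.out hcomm, LinearMap.rTensor_pow, LinearMap.lTensor_pow,
    PDGAlgebra.d_pow, LinearMap.lTensor_zero, add_zero] at h2
  exact h2.symm

/-- Since `D ^ p` commutes with the operators `S_v` and the right action, which generate everything
from the empty word, it suffices to look at the image of `ι`, where `D` is the differential of `M`.
-/
theorem barD_pow : barD M b ^ p = 0 := by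
  have h : ∀ r m, (barD M b ^ p) (Finsupp.single r (induce M m 1)) = 0 := by
    intro r
    induction r with
    | nil =>
      intro m
      rw [← barι_apply, ← map_pow_apply (f := barι M ι) (fun m => (barD_barι M b m).symm), M.d_pow]
      exact map_zero _
    | cons l r ih =>
      intro m
      have := barS_single M b l.level r m l.index
      rw [← this, barD_pow_barS, ← one_mul (b l.index), ← barR_single, barD_pow_barR, ih, map_zero,
        map_zero]
  refine bar_ext fun r m c => ?_
  rw [← one_mul c, ← barR_single, barD_pow_barR, h, map_zero]
  rfl

/-- The primitive is `S_0 u`. As `u` is a cocycle, `D^j (S_0 u) = S_j u`, and the last step gives `D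
(S_(p-2) u) = u - ι π u = u`. -/
theorem exists_barD_pow (u : Bar M ι) (hu : barD M b u = 0) (hπ : barπ M ι u = 0) :
    ∃ w, barπ M ι w = 0 ∧ (barD M b ^ (p - 1)) w = u := by
  have h2 := hp.out.two_le
  have h0 : ∀ j (hj : j < p - 1), (barD M b ^ j) (barS M b ⟨0, by omega⟩ u) = barS M b ⟨j, hj⟩ u := by
    intro j
    induction j with
    | zero => exact fun _ => rfl
    | succ j ih =>
      intro hj
      rw [pow_succ', Module.End.mul_apply, ih (by omega), barD_barS, hu, map_zero, zero_add, barT,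
        dif_pos hj]
  refine ⟨barS M b ⟨0, by omega⟩ u, barπ_barS M b _ u, ?_⟩
  have h1 := h0 (p - 2) (by omega)
  have h3 : barD M b ^ (p - 1) = barD M b * barD M b ^ (p - 2) := by
    rw [← pow_succ']; congr 1; omega
  rw [h3, Module.End.mul_apply, h1, barD_barS, hu, map_zero,
    zero_add, barT, dif_neg (by simp only; omega), LinearMap.sub_apply, LinearMap.comp_apply, hπ,
    map_zero, sub_zero]
  rfl

end Bar
end PDGBimod
end PDG

/-! ### Degrees and ranks in the bar resolution -/

namespace PDG

theorem mem_span_of_mem_gr {p : ℕ} {k C : Type u} [Field k] [Ring C] [Algebra k C] [PDGAlgebra p k C]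
    {ι : Type u} (b : Module.Basis ι k C) {β : ι → ℤ}
    (hβ : ∀ i, b i ∈ PDGAlgebra.gr (p := p) (k := k) (β i)) {e : ℤ} {c : C}
    (hc : c ∈ PDGAlgebra.gr (p := p) (k := k) e) : c ∈ Submodule.span k (b '' {i | β i = e}) := by
  have hI := PDGAlgebra.internal (p := p) (k := k) (A := C)
  have h : ∀ c, gproj hI e c ∈ Submodule.span k (b '' {i | β i = e}) := by
    intro c
    have hc : c ∈ Submodule.span k (Set.range b) := b.mem_span c
    induction hc using Submodule.span_induction with
    | zero => rw [map_zero]; exact zero_mem _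
    | mem x hx =>
      obtain ⟨i, rfl⟩ := hx
      rw [gproj_of_mem hI (hβ i)]
      split_ifs with h
      · exact Submodule.subset_span ⟨i, h, rfl⟩
      · exact zero_mem _
    | add x y _ _ hx hy => rw [map_add]; exact add_mem hx hy
    | smul c x _ hx => rw [map_smul]; exact Submodule.smul_mem _ _ hx
  have := h c
  rwa [gproj_of_mem hI hc, if_pos rfl] at this

namespace PDGBimod

theorem one_mem_gr {p : ℕ} {k C : Type u} [Field k] [Ring C] [Algebra k C] [PDGAlgebra p k C] :
    (1 : C) ∈ PDGAlgebra.gr (p := p) (k := k) (0 : ℤ) :=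
  (PDGAlgebra.gradedMonoid (p := p) (k := k) (A := C)).one_mem

section Word
variable {p : ℕ} {ι : Type u}

/-- The degree of a word. -/
def wordDeg (β : ι → ℤ) (r : List (Letter p ι)) : ℤ :=
  (r.map fun l => β l.index - 2 * ((p - 1 : ℕ) - l.level.1)).sum

/-- The rank of a word. -/
def wordRank (ρ : ι → ℕ) (r : List (Letter p ι)) : ℕ :=
  (r.map fun l => ρ l.index + (p - 1 - l.level.1)).sum

theorem wordDeg_cons (β : ι → ℤ) (l : Letter p ι) (r : List (Letter p ι)) :
    wordDeg β (l :: r) = β l.index - 2 * ((p - 1 : ℕ) - l.level.1) + wordDeg β r := by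
  simp [wordDeg]

theorem wordRank_cons (ρ : ι → ℕ) (l : Letter p ι) (r : List (Letter p ι)) :
    wordRank ρ (l :: r) = ρ l.index + (p - 1 - l.level.1) + wordRank ρ r := by
  simp [wordRank]

end Word

variable {p : ℕ} [hp : Fact p.Prime] {k A C : Type u} [Field k] [CharP k p]
  [Ring A] [Algebra k A] [PDGAlgebra p k A] [Ring C] [Algebra k C] [PDGAlgebra p k C]

section Bar
variable (M : PDGBimod p k A C) {ι : Type u} (b : Module.Basis ι k C)

theorem barS_mem {v : Fin (p - 1)} {r : List (Letter p ι)} {s : Set ι} {S : Submodule k (Bar M ι)}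
    {m : M} (h : ∀ i ∈ s, Finsupp.single (⟨v, i⟩ :: r) (induce M m 1) ∈ S) {c : C}
    (hc : c ∈ Submodule.span k (b '' s)) : barS M b v (Finsupp.single r (induce M m c)) ∈ S := by
  have : Submodule.span k (b '' s) ≤ S.comap (barS M b v ∘ₗ Finsupp.lsingle r ∘ₗ induce M m) := by
    refine Submodule.span_le.2 ?_
    rintro _ ⟨i, hi, rfl⟩
    change barS M b v (Finsupp.single r (induce M m (b i))) ∈ S
    rw [barS_single]
    exact h i hi
  exact this hc

section Degree
variable {β : ι → ℤ}

variable {M} in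
theorem mem_barGr_congr {i j : ℤ} (h : i = j) {u : Bar M ι}
    (hu : u ∈ finsuppGr (induced M) (wordDeg β) i) : u ∈ finsuppGr (induced M) (wordDeg β) j :=
  h ▸ hu

variable {M} in
theorem mem_of_mem_barGr {W : Type u} [AddCommGroup W] [Module k W] {f : Bar M ι →ₗ[k] W}
    {S : Submodule k W} {j : ℤ}
    (h : ∀ r a e m c, m ∈ M.gr a → c ∈ PDGAlgebra.gr (p := p) (k := k) e → a + e + wordDeg β r = j →
      f (Finsupp.single r (induce M m c)) ∈ S) {u : Bar M ι}
    (hu : u ∈ finsuppGr (induced M) (wordDeg β) j) : f u ∈ S := by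
  rw [← u.sum_single, Finsupp.sum, map_sum]
  refine Submodule.sum_mem _ fun r _ => ?_
  exact mem_of_mem_induced (f := f ∘ₗ Finsupp.lsingle r) (fun a e m c hm hc hae =>
    h r a e m c hm hc (by omega)) (hu r)

theorem single_mem_barGr {r : List (Letter p ι)} {a e j : ℤ} {m : M} {c : C} (hm : m ∈ M.gr a)
    (hc : c ∈ PDGAlgebra.gr (p := p) (k := k) e) (h : a + e + wordDeg β r = j) :
    Finsupp.single r (induce M m c) ∈ finsuppGr (induced M) (wordDeg β) j :=
  single_mem_finsuppGr _ _ (induce_mem M hm hc (by omega))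

theorem barR_degree {c : C} {e : ℤ} (hc : c ∈ PDGAlgebra.gr (p := p) (k := k) e) {j : ℤ}
    {u : Bar M ι} (hu : u ∈ finsuppGr (induced M) (wordDeg β) j) :
    barR M c u ∈ finsuppGr (induced M) (wordDeg β) (j + e) := fun r => by
  rw [add_sub_right_comm]
  exact (induced M).ract_mem hc (hu r)

theorem barπ_degree {j : ℤ} {u : Bar M ι} (hu : u ∈ finsuppGr (induced M) (wordDeg β) j) :
    barπ M ι u ∈ M.gr j := by
  refine mem_of_mem_barGr (fun r a e m c hm hc h => ?_) hu
  cases r with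
  | nil =>
    rw [barπ_nil, show j = a + e by rw [← h]; exact add_zero _]
    exact M.ract_mem hc hm
  | cons l r => rw [barπ_cons]; exact zero_mem _

/-- The shift `2 (p - 1 - v)` is forced: bracketing with `D` adds two to the degree for each level,
and the chain must end at `1 - ι π`, which has degree zero. -/
theorem barS_degree (hβ : ∀ i, b i ∈ PDGAlgebra.gr (p := p) (k := k) (β i))
    (v : Fin (p - 1)) {j : ℤ} {u : Bar M ι}
    (hu : u ∈ finsuppGr (induced M) (wordDeg β) j) : barS M b v u
      ∈ finsuppGr (induced M) (wordDeg β) (j - 2 * ((p - 1 : ℕ) - v.1)) := by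
  refine mem_of_mem_barGr (fun r a e m c hm hc h => ?_) hu
  refine barS_mem M b (fun i (hi : β i = e) => ?_) (mem_span_of_mem_gr b hβ hc)
  refine single_mem_barGr M hm one_mem_gr ?_
  rw [wordDeg_cons]
  simp only
  omega

theorem barT_degree (hβ : ∀ i, b i ∈ PDGAlgebra.gr (p := p) (k := k) (β i))
    (v : Fin (p - 1)) {j : ℤ} {u : Bar M ι}
    (hu : u ∈ finsuppGr (induced M) (wordDeg β) j) : barT M b v u
      ∈ finsuppGr (induced M) (wordDeg β) (j - 2 * ((p - 1 : ℕ) - v.1) + 2) := by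
  rw [barT]
  split_ifs with h
  · exact mem_barGr_congr (by push_cast; ring) (barS_degree M b hβ ⟨v.1 + 1, h⟩ hu)
  · have hv := v.2
    have hj : j - 2 * ((p - 1 : ℕ) - v.1 : ℤ) + 2 = j := by omega
    rw [hj, LinearMap.sub_apply, LinearMap.comp_apply]
    exact sub_mem hu (single_mem_barGr M (barπ_degree M hu) one_mem_gr (by simp [wordDeg]))

theorem barGen_degree (hβ : ∀ i, b i ∈ PDGAlgebra.gr (p := p) (k := k) (β i))
    (r : List (Letter p ι)) : ∀ {a : ℤ} {m : M}, m ∈ M.gr a →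
    barGen M b r m ∈ finsuppGr (induced M) (wordDeg β) (a + wordDeg β r + 2) := by
  induction r with
  | nil =>
    intro a m hm
    exact single_mem_barGr M (M.d_mem hm) one_mem_gr (by simp [wordDeg])
  | cons l r ih =>
    intro a m hm
    rw [barGen_cons, barD_single, wordDeg_cons]
    have h1 := barR_degree M (hβ l.index) (ih hm)
    have h2 := single_mem_barGr M (r := r) (β := β) hm (PDGAlgebra.d_mem (hβ l.index)) rfl
    have h3 := single_mem_barGr M (r := r) (β := β) hm (hβ l.index) rfl
    refine add_mem ?_ ?_
    · exact mem_barGr_congr (by ring) (barS_degree M b hβ l.level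
        (add_mem h1 (mem_barGr_congr (by ring) h2)))
    · exact mem_barGr_congr (by ring) (barT_degree M b hβ l.level h3)

theorem barD_degree (hβ : ∀ i, b i ∈ PDGAlgebra.gr (p := p) (k := k) (β i))
    {j : ℤ} {u : Bar M ι} (hu : u ∈ finsuppGr (induced M) (wordDeg β) j) :
    barD M b u ∈ finsuppGr (induced M) (wordDeg β) (j + 2) := by
  refine mem_of_mem_barGr (fun r a e m c hm hc h => ?_) hu
  rw [barD_single]
  refine add_mem ?_ (single_mem_barGr M hm (PDGAlgebra.d_mem hc) (by omega))
  exact mem_barGr_congr (by omega) (barR_degree M hc (barGen_degree M b hβ r hm))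

end Degree

section Rank
variable {ρ : ι → ℕ}

theorem barR_rank (c : C) {N : ℕ} {u : Bar M ι}
    (hu : u ∈ Finsupp.supported (induced M) k {l : List (Letter p ι) | wordRank ρ l < N}) :
    barR M c u ∈ Finsupp.supported (induced M) k {l : List (Letter p ι) | wordRank ρ l < N} := by
  refine mem_of_mem_supported (barR M c) _ (fun r hr e => ?_) hu
  have : barR M c (Finsupp.single r e) = Finsupp.single r ((induced M).ract (op c) e) :=
    Finsupp.mapRange_single (hf := map_zero ((induced M).ract (op c)))
  rw [this]
  exact Finsupp.single_mem_supported k _ hr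

/-- The rank of a letter combines the weight `ρ` of its basis vector with the number of levels left,
`p - 1 - v`. Raising the level or removing the letter lowers the rank, `d` lowers `ρ` strictly, and
right multiplication by a basis vector produces nothing of weight above that of the vector. -/
theorem barGen_rank
    (hd : ∀ i, PDGAlgebra.d (p := p) (k := k) (b i) ∈ Submodule.span k (b '' {j | ρ j < ρ i}))
    (hm : ∀ i j, b j * b i ∈ Submodule.span k (b '' {l | ρ l ≤ ρ i}))
    (r : List (Letter p ι)) : ∀ m, barGen M b r m - Finsupp.single r (induce M (M.d m) 1)
      ∈ Finsupp.supported (induced M) k {l | wordRank ρ l < wordRank ρ r} := by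
  induction r with
  | nil =>
    intro m
    have : barGen M b [] m = Finsupp.single [] (induce M (M.d m) 1) := rfl
    rw [this, sub_self]
    exact zero_mem _
  | cons l r ih =>
    intro m
    have hv := l.level.2
    have h0 := barD_single M b r m (b l.index)
    rw [← sub_add_cancel (barGen M b r m) (Finsupp.single r (induce M (M.d m) 1)), map_add, barR_single,
      one_mul] at h0
    rw [barGen_cons, h0, map_add, map_add, barS_single]
    have h1 : ∀ x y z t : Bar M ι, x + y + z + t - y = x + t + z := fun x y z t => by abel
    refine (congrArg (· ∈ _) (h1 _ _ _ _)).mpr ?_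
    refine add_mem (add_mem ?_ ?_) ?_
    · refine mem_of_mem_supported (barS M b l.level ∘ₗ barR M (b l.index)) _
        (fun s (hs : wordRank ρ s < wordRank ρ r) e => ?_) (ih m)
      rw [← Submodule.Quotient.mk_eq_zero]
      refine LinearMap.congr_fun (f := Submodule.mkQ _ ∘ₗ (barS M b l.level ∘ₗ barR M (b l.index)) ∘ₗ
        Finsupp.lsingle s) (g := 0) (induced_ext fun m' c => ?_) e
      refine LinearMap.congr_fun (f := (Submodule.mkQ _ ∘ₗ
        (barS M b l.level ∘ₗ barR M (b l.index)) ∘ₗ Finsupp.lsingle s) ∘ₗ induce M m') (g := 0)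
        (b.ext fun j => ?_) c
      refine (Submodule.Quotient.mk_eq_zero _).2 ?_
      change barS M b l.level (barR M (b l.index) (Finsupp.single s (induce M m' (b j)))) ∈ _
      rw [barR_single]
      refine barS_mem M b (fun i (hi : ρ i ≤ _) => Finsupp.single_mem_supported k _ ?_) (hm l.index j)
      change wordRank ρ _ < wordRank ρ _
      rw [wordRank_cons, wordRank_cons]
      simp only
      omega
    · unfold barT
      split_ifs with h
      · rw [barS_single]
        refine Finsupp.single_mem_supported k _ ?_
        change wordRank ρ _ < wordRank ρ _
        rw [wordRank_cons, wordRank_cons]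
        simp only
        omega
      · rw [LinearMap.sub_apply, LinearMap.comp_apply, barι_apply]
        refine sub_mem (Finsupp.single_mem_supported k _ ?_) (Finsupp.single_mem_supported k _ ?_)
        · change wordRank ρ _ < wordRank ρ _
          rw [wordRank_cons]
          omega
        · change wordRank ρ _ < wordRank ρ _
          rw [wordRank_cons]
          simp only [wordRank, List.map_nil, List.sum_nil]
          omega
    · refine barS_mem M b (fun i (hi : ρ i < _) => Finsupp.single_mem_supported k _ ?_) (hd l.index)
      change wordRank ρ _ < wordRank ρ _
      rw [wordRank_cons, wordRank_cons]
      simp only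
      omega

theorem barD_rank
    (hd : ∀ i, PDGAlgebra.d (p := p) (k := k) (b i) ∈ Submodule.span k (b '' {j | ρ j < ρ i}))
    (hm : ∀ i j, b j * b i ∈ Submodule.span k (b '' {l | ρ l ≤ ρ i}))
    (r : List (Letter p ι)) (e : induced M) :
    barD M b (Finsupp.single r e) - Finsupp.single r ((induced M).d e)
      ∈ Finsupp.supported (induced M) k {l | wordRank ρ l < wordRank ρ r} := by
  rw [← Submodule.Quotient.mk_eq_zero]
  refine LinearMap.congr_fun (f := Submodule.mkQ _ ∘ₗ (barD M b ∘ₗ Finsupp.lsingle r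
    - Finsupp.lsingle r ∘ₗ (induced M).d)) (g := 0) (induced_ext fun m c => ?_) e
  refine (Submodule.Quotient.mk_eq_zero _).2 ?_
  change barD M b (Finsupp.single r (induce M m c)) - Finsupp.single r ((induced M).d (induce M m c))
    ∈ _
  rw [barD_single, d_induce, Finsupp.single_add, add_sub_add_right_eq_sub]
  have h1 := barR_rank M c (barGen_rank M b hd hm r m)
  rwa [map_sub, barR_single, one_mul] at h1

end Rank

/-- Bar resolutions exist over algebras which are unipotent with respect to some filtration. -/
theorem exists_isBarResolution {β : ι → ℤ} (hβ : ∀ i, b i ∈ PDGAlgebra.gr (p := p) (k := k) (β i))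
    (ρ : ι → ℕ)
    (hd : ∀ i, PDGAlgebra.d (p := p) (k := k) (b i) ∈ Submodule.span k (b '' {j | ρ j < ρ i}))
    (hm : ∀ i j, b j * b i ∈ Submodule.span k (b '' {l | ρ l ≤ ρ i}))
    (hM : Nonempty (Retract (induced M) (free p k A C))) :
    ∃ (X : PDGBimod p k A C) (π : X ⟶ M), IsBarResolution π := by
  let X : PDGBimod p k A C := finsupp (induced M) (wordDeg β) (barD M b)
    (fun _ _ hu => barD_degree M b hβ hu) (barD_barL M b) (barD_barR M b) (barD_pow M b)
  let π : X ⟶ M := ⟨barπ M ι, barπ_barL M, fun c => barπ_barR M c.unop, fun hu => barπ_degree M hu,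
    barπ_barD M b⟩
  have hs : Function.Surjective π.lin := fun m => ⟨barι M ι m, barπ_barι M m⟩
  refine ⟨X, π, propertyP_finsupp _ _ _ _ hM (wordRank ρ) (barD_rank M b hd hm), hs,
    quasiIso_of_kerAcyclic π hs fun u hu hdu => ?_⟩
  obtain ⟨w, hw, hwu⟩ := exists_barD_pow M b u hdu hu
  exact ⟨w, hw, hwu⟩

end Bar

/-! ### The two bimodules `A(n)` and `A(n) ⊗ (n)A` -/

section Column
open AShriek
variable {n : ℕ}

theorem d_mul_vertex (a : AShriek k n) (i : Fin n) : PDGAlgebra.d (p := p) (k := k) a * vertex k i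
    = PDGAlgebra.d (p := p) (k := k) (a * vertex k i) := by
  rw [PDGAlgebra.d_mul, d_vertex, mul_zero, add_zero]

theorem d_vertex_mul (a : AShriek k n) (i : Fin n) : vertex k i * PDGAlgebra.d (p := p) (k := k) a
    = PDGAlgebra.d (p := p) (k := k) (vertex k i * a) := by
  rw [PDGAlgebra.d_mul, d_vertex, zero_mul, zero_add]

variable [NeZero n]

/-- `A(n)` is a direct summand of `A`. -/
noncomputable def retractColumn :
    Retract (columnLast p k n).leftPart (regular p k (AShriek k n)).leftPart where
  i := ⟨(endingAtLast k n).subtype, fun _ _ => rfl, fun _ _ => rfl, fun hm => hm, fun _ => rfl⟩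
  r := ⟨projEnding k n, fun a m => Subtype.ext (mul_assoc a m _), fun c m => map_smul (projEnding k n) c.unop m,
    fun {i m} hm => by
      have := (PDGAlgebra.gradedMonoid (p := p) (k := k) (A := AShriek k n)).mul_mem (i := i) (j := 0)
        hm (vertex_mem (last n))
      rwa [add_zero] at this,
    fun m => Subtype.ext (d_mul_vertex (show AShriek k n from m) (last n))⟩
  retract := Hom.ext (LinearMap.ext fun m => Subtype.ext m.2)

/-- `(n)A` is a direct summand of `A`. -/
noncomputable def retractRow :
    Retract (rowLast p k n).rightPart (regular p k (AShriek k n)).rightPart where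
  i := ⟨(startingAtLast k n).subtype, fun _ _ => rfl, fun _ _ => rfl, fun hm => hm, fun _ => rfl⟩
  r := ⟨projStarting k n, fun c m => map_smul (projStarting k n) c m, fun a m => Subtype.ext (mul_assoc _ _ _).symm,
    fun {i m} hm => by
      have := (PDGAlgebra.gradedMonoid (p := p) (k := k) (A := AShriek k n)).mul_mem (i := 0) (j := i)
        (vertex_mem (last n)) hm
      rwa [zero_add] at this,
    fun m => Subtype.ext (d_vertex_mul (show AShriek k n from m) (last n))⟩
  retract := Hom.ext (LinearMap.ext fun m => Subtype.ext m.2)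

variable (p k n) in
-- The weights `n - j` on the basis `x ^ j` are adapted to the algebra, since multiplication and `d`
-- only raise exponents. The induced bimodule `A(n) ⊗ C` is a retract of `A ⊗ C`, because `A(n)` is
-- cut out by an idempotent with zero differential.
theorem exists_isBarResolution_columnLast :
    ∃ (X : PDGBimod p k (AShriek k n) (TruncPoly k n)) (π : X ⟶ columnLast p k n),
      IsBarResolution π := by
  let b := (TruncPoly.powBasis k n).reindex Equiv.ulift.{u}.symm
  have hb : ∀ i, b i = TruncPoly.x k n ^ i.down.1 := fun i =>
    (Module.Basis.reindex_apply _ _ _).trans (TruncPoly.powBasis_apply _)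
  have hmem : ∀ (s : Set (ULift.{u} (Fin n))) (m : ℕ), (∀ h : m < n, (⟨⟨m, h⟩⟩ : ULift (Fin n)) ∈ s) →
      TruncPoly.x k n ^ m ∈ Submodule.span k (b '' s) := by
    intro s m h
    rcases lt_or_ge m n with hm | hm
    · exact Submodule.subset_span ⟨⟨⟨m, hm⟩⟩, h hm, hb _⟩
    · rw [TruncPoly.pow_eq_zero hm]; exact zero_mem _
  refine exists_isBarResolution (columnLast p k n) b (β := fun i => 2 * i.down.1) (fun i => ?_)
    (fun i => n - i.down.1) (fun i => ?_) (fun i j => ?_)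
    ⟨retractTensor retractColumn (Retract.refl _)⟩
  · rw [hb]
    exact Submodule.subset_span ⟨List.replicate i.down.1 (), by simp [mul_comm], by simp⟩
  · rw [hb, TruncPoly.d_pow]
    refine Submodule.smul_mem _ _ (hmem _ _ fun h => ?_)
    change n - (i.down.1 + 1) < n - i.down.1
    omega
  · rw [hb, hb, ← pow_add]
    refine hmem _ _ fun h => ?_
    change n - (j.down.1 + i.down.1) ≤ n - i.down.1
    omega

/-- Cutting by the last vertex on both sides makes this a retract of `A ⊗ A`, so a single filtration
step suffices. -/
theorem isFiniteCell_EF : IsFiniteCell (EF p k n) := by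
  refine ⟨propertyP_of_retract ⟨retractTensor retractColumn retractRow⟩, ?_⟩
  have h1 : Module.Finite k (columnLast p k n).leftPart :=
    inferInstanceAs (Module.Finite k (endingAtLast k n))
  have h2 : Module.Finite k (rowLast p k n).rightPart :=
    inferInstanceAs (Module.Finite k (startingAtLast k n))
  have h3 : Module.Finite k (EF p k n) :=
    inferInstanceAs (Module.Finite k (_ ⧸ balanced (columnLast p k n).leftPart (rowLast p k n).rightPart))
  obtain ⟨s, hs⟩ := h3.fg_top
  refine ⟨s, eq_top_iff.2 (hs ▸ Submodule.span_mono fun x hx => ⟨1, 1, x, hx, ?_⟩)⟩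
  rw [op_one, map_one, map_one]; rfl

end Column
end PDGBimod
end PDG

namespace PDG

section Acyclic
variable {k V W Z : Type u} [Field k] [AddCommGroup V] [Module k V] [AddCommGroup W] [Module k W]
  [AddCommGroup Z] [Module k Z] {p : ℕ}

theorem AcyclicOn.comap {d : Module.End k V} {e : Module.End k W} (f : V ≃ₗ[k] W)
    (hf : ∀ v, f (d v) = e (f v)) {N : Submodule k W} (h : AcyclicOn p e N) :
    AcyclicOn p d (N.comap f.toLinearMap) := by
  intro u hu hdu
  obtain ⟨w, hw, hwu⟩ := h (f u) hu (by rw [← hf, hdu, map_zero])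
  refine ⟨f.symm w, ?_, f.injective ?_⟩
  · rw [Submodule.mem_comap]
    exact (f.apply_symm_apply w).symm ▸ hw
  · rw [← LinearEquiv.coe_coe, map_pow_apply hf, LinearEquiv.coe_coe, f.apply_symm_apply, hwu]

/-- A surjection with acyclic kernel stays so after tensoring with a complex. -/
theorem AcyclicOn.ker_rTensor [hp : Fact p.Prime] [CharP k p] {d : Module.End k V} (hd : d ^ p = 0)
    {f : V →ₗ[k] W} (hf : Function.Surjective f) (hN : ∀ u ∈ LinearMap.ker f, d u ∈ LinearMap.ker f)
    (h : AcyclicOn p d (LinearMap.ker f)) (e : Module.End k Z) :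
    AcyclicOn p (LinearMap.rTensor Z d + LinearMap.lTensor V e)
      (LinearMap.ker (LinearMap.rTensor Z f)) := by
  obtain ⟨s, hs⟩ := exists_commutator (restrict_pow_eq_zero hd hN)
    ((acyclicOn_iff_restrict hN).1 h)
  let K := LinearMap.ker f
  let ι : K ⊗[k] Z →ₗ[k] V ⊗[k] Z := LinearMap.rTensor Z K.subtype
  let D : Module.End k (K ⊗[k] Z) := LinearMap.rTensor Z (d.restrict hN) + LinearMap.lTensor K e
  have hι : ∀ t, ι (D t) = (LinearMap.rTensor Z d + LinearMap.lTensor V e) (ι t) :=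
    LinearMap.congr_fun (f := ι ∘ₗ D) (g := (LinearMap.rTensor Z d + LinearMap.lTensor V e) ∘ₗ ι)
      (TensorProduct.ext' fun u z => rfl)
  have hinj : Function.Injective ι :=
    Module.Flat.rTensor_preserves_injective_linearMap _ K.injective_subtype
  have hex : Function.Exact ι (LinearMap.rTensor Z f) :=
    rTensor_exact Z (f := K.subtype) (g := f) (LinearMap.exact_subtype_ker_map f) hf
  have hD : AcyclicOn p D ⊤ := by
    refine AcyclicOn.of_commutator (s := LinearMap.rTensor Z s) (fun _ _ => trivial) fun t _ => ?_
    refine LinearMap.congr_fun (f := D ∘ₗ LinearMap.rTensor Z s - LinearMap.rTensor Z s ∘ₗ D)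
      (g := LinearMap.id) (TensorProduct.ext' fun u z => ?_) t
    simp only [D, LinearMap.sub_apply, LinearMap.comp_apply, LinearMap.add_apply,
      LinearMap.rTensor_tmul, LinearMap.lTensor_tmul, map_add, LinearMap.id_apply]
    rw [add_sub_add_right_eq_sub, ← TensorProduct.sub_tmul, hs]
  intro t ht hdt
  obtain ⟨t, rfl⟩ := (hex t).1 ht
  obtain ⟨v, -, hv⟩ := hD t trivial (hinj (by rw [hι, hdt, map_zero]))
  exact ⟨ι v, (hex _).2 ⟨v, rfl⟩, by rw [← map_pow_apply hι, hv]⟩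

end Acyclic

/-! ### Comparison morphisms between tensor products -/

namespace PDGBimod

section Morphisms
variable {p : ℕ} [hp : Fact p.Prime] {k A B C D : Type u} [Field k]
  [Ring A] [Algebra k A] [PDGAlgebra p k A] [Ring B] [Algebra k B] [PDGAlgebra p k B]
  [Ring C] [Algebra k C] [PDGAlgebra p k C] [Ring D] [Algebra k D] [PDGAlgebra p k D]

/-- Forgetting the right actions. -/
def leftHom {M N : PDGBimod p k A B} (f : M ⟶ N) : M.leftPart ⟶ N.leftPart where
  lin := f.lin
  map_lact := f.map_lact
  map_ract c m := map_smul f.lin c.unop m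
  map_mem := f.map_mem
  map_d := f.map_d

/-- The linear map `X₀ ⊗_k Y₀ ⟶ X ⊗_B Y` induced by linear maps `X₀ ⟶ X` and `Y₀ ⟶ Y`. -/
def fromBaseLin {X₀ : PDGBimod p k A k} {Y₀ : PDGBimod p k k C} {X : PDGBimod p k A B}
    {Y : PDGBimod p k B C} (i : X₀ →ₗ[k] X) (j : Y₀ →ₗ[k] Y) :
    tensorCarrier X₀ Y₀ →ₗ[k] tensorCarrier X Y :=
  (balanced X₀ Y₀).liftQ ((balanced X Y).mkQ ∘ₗ TensorProduct.map i j)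
    (balanced_base X₀ Y₀ ▸ bot_le)

theorem tensorBase_d (X : PDGBimod p k A k) (Y : PDGBimod p k k C) (t : tensorCarrier X Y) :
    tensorBase X Y (tensorD X Y t)
      = (LinearMap.rTensor Y X.d + LinearMap.lTensor X Y.d) (tensorBase X Y t) :=
  LinearMap.congr_fun (f := (tensorBase X Y).toLinearMap ∘ₗ tensorD X Y)
    (g := (LinearMap.rTensor Y X.d + LinearMap.lTensor X Y.d) ∘ₗ (tensorBase X Y).toLinearMap)
    (tensor_ext fun _ _ => rfl) t

variable [CharP k p]

/-- The morphism `X₀ ⊗_k Y₀ ⟶ X ⊗_B Y` induced by a map `X₀ ⟶ X` of left modules and a map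
`Y₀ ⟶ Y` of right modules. -/
def fromBase {X₀ : PDGBimod p k A k} {Y₀ : PDGBimod p k k C} {X : PDGBimod p k A B}
    {Y : PDGBimod p k B C} (i : X₀ →ₗ[k] X) (hil : ∀ a x, i (X₀.lact a x) = X.lact a (i x))
    (him : ∀ {a x}, x ∈ X₀.gr a → i x ∈ X.gr a) (hid : ∀ x, i (X₀.d x) = X.d (i x))
    (j : Y₀ →ₗ[k] Y) (hjr : ∀ c y, j (Y₀.ract c y) = Y.ract c (j y))
    (hjm : ∀ {b y}, y ∈ Y₀.gr b → j y ∈ Y.gr b) (hjd : ∀ y, j (Y₀.d y) = Y.d (j y)) :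
    X₀.tensor Y₀ ⟶ X.tensor Y where
  lin := fromBaseLin i j
  map_lact a := LinearMap.congr_fun (f := fromBaseLin i j ∘ₗ tensorLact X₀ Y₀ a)
    (g := tensorLact X Y a ∘ₗ fromBaseLin i j)
    (tensor_ext fun x y => congrArg (tmul X Y · (j y)) (hil a x))
  map_ract c := LinearMap.congr_fun (f := fromBaseLin i j ∘ₗ tensorRact X₀ Y₀ c)
    (g := tensorRact X Y c ∘ₗ fromBaseLin i j)
    (tensor_ext fun x y => congrArg (tmul X Y (i x)) (hjr c y))
  map_mem {m t} ht := by
    have : tensorGr X₀ Y₀ m ≤ (tensorGr X Y m).comap (fromBaseLin i j) := by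
      refine Submodule.span_le.2 ?_
      rintro _ ⟨a, b, x, y, hx, hy, hab, rfl⟩
      exact tmul_mem X Y (him hx) (hjm hy) hab
    exact this ht
  map_d := LinearMap.congr_fun (f := fromBaseLin i j ∘ₗ tensorD X₀ Y₀)
    (g := tensorD X Y ∘ₗ fromBaseLin i j)
    (tensor_ext fun x y => congrArg₂ (· + ·) (congrArg (tmul X Y · (j y)) (hid x))
      (congrArg (tmul X Y (i x)) (hjd y)))

/-- The projection `X ⊗_k Y ⟶ X ⊗_B Y`. -/
def collapse (X : PDGBimod p k A B) (Y : PDGBimod p k B C) :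
    X.leftPart.tensor Y.rightPart ⟶ X.tensor Y :=
  fromBase (X₀ := X.leftPart) (Y₀ := Y.rightPart) LinearMap.id (fun _ _ => rfl) (fun h => h)
    (fun _ => rfl) LinearMap.id (fun _ _ => rfl) (fun h => h) (fun _ => rfl)

theorem collapse_surjective (X : PDGBimod p k A B) (Y : PDGBimod p k B C) :
    Function.Surjective (collapse X Y).lin := by
  intro t
  obtain ⟨t, rfl⟩ := Submodule.mkQ_surjective _ t
  refine ⟨(balanced X.leftPart Y.rightPart).mkQ t, ?_⟩
  change (balanced X Y).mkQ (TensorProduct.map LinearMap.id LinearMap.id t) = _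
  rw [TensorProduct.map_id]
  rfl

theorem quasiIso_tensorHom {X X' : PDGBimod p k A k} (f : X ⟶ X')
    (hf : Function.Surjective f.lin) (h : AcyclicOn p X.d (LinearMap.ker f.lin))
    (Y : PDGBimod p k k C) : QuasiIso (tensorHom f (𝟙 Y)) := by
  refine quasiIso_of_kerAcyclic _ (fun t => ?_) ?_
  · obtain ⟨t, rfl⟩ := Submodule.mkQ_surjective _ t
    obtain ⟨t, rfl⟩ := LinearMap.rTensor_surjective Y hf t
    exact ⟨(balanced X Y).mkQ t, rfl⟩
  · have h1 := (h.ker_rTensor X.d_pow hf (fun u hu => by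
      rw [LinearMap.mem_ker, f.map_d, hu, map_zero]) Y.d).comap (tensorBase X Y) (tensorBase_d X Y)
    have e : LinearMap.ker (tensorHom f (𝟙 Y)).lin
        = (LinearMap.ker (LinearMap.rTensor Y f.lin)).comap (tensorBase X Y).toLinearMap := by
      rw [← LinearMap.ker_comp]
      refine (LinearEquiv.ker_comp (tensorBase X' Y) (tensorHom f (𝟙 Y)).lin).symm.trans ?_
      exact congrArg LinearMap.ker (tensor_ext fun _ _ => rfl)
    exact e ▸ h1

/-- The bilinear map `(x, y) ↦ x ⊗ y`. -/
def tensorMk (X : PDGBimod p k A B) (Y : PDGBimod p k B C) : X →ₗ[k] Y →ₗ[k] tensorCarrier X Y :=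
  (TensorProduct.mk k X Y).compr₂ (balanced X Y).mkQ

/-- The linear map on `X ⊗_B Y` given by a balanced bilinear map. -/
def tensorLift {X : PDGBimod p k A B} {Y : PDGBimod p k B C} {W : Type u} [AddCommGroup W]
    [Module k W] (φ : X →ₗ[k] Y →ₗ[k] W) (h : ∀ x b y, φ (X.ract (op b) x) y = φ x (Y.lact b y)) :
    tensorCarrier X Y →ₗ[k] W :=
  (balanced X Y).liftQ (TensorProduct.lift φ) (by
    refine Submodule.span_le.2 ?_
    rintro _ ⟨x, b, y, rfl⟩
    change _ = _
    rw [map_sub, TensorProduct.lift.tmul, TensorProduct.lift.tmul, h, sub_self])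

variable (X : PDGBimod p k A B) (Y : PDGBimod p k B C) (Z : PDGBimod p k C D)

/-- The linear map `y ⊗ z ↦ (x ⊗ y) ⊗ z`. -/
def assocAux (x : X) : tensorCarrier Y Z →ₗ[k] tensorCarrier (X.tensor Y) Z :=
  tensorLift (tensorMk (X.tensor Y) Z ∘ₗ tensorMk X Y x) fun y c z =>
    tmul_balanced (X.tensor Y) Z (tmul X Y x y) c z

/-- The linear map `x ⊗ (y ⊗ z) ↦ (x ⊗ y) ⊗ z`. -/
def assocLin : tensorCarrier X (Y.tensor Z) →ₗ[k] tensorCarrier (X.tensor Y) Z :=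
  tensorLift (Y := Y.tensor Z)
    { toFun := assocAux X Y Z
      map_add' := fun x x' => tensor_ext fun y z =>
        (congrArg (tmul (X.tensor Y) Z · z) (add_tmul X Y x x' y)).trans (add_tmul _ _ _ _ _)
      map_smul' := fun c x => tensor_ext fun y z =>
        (congrArg (tmul (X.tensor Y) Z · z) (smul_tmul X Y c x y)).trans (smul_tmul _ _ _ _ _) }
    fun x b => LinearMap.congr_fun (f := assocAux X Y Z (X.ract (op b) x))
      (g := assocAux X Y Z x ∘ₗ tensorLact Y Z b)
      (tensor_ext fun y z => congrArg (tmul (X.tensor Y) Z · z) (tmul_balanced X Y x b y))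

/-- The linear map `x ⊗ y ↦ (z ↦ x ⊗ (y ⊗ z))`. -/
def assocInvAux : tensorCarrier X Y →ₗ[k] Z →ₗ[k] tensorCarrier X (Y.tensor Z) :=
  tensorLift (LinearMap.mk₂ k (fun x y => tensorMk X (Y.tensor Z) x ∘ₗ tensorMk Y Z y)
    (fun x x' y => by rw [map_add]; exact LinearMap.add_comp _ _ _)
    (fun c x y => by rw [map_smul]; exact LinearMap.smul_comp _ _ _)
    (fun x y y' => by rw [map_add]; exact LinearMap.comp_add _ _ _)
    (fun c x y => by rw [map_smul]; exact LinearMap.comp_smul _ _ _))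
    fun x b y => LinearMap.ext fun z => tmul_balanced X (Y.tensor Z) x b (tmul Y Z y z)

/-- The linear map `(x ⊗ y) ⊗ z ↦ x ⊗ (y ⊗ z)`. -/
def assocInvLin : tensorCarrier (X.tensor Y) Z →ₗ[k] tensorCarrier X (Y.tensor Z) :=
  tensorLift (X := X.tensor Y) (assocInvAux X Y Z) fun t c z =>
    LinearMap.congr_fun (f := (assocInvAux X Y Z).flip z ∘ₗ tensorRact X Y (op c))
      (g := (assocInvAux X Y Z).flip (Z.lact c z))
      (tensor_ext fun x y => congrArg (tmul X (Y.tensor Z) x) (tmul_balanced Y Z y c z)) t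

theorem assocInv_assoc (t : tensorCarrier X (Y.tensor Z)) :
    assocInvLin X Y Z (assocLin X Y Z t) = t :=
  LinearMap.congr_fun (f := assocInvLin X Y Z ∘ₗ assocLin X Y Z) (g := LinearMap.id)
    (tensor_ext (Y := Y.tensor Z) fun x => LinearMap.congr_fun
      (f := assocInvLin X Y Z ∘ₗ assocAux X Y Z x) (g := tensorMk X (Y.tensor Z) x)
      (tensor_ext fun _ _ => rfl)) t

theorem assoc_assocInv (t : tensorCarrier (X.tensor Y) Z) :
    assocLin X Y Z (assocInvLin X Y Z t) = t :=
  LinearMap.congr_fun (f := assocLin X Y Z ∘ₗ assocInvLin X Y Z) (g := LinearMap.id)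
    (tensor_ext (X := X.tensor Y) fun t z => LinearMap.congr_fun
      (f := assocLin X Y Z ∘ₗ (assocInvAux X Y Z).flip z) (g := (tensorMk (X.tensor Y) Z).flip z)
      (tensor_ext fun _ _ => rfl) t) t

/-- Two linear maps on `X ⊗ (Y ⊗ Z)` agreeing on pure tensors are equal. -/
theorem tensor_ext_right {W : Type u} [AddCommGroup W] [Module k W]
    {f g : tensorCarrier X (Y.tensor Z) →ₗ[k] W}
    (h : ∀ x y z, f (tmul X (Y.tensor Z) x (tmul Y Z y z)) = g (tmul X (Y.tensor Z) x (tmul Y Z y z))) :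
    f = g :=
  tensor_ext (Y := Y.tensor Z) fun x => LinearMap.congr_fun
    (f := f ∘ₗ tensorMk X (Y.tensor Z) x) (g := g ∘ₗ tensorMk X (Y.tensor Z) x)
    (tensor_ext fun y z => h x y z)

/-- Associativity of the tensor product. -/
def assoc : X.tensor (Y.tensor Z) ⟶ (X.tensor Y).tensor Z where
  lin := assocLin X Y Z
  map_lact a := LinearMap.congr_fun (f := assocLin X Y Z ∘ₗ tensorLact X (Y.tensor Z) a)
    (g := tensorLact (X.tensor Y) Z a ∘ₗ assocLin X Y Z) (tensor_ext_right _ _ _ fun _ _ _ => rfl)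
  map_ract c := LinearMap.congr_fun (f := assocLin X Y Z ∘ₗ tensorRact X (Y.tensor Z) c)
    (g := tensorRact (X.tensor Y) Z c ∘ₗ assocLin X Y Z) (tensor_ext_right _ _ _ fun _ _ _ => rfl)
  map_mem {i t} ht := by
    have : tensorGr X (Y.tensor Z) i ≤ (tensorGr (X.tensor Y) Z i).comap (assocLin X Y Z) := by
      refine Submodule.span_le.2 ?_
      rintro _ ⟨a, b, x, t, hx, ht, hab, rfl⟩
      have h2 : tensorGr Y Z b ≤ (tensorGr (X.tensor Y) Z i).comap (assocAux X Y Z x) := by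
        refine Submodule.span_le.2 ?_
        rintro _ ⟨b', c, y, z, hy, hz, hbc, rfl⟩
        exact tmul_mem (X.tensor Y) Z (tmul_mem X Y hx hy rfl) hz (by omega)
      exact h2 ht
    exact this ht
  map_d := LinearMap.congr_fun (f := assocLin X Y Z ∘ₗ tensorD X (Y.tensor Z))
    (g := tensorD (X.tensor Y) Z ∘ₗ assocLin X Y Z) (tensor_ext_right _ _ _ fun x y z => by
      change tmul (X.tensor Y) Z (tmul X Y (X.d x) y) z
        + assocAux X Y Z x (tmul Y Z (Y.d y) z + tmul Y Z y (Z.d z))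
        = tmul (X.tensor Y) Z (tmul X Y (X.d x) y + tmul X Y x (Y.d y)) z
        + tmul (X.tensor Y) Z (tmul X Y x y) (Z.d z)
      rw [map_add]
      refine (add_assoc _ _ _).symm.trans (congrArg (· + _) ?_)
      exact (add_tmul (X.tensor Y) Z _ _ z).symm)

theorem quasiIso_assoc : QuasiIso (assoc X Y Z) := by
  refine quasiIso_of_kerAcyclic _ (fun t => ⟨assocInvLin X Y Z t, assoc_assocInv X Y Z t⟩) ?_
  intro t ht _
  have h0 : t = 0 := (assocInv_assoc X Y Z t).symm.trans
    ((congrArg (assocInvLin X Y Z) ht).trans (map_zero _))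
  exact ⟨0, zero_mem _, by rw [map_zero, h0]⟩

/-- Forgetting the left action before or after tensoring. -/
def rightTensor : Y.rightPart.tensor Z ≅ (Y.tensor Z).rightPart where
  hom := ⟨LinearMap.id, fun b t => (lact_base (Y.rightPart.tensor Z) b t).trans
    (lact_base (Y.tensor Z).rightPart b t).symm, fun _ _ => rfl, fun h => h, fun _ => rfl⟩
  inv := ⟨LinearMap.id, fun b t => (lact_base (Y.tensor Z).rightPart b t).trans
    (lact_base (Y.rightPart.tensor Z) b t).symm, fun _ _ => rfl, fun h => h, fun _ => rfl⟩
  hom_inv_id := rfl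
  inv_hom_id := rfl

/-- A natural transformation inverted by `toD` pointwise. -/
noncomputable def natIsoOfToD {𝒞 : Type*} [Category 𝒞] {F G : 𝒞 ⥤ PDGBimod p k A B} (η : F ⟶ G)
    (h : ∀ M, IsIso ((toD p k A B).map (η.app M))) : F ⋙ toD p k A B ≅ G ⋙ toD p k A B :=
  NatIso.ofComponents (fun M => @asIso _ _ _ _ ((toD p k A B).map (η.app M)) (h M)) fun f => by
    change (toD p k A B).map (F.map f) ≫ (toD p k A B).map (η.app _)
      = (toD p k A B).map (η.app _) ≫ (toD p k A B).map (G.map f)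
    rw [← Functor.map_comp, ← Functor.map_comp, η.naturality]

end Morphisms
end PDGBimod
end PDG

namespace PDG
namespace PDGBimod

/-! ### Comparison of `X ⊗_C Y` with `X ⊗ Y` when `n = 1` in `k` -/

section Comparison
variable {p : ℕ} [hp : Fact p.Prime] {k A C D : Type u} [Field k] [CharP k p]
  [Ring A] [Algebra k A] [PDGAlgebra p k A] [Ring C] [Algebra k C] [PDGAlgebra p k C]
  [Ring D] [Algebra k D] [PDGAlgebra p k D]

/-- Write `X ⊗ Y` as `X ⊗_C (C ⊗ Y)`. The collapse then becomes `X ⊗_C -` applied to the action map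
`C ⊗ Y → Y`, whose kernel is acyclic for `n = 1` in `k`, and `X` preserves this by goodness. -/
theorem quasiIso_collapse {n : ℕ} {X : PDGBimod p k A (TruncPoly k n)} (hX : Good X.toR)
    (hn : (n : k) = 1) (Y : PDGBimod p k (TruncPoly k n) C) : QuasiIso (collapse X Y) := by
  refine quasiIso_of_kerAcyclic _ (collapse_surjective X Y) ?_
  have hY : ∀ y, Y.toL.lact (TruncPoly.x k n ^ n) y = 0 := fun y => by
    rw [TruncPoly.x_pow, map_zero]; rfl
  have h1 := hX.acy (Y.toL.counit le_rfl hY) (Y.toL.counit_isChain le_rfl hY)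
    (Y.toL.counit_surjective le_rfl hY) (Y.toL.counit_acyclicOn le_rfl hY hn)
  have h2 := h1.comap (LinearEquiv.ofLinearMap (X.toR.toInd Y.toL.d_pow) (X.toR.fromInd Y.toL.d_pow)
    (LinearMap.ext (X.toR.toInd_fromInd Y.toL.d_pow))
    (LinearMap.ext (X.toR.fromInd_toInd Y.toL.d_pow))) (X.toR.toInd_d Y.toL.d_pow)
  have h3 := h2.comap (tensorBase X.leftPart Y.rightPart) (tensorBase_d X.leftPart Y.rightPart)
  have e : LinearMap.ker (collapse X Y).lin = LinearMap.ker
      ((rmap (RLin.id X.toR) (Y.toL.counit le_rfl hY) ∘ₗ X.toR.toInd Y.toL.d_pow) ∘ₗ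
        (tensorBase X.leftPart Y.rightPart).toLinearMap) := by
    refine congrArg LinearMap.ker (tensor_ext (X := X.leftPart) (Y := Y.rightPart) fun x y => ?_)
    refine congrArg (rtmul X.toR Y.toL x) ?_
    exact (LinearMap.congr_fun (map_one (Y.toL.descend hY)) y).symm
  rw [e]
  exact h3

variable {n : ℕ} {X M : PDGBimod p k A (TruncPoly k n)} {π : X ⟶ M}

theorem IsBarResolution.toD_collapse (h : IsBarResolution π) (hn : (n : k) = 1)
    (Y : PDGBimod p k (TruncPoly k n) C) : IsIso ((toD p k A C).map (collapse X Y)) :=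
  toD_map_isIso _ (quasiIso_collapse h.propertyP.good hn Y)

theorem IsBarResolution.toD_leftHom (h : IsBarResolution π) (Y : PDGBimod p k k C) :
    IsIso ((toD p k A C).map (tensorHom (leftHom π) (𝟙 Y))) :=
  toD_map_isIso _ (quasiIso_tensorHom (leftHom π) h.surjective
    (kerAcyclic_of_quasiIso π h.quasiIso h.surjective) Y)

/-- The derived tensor product over `k[x]/(x ^ n)` is the tensor product over `k` when `n = 1` in
`k`. -/
noncomputable def IsBarResolution.tensorIso (h : IsBarResolution π) (hn : (n : k) = 1)
    (Y : PDGBimod p k (TruncPoly k n) C) :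
    (toD p k A C).obj (X.tensor Y) ≅ (toD p k A C).obj (M.leftPart.tensor Y.rightPart) :=
  (@asIso _ _ _ _ _ (h.toD_collapse hn Y)).symm ≪≫ @asIso _ _ _ _ _ (h.toD_leftHom Y.rightPart)

/-- The projection `X ⊗_k (Y ⊗ Z) ⟶ X ⊗ (Y ⊗ Z)`, natural in `Z`. -/
def collapseNat (X : PDGBimod p k A D) (Y : PDGBimod p k D C) :
    Y.rightPart.tensorLeft (C := k) ⋙ X.leftPart.tensorLeft ⟶ Y.tensorLeft ⋙ X.tensorLeft where
  app Z := X.leftPart.tensorLeft.map (rightTensor Y Z).hom ≫ collapse X (Y.tensor Z)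
  naturality Z _ _ := Hom.ext (tensor_ext (X := X.leftPart) (Y := Y.rightPart.tensor Z)
    fun _ _ => rfl)

/-- The map `π ⊗ Z`, natural in `Z`. -/
noncomputable def leftHomNat (π : X ⟶ M) (Y : PDGBimod p k k D) :
    Y.tensorLeft (C := C) ⋙ X.leftPart.tensorLeft ⟶ Y.tensorLeft ⋙ M.leftPart.tensorLeft where
  app Z := tensorHom (leftHom π) (𝟙 (Y.tensor Z))
  naturality Z _ _ := Hom.ext (tensor_ext (X := X.leftPart) (Y := Y.tensor Z) fun _ _ => rfl)

/-- Associativity of the tensor product, natural in the last variable. -/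
def assocNat (X : PDGBimod p k A C) (Y : PDGBimod p k C D) :
    Y.tensorLeft (C := k) ⋙ X.tensorLeft ⟶ (X.tensor Y).tensorLeft where
  app Z := assoc X Y Z
  naturality Z _ _ := Hom.ext (tensor_ext_right X Y Z fun _ _ _ => rfl)

/-- The comparison is a zigzag of natural quasi-isomorphisms, `X ⊗_C (Y ⊗ Z) ← X ⊗ (Y ⊗ Z) → M ⊗ (Y
⊗ Z) → (M ⊗ Y) ⊗ Z`, where unmarked products next to `X` and `M` are over `k`. They become
invertible one by one in the derived category. -/
theorem IsBarResolution.nonempty_tensorLeft_iso (h : IsBarResolution π) (hn : (n : k) = 1)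
    (Y : PDGBimod p k (TruncPoly k n) C) :
    Nonempty ((Y.tensorLeft ⋙ X.tensorLeft) ⋙ toD p k A k ≅
      (M.leftPart.tensor Y.rightPart).tensorLeft ⋙ toD p k A k) := by
  refine ⟨(natIsoOfToD (collapseNat X Y) fun Z => ?_).symm ≪≫
    natIsoOfToD (leftHomNat π Y.rightPart) (fun Z => h.toD_leftHom _) ≪≫
    natIsoOfToD (assocNat M.leftPart Y.rightPart) (fun Z => toD_map_isIso _ (quasiIso_assoc _ _ _))⟩
  have := h.toD_collapse hn (Y.tensor Z)
  exact (Functor.map_comp (toD p k A k) (X.leftPart.tensorLeft.map (rightTensor Y Z).hom)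
    (collapse X (Y.tensor Z))).symm ▸
    @IsIso.comp_isIso _ _ _ _ _ ((toD p k A k).map (X.leftPart.tensorLeft.map (rightTensor Y Z).hom))
      ((toD p k A k).map (collapse X (Y.tensor Z))) inferInstance this

end Comparison

end PDGBimod
end PDG

theorem theorem5p5 (p : ℕ) [Fact p.Prime] (k : Type u) [Field k] [CharP k p] (n : ℕ) [NeZero n] :
    (∃ (X : PDG.PDGBimod p k (PDG.AShriek k n) (PDG.TruncPoly k n))
      (π : X ⟶ PDG.AShriek.columnLast p k n), PDG.PDGBimod.IsBarResolution π) ∧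
    ∀ (X : PDG.PDGBimod p k (PDG.AShriek k n) (PDG.TruncPoly k n))
      (π : X ⟶ PDG.AShriek.columnLast p k n), PDG.PDGBimod.IsBarResolution π →
      (p ∣ n - 1 →
        PDG.PDGBimod.IsFiniteCell (PDG.EF p k n) ∧
        Nonempty ((PDG.PDGBimod.toD p k _ _).obj (PDG.jwBimod X) ≅
          (PDG.PDGBimod.toD p k _ _).obj (PDG.EF p k n)) ∧
        PDG.Represents (PDG.EF p k n) (PDG.jonesWenzl X)) ∧
      (¬ p ∣ n - 1 →
        (∀ K : PDG.PDGBimod p k (PDG.AShriek k n) (PDG.AShriek k n),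
          PDG.PDGBimod.IsFiniteCell K →
            IsEmpty ((PDG.PDGBimod.toD p k _ _).obj (PDG.jwBimod X) ≅
              (PDG.PDGBimod.toD p k _ _).obj K) ∧
            ¬ PDG.Represents K (PDG.jonesWenzl X)) ∧
        ∃ i : ℕ, 0 < i ∧ i < p ∧
          ¬ Module.Finite k (PDG.PDGBimod.pCohomology
            ((PDG.jonesWenzl X).obj (PDG.AShriek.simple k p (PDG.AShriek.last n))) i)) := by 
  refine ⟨PDG.PDGBimod.exists_isBarResolution_columnLast p k n, fun X π h => ⟨fun hn => ?_,
    fun hn => ⟨fun K hK => h.not_finiteCell hn hK, 1, one_pos, (Fact.out : p.Prime).one_lt,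
      h.not_finite_simple hn⟩⟩⟩
  -- Divisibility is used only in this form; the subtraction in `n - 1` is genuine because `n` is
  -- positive.
  have hn1 : (n : k) = 1 := by
    obtain ⟨m, hm⟩ := hn
    have h0 : n = p * m + 1 := by
      have := NeZero.pos n
      omega
    rw [h0, Nat.cast_succ, Nat.cast_mul, CharP.cast_eq_zero, zero_mul, zero_add]
  exact ⟨PDG.PDGBimod.isFiniteCell_EF, ⟨h.tensorIso hn1 (PDG.AShriek.rowLast p k n)⟩,
    h.nonempty_tensorLeft_iso hn1 (PDG.AShriek.rowLast p k n)⟩
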